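/- Let $\Sigma$ be a compact, oriented, smooth surface with smooth boundary, each connected component of which has non-empty boundary (for instance, $\Sigma$ connected with $\partial\Sigma\neq\emptyset$), and let $\Omega$ be a smooth area form on $\Sigma$. Let $\phi:\Sigma\to\Sigma$ be a diffeomorphism with $\phi^*\Omega=\Omega$, and suppose that $\phi$ is isotopic to the identity through area-preserving diffeomorphisms, i.e. there is a smooth family $\{\phi^t\}_{t\in[0,1]}$ of diffeomorphisms of $\Sigma$ with $(\phi^t)^*\Omega=\Omega$ for all $t$, $\phi^0=\mathrm{id}$ and $\phi^1=\phi$. Call $\phi$ Hamiltonian if there is a smooth function $H:\mathbb{R}/\mathbb{Z}\times\Sigma\to\mathbb{R}$ such that $H_t=H(t,-)$ is locally constant on $\partial\Sigma$ for every $t$ and such that $\phi=\psi^1_H$, where $\{\psi^t_H\}_{t\in\mathbb{R}}$ is the flow, with $\psi^0_H=\mathrm{id}$, of the time-dependent vector field $X_{H_t}$ on $\Sigma$ defined by $\Omega(-,X_{H_t})=dH_t$. Let $M_\phi$ be the mapping torus of $\phi$, that is, the quotient of $[0,1]\times\Sigma$ by $(1,p)\sim(0,\phi(p))$ (equivalently,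 of $\mathbb{R}\times\Sigma$ by $(t+1,p)\sim(t,\phi(p))$, with the quotient smooth structure), and let $\Omega_\phi$ be the two-form on $M_\phi$ induced from $\Omega$, i.e. the unique two-form whose pullback to $\mathbb{R}\times\Sigma$ is the pullback of $\Omega$ under the projection to $\Sigma$. Then $\phi$ is Hamiltonian if and only if $\Omega_\phi$ is exact, i.e. $\Omega_\phi=d\eta$ for some smooth one-form $\eta$ on $M_\phi$. -/

import Mathlib

open Set Filter
open scoped Manifold ContDiff Topology

set_option linter.unusedSectionVars false

noncomputable section

namespace SurfaceDynamics

section Forms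

variable {E : Type*} [NormedAddCommGroup E] [NormedSpace ℝ E]
  {H : Type*} [TopologicalSpace H] {E' : Type*} [NormedAddCommGroup E'] [NormedSpace ℝ E']
  {H' : Type*} [TopologicalSpace H']

/-- A differential `k`-form on `M` (no regularity assumed): an alternating `k`-linear form on each
tangent space. -/
abbrev Form (I : ModelWithCorners ℝ E H) (M : Type*) [TopologicalSpace M] [ChartedSpace H M]
    (k : ℕ) : Type _ :=
  ∀ x : M, TangentSpace I x [⋀^Fin k]→L[ℝ] ℝ

variable {I : ModelWithCorners ℝ E H} {J : ModelWithCorners ℝ E' H'}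
  {M : Type*} [TopologicalSpace M] [ChartedSpace H M]
  {N : Type*} [TopologicalSpace N] [ChartedSpace H' N] {k : ℕ}

/-- The pullback `f^* α`. -/
def pullback (f : M → N) (α : Form J N k) : Form I M k :=
  fun x => (α (f x)).compContinuousLinearMap (mfderiv I J f x)

/-- The coordinate expression of `α` in the chart around `x₀`: the pullback of `α` under the inverse
chart, a form on the subset `(extChartAt I x₀).target` of the model vector space (relatively open in
`range I`). -/
def Form.inChart (α : Form I M k) (x₀ : M) (y : E) : E [⋀^Fin k]→L[ℝ] ℝ :=
  (α ((extChartAt I x₀).symm y)).compContinuousLinearMap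
    (mfderivWithin 𝓘(ℝ, E) I (extChartAt I x₀).symm (range I) y)

/-- `α` is `C^∞` (up to the boundary): its coordinate expressions are. -/
def Form.IsSmooth (α : Form I M k) : Prop :=
  ∀ x₀ : M, ContDiffOn ℝ ∞ (Form.inChart α x₀) (extChartAt I x₀).target

/-- The exterior derivative on a manifold: at `x`, the exterior derivative of the coordinate
expression of `α` in the chart around `x`, transported back to the tangent space at `x`. -/
def Form.d (α : Form I M k) : Form I M (k + 1) :=
  fun x => (extDerivWithin (Form.inChart α x) (range I) (extChartAt I x x)).compContinuousLinearMap
    (mfderiv I 𝓘(ℝ, E) (extChartAt I x) x)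

/-- A form is exact if it is the exterior derivative of a smooth form on all of `M`. -/
def Form.IsExact (β : Form I M (k + 1)) : Prop :=
  ∃ η : Form I M k, Form.IsSmooth η ∧ Form.d η = β

/-- Functoriality of the pullback. -/
theorem pullback_comp
    {E'' : Type*} [NormedAddCommGroup E''] [NormedSpace ℝ E'']
    {H'' : Type*} [TopologicalSpace H''] {K : ModelWithCorners ℝ E'' H''}
    {P : Type*} [TopologicalSpace P] [ChartedSpace H'' P]
    {f : M → N} {g : N → P} (α : Form K P k) {x : M} (hg : MDifferentiableAt J K g (f x))
    (hf : MDifferentiableAt I J f x) :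
    pullback (I := I) (J := K) (g ∘ f) α x =
      pullback (I := I) (J := J) f (pullback (I := J) (J := K) g α) x := by
  simp only [pullback, mfderiv_comp x hg hf]
  rfl

end Forms

section Surfaces

variable {S : Type*} [TopologicalSpace S] [ChartedSpace (EuclideanHalfSpace 2) S]

/-- An area form on a surface with boundary: a smooth nowhere vanishing two-form. It is positive for
exactly one orientation, so it also records the orientation of the surface. -/
structure AreaForm (S : Type*) [TopologicalSpace S] [ChartedSpace (EuclideanHalfSpace 2) S] where
  form : Form (𝓡∂ 2) S 2
  smooth : Form.IsSmooth form
  ne_zero : ∀ x, form x ≠ 0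

/-- The diffeomorphism `φ` lies in `Diff(S, Ω)`: it satisfies `φ^* Ω = Ω`. -/
def PreservesArea (Ω : AreaForm S) (φ : S ≃ₘ⟮𝓡∂ 2, 𝓡∂ 2⟯ S) : Prop :=
  pullback φ Ω.form = Ω.form

/-- A family `ψ t` of diffeomorphisms of `S` is smooth for `t ∈ J`: the level preserving map
`(t, x) ↦ (t, ψ t x)` is a diffeomorphism of `J × S`. -/
def IsSmoothFamily (J : Set ℝ) (ψ : ℝ → S ≃ₘ⟮𝓡∂ 2, 𝓡∂ 2⟯ S) : Prop :=
  ContMDiffOn (𝓘(ℝ, ℝ).prod (𝓡∂ 2)) (𝓡∂ 2) ∞ (fun z : ℝ × S => ψ z.1 z.2) (J ×ˢ univ) ∧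
    ContMDiffOn (𝓘(ℝ, ℝ).prod (𝓡∂ 2)) (𝓡∂ 2) ∞ (fun z : ℝ × S => (ψ z.1).symm z.2) (J ×ˢ univ)

/-- `φ` is isotopic to the identity through area-preserving diffeomorphisms. -/
def IsAreaIsotopicToId (Ω : AreaForm S) (φ : S ≃ₘ⟮𝓡∂ 2, 𝓡∂ 2⟯ S) : Prop :=
  ∃ ψ : ℝ → S ≃ₘ⟮𝓡∂ 2, 𝓡∂ 2⟯ S, IsSmoothFamily (Icc 0 1) ψ ∧
    (∀ t ∈ Icc (0 : ℝ) 1, PreservesArea Ω (ψ t)) ∧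
    ψ 0 = Diffeomorph.refl (𝓡∂ 2) S ∞ ∧ ψ 1 = φ

/-- The Hamiltonians on `S`: smooth functions on `ℝ/ℤ × S`, given as functions on `ℝ × S` of period
`1` in the first variable, whose restriction to `{t} × ∂S` is locally constant for every `t`. -/
structure IsHamiltonianFunction (H : ℝ × S → ℝ) : Prop where
  smooth : ContMDiff (𝓘(ℝ, ℝ).prod (𝓡∂ 2)) 𝓘(ℝ, ℝ) ∞ H
  periodic : ∀ t x, H (t + 1, x) = H (t, x)
  locallyConstant_boundary :
    ∀ t, IsLocallyConstant (fun x : (𝓡∂ 2).boundary S => H (t, (x : S)))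

/-- `X` is the value at `x` of the Hamiltonian vector field of `h : S → ℝ`, which is defined by
`Ω(-, X) = dh`. As `Ω` is nondegenerate, it is unique. -/
def IsHamiltonianVector (Ω : AreaForm S) (h : S → ℝ) (x : S) (X : TangentSpace (𝓡∂ 2) x) : Prop :=
  ∀ v : TangentSpace (𝓡∂ 2) x, Ω.form x ![v, X] = mfderiv (𝓡∂ 2) 𝓘(ℝ, ℝ) h x v

/-- `ψ` is the flow of the time-dependent Hamiltonian vector field of `H`: it starts at the identity
and `d/dt (ψ t x) = X_{H_t} (ψ t x)` for all `t` and `x`. -/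
structure IsHamiltonianFlow (Ω : AreaForm S) (H : ℝ × S → ℝ)
    (ψ : ℝ → S ≃ₘ⟮𝓡∂ 2, 𝓡∂ 2⟯ S) : Prop where
  smooth : IsSmoothFamily univ ψ
  zero : ψ 0 = Diffeomorph.refl (𝓡∂ 2) S ∞
  deriv : ∀ t x, ∃ X : TangentSpace (𝓡∂ 2) (ψ t x),
    IsHamiltonianVector Ω (fun y => H (t, y)) (ψ t x) X ∧
    HasMFDerivAt 𝓘(ℝ, ℝ) (𝓡∂ 2) (fun s : ℝ => ψ s x) t
      ((1 : ℝ →L[ℝ] ℝ).smulRight X)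

/-- `φ` is Hamiltonian: it is the time-one map of the flow of a Hamiltonian. -/
def IsHamiltonian (Ω : AreaForm S) (φ : S ≃ₘ⟮𝓡∂ 2, 𝓡∂ 2⟯ S) : Prop :=
  ∃ (H : ℝ × S → ℝ) (ψ : ℝ → S ≃ₘ⟮𝓡∂ 2, 𝓡∂ 2⟯ S),
    IsHamiltonianFunction H ∧ IsHamiltonianFlow Ω H ψ ∧ ψ 1 = φ

/-- The product `ℝ × S` (with its product topology and manifold structure), carrying the action of
`ℤ` defined by `φ` below. -/
def Cover (_φ : S ≃ₘ⟮𝓡∂ 2, 𝓡∂ 2⟯ S) : Type _ := ℝ × S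

variable (φ : S ≃ₘ⟮𝓡∂ 2, 𝓡∂ 2⟯ S)

instance : TopologicalSpace (Cover φ) := inferInstanceAs (TopologicalSpace (ℝ × S))
instance [T2Space S] : T2Space (Cover φ) := inferInstanceAs (T2Space (ℝ × S))
instance [CompactSpace S] [T2Space S] : LocallyCompactSpace (Cover φ) :=
  inferInstanceAs (LocallyCompactSpace (ℝ × S))
instance : ChartedSpace (ModelProd ℝ (EuclideanHalfSpace 2)) (Cover φ) :=
  inferInstanceAs (ChartedSpace (ModelProd ℝ (EuclideanHalfSpace 2)) (ℝ × S))
instance [IsManifold (𝓡∂ 2) ∞ S] : IsManifold (𝓘(ℝ, ℝ).prod (𝓡∂ 2)) ∞ (Cover φ) :=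
  inferInstanceAs (IsManifold (𝓘(ℝ, ℝ).prod (𝓡∂ 2)) ∞ (ℝ × S))

/-- The action of `ℤ` on `ℝ × S` generated by `(t, p) ↦ (t - 1, φ p)`. -/
instance : AddAction ℤ (Cover φ) where
  vadd n z := ((z.1 - n, (φ.toEquiv ^ n) z.2) : ℝ × S)
  zero_vadd z := by
    change ((z.1 - ((0 : ℤ) : ℝ), (φ.toEquiv ^ (0 : ℤ)) z.2) : ℝ × S) = z
    simp only [Int.cast_zero, sub_zero, zpow_zero]
    rfl
  add_vadd m n z := by
    change ((z.1 - ((m + n : ℤ) : ℝ), (φ.toEquiv ^ (m + n)) z.2) : ℝ × S) =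
      ((z.1 - n) - m, (φ.toEquiv ^ m) ((φ.toEquiv ^ n) z.2))
    rw [zpow_add]
    ext
    · push_cast; ring
    · rfl

theorem vadd_def (n : ℤ) (z : Cover φ) :
    n +ᵥ z = ((z.1 - n, (φ.toEquiv ^ n) z.2) : ℝ × S) := rfl

theorem contMDiff_zpow (n : ℤ) :
    ContMDiff (𝓡∂ 2) (𝓡∂ 2) ∞ (φ.toEquiv ^ n : Equiv.Perm S) := by
  induction n with
  | zero => exact contMDiff_id
  | succ n ih =>
    rw [zpow_add_one]
    exact ih.comp φ.contMDiff
  | pred n ih =>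
    rw [zpow_sub_one]
    exact ih.comp φ.symm.contMDiff

theorem contMDiff_vadd (n : ℤ) :
    ContMDiff (𝓘(ℝ, ℝ).prod (𝓡∂ 2)) (𝓘(ℝ, ℝ).prod (𝓡∂ 2)) ∞ (fun z : Cover φ => n +ᵥ z) := by
  have h : ContMDiff (𝓘(ℝ, ℝ).prod (𝓡∂ 2)) (𝓘(ℝ, ℝ).prod (𝓡∂ 2)) ∞
      (fun z : ℝ × S => ((z.1 - n, (φ.toEquiv ^ n) z.2) : ℝ × S)) :=
    (contMDiff_fst.sub contMDiff_const).prodMk ((contMDiff_zpow φ n).comp contMDiff_snd)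
  exact h

instance : ContinuousConstVAdd ℤ (Cover φ) := ⟨fun n => (contMDiff_vadd φ n).continuous⟩

theorem preservesArea_zpow {Ω : AreaForm S} (h : PreservesArea Ω φ) (n : ℤ) :
    pullback (φ.toEquiv ^ n : Equiv.Perm S) Ω.form = Ω.form := by
  have hi : pullback (I := 𝓡∂ 2) φ.symm Ω.form = Ω.form := by
    funext x
    have h1 := pullback_comp (f := φ.symm) (g := φ) (x := x) Ω.form
      (φ.contMDiff.mdifferentiable (by simp) _) (φ.symm.contMDiff.mdifferentiable (by simp) _)
    have h2 : (φ ∘ φ.symm : S → S) = id := by ext; simp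
    have h3 : pullback (I := 𝓡∂ 2) φ Ω.form = Ω.form := h
    rw [h3, h2] at h1
    rw [← h1]
    simp only [pullback, mfderiv_id]
    rfl
  induction n with
  | zero =>
    funext x
    change (Ω.form x).compContinuousLinearMap (mfderiv (𝓡∂ 2) (𝓡∂ 2) id x) = _
    rw [mfderiv_id]
    rfl
  | succ n ih =>
    funext x
    rw [zpow_add_one]
    have h1 := pullback_comp (f := φ) (g := (φ.toEquiv ^ (n : ℤ) : Equiv.Perm S)) (x := x) Ω.form
      ((contMDiff_zpow φ n).mdifferentiable (by simp) _) (φ.contMDiff.mdifferentiable (by simp) _)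
    rw [ih] at h1
    exact h1.trans (congrFun h x)
  | pred n ih =>
    funext x
    rw [zpow_sub_one]
    have h1 := pullback_comp (f := φ.symm) (g := (φ.toEquiv ^ (-n : ℤ) : Equiv.Perm S)) (x := x)
      Ω.form ((contMDiff_zpow φ (-n)).mdifferentiable (by simp) _)
      (φ.symm.contMDiff.mdifferentiable (by simp) _)
    rw [ih] at h1
    exact h1.trans (congrFun hi x)

theorem contMDiff_snd_cover : ContMDiff (𝓘(ℝ, ℝ).prod (𝓡∂ 2)) (𝓡∂ 2) ∞ (fun z : Cover φ => z.2) :=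
  (contMDiff_snd : ContMDiff (𝓘(ℝ, ℝ).prod (𝓡∂ 2)) (𝓡∂ 2) ∞ (Prod.snd : ℝ × S → S))

instance : IsCancelVAdd ℤ (Cover φ) where
  right_cancel' a b z h := by
    have h1 : z.1 - (a : ℝ) = z.1 - b := congrArg Prod.fst h
    exact_mod_cast sub_right_injective h1
  left_cancel' a z w h := by
    simpa using h

instance : ProperlyDiscontinuousVAdd ℤ (Cover φ) where
  finite_disjoint_inter_image {K L} hK hL := by
    have hc : Continuous (fun z : Cover φ => z.1) := (continuous_fst : Continuous (Prod.fst : ℝ × S → ℝ))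
    obtain ⟨r, hr⟩ := (hK.image hc).isBounded.exists_norm_le
    obtain ⟨s, hs⟩ := (hL.image hc).isBounded.exists_norm_le
    refine (Set.finite_Icc (-⌈r + s⌉) ⌈r + s⌉).subset ?_
    rintro n ⟨_, ⟨z, hz, rfl⟩, hw⟩
    have h1 := hr _ ⟨z, hz, rfl⟩
    have h2 : ‖z.1 - (n : ℝ)‖ ≤ s := hs _ ⟨_, hw, rfl⟩
    rw [Real.norm_eq_abs, abs_le] at h1 h2
    have h3 := Int.le_ceil (r + s)
    constructor
    · have : (-(⌈r + s⌉ : ℝ)) ≤ n := by linarith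
      exact_mod_cast this
    · have : (n : ℝ) ≤ ⌈r + s⌉ := by linarith
      exact_mod_cast this

/-- The mapping torus of `φ`: the quotient of `ℝ × S` by `(t + 1, p) ∼ (t, φ p)`, equivalently the
quotient of `[0, 1] × S` by `(1, p) ∼ (0, φ p)`. -/
def MappingTorus : Type _ := AddAction.orbitRel.Quotient ℤ (Cover φ)

instance : TopologicalSpace (MappingTorus φ) :=
  inferInstanceAs (TopologicalSpace (AddAction.orbitRel.Quotient ℤ (Cover φ)))

/-- The quotient map `ℝ × S → M_φ`. -/
def proj (z : Cover φ) : MappingTorus φ := Quotient.mk (AddAction.orbitRel ℤ (Cover φ)) z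

/-- A representative in `ℝ × S` of a point of the mapping torus. -/
def rep (m : MappingTorus φ) : Cover φ := Quotient.out m

theorem proj_rep (m : MappingTorus φ) : proj φ (rep φ m) = m := Quotient.out_eq m

theorem proj_eq_iff {z w : Cover φ} : proj φ z = proj φ w ↔ ∃ n : ℤ, n +ᵥ w = z :=
  Quotient.eq (r := AddAction.orbitRel ℤ (Cover φ))

theorem proj_one (p : S) : proj φ ((1, p) : ℝ × S) = proj φ ((0, φ p) : ℝ × S) := by
  refine ((proj_eq_iff φ).2 ⟨1, ?_⟩).symm
  have h1 : ((1 : ℝ) - ((1 : ℤ) : ℝ), (φ.toEquiv ^ (1 : ℤ)) p) = ((0 : ℝ), φ p) := by simp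
  exact h1

variable [CompactSpace S] [T2Space S]

theorem isLocalHomeomorph_proj : IsLocalHomeomorph (proj φ) :=
  (isAddQuotientCoveringMap_quotientMk_of_properlyDiscontinuousVAdd
    (G := ℤ) (E := Cover φ)).isCoveringMap.isLocalHomeomorph

/-- The local inverse of the quotient map near `z`. -/
def localSection (z : Cover φ) : OpenPartialHomeomorph (MappingTorus φ) (Cover φ) :=
  (isLocalHomeomorph_proj φ).localInverseAt z

theorem localSection_symm (w : Cover φ) : ⇑(localSection φ w).symm = proj φ :=
  (isLocalHomeomorph_proj φ).localInverseAt_symm w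

/-- The charts of the mapping torus: local inverses of the quotient map followed by charts of `ℝ × S`. -/
instance : ChartedSpace (ModelProd ℝ (EuclideanHalfSpace 2)) (MappingTorus φ) :=
  (isLocalHomeomorph_proj φ).chartedSpaceOfRightInverse (g := rep φ) (proj_rep φ)

theorem chartAt_eq (m : MappingTorus φ) : chartAt (ModelProd ℝ (EuclideanHalfSpace 2)) m =
   (localSection φ (rep φ m)).trans (chartAt _ (rep φ m)) := rfl

theorem localSection_proj {w x : Cover φ} (hx : proj φ x ∈ (localSection φ w).source) :
    ∃ n : ℤ, ∀ᶠ x' in 𝓝 x, localSection φ w (proj φ x') = n +ᵥ x' := by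
  have hq := isLocalHomeomorph_proj φ
  obtain ⟨n, hn⟩ := (proj_eq_iff φ).1 (hq.apply_localInverseAt_of_mem hx)
  refine ⟨n, ?_⟩
  have h1 : n +ᵥ x ∈ (localSection φ w).target := by
    rw [hn]; exact (localSection φ w).map_source hx
  have h2 : ∀ᶠ x' in 𝓝 x, n +ᵥ x' ∈ (localSection φ w).target :=
    (continuous_const_vadd n).continuousAt.eventually ((localSection φ w).open_target.mem_nhds h1)
  filter_upwards [h2] with x' hx'
  have h3 : proj φ x' = (localSection φ w).symm (n +ᵥ x') := by
    rw [localSection_symm]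
    exact ((proj_eq_iff φ).2 ⟨n, rfl⟩).symm
  rw [h3, (localSection φ w).right_inv hx']

theorem contMDiffAt_localSection_proj {w x : Cover φ}
    (hx : proj φ x ∈ (localSection φ w).source) :
    ContMDiffAt (𝓘(ℝ, ℝ).prod (𝓡∂ 2)) (𝓘(ℝ, ℝ).prod (𝓡∂ 2)) ∞ (fun x' => localSection φ w (proj φ x')) x := by
  obtain ⟨n, hn⟩ := localSection_proj φ hx
  exact (contMDiff_vadd φ n).contMDiffAt.congr_of_eventuallyEq hn

variable [IsManifold (𝓡∂ 2) ∞ S]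

/-- The mapping torus is a smooth manifold (with boundary). -/
instance : IsManifold (𝓘(ℝ, ℝ).prod (𝓡∂ 2)) ∞ (MappingTorus φ) := by
  refine isManifold_of_contDiffOn _ _ _ ?_
  rintro _ _ ⟨m, rfl⟩ ⟨m', rfl⟩
  rw [← contMDiffOn_iff_contDiffOn]
  rintro y ⟨hy, hyI⟩
  have hy0 : (𝓘(ℝ, ℝ).prod (𝓡∂ 2)).symm y ∈ (((localSection φ (rep φ m)).trans (chartAt _ (rep φ m))).symm.trans
    ((localSection φ (rep φ m')).trans (chartAt _ (rep φ m')))).source := hy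
  simp only [OpenPartialHomeomorph.trans_source, OpenPartialHomeomorph.symm_source,
    OpenPartialHomeomorph.trans_target, OpenPartialHomeomorph.coe_trans_symm, mem_inter_iff,
    mem_preimage, Function.comp, localSection_symm] at hy0
  obtain ⟨⟨hy1, hy2⟩, hy3, hy4⟩ := hy0
  have h0 : ContMDiffWithinAt 𝓘(ℝ, ℝ × EuclideanSpace ℝ (Fin 2)) (𝓘(ℝ, ℝ).prod (𝓡∂ 2)) ∞ (𝓘(ℝ, ℝ).prod (𝓡∂ 2)).symm (range (𝓘(ℝ, ℝ).prod (𝓡∂ 2))) y :=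
    (𝓘(ℝ, ℝ).prod (𝓡∂ 2)).contMDiffOn_symm y hyI
  have h1 : ContMDiffAt (𝓘(ℝ, ℝ).prod (𝓡∂ 2)) (𝓘(ℝ, ℝ).prod (𝓡∂ 2)) ∞
      (chartAt (ModelProd ℝ (EuclideanHalfSpace 2)) (rep φ m)).symm ((𝓘(ℝ, ℝ).prod (𝓡∂ 2)).symm y) :=
    contMDiffOn_chart_symm.contMDiffAt ((OpenPartialHomeomorph.open_target _).mem_nhds hy1)
  have h2 := contMDiffAt_localSection_proj φ hy3
  have h3 : ContMDiffAt (𝓘(ℝ, ℝ).prod (𝓡∂ 2)) (𝓘(ℝ, ℝ).prod (𝓡∂ 2)) ∞ (chartAt (ModelProd ℝ (EuclideanHalfSpace 2)) (rep φ m'))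
      (localSection φ (rep φ m') (proj φ
        ((chartAt (ModelProd ℝ (EuclideanHalfSpace 2)) (rep φ m)).symm ((𝓘(ℝ, ℝ).prod (𝓡∂ 2)).symm y)))) :=
    contMDiffOn_chart.contMDiffAt ((OpenPartialHomeomorph.open_source _).mem_nhds hy4)
  have h23 : ContMDiffAt (𝓘(ℝ, ℝ).prod (𝓡∂ 2)) (𝓘(ℝ, ℝ).prod (𝓡∂ 2)) ∞
      (fun y => chartAt (ModelProd ℝ (EuclideanHalfSpace 2)) (rep φ m')
        (localSection φ (rep φ m') (proj φ
          ((chartAt (ModelProd ℝ (EuclideanHalfSpace 2)) (rep φ m)).symm y)))) ((𝓘(ℝ, ℝ).prod (𝓡∂ 2)).symm y) :=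
    ContMDiffAt.comp (f := fun y => localSection φ (rep φ m') (proj φ
      ((chartAt (ModelProd ℝ (EuclideanHalfSpace 2)) (rep φ m)).symm y))) _ h3 (h2.comp _ h1)
  have h4 := ContMDiffAt.comp (g := (𝓘(ℝ, ℝ).prod (𝓡∂ 2))) _ ((𝓘(ℝ, ℝ).prod (𝓡∂ 2)).contMDiff.contMDiffAt (n := ∞)) h23
  have h5 := (h4.comp_contMDiffWithinAt y h0).mono (t := (𝓘(ℝ, ℝ).prod (𝓡∂ 2)).symm ⁻¹'
    (((localSection φ (rep φ m)).trans (chartAt _ (rep φ m))).symm.trans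
    ((localSection φ (rep φ m')).trans (chartAt (ModelProd ℝ (EuclideanHalfSpace 2))
      (rep φ m')))).source ∩ range (𝓘(ℝ, ℝ).prod (𝓡∂ 2)))
    inter_subset_right
  have h6 : (((localSection φ (rep φ m)).trans (chartAt (ModelProd ℝ (EuclideanHalfSpace 2))
      (rep φ m))).symm : ModelProd ℝ (EuclideanHalfSpace 2) → MappingTorus φ) =
      fun y => proj φ ((chartAt (ModelProd ℝ (EuclideanHalfSpace 2)) (rep φ m)).symm y) := by
    rw [← localSection_symm φ (rep φ m)]; rfl
  convert! h5 using 1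
  funext y
  exact congrArg (fun f : ModelProd ℝ (EuclideanHalfSpace 2) → MappingTorus φ =>
    (𝓘(ℝ, ℝ).prod (𝓡∂ 2)) (chartAt (ModelProd ℝ (EuclideanHalfSpace 2)) (rep φ m')
      (localSection φ (rep φ m') (f ((𝓘(ℝ, ℝ).prod (𝓡∂ 2)).symm y))))) h6

/-- The quotient map is smooth; so are its local inverses, so it is a local diffeomorphism. -/
theorem contMDiff_proj : ContMDiff (𝓘(ℝ, ℝ).prod (𝓡∂ 2)) (𝓘(ℝ, ℝ).prod (𝓡∂ 2)) ∞ (proj φ) := by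
  intro z
  set m := proj φ z with hm
  have hq := isLocalHomeomorph_proj φ
  have hz : proj φ z ∈ (localSection φ (rep φ m)).source := by
    have := hq.apply_self_mem_localInverseAt_source (x := rep φ m)
    rwa [proj_rep] at this
  have hu : localSection φ (rep φ m) (proj φ z) = rep φ m := by
    have := hq.localInverseAt_apply_self (x := rep φ m)
    rwa [proj_rep] at this
  have h1 := contMDiffAt_localSection_proj φ hz
  have h2 : ContMDiffAt (𝓘(ℝ, ℝ).prod (𝓡∂ 2)) (𝓘(ℝ, ℝ).prod (𝓡∂ 2)) ∞ (chartAt (ModelProd ℝ (EuclideanHalfSpace 2)) (rep φ m))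
      (localSection φ (rep φ m) (proj φ z)) := by
    rw [hu]
    exact contMDiffAt_of_mem_maximalAtlas (IsManifold.chart_mem_maximalAtlas _)
      (mem_chart_source _ _)
  have h3 : ContMDiffAt (𝓘(ℝ, ℝ).prod (𝓡∂ 2)) (𝓘(ℝ, ℝ).prod (𝓡∂ 2)) ∞ (chartAt (ModelProd ℝ (EuclideanHalfSpace 2)) m).symm
      (chartAt (ModelProd ℝ (EuclideanHalfSpace 2)) (rep φ m)
        (localSection φ (rep φ m) (proj φ z))) :=
    contMDiffAt_symm_of_mem_maximalAtlas (IsManifold.chart_mem_maximalAtlas _)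
      ((chartAt (ModelProd ℝ (EuclideanHalfSpace 2)) m).map_source (mem_chart_source _ m))
  refine (h3.comp z (h2.comp z h1)).congr_of_eventuallyEq ?_
  have hc : ContinuousAt (proj φ) z := hq.continuous.continuousAt
  filter_upwards [hc.eventually ((chartAt (ModelProd ℝ (EuclideanHalfSpace 2)) m).open_source.mem_nhds
    (mem_chart_source _ m))] with x hx
  exact ((chartAt (ModelProd ℝ (EuclideanHalfSpace 2)) m).left_inv hx).symm

theorem contMDiffOn_localSection (w : Cover φ) :
    ContMDiffOn (𝓘(ℝ, ℝ).prod (𝓡∂ 2)) (𝓘(ℝ, ℝ).prod (𝓡∂ 2)) ∞ (localSection φ w) (localSection φ w).source := by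
  intro m hm
  apply ContMDiffAt.contMDiffWithinAt
  have hq := isLocalHomeomorph_proj φ
  have hm' : m ∈ (localSection φ (rep φ m)).source := by
    have := hq.apply_self_mem_localInverseAt_source (x := rep φ m)
    rwa [proj_rep] at this
  have hu : localSection φ (rep φ m) m = rep φ m := by
    have := hq.localInverseAt_apply_self (x := rep φ m)
    rwa [proj_rep] at this
  have h1 : ContMDiffAt (𝓘(ℝ, ℝ).prod (𝓡∂ 2)) (𝓘(ℝ, ℝ).prod (𝓡∂ 2)) ∞ (chartAt (ModelProd ℝ (EuclideanHalfSpace 2)) m) m :=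
    contMDiffAt_of_mem_maximalAtlas (IsManifold.chart_mem_maximalAtlas _) (mem_chart_source _ _)
  have he : chartAt (ModelProd ℝ (EuclideanHalfSpace 2)) m m =
      chartAt (ModelProd ℝ (EuclideanHalfSpace 2)) (rep φ m) (rep φ m) :=
    congrArg (chartAt (ModelProd ℝ (EuclideanHalfSpace 2)) (rep φ m)) hu
  have h2 : ContMDiffAt (𝓘(ℝ, ℝ).prod (𝓡∂ 2)) (𝓘(ℝ, ℝ).prod (𝓡∂ 2)) ∞ (chartAt (ModelProd ℝ (EuclideanHalfSpace 2)) (rep φ m)).symm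
      (chartAt (ModelProd ℝ (EuclideanHalfSpace 2)) m m) := by
    rw [he]
    exact contMDiffAt_symm_of_mem_maximalAtlas (IsManifold.chart_mem_maximalAtlas _)
      (mem_chart_target _ _)
  have hr : (chartAt (ModelProd ℝ (EuclideanHalfSpace 2)) (rep φ m)).symm
      (chartAt (ModelProd ℝ (EuclideanHalfSpace 2)) m m) = rep φ m := by
    rw [he]; exact (chartAt _ (rep φ m)).left_inv (mem_chart_source _ _)
  have h3 : ContMDiffAt (𝓘(ℝ, ℝ).prod (𝓡∂ 2)) (𝓘(ℝ, ℝ).prod (𝓡∂ 2)) ∞ (fun x' => localSection φ w (proj φ x'))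
      ((chartAt (ModelProd ℝ (EuclideanHalfSpace 2)) (rep φ m)).symm
      (chartAt (ModelProd ℝ (EuclideanHalfSpace 2)) m m)) := by
    rw [hr]
    exact contMDiffAt_localSection_proj φ (by rwa [proj_rep])
  refine (h3.comp m (h2.comp m h1)).congr_of_eventuallyEq ?_
  filter_upwards [(chartAt (ModelProd ℝ (EuclideanHalfSpace 2)) m).open_source.mem_nhds
    (mem_chart_source _ m)] with x hx
  have hx1 : x ∈ (localSection φ (rep φ m)).source := hx.1
  have hx2 : localSection φ (rep φ m) x ∈ (chartAt (ModelProd ℝ (EuclideanHalfSpace 2))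
    (rep φ m)).source := hx.2
  have h5 : (chartAt (ModelProd ℝ (EuclideanHalfSpace 2)) (rep φ m)).symm
      (chartAt (ModelProd ℝ (EuclideanHalfSpace 2)) (rep φ m) (localSection φ (rep φ m) x)) =
      localSection φ (rep φ m) x := OpenPartialHomeomorph.left_inv _ hx2
  have h6 : proj φ (localSection φ (rep φ m) x) = x := hq.apply_localInverseAt_of_mem hx1
  change localSection φ w x = localSection φ w (proj φ ((chartAt _ (rep φ m)).symm
      (chartAt (ModelProd ℝ (EuclideanHalfSpace 2)) (rep φ m) (localSection φ (rep φ m) x))))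
  rw [h5, h6]

/-- The pullback of `Ω` to `ℝ × S`. -/
def coverForm (Ω : AreaForm S) : Form (𝓘(ℝ, ℝ).prod (𝓡∂ 2)) (Cover φ) 2 :=
  pullback (fun z : Cover φ => z.2) Ω.form

/-- The two-form `Ω_φ` on the mapping torus induced from `Ω`: locally the pullback of `Ω` under the
projection to `S`. It does not depend on the representatives: it is the form whose pullback to
`ℝ × S` is the pullback of `Ω`, as shown below. -/
def inducedForm (Ω : AreaForm S) : Form (𝓘(ℝ, ℝ).prod (𝓡∂ 2)) (MappingTorus φ) 2 :=
  fun m => pullback (localSection φ (rep φ m)) (coverForm φ Ω) m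

/-- Since `φ^* Ω = Ω`, the pullback of `Ω_φ` under the quotient map is the pullback of `Ω`. -/
theorem pullback_proj_inducedForm {Ω : AreaForm S} (h : PreservesArea Ω φ) :
    pullback (proj φ) (inducedForm φ Ω) = coverForm φ Ω := by
  funext z
  have hq := isLocalHomeomorph_proj φ
  have hz : proj φ z ∈ (localSection φ (rep φ (proj φ z))).source := by
    have := hq.apply_self_mem_localInverseAt_source (x := rep φ (proj φ z))
    rwa [proj_rep] at this
  obtain ⟨n, hn⟩ := localSection_proj φ hz
  have h1 := pullback_comp (f := proj φ) (g := localSection φ (rep φ (proj φ z))) (x := z)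
    (coverForm φ Ω)
    (((contMDiffOn_localSection φ _).contMDiffAt
      ((localSection φ _).open_source.mem_nhds hz)).mdifferentiableAt (by simp))
    ((contMDiff_proj φ).mdifferentiable (by simp) z)
  have h2 : pullback (I := (𝓘(ℝ, ℝ).prod (𝓡∂ 2))) (J := (𝓘(ℝ, ℝ).prod (𝓡∂ 2))) (localSection φ (rep φ (proj φ z)) ∘ proj φ)
      (coverForm φ Ω) z = pullback (I := (𝓘(ℝ, ℝ).prod (𝓡∂ 2))) (fun z : Cover φ => n +ᵥ z) (coverForm φ Ω) z := by
    have he : (localSection φ (rep φ (proj φ z)) ∘ proj φ) =ᶠ[𝓝 z] (fun z : Cover φ => n +ᵥ z) := hn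
    have hv := he.self_of_nhds
    unfold pullback
    rw [he.mfderiv_eq]
    exact congrArg (fun y : Cover φ => (show (ℝ × EuclideanSpace ℝ (Fin 2)) [⋀^Fin 2]→L[ℝ] ℝ from
      coverForm φ Ω y).compContinuousLinearMap (show (ℝ × EuclideanSpace ℝ (Fin 2)) →L[ℝ]
        (ℝ × EuclideanSpace ℝ (Fin 2)) from mfderiv (𝓘(ℝ, ℝ).prod (𝓡∂ 2)) (𝓘(ℝ, ℝ).prod (𝓡∂ 2)) (fun z : Cover φ => n +ᵥ z) z)) hv
  have h3 := pullback_comp (f := fun z : Cover φ => n +ᵥ z) (g := fun z : Cover φ => z.2) (x := z)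
    Ω.form ((contMDiff_snd_cover φ).mdifferentiable (by simp) _)
    ((contMDiff_vadd φ n).mdifferentiable (by simp) z)
  have h4 := pullback_comp (f := fun z : Cover φ => z.2)
    (g := (φ.toEquiv ^ n : Equiv.Perm S)) (x := z) Ω.form
    ((contMDiff_zpow φ n).mdifferentiable (by simp) _)
    ((contMDiff_snd_cover φ).mdifferentiable (by simp) z)
  rw [preservesArea_zpow φ h n] at h4
  calc pullback (proj φ) (inducedForm φ Ω) z
      = pullback (I := (𝓘(ℝ, ℝ).prod (𝓡∂ 2))) (J := (𝓘(ℝ, ℝ).prod (𝓡∂ 2))) (localSection φ (rep φ (proj φ z)) ∘ proj φ)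
          (coverForm φ Ω) z := h1.symm
    _ = _ := h2
    _ = _ := h3.symm
    _ = _ := h4

end Surfaces

end SurfaceDynamics

end

open SurfaceDynamics

noncomputable section

namespace SurfaceDynamics


section AlternatingMaps

variable {E : Type*} [NormedAddCommGroup E] [NormedSpace ℝ E] [FiniteDimensional ℝ E]
  {G : Type*} [NormedAddCommGroup G] [NormedSpace ℝ G] {k : ℕ}

/-- Evaluation of an alternating form on all tuples of basis vectors. -/
def evalBasis (E : Type*) [NormedAddCommGroup E] [NormedSpace ℝ E] [FiniteDimensional ℝ E] (k : ℕ) :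
    (E [⋀^Fin k]→L[ℝ] ℝ) →ₗ[ℝ] ((Fin k → Fin (Module.finrank ℝ E)) → ℝ) where
  toFun τ i := τ fun j => Module.finBasis ℝ E (i j)
  map_add' _ _ := rfl
  map_smul' _ _ := rfl

theorem evalBasis_injective : Function.Injective (evalBasis E k) := by
  intro a b h
  apply ContinuousAlternatingMap.toAlternatingMap_injective
  refine Module.Basis.ext_alternating (Module.finBasis ℝ E) fun v _ => congrFun h v

theorem contDiffWithinAt_alternating_iff {n : WithTop ℕ∞} {τ : G → E [⋀^Fin k]→L[ℝ] ℝ} {s : Set G}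
    {y : G} : ContDiffWithinAt ℝ n τ s y ↔ ∀ v, ContDiffWithinAt ℝ n (fun z => τ z v) s y := by
  constructor
  · intro h v
    exact (ContinuousAlternatingMap.apply ℝ E ℝ v).contDiff.contDiffAt.comp_contDiffWithinAt y h
  · intro h
    obtain ⟨g, hg⟩ := LinearMap.exists_leftInverse_of_injective (evalBasis E k)
      (LinearMap.ker_eq_bot.2 evalBasis_injective)
    have h1 : ContDiffWithinAt ℝ n (fun z => evalBasis E k (τ z)) s y :=
      contDiffWithinAt_pi.2 fun i => h _
    have h2 := (LinearMap.toContinuousLinearMap g).contDiff.contDiffAt.comp_contDiffWithinAt y h1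
    refine h2.congr (fun z _ => ?_) ?_
    · exact (LinearMap.congr_fun hg (τ z)).symm
    · exact (LinearMap.congr_fun hg (τ y)).symm

theorem contDiffOn_alternating_iff {n : WithTop ℕ∞} {τ : G → E [⋀^Fin k]→L[ℝ] ℝ} {s : Set G} :
    ContDiffOn ℝ n τ s ↔ ∀ v, ContDiffOn ℝ n (fun z => τ z v) s :=
  ⟨fun h v y hy => contDiffWithinAt_alternating_iff.1 (h y hy) v,
    fun h y hy => contDiffWithinAt_alternating_iff.2 fun v => h v y hy⟩

/-- A smooth form applied to smooth vector-valued functions is smooth. -/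
theorem _root_.ContDiffWithinAt.alternating_apply {n : WithTop ℕ∞} {τ : G → E [⋀^Fin k]→L[ℝ] ℝ}
    {v : G → Fin k → E} {s : Set G} {y : G} (hτ : ContDiffWithinAt ℝ n τ s y)
    (hv : ∀ i, ContDiffWithinAt ℝ n (fun z => v z i) s y) :
    ContDiffWithinAt ℝ n (fun z => τ z (v z)) s y := by
  let b := Module.finBasis ℝ E
  have h1 : (fun z => τ z (v z)) = fun z => ∑ r : Fin k → Fin (Module.finrank ℝ E),
      (∏ i, b.repr (v z i) (r i)) • τ z (fun i => b (r i)) := by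
    funext z
    conv_lhs => rw [← funext (fun i => b.sum_repr (v z i))]
    exact ((τ z).toMultilinearMap.map_sum _).trans
      (Finset.sum_congr rfl fun r _ => (τ z).toMultilinearMap.map_smul_univ _ _)
  rw [h1]
  refine ContDiffWithinAt.sum fun r _ => ContDiffWithinAt.fun_smul ?_
    (contDiffWithinAt_alternating_iff.1 hτ _)
  refine contDiffWithinAt_prod fun i _ => ?_
  exact (LinearMap.toContinuousLinearMap (b.coord (r i))).contDiff.contDiffAt.comp_contDiffWithinAt
    y (hv i)

theorem _root_.ContDiffWithinAt.alternating_comp {E' : Type*} [NormedAddCommGroup E']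
    [NormedSpace ℝ E'] [FiniteDimensional ℝ E'] {n : WithTop ℕ∞} {τ : G → E' [⋀^Fin k]→L[ℝ] ℝ}
    {A : G → E →L[ℝ] E'} {s : Set G} {y : G} (hτ : ContDiffWithinAt ℝ n τ s y)
    (hA : ContDiffWithinAt ℝ n A s y) :
    ContDiffWithinAt ℝ n (fun z => (τ z).compContinuousLinearMap (A z)) s y := by
  rw [contDiffWithinAt_alternating_iff]
  intro v
  exact hτ.alternating_apply (v := fun z i => A z (v i)) fun i => hA.clm_apply contDiffWithinAt_const

end AlternatingMaps

section FormCalculus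

variable {E : Type*} [NormedAddCommGroup E] [NormedSpace ℝ E] [FiniteDimensional ℝ E]
  {H : Type*} [TopologicalSpace H]
  {E' : Type*} [NormedAddCommGroup E'] [NormedSpace ℝ E'] [FiniteDimensional ℝ E']
  {H' : Type*} [TopologicalSpace H'] {I : ModelWithCorners ℝ E H} {J : ModelWithCorners ℝ E' H'}
  {M : Type*} [TopologicalSpace M] [ChartedSpace H M] [IsManifold I ∞ M]
  {N : Type*} [TopologicalSpace N] [ChartedSpace H' N] [IsManifold J ∞ N] {k : ℕ}

theorem isManifold_one : IsManifold I 1 M := IsManifold.of_le (n := ∞) (by norm_cast)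

theorem inChart_pullback {f : M → N} (α : Form J N k) {x₀ : M} {y₀ : N} {y : E}
    (hy : y ∈ (extChartAt I x₀).target)
    (hfy : f ((extChartAt I x₀).symm y) ∈ (extChartAt J y₀).source)
    (hf : MDifferentiableAt I J f ((extChartAt I x₀).symm y)) :
    Form.inChart (pullback (I := I) f α) x₀ y =
      (Form.inChart α y₀ (extChartAt J y₀ (f ((extChartAt I x₀).symm y)))).compContinuousLinearMap
        (fderivWithin ℝ (extChartAt J y₀ ∘ f ∘ (extChartAt I x₀).symm) (range I) y) := by
  have := isManifold_one (I := I) (M := M)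
  have := isManifold_one (I := J) (M := N)
  set e := extChartAt I x₀
  set e' := extChartAt J y₀
  have hyr : y ∈ range I := extChartAt_target_subset_range x₀ hy
  have hu : UniqueMDiffWithinAt 𝓘(ℝ, E) (range I) y :=
    (I.uniqueDiffOn y hyr).uniqueMDiffWithinAt
  have he : MDifferentiableWithinAt 𝓘(ℝ, E) I e.symm (range I) y :=
    mdifferentiableWithinAt_extChartAt_symm hy
  have hfe : MDifferentiableWithinAt 𝓘(ℝ, E) J (f ∘ e.symm) (range I) y :=
    hf.comp_mdifferentiableWithinAt y he
  have h1 : mfderivWithin 𝓘(ℝ, E) J (f ∘ e.symm) (range I) y =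
      (mfderiv I J f (e.symm y)).comp (mfderivWithin 𝓘(ℝ, E) I e.symm (range I) y) :=
    mfderiv_comp_mfderivWithin y hf he hu
  have he' : MDifferentiableAt J 𝓘(ℝ, E') e' (f (e.symm y)) :=
    mdifferentiableAt_extChartAt (by rwa [extChartAt_source] at hfy)
  have hF : MDifferentiableWithinAt 𝓘(ℝ, E) 𝓘(ℝ, E') (e' ∘ f ∘ e.symm) (range I) y :=
    he'.comp_mdifferentiableWithinAt y hfe
  have he's : MDifferentiableWithinAt 𝓘(ℝ, E') J e'.symm (range J) ((e' ∘ f ∘ e.symm) y) :=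
    mdifferentiableWithinAt_extChartAt_symm (e'.map_source hfy)
  have h2 : mfderivWithin 𝓘(ℝ, E) J (e'.symm ∘ (e' ∘ f ∘ e.symm)) (range I) y =
      (mfderivWithin 𝓘(ℝ, E') J e'.symm (range J) ((e' ∘ f ∘ e.symm) y)).comp
        (mfderivWithin 𝓘(ℝ, E) 𝓘(ℝ, E') (e' ∘ f ∘ e.symm) (range I) y) := by
    refine mfderivWithin_comp y he's hF ?_ hu
    intro z _
    exact ⟨chartAt H' y₀ (f (e.symm z)), rfl⟩
  have h3 : (e'.symm ∘ (e' ∘ f ∘ e.symm)) =ᶠ[𝓝[range I] y] f ∘ e.symm := by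
    filter_upwards [hfe.continuousWithinAt.preimage_mem_nhdsWithin
      ((isOpen_extChartAt_source y₀).mem_nhds hfy)] with z hz
    exact e'.left_inv hz
  have h4 := h3.mfderivWithin_eq (I := 𝓘(ℝ, E)) (I' := J) (e'.left_inv hfy)
  rw [h2, h1] at h4
  have h5 : e'.symm ((e' ∘ f ∘ e.symm) y) = f (e.symm y) := e'.left_inv hfy
  have key : ∀ (p q : N) (_ : p = q) (A B : E →L[ℝ] E') (_ : A = B),
      (show E' [⋀^Fin k]→L[ℝ] ℝ from α p).compContinuousLinearMap A =
      (show E' [⋀^Fin k]→L[ℝ] ℝ from α q).compContinuousLinearMap B := by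
    rintro p _ rfl A _ rfl; rfl
  rw [mfderivWithin_eq_fderivWithin] at h4
  exact (key _ _ h5 _ _ h4).symm

theorem eventually_mdifferentiableAt {f : M → N} {x : M} (hf : ContMDiffAt I J ∞ f x) :
    ∀ᶠ z in 𝓝 x, MDifferentiableAt I J f z := by
  have := isManifold_one (I := I) (M := M)
  have := isManifold_one (I := J) (M := N)
  have h2 : ContMDiffAt I J 1 f x := hf.of_le (by norm_cast)
  filter_upwards [(contMDiffAt_iff_contMDiffAt_nhds (by simp)).1 h2] with z hz
  exact hz.mdifferentiableAt (by simp)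

theorem minSmoothness_two_le : minSmoothness ℝ 2 ≤ ∞ := by
  simp only [minSmoothness_of_isRCLikeNormedField]
  norm_cast

/-- `α` is `C^∞` at `x`, expressed in the chart around `x`. -/
def Form.SmoothAt (α : Form I M k) (x : M) : Prop :=
  ContDiffWithinAt ℝ ∞ (Form.inChart α x) (range I) (extChartAt I x x)

theorem inChart_eq_pullback_coordChange (α : Form I M k) {x₀ x₁ : M} {y : E}
    (hy : y ∈ (extChartAt I x₀).target)
    (hy' : (extChartAt I x₀).symm y ∈ (extChartAt I x₁).source) :
    Form.inChart α x₀ y =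
      (Form.inChart α x₁ (extChartAt I x₁ ((extChartAt I x₀).symm y))).compContinuousLinearMap
        (fderivWithin ℝ (extChartAt I x₁ ∘ (extChartAt I x₀).symm) (range I) y) := by
  have h := inChart_pullback (I := I) (f := id) α (x₀ := x₀) hy hy' mdifferentiableAt_id
  have h2 : pullback (I := I) (J := I) id α = α := by
    funext x
    simp only [pullback, mfderiv_id]
    rfl
  rw [h2] at h
  exact h

theorem contDiffWithinAt_coordChange {x₀ x₁ : M} {y : E}
    (hy : y ∈ (extChartAt I x₀).target)
    (hy' : (extChartAt I x₀).symm y ∈ (extChartAt I x₁).source) :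
    ContDiffWithinAt ℝ ∞ (extChartAt I x₁ ∘ (extChartAt I x₀).symm) (range I) y :=
  contDiffWithinAt_ext_coord_change x₁ x₀ (by
    rw [PartialEquiv.trans_source, PartialEquiv.symm_source]
    exact ⟨hy, hy'⟩)

theorem eventually_mem_extChartAt_target {x₀ : M} {y : E} (hy : y ∈ (extChartAt I x₀).target) :
    ∀ᶠ z in 𝓝[range I] y, z ∈ (extChartAt I x₀).target :=
  extChartAt_target_mem_nhdsWithin_of_mem hy

theorem continuousWithinAt_extChartAt_symm_range {x₀ : M} {y : E}
    (hy : y ∈ (extChartAt I x₀).target) :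
    ContinuousWithinAt (extChartAt I x₀).symm (range I) y :=
  (continuousAt_extChartAt_symm'' hy).continuousWithinAt

/-- A neighbourhood property of points of `M`, read in a chart. -/
theorem eventually_extChartAt_symm {x₀ : M} {y : E} (hy : y ∈ (extChartAt I x₀).target)
    {p : M → Prop} (hp : ∀ᶠ x in 𝓝 ((extChartAt I x₀).symm y), p x) :
    ∀ᶠ z in 𝓝[range I] y, p ((extChartAt I x₀).symm z) :=
  (continuousWithinAt_extChartAt_symm_range hy).eventually hp

theorem _root_.ContDiffWithinAt.fderivWithin_range {F : E → E'} {y : E}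
    (hF : ContDiffWithinAt ℝ ∞ F (range I) y) (hy : y ∈ range I) :
    ContDiffWithinAt ℝ ∞ (fderivWithin ℝ F (range I)) (range I) y :=
  hF.fderivWithin_right I.uniqueDiffOn (by simp) hy

theorem contDiffWithinAt_inChart_of_inChart {α : Form I M k} {x₀ x₁ : M} {y : E}
    (hy : y ∈ (extChartAt I x₀).target)
    (hy' : (extChartAt I x₀).symm y ∈ (extChartAt I x₁).source)
    (h : ContDiffWithinAt ℝ ∞ (Form.inChart α x₁) (range I)
      (extChartAt I x₁ ((extChartAt I x₀).symm y))) :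
    ContDiffWithinAt ℝ ∞ (Form.inChart α x₀) (range I) y := by
  have hF := contDiffWithinAt_coordChange hy hy'
  have hyr := extChartAt_target_subset_range x₀ hy
  have h1 : ContDiffWithinAt ℝ ∞ (fun z => (Form.inChart α x₁ (extChartAt I x₁
      ((extChartAt I x₀).symm z))).compContinuousLinearMap
        (fderivWithin ℝ (extChartAt I x₁ ∘ (extChartAt I x₀).symm) (range I) z)) (range I) y := by
    refine ContDiffWithinAt.alternating_comp ?_ (hF.fderivWithin_range hyr)
    refine ContDiffWithinAt.comp (t := range I) y h hF fun z _ => ?_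
    exact ⟨chartAt H x₁ ((extChartAt I x₀).symm z), rfl⟩
  refine h1.congr_of_eventuallyEq_of_mem ?_ hyr
  filter_upwards [eventually_mem_extChartAt_target hy, eventually_extChartAt_symm hy
    ((isOpen_extChartAt_source x₁).mem_nhds hy')] with z hz hz'
  exact inChart_eq_pullback_coordChange α hz hz'

theorem Form.smoothAt_iff_inChart {α : Form I M k} {x₀ x : M} (hx : x ∈ (extChartAt I x₀).source) :
    Form.SmoothAt α x ↔
      ContDiffWithinAt ℝ ∞ (Form.inChart α x₀) (range I) (extChartAt I x₀ x) := by
  constructor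
  · intro h
    refine contDiffWithinAt_inChart_of_inChart (x₁ := x) ((extChartAt I x₀).map_source hx) ?_ ?_
    · rw [(extChartAt I x₀).left_inv hx]; exact mem_extChartAt_source x
    · rw [(extChartAt I x₀).left_inv hx]; exact h
  · intro h
    refine contDiffWithinAt_inChart_of_inChart (x₁ := x₀) (mem_extChartAt_target x) ?_ ?_
    · rwa [(extChartAt I x).left_inv (mem_extChartAt_source x)]
    · rwa [(extChartAt I x).left_inv (mem_extChartAt_source x)]

theorem Form.isSmooth_iff_smoothAt {α : Form I M k} :
    Form.IsSmooth α ↔ ∀ x, Form.SmoothAt α x := by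
  constructor
  · intro h x
    exact (h x _ (mem_extChartAt_target x)).mono_of_mem_nhdsWithin
      (extChartAt_target_mem_nhdsWithin x)
  · intro h x₀ y hy
    have h1 := (Form.smoothAt_iff_inChart ((extChartAt I x₀).map_target hy)).1
      (h ((extChartAt I x₀).symm y))
    rw [(extChartAt I x₀).right_inv hy] at h1
    exact h1.mono (extChartAt_target_subset_range x₀)

theorem Form.IsSmooth.smoothAt {α : Form I M k} (h : Form.IsSmooth α) (x : M) :
    Form.SmoothAt α x := Form.isSmooth_iff_smoothAt.1 h x

theorem Form.IsSmooth.contDiffWithinAt {α : Form I M k} (h : Form.IsSmooth α) {x₀ : M} {y : E}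
    (hy : y ∈ (extChartAt I x₀).target) :
    ContDiffWithinAt ℝ ∞ (Form.inChart α x₀) (range I) y :=
  (h x₀ y hy).mono_of_mem_nhdsWithin (extChartAt_target_mem_nhdsWithin_of_mem hy)

theorem inChart_congr {α β : Form I M k} {x₀ : M} {y : E}
    (h : α ((extChartAt I x₀).symm y) = β ((extChartAt I x₀).symm y)) :
    Form.inChart α x₀ y = Form.inChart β x₀ y := by
  simp only [Form.inChart, h]

theorem inChart_eventuallyEq {α β : Form I M k} {x₀ : M} {y : E}
    (hy : y ∈ (extChartAt I x₀).target)
    (h : ∀ᶠ x in 𝓝 ((extChartAt I x₀).symm y), α x = β x) :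
    Form.inChart α x₀ =ᶠ[𝓝[range I] y] Form.inChart β x₀ :=
  (eventually_extChartAt_symm hy h).mono fun _ hz => inChart_congr hz

theorem Form.SmoothAt.congr {α β : Form I M k} {x : M} (hα : Form.SmoothAt α x)
    (h : ∀ᶠ z in 𝓝 x, α z = β z) : Form.SmoothAt β x := by
  refine ContDiffWithinAt.congr_of_eventuallyEq_of_mem hα ?_
    (extChartAt_target_subset_range x (mem_extChartAt_target x))
  refine (inChart_eventuallyEq (mem_extChartAt_target x) ?_).symm
  rwa [extChartAt_to_inv]

theorem Form.d_congr {α β : Form I M k} {x : M} (h : ∀ᶠ z in 𝓝 x, α z = β z) :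
    Form.d α x = Form.d β x := by
  have h1 : Form.inChart α x =ᶠ[𝓝[range I] (extChartAt I x x)] Form.inChart β x := by
    refine inChart_eventuallyEq (mem_extChartAt_target x) ?_
    rwa [extChartAt_to_inv]
  rw [Form.d, Form.d, h1.extDerivWithin_eq_of_mem
    (extChartAt_target_subset_range x (mem_extChartAt_target x))]

theorem Form.SmoothAt.pullback {f : M → N} {α : Form J N k} {x : M} (hα : Form.SmoothAt α (f x))
    (hf : ContMDiffAt I J ∞ f x) : Form.SmoothAt (pullback (I := I) f α) x := by
  have hF : ContDiffWithinAt ℝ ∞ (extChartAt J (f x) ∘ f ∘ (extChartAt I x).symm) (range I)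
      (extChartAt I x x) := (contMDiffAt_iff.1 hf).2
  have hyr := extChartAt_target_subset_range x (mem_extChartAt_target (I := I) x)
  have h1 : ContDiffWithinAt ℝ ∞ (fun z => (Form.inChart α (f x) (extChartAt J (f x)
      (f ((extChartAt I x).symm z)))).compContinuousLinearMap
        (fderivWithin ℝ (extChartAt J (f x) ∘ f ∘ (extChartAt I x).symm) (range I) z)) (range I)
        (extChartAt I x x) := by
    refine ContDiffWithinAt.alternating_comp ?_ (hF.fderivWithin_range hyr)
    refine ContDiffWithinAt.comp (g := Form.inChart α (f x)) (t := range J) _ ?_ hF fun z _ => ?_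
    · simp only [extChartAt_to_inv]; exact hα
    · exact ⟨chartAt H' (f x) (f ((extChartAt I x).symm z)), rfl⟩
  refine h1.congr_of_eventuallyEq_of_mem ?_ hyr
  have hd : ∀ᶠ z in 𝓝 x, MDifferentiableAt I J f z := eventually_mdifferentiableAt hf
  have hs : ∀ᶠ z in 𝓝 x, f z ∈ (extChartAt J (f x)).source :=
    hf.continuousAt.eventually (extChartAt_source_mem_nhds (f x))
  rw [← extChartAt_to_inv (I := I) x] at hd hs
  filter_upwards [eventually_mem_extChartAt_target (mem_extChartAt_target x),
    eventually_extChartAt_symm (mem_extChartAt_target x) hd,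
    eventually_extChartAt_symm (mem_extChartAt_target x) hs] with z hz hz1 hz2
  exact inChart_pullback α hz (by simpa using hz2) hz1

theorem Form.IsSmooth.pullback {f : M → N} {α : Form J N k} (hα : Form.IsSmooth α)
    (hf : ContMDiff I J ∞ f) : Form.IsSmooth (pullback (I := I) f α) :=
  Form.isSmooth_iff_smoothAt.2 fun x => (hα.smoothAt (f x)).pullback (hf x)

/-- The exterior derivative commutes with pullbacks. -/
theorem Form.d_pullback {f : M → N} {α : Form J N k} {x : M} (hα : Form.SmoothAt α (f x))
    (hf : ContMDiffAt I J ∞ f x) :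
    Form.d (SurfaceDynamics.pullback (I := I) f α) x =
      SurfaceDynamics.pullback (I := I) f (Form.d α) x := by
  have := isManifold_one (I := I) (M := M)
  have := isManifold_one (I := J) (M := N)
  set F := extChartAt J (f x) ∘ f ∘ (extChartAt I x).symm with hFdef
  have hF : ContDiffWithinAt ℝ ∞ F (range I) (extChartAt I x x) := (contMDiffAt_iff.1 hf).2
  have hyr := extChartAt_target_subset_range x (mem_extChartAt_target (I := I) x)
  have hFx : F (extChartAt I x x) = extChartAt J (f x) (f x) := by
    simp only [hFdef, Function.comp_apply, extChartAt_to_inv]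
  have hd : ∀ᶠ z in 𝓝 x, MDifferentiableAt I J f z := eventually_mdifferentiableAt hf
  have hs : ∀ᶠ z in 𝓝 x, f z ∈ (extChartAt J (f x)).source :=
    hf.continuousAt.eventually (extChartAt_source_mem_nhds (f x))
  have hfx := hd.self_of_nhds
  rw [← extChartAt_to_inv (I := I) x] at hd hs
  have h0 : Form.inChart (SurfaceDynamics.pullback (I := I) f α) x =ᶠ[𝓝[range I] extChartAt I x x]
      fun z => (Form.inChart α (f x) (F z)).compContinuousLinearMap
        (fderivWithin ℝ F (range I) z) := by
    filter_upwards [eventually_mem_extChartAt_target (mem_extChartAt_target x),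
      eventually_extChartAt_symm (mem_extChartAt_target x) hd,
      eventually_extChartAt_symm (mem_extChartAt_target x) hs] with z hz hz1 hz2
    exact inChart_pullback α hz (by simpa using hz2) hz1
  have h1 : extDerivWithin (fun z => (Form.inChart α (f x) (F z)).compContinuousLinearMap
        (fderivWithin ℝ F (range I) z)) (range I) (extChartAt I x x) =
      (extDerivWithin (Form.inChart α (f x)) (range J) (F (extChartAt I x x))).compContinuousLinearMap
        (fderivWithin ℝ F (range I) (extChartAt I x x)) := by
    refine extDerivWithin_pullback (r := ∞) ?_ hF minSmoothness_two_le I.uniqueDiffOn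
      (I.range_subset_closure_interior hyr) hyr fun z _ => ?_
    · rw [hFx]
      exact ContDiffWithinAt.differentiableWithinAt hα (by simp)
    · exact ⟨chartAt H' (f x) (f ((extChartAt I x).symm z)), rfl⟩
  rw [Form.d, h0.extDerivWithin_eq_of_mem hyr, h1, hFx]
  have h2 : (fderivWithin ℝ F (range I) (extChartAt I x x)).comp
      (mfderiv I 𝓘(ℝ, E) (extChartAt I x) x : E →L[ℝ] E) =
      (mfderiv J 𝓘(ℝ, E') (extChartAt J (f x)) (f x) : E' →L[ℝ] E').comp
        (mfderiv I J f x : E →L[ℝ] E') := by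
    have he : MDifferentiableAt J 𝓘(ℝ, E') (extChartAt J (f x)) (f x) :=
      mdifferentiableAt_extChartAt (mem_chart_source _ _)
    have hfd : mfderiv I J f x = fderivWithin ℝ (writtenInExtChartAt I J x f) (range I)
      (extChartAt I x x) := by
      exact hfx.mfderiv
    have e1 : (mfderiv I 𝓘(ℝ, E) (extChartAt I x) x : E →L[ℝ] E) = ContinuousLinearMap.id ℝ E :=
      mfderiv_extChartAt_self
    have e2 : (mfderiv J 𝓘(ℝ, E') (extChartAt J (f x)) (f x) : E' →L[ℝ] E') =
      ContinuousLinearMap.id ℝ E' := mfderiv_extChartAt_self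
    rw [e1, e2, hfd]
    rfl
  ext v
  exact congrArg (extDerivWithin (Form.inChart α (f x)) (range J) (extChartAt J (f x) (f x)))
    (funext fun i => congrArg (fun A : E →L[ℝ] E' => A (v i)) h2)

/-- The exterior derivative, computed in an arbitrary chart. -/
theorem inChart_d {α : Form I M k} {x₀ : M} {y : E} (hy : y ∈ (extChartAt I x₀).target)
    (hα : Form.SmoothAt α ((extChartAt I x₀).symm y)) :
    Form.inChart (Form.d α) x₀ y = extDerivWithin (Form.inChart α x₀) (range I) y := by
  have := isManifold_one (I := I) (M := M)
  set x := (extChartAt I x₀).symm y with hx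
  set F := extChartAt I x ∘ (extChartAt I x₀).symm with hFdef
  have hy' : (extChartAt I x₀).symm y ∈ (extChartAt I x).source := mem_extChartAt_source x
  have hF : ContDiffWithinAt ℝ ∞ F (range I) y := contDiffWithinAt_coordChange hy hy'
  have hyr := extChartAt_target_subset_range x₀ hy
  have h0 : Form.inChart α x₀ =ᶠ[𝓝[range I] y]
      fun z => (Form.inChart α x (F z)).compContinuousLinearMap
        (fderivWithin ℝ F (range I) z) := by
    filter_upwards [eventually_mem_extChartAt_target hy, eventually_extChartAt_symm hy
      ((isOpen_extChartAt_source x).mem_nhds hy')] with z hz hz'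
    exact inChart_eq_pullback_coordChange α hz hz'
  have h1 : extDerivWithin (fun z => (Form.inChart α x (F z)).compContinuousLinearMap
        (fderivWithin ℝ F (range I) z)) (range I) y =
      (extDerivWithin (Form.inChart α x) (range I) (F y)).compContinuousLinearMap
        (fderivWithin ℝ F (range I) y) := by
    refine extDerivWithin_pullback (r := ∞) ?_ hF minSmoothness_two_le I.uniqueDiffOn
      (I.range_subset_closure_interior hyr) hyr fun z _ => ?_
    · exact ContDiffWithinAt.differentiableWithinAt hα (by simp)
    · exact ⟨chartAt H x ((extChartAt I x₀).symm z), rfl⟩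
  rw [h0.extDerivWithin_eq_of_mem hyr, h1]
  rw [Form.inChart, Form.d]
  ext v
  have h2 : (mfderiv I 𝓘(ℝ, E) (extChartAt I x) x : E →L[ℝ] E).comp
      (mfderivWithin 𝓘(ℝ, E) I (extChartAt I x₀).symm (range I) y : E →L[ℝ] E) =
      fderivWithin ℝ F (range I) y := by
    have h3 := mfderiv_comp_mfderivWithin (I := 𝓘(ℝ, E)) (I' := I) (I'' := 𝓘(ℝ, E)) y
      (f := (extChartAt I x₀).symm) (s := range I) (g := extChartAt I x)
      (mdifferentiableAt_extChartAt (mem_chart_source _ _))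
      (mdifferentiableWithinAt_extChartAt_symm hy) (I.uniqueDiffOn y hyr).uniqueMDiffWithinAt
    rw [mfderivWithin_eq_fderivWithin] at h3
    exact h3.symm
  exact congrArg (extDerivWithin (Form.inChart α x) (range I) (extChartAt I x x))
    (funext fun i => congrArg (fun A : E →L[ℝ] E => A (v i)) h2)

end FormCalculus

section FormAlgebra

variable {E : Type*} [NormedAddCommGroup E] [NormedSpace ℝ E] [FiniteDimensional ℝ E]
  {H : Type*} [TopologicalSpace H]
  {E' : Type*} [NormedAddCommGroup E'] [NormedSpace ℝ E'] [FiniteDimensional ℝ E']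
  {H' : Type*} [TopologicalSpace H'] {I : ModelWithCorners ℝ E H} {J : ModelWithCorners ℝ E' H'}
  {M : Type*} [TopologicalSpace M] [ChartedSpace H M] [IsManifold I ∞ M]
  {N : Type*} [TopologicalSpace N] [ChartedSpace H' N] [IsManifold J ∞ N] {k : ℕ}

theorem inChart_add (α β : Form I M k) (x₀ : M) :
    Form.inChart (α + β) x₀ = Form.inChart α x₀ + Form.inChart β x₀ := rfl

theorem inChart_neg (α : Form I M k) (x₀ : M) :
    Form.inChart (-α) x₀ = -Form.inChart α x₀ := rfl

theorem Form.SmoothAt.add {α β : Form I M k} {x : M} (hα : Form.SmoothAt α x)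
    (hβ : Form.SmoothAt β x) : Form.SmoothAt (α + β) x :=
  ContDiffWithinAt.add hα hβ

theorem Form.SmoothAt.neg {α : Form I M k} {x : M} (hα : Form.SmoothAt α x) :
    Form.SmoothAt (-α) x :=
  ContDiffWithinAt.neg hα

theorem Form.SmoothAt.sub {α β : Form I M k} {x : M} (hα : Form.SmoothAt α x)
    (hβ : Form.SmoothAt β x) : Form.SmoothAt (α - β) x := by
  rw [sub_eq_add_neg]; exact hα.add hβ.neg

theorem Form.smoothAt_zero {x : M} : Form.SmoothAt (0 : Form I M k) x :=
  contDiffWithinAt_const (c := (0 : E [⋀^Fin k]→L[ℝ] ℝ))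

theorem _root_.ContMDiffAt.contDiffWithinAt_symm {f : M → ℝ} {x : M}
    (hf : ContMDiffAt I 𝓘(ℝ, ℝ) ∞ f x) :
    ContDiffWithinAt ℝ ∞ (fun y => f ((extChartAt I x).symm y)) (range I) (extChartAt I x x) :=
  (contMDiffAt_iff.1 hf).2

theorem Form.SmoothAt.smul {f : M → ℝ} {α : Form I M k} {x : M}
    (hf : ContMDiffAt I 𝓘(ℝ, ℝ) ∞ f x) (hα : Form.SmoothAt α x) :
    Form.SmoothAt (fun x => f x • α x : Form I M k) x :=
  ContDiffWithinAt.fun_smul hf.contDiffWithinAt_symm hα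

theorem Form.IsSmooth.add {α β : Form I M k} (hα : Form.IsSmooth α) (hβ : Form.IsSmooth β) :
    Form.IsSmooth (α + β) :=
  Form.isSmooth_iff_smoothAt.2 fun x => (hα.smoothAt x).add (hβ.smoothAt x)

theorem Form.IsSmooth.sub {α β : Form I M k} (hα : Form.IsSmooth α) (hβ : Form.IsSmooth β) :
    Form.IsSmooth (α - β) :=
  Form.isSmooth_iff_smoothAt.2 fun x => (hα.smoothAt x).sub (hβ.smoothAt x)

theorem Form.IsSmooth.smul {f : M → ℝ} {α : Form I M k}
    (hf : ContMDiff I 𝓘(ℝ, ℝ) ∞ f) (hα : Form.IsSmooth α) :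
    Form.IsSmooth (fun x => f x • α x : Form I M k) :=
  Form.isSmooth_iff_smoothAt.2 fun x => .smul (hf x) (hα.smoothAt x)

theorem Form.SmoothAt.differentiableWithinAt {α : Form I M k} {x : M} (hα : Form.SmoothAt α x) :
    DifferentiableWithinAt ℝ (Form.inChart α x) (range I) (extChartAt I x x) :=
  ContDiffWithinAt.differentiableWithinAt hα (by simp)

theorem uniqueDiffWithinAt_range_extChartAt (x : M) :
    UniqueDiffWithinAt ℝ (range I) (extChartAt I x x) :=
  I.uniqueDiffOn _ (extChartAt_target_subset_range x (mem_extChartAt_target x))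

theorem Form.d_add {α β : Form I M k} {x : M} (hα : Form.SmoothAt α x) (hβ : Form.SmoothAt β x) :
    Form.d (α + β) x = Form.d α x + Form.d β x := by
  rw [Form.d, Form.d, Form.d, inChart_add, extDerivWithin_add
    (uniqueDiffWithinAt_range_extChartAt x) hα.differentiableWithinAt hβ.differentiableWithinAt]
  rfl

theorem Form.d_neg {α : Form I M k} {x : M} :
    Form.d (-α) x = -Form.d α x := by
  have h := extDerivWithin_smul (𝕜 := ℝ) (-1 : ℝ) (Form.inChart α x)
    (uniqueDiffWithinAt_range_extChartAt (I := I) x)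
  rw [neg_one_smul, neg_one_smul] at h
  rw [Form.d, Form.d, inChart_neg, h]
  rfl

theorem Form.d_sub {α β : Form I M k} {x : M} (hα : Form.SmoothAt α x) (hβ : Form.SmoothAt β x) :
    Form.d (α - β) x = Form.d α x - Form.d β x := by
  rw [sub_eq_add_neg, Form.d_add hα hβ.neg, Form.d_neg, ← sub_eq_add_neg]

theorem extDerivWithin_one_apply {σ : E → E [⋀^Fin 1]→L[ℝ] ℝ} {s : Set E} {y : E} (v w : E) :
    extDerivWithin σ s y ![v, w] =
      fderivWithin ℝ σ s y v ![w] - fderivWithin ℝ σ s y w ![v] := by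
  rw [extDerivWithin, ContinuousAlternatingMap.alternatizeUncurryFin_apply, Fin.sum_univ_two]
  have h0 : (0 : Fin 2).removeNth ![v, w] = ![w] := by
    ext i; fin_cases i; rfl
  have h1 : (1 : Fin 2).removeNth ![v, w] = ![v] := by
    ext i; fin_cases i; rfl
  rw [h0, h1]
  simp [sub_eq_add_neg]

/-- The exterior derivative of a one-form at a point, in the chart around the point. -/
theorem Form.d_one_apply (α : Form I M 1) (x : M) (v w : E) :
    (show E [⋀^Fin 2]→L[ℝ] ℝ from Form.d α x) ![v, w] =
      fderivWithin ℝ (Form.inChart α x) (range I) (extChartAt I x x) v ![w] -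
        fderivWithin ℝ (Form.inChart α x) (range I) (extChartAt I x x) w ![v] := by
  have := isManifold_one (I := I) (M := M)
  rw [← extDerivWithin_one_apply]
  have e1 : (mfderiv I 𝓘(ℝ, E) (extChartAt I x) x : E →L[ℝ] E) = ContinuousLinearMap.id ℝ E :=
    mfderiv_extChartAt_self
  have h : ∀ A : E →L[ℝ] E, A = ContinuousLinearMap.id ℝ E →
      ((extDerivWithin (Form.inChart α x) (range I) (extChartAt I x x)).compContinuousLinearMap A)
        ![v, w] = extDerivWithin (Form.inChart α x) (range I) (extChartAt I x x) ![v, w] := by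
    rintro _ rfl; rfl
  exact h _ e1

theorem inChart_self (α : Form I M k) (x : M) :
    Form.inChart α x (extChartAt I x x) = (show E [⋀^Fin k]→L[ℝ] ℝ from α x) := by
  have := isManifold_one (I := I) (M := M)
  have e1 : (mfderivWithin 𝓘(ℝ, E) I (extChartAt I x).symm (range I) (extChartAt I x x) :
      E →L[ℝ] E) = ContinuousLinearMap.id ℝ E := mfderivWithin_range_extChartAt_symm
  have h : ∀ (p : M) (_ : p = x) (A : E →L[ℝ] E), A = ContinuousLinearMap.id ℝ E →
      (show E [⋀^Fin k]→L[ℝ] ℝ from α p).compContinuousLinearMap A =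
      (show E [⋀^Fin k]→L[ℝ] ℝ from α x) := by
    rintro _ rfl _ rfl; rfl
  exact h _ (extChartAt_to_inv x) _ e1

/-- The differential of a function, as a one-form. -/
def differential (f : M → ℝ) : Form I M 1 :=
  fun x => ContinuousAlternatingMap.ofSubsingleton ℝ (TangentSpace I x) ℝ (0 : Fin 1)
    (mfderiv I 𝓘(ℝ, ℝ) f x)

theorem inChart_differential {f : M → ℝ} {x₀ : M} {y : E} (hy : y ∈ (extChartAt I x₀).target)
    (hf : MDifferentiableAt I 𝓘(ℝ, ℝ) f ((extChartAt I x₀).symm y)) :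
    Form.inChart (differential (I := I) f) x₀ y =
      ContinuousAlternatingMap.ofSubsingleton ℝ E ℝ (0 : Fin 1)
        (fderivWithin ℝ (fun z => f ((extChartAt I x₀).symm z)) (range I) y) := by
  have := isManifold_one (I := I) (M := M)
  have hyr := extChartAt_target_subset_range x₀ hy
  have h3 := mfderiv_comp_mfderivWithin (I := 𝓘(ℝ, E)) (I' := I) (I'' := 𝓘(ℝ, ℝ)) y
      (f := (extChartAt I x₀).symm) (s := range I) (g := f) hf
      (mdifferentiableWithinAt_extChartAt_symm hy) (I.uniqueDiffOn y hyr).uniqueMDiffWithinAt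
  rw [mfderivWithin_eq_fderivWithin] at h3
  ext v
  exact (congrArg (fun A : E →L[ℝ] ℝ => A (v 0)) h3).symm

theorem eventually_inChart_differential {f : M → ℝ} {x : M} (hf : ContMDiffAt I 𝓘(ℝ, ℝ) ∞ f x) :
    Form.inChart (differential (I := I) f) x =ᶠ[𝓝[range I] (extChartAt I x x)] fun y =>
      ContinuousAlternatingMap.ofSubsingleton ℝ E ℝ (0 : Fin 1)
        (fderivWithin ℝ (fun z => f ((extChartAt I x).symm z)) (range I) y) := by
  have hd := eventually_mdifferentiableAt hf
  rw [← extChartAt_to_inv (I := I) x] at hd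
  filter_upwards [eventually_mem_extChartAt_target (mem_extChartAt_target x),
    eventually_extChartAt_symm (mem_extChartAt_target x) hd] with y hy hy'
  exact inChart_differential hy hy'

theorem smoothAt_differential {f : M → ℝ} {x : M} (hf : ContMDiffAt I 𝓘(ℝ, ℝ) ∞ f x) :
    Form.SmoothAt (differential (I := I) f) x := by
  have hyr := extChartAt_target_subset_range x (mem_extChartAt_target (I := I) x)
  refine ContDiffWithinAt.congr_of_eventuallyEq_of_mem ?_ (eventually_inChart_differential hf) hyr
  rw [contDiffWithinAt_alternating_iff]
  intro v
  exact (hf.contDiffWithinAt_symm.fderivWithin_range hyr).clm_apply contDiffWithinAt_const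

theorem isSmooth_differential {f : M → ℝ} (hf : ContMDiff I 𝓘(ℝ, ℝ) ∞ f) :
    Form.IsSmooth (differential (I := I) f) :=
  Form.isSmooth_iff_smoothAt.2 fun x => smoothAt_differential (hf x)

theorem Form.d_differential {f : M → ℝ} {x : M} (hf : ContMDiffAt I 𝓘(ℝ, ℝ) ∞ f x) :
    Form.d (differential (I := I) f) x = 0 := by
  have hyr := extChartAt_target_subset_range x (mem_extChartAt_target (I := I) x)
  have h1 : extDerivWithin (Form.inChart (differential (I := I) f) x) (range I)
      (extChartAt I x x) = 0 := by
    rw [(eventually_inChart_differential hf).extDerivWithin_eq_of_mem hyr]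
    have h2 : ∀ y ∈ range I, ContinuousAlternatingMap.ofSubsingleton ℝ E ℝ (0 : Fin 1)
        (fderivWithin ℝ (fun z => f ((extChartAt I x).symm z)) (range I) y) =
        extDerivWithin (fun z => ContinuousAlternatingMap.constOfIsEmpty ℝ E (Fin 0)
          (f ((extChartAt I x).symm z))) (range I) y := fun y hy =>
      (extDerivWithin_constOfIsEmpty _ (I.uniqueDiffOn y hy)).symm
    rw [extDerivWithin_congr' (fun y hy => h2 y hy) hyr]
    refine extDerivWithin_extDerivWithin_apply (r := ∞) ?_ minSmoothness_two_le I.uniqueDiffOn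
      (I.range_subset_closure_interior hyr) hyr
    rw [contDiffWithinAt_alternating_iff]
    intro v
    exact hf.contDiffWithinAt_symm
  rw [Form.d, h1]
  rfl

end FormAlgebra

section ParametricIntegral

open MeasureTheory

universe u
variable {E : Type u} [NormedAddCommGroup E] [NormedSpace ℝ E]

theorem eventually_forall_norm_sub_lt {F : Type*} [NormedAddCommGroup F] {f : ℝ × E → F} {s : Set E}
    (hf : ContinuousOn f (Icc 0 1 ×ˢ s)) {y : E} (hy : y ∈ s) {ε : ℝ} (hε : 0 < ε) :
    ∀ᶠ z in 𝓝[s] y, ∀ u ∈ Icc (0 : ℝ) 1, ‖f (u, z) - f (u, y)‖ < ε := by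
  have h := (isCompact_Icc (a := (0 : ℝ)) (b := 1)).eventually_forall_of_forall_eventually
    (x₀ := y) (P := fun z u => z ∈ s → u ∈ Icc (0 : ℝ) 1 → ‖f (u, z) - f (u, y)‖ < ε) ?_
  · rw [eventually_nhdsWithin_iff]
    filter_upwards [h] with z hz hzs u hu using hz u hu hzs hu
  · intro u hu
    have h1 := (hf (u, y) ⟨hu, hy⟩).eventually (Metric.ball_mem_nhds _ (half_pos hε))
    rw [eventually_nhdsWithin_iff, nhds_prod_eq] at h1
    have h2 : ∀ᶠ u' in 𝓝 u, u' ∈ Icc (0 : ℝ) 1 → dist (f (u', y)) (f (u, y)) < ε / 2 := by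
      have h3 : Tendsto (fun u' : ℝ => (u', y)) (𝓝 u) (𝓝 u ×ˢ 𝓝 y) := by
        rw [← nhds_prod_eq]; exact Continuous.tendsto (by fun_prop) u
      filter_upwards [h3.eventually h1] with u' hu' hu'' using hu' ⟨hu'', hy⟩
    have h4 := (tendsto_snd (f := 𝓝 y) (g := 𝓝 u)).eventually h2
    have h5 := (Filter.prod_comm (f := 𝓝 u) (g := 𝓝 y)) ▸ h1
    rw [Filter.eventually_map] at h5
    rw [nhds_prod_eq]
    filter_upwards [h4, h5] with p hp hp' hps hpu
    have h6 := hp hpu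
    have h7 : dist (f (p.2, p.1)) (f (u, y)) < ε / 2 := hp' ⟨hpu, hps⟩
    rw [← dist_eq_norm]
    calc _ ≤ dist (f (p.2, p.1)) (f (u, y)) + dist (f (p.2, y)) (f (u, y)) :=
          dist_triangle_right _ _ _
      _ < ε := by linarith

theorem continuousOn_parametric_integral {F : Type*} [NormedAddCommGroup F] [NormedSpace ℝ F]
    {f : ℝ × E → F} {s : Set E} (hf : ContinuousOn f (Icc 0 1 ×ˢ s)) :
    ContinuousOn (fun y => ∫ u in (0 : ℝ)..1, f (u, y)) s := by
  have hi : ∀ z ∈ s, IntervalIntegrable (fun u => f (u, z)) volume 0 1 := fun z hz =>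
    ContinuousOn.intervalIntegrable_of_Icc zero_le_one
      (hf.comp (by fun_prop) fun u hu => ⟨hu, hz⟩)
  intro y hy
  rw [Metric.continuousWithinAt_iff']
  intro ε hε
  filter_upwards [eventually_forall_norm_sub_lt hf hy (half_pos hε), self_mem_nhdsWithin]
    with z hz hzs
  rw [dist_eq_norm, ← intervalIntegral.integral_sub (hi z hzs) (hi y hy)]
  have h1 := intervalIntegral.norm_integral_le_of_norm_le_const (a := (0 : ℝ)) (b := 1)
    (f := fun u => f (u, z) - f (u, y)) (C := ε / 2) fun u hu => by
      rw [uIoc_of_le zero_le_one] at hu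
      exact (hz u ⟨hu.1.le, hu.2⟩).le
  simp at h1
  linarith

theorem hasFDerivWithinAt_parametric_integral {F : Type*} [NormedAddCommGroup F] [NormedSpace ℝ F]
    [CompleteSpace F]
    {f : ℝ × E → F} {g : ℝ × E → E →L[ℝ] F} {s : Set E} (hs : Convex ℝ s)
    (hf : ContinuousOn f (Icc 0 1 ×ˢ s)) (hg : ContinuousOn g (Icc 0 1 ×ˢ s))
    (hfg : ∀ u ∈ Icc (0 : ℝ) 1, ∀ y ∈ s, HasFDerivWithinAt (fun z => f (u, z)) (g (u, y)) s y)
    {y : E} (hy : y ∈ s) :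
    HasFDerivWithinAt (fun z => ∫ u in (0 : ℝ)..1, f (u, z)) (∫ u in (0 : ℝ)..1, g (u, y)) s y := by
  have hi : ∀ z ∈ s, IntervalIntegrable (fun u => f (u, z)) volume 0 1 := fun z hz =>
    ContinuousOn.intervalIntegrable_of_Icc zero_le_one
      (hf.comp (by fun_prop) fun u hu => ⟨hu, hz⟩)
  have hi' : ∀ z ∈ s, IntervalIntegrable (fun u => g (u, z)) volume 0 1 := fun z hz =>
    ContinuousOn.intervalIntegrable_of_Icc zero_le_one
      (hg.comp (by fun_prop) fun u hu => ⟨hu, hz⟩)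
  rw [hasFDerivWithinAt_iff_isLittleO, Asymptotics.isLittleO_iff]
  intro ε hε
  obtain ⟨δ, hδ, hball⟩ := Metric.mem_nhdsWithin_iff.1 (eventually_forall_norm_sub_lt hg hy hε)
  have hb : Metric.ball y δ ∩ s ∈ 𝓝[s] y := inter_mem (mem_nhdsWithin_of_mem_nhds (Metric.ball_mem_nhds y hδ))
    self_mem_nhdsWithin
  filter_upwards [hb] with z hz
  have hc : Convex ℝ (Metric.ball y δ ∩ s) := (convex_ball y δ).inter hs
  have h1 : ∀ u ∈ Icc (0 : ℝ) 1, ‖f (u, z) - f (u, y) - g (u, y) (z - y)‖ ≤ ε * ‖z - y‖ := by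
    intro u hu
    refine hc.norm_image_sub_le_of_norm_hasFDerivWithin_le' (f := fun z => f (u, z))
      (f' := fun z => g (u, z)) (fun w hw => (hfg u hu w hw.2).mono inter_subset_right)
      (fun w hw => (hball hw u hu).le) ⟨Metric.mem_ball_self hδ, hy⟩ hz
  have hi2 : IntervalIntegrable (fun u => g (u, y) (z - y)) volume 0 1 :=
    ContinuousOn.intervalIntegrable_of_Icc zero_le_one ((hg.comp (f := fun u : ℝ => (u, y))
      (by fun_prop) fun u hu => ⟨hu, hy⟩).clm_apply continuousOn_const)
  rw [ContinuousLinearMap.intervalIntegral_apply (hi' y hy),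
    ← intervalIntegral.integral_sub (hi z hz.2) (hi y hy), ← intervalIntegral.integral_sub
    ((hi z hz.2).sub (hi y hy)) hi2]
  have h2 := intervalIntegral.norm_integral_le_of_norm_le_const (a := (0 : ℝ)) (b := 1)
    (f := fun u => f (u, z) - f (u, y) - g (u, y) (z - y)) (C := ε * ‖z - y‖) fun u hu => by
      rw [uIoc_of_le zero_le_one] at hu
      exact h1 u ⟨hu.1.le, hu.2⟩
  simpa using h2

/-- The derivative of `f` in the direction of the second factor. -/
def partialSnd {F : Type*} [NormedAddCommGroup F] [NormedSpace ℝ F] (f : ℝ × E → F) (s : Set E)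
    (p : ℝ × E) : E →L[ℝ] F :=
  (fderivWithin ℝ f (Icc 0 1 ×ˢ s) p).comp (ContinuousLinearMap.inr ℝ ℝ E)

theorem uniqueDiffOn_Icc_prod {s : Set E} (hs : UniqueDiffOn ℝ s) :
    UniqueDiffOn ℝ (Icc (0 : ℝ) 1 ×ˢ s) := (uniqueDiffOn_Icc zero_lt_one).prod hs

theorem contDiffOn_partialSnd {F : Type*} [NormedAddCommGroup F] [NormedSpace ℝ F] {f : ℝ × E → F}
    {s : Set E} (hs : UniqueDiffOn ℝ s) {m n : WithTop ℕ∞} (hmn : m + 1 ≤ n)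
    (hf : ContDiffOn ℝ n f (Icc 0 1 ×ˢ s)) : ContDiffOn ℝ m (partialSnd f s) (Icc 0 1 ×ˢ s) :=
  ContDiffOn.clm_comp (hf.fderivWithin (uniqueDiffOn_Icc_prod hs) hmn) contDiffOn_const

theorem hasFDerivWithinAt_partialSnd {F : Type*} [NormedAddCommGroup F] [NormedSpace ℝ F]
    {f : ℝ × E → F} {s : Set E} {n : WithTop ℕ∞} (hn : n ≠ 0) (hf : ContDiffOn ℝ n f (Icc 0 1 ×ˢ s))
    {u : ℝ} (hu : u ∈ Icc (0 : ℝ) 1) {y : E} (hy : y ∈ s) :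
    HasFDerivWithinAt (fun z => f (u, z)) (partialSnd f s (u, y)) s y :=
  HasFDerivWithinAt.comp (g := f) (t := Icc (0 : ℝ) 1 ×ˢ s) y
    ((hf.differentiableOn hn) (u, y) ⟨hu, hy⟩).hasFDerivWithinAt
    (hasFDerivAt_prodMk_right u y).hasFDerivWithinAt fun _ hz => ⟨hu, hz⟩

theorem hasFDerivWithinAt_parametric_integral_partialSnd {F : Type*} [NormedAddCommGroup F]
    [NormedSpace ℝ F] [CompleteSpace F] {f : ℝ × E → F} {s : Set E} (hs : Convex ℝ s)
    (hs' : UniqueDiffOn ℝ s) {n : WithTop ℕ∞} (hn : 1 ≤ n) (hf : ContDiffOn ℝ n f (Icc 0 1 ×ˢ s))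
    {y : E} (hy : y ∈ s) :
    HasFDerivWithinAt (fun z => ∫ u in (0 : ℝ)..1, f (u, z))
      (∫ u in (0 : ℝ)..1, partialSnd f s (u, y)) s y :=
  hasFDerivWithinAt_parametric_integral hs hf.continuousOn
    (contDiffOn_partialSnd hs' (m := 0) (by simpa using hn) hf).continuousOn
    (fun _ hu _ hz => hasFDerivWithinAt_partialSnd (by rintro rfl; simp at hn) hf hu hz) hy

theorem contDiffOn_nat_parametric_integral {s : Set E} (hs : Convex ℝ s)
    (hs' : UniqueDiffOn ℝ s) (n : ℕ) : ∀ {F : Type u} [NormedAddCommGroup F] [NormedSpace ℝ F]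
    [CompleteSpace F] {f : ℝ × E → F}, ContDiffOn ℝ n f (Icc 0 1 ×ˢ s) →
    ContDiffOn ℝ n (fun y => ∫ u in (0 : ℝ)..1, f (u, y)) s := by
  induction n with
  | zero =>
    intro F _ _ _ f hf
    exact contDiffOn_zero.2 (continuousOn_parametric_integral hf.continuousOn)
  | succ n ih =>
    intro F _ _ _ f hf
    have h1 : ∀ y ∈ s, HasFDerivWithinAt (fun z => ∫ u in (0 : ℝ)..1, f (u, z))
        (∫ u in (0 : ℝ)..1, partialSnd f s (u, y)) s y := fun y hy =>
      hasFDerivWithinAt_parametric_integral_partialSnd hs hs' (by simp) hf hy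
    push_cast
    refine (contDiffOn_succ_iff_fderivWithin hs').2 ⟨fun y hy => (h1 y hy).differentiableWithinAt,
      by simp, ?_⟩
    refine (ih (contDiffOn_partialSnd hs' (m := n) (by simp) hf)).congr fun y hy => ?_
    exact (h1 y hy).fderivWithin (hs' y hy)

theorem contDiffOn_parametric_integral {F : Type u} [NormedAddCommGroup F] [NormedSpace ℝ F]
    [CompleteSpace F] {f : ℝ × E → F} {s : Set E} (hs : Convex ℝ s)
    (hs' : UniqueDiffOn ℝ s) (hf : ContDiffOn ℝ ∞ f (Icc 0 1 ×ˢ s)) :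
    ContDiffOn ℝ ∞ (fun y => ∫ u in (0 : ℝ)..1, f (u, y)) s :=
  contDiffOn_infty.2 fun n => contDiffOn_nat_parametric_integral hs hs' n
    (hf.of_le (by norm_cast; exact le_top))

/-- The integral from `0` to `t` of a function of time and position. -/
def timeIntegral {X : Type*} (a : ℝ × X → ℝ) (p : ℝ × X) : ℝ := ∫ r in (0 : ℝ)..p.1, a (r, p.2)

theorem timeIntegral_eq {X : Type*} (a : ℝ × X → ℝ) (p : ℝ × X) :
    timeIntegral a p = ∫ u in (0 : ℝ)..1, p.1 * a (p.1 * u, p.2) := by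
  rw [timeIntegral, intervalIntegral.integral_const_mul]
  have := intervalIntegral.mul_integral_comp_mul_left (f := fun r => a (r, p.2)) (a := 0) (b := 1)
    p.1
  simpa using this.symm

variable {s : Set E} {a : ℝ × E → ℝ}

theorem contDiffOn_timeIntegral {E : Type} [NormedAddCommGroup E] [NormedSpace ℝ E]
    {s : Set E} {a : ℝ × E → ℝ} (hs : Convex ℝ s) (hs' : UniqueDiffOn ℝ s)
    (ha : ContDiffOn ℝ ∞ a (univ ×ˢ s)) : ContDiffOn ℝ ∞ (timeIntegral a) (univ ×ˢ s) := by
  have h1 : ContDiffOn ℝ ∞ (fun q : ℝ × (ℝ × E) => q.2.1 * a (q.2.1 * q.1, q.2.2))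
      (Icc 0 1 ×ˢ (univ ×ˢ s)) := by
    refine ContDiffOn.mul (by fun_prop) ?_
    refine ha.comp (f := fun q : ℝ × (ℝ × E) => (q.2.1 * q.1, q.2.2)) (by fun_prop) ?_
    rintro ⟨u, t, y⟩ ⟨_, _, hy⟩
    exact ⟨trivial, hy⟩
  refine (contDiffOn_parametric_integral (convex_univ.prod hs) (uniqueDiffOn_univ.prod hs')
    h1).congr fun p _ => timeIntegral_eq a p

theorem hasFDerivWithinAt_timeIntegral_right {E : Type} [NormedAddCommGroup E] [NormedSpace ℝ E]
    {s : Set E} {a : ℝ × E → ℝ} {a' : ℝ × E → E →L[ℝ] ℝ} (hs : Convex ℝ s)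
    (ha : ContinuousOn a (univ ×ˢ s)) (ha' : ContinuousOn a' (univ ×ˢ s))
    (h : ∀ r, ∀ y ∈ s, HasFDerivWithinAt (fun z => a (r, z)) (a' (r, y)) s y)
    (t : ℝ) {y : E} (hy : y ∈ s) :
    HasFDerivWithinAt (fun z => timeIntegral a (t, z)) (∫ r in (0 : ℝ)..t, a' (r, y)) s y := by
  have h1 : ContinuousOn (fun q : ℝ × E => t * a (t * q.1, q.2)) (Icc 0 1 ×ˢ s) :=
    continuousOn_const.mul (ha.comp (f := fun q : ℝ × E => (t * q.1, q.2)) (by fun_prop)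
      fun q (hq : q ∈ Icc (0 : ℝ) 1 ×ˢ s) => ⟨trivial, hq.2⟩)
  have h2 : ContinuousOn (fun q : ℝ × E => t • a' (t * q.1, q.2)) (Icc 0 1 ×ˢ s) :=
    (ha'.comp (f := fun q : ℝ × E => (t * q.1, q.2)) (by fun_prop)
      fun q (hq : q ∈ Icc (0 : ℝ) 1 ×ˢ s) => ⟨trivial, hq.2⟩).const_smul t
  have h3 := hasFDerivWithinAt_parametric_integral hs h1 h2
    (fun u _ z hz => (h (t * u) z hz).const_mul t) hy
  have h4 : ∫ r in (0 : ℝ)..t, a' (r, y) = ∫ u in (0 : ℝ)..1, t • a' (t * u, y) := by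
    rw [intervalIntegral.integral_smul]
    have := intervalIntegral.smul_integral_comp_mul_left (f := fun r => a' (r, y)) (a := 0) (b := 1) t
    simpa using this.symm
  rw [h4]
  exact h3.congr (fun z _ => timeIntegral_eq a (t, z)) (timeIntegral_eq a (t, y))

end ParametricIntegral

section Evaluation

theorem update_vec_one {X : Type*} (a v : X) : Function.update ![a] 0 v = ![v] := by
  ext i; fin_cases i; rfl

theorem update_vec_two {X : Type*} (a b v : X) : Function.update ![a, b] 0 v = ![v, b] := by
  ext i; fin_cases i <;> rfl

theorem alternating_one_add {E : Type*} [NormedAddCommGroup E] [NormedSpace ℝ E]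
    (σ : E [⋀^Fin 1]→L[ℝ] ℝ) (v w : E) : σ ![v + w] = σ ![v] + σ ![w] := by
  have h := σ.map_update_add ![0] 0 v w
  simpa only [update_vec_one, smul_eq_mul] using h

theorem alternating_one_smul {E : Type*} [NormedAddCommGroup E] [NormedSpace ℝ E]
    (σ : E [⋀^Fin 1]→L[ℝ] ℝ) (c : ℝ) (v : E) : σ ![c • v] = c * σ ![v] := by
  have h := σ.map_update_smul ![0] 0 c v
  simpa only [update_vec_one, smul_eq_mul] using h

theorem alternating_two_add {E : Type*} [NormedAddCommGroup E] [NormedSpace ℝ E]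
    (σ : E [⋀^Fin 2]→L[ℝ] ℝ) (u v w : E) : σ ![u + v, w] = σ ![u, w] + σ ![v, w] := by
  have h := σ.map_update_add ![0, w] 0 u v
  simpa only [update_vec_two, smul_eq_mul] using h

theorem alternating_two_smul {E : Type*} [NormedAddCommGroup E] [NormedSpace ℝ E]
    (σ : E [⋀^Fin 2]→L[ℝ] ℝ) (c : ℝ) (v w : E) : σ ![c • v, w] = c * σ ![v, w] := by
  have h := σ.map_update_smul ![0, w] 0 c v
  simpa only [update_vec_two, smul_eq_mul] using h

variable {E : Type*} [NormedAddCommGroup E] [NormedSpace ℝ E]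
  {H : Type*} [TopologicalSpace H]
  {E' : Type*} [NormedAddCommGroup E'] [NormedSpace ℝ E']
  {H' : Type*} [TopologicalSpace H'] {I : ModelWithCorners ℝ E H} {J : ModelWithCorners ℝ E' H'}
  {M : Type*} [TopologicalSpace M] [ChartedSpace H M]
  {N : Type*} [TopologicalSpace N] [ChartedSpace H' N]

/-- The value of a one-form on a tangent vector, given in the model vector space. -/
def Form.app1 (α : Form I M 1) (x : M) (v : E) : ℝ := (show E [⋀^Fin 1]→L[ℝ] ℝ from α x) ![v]

/-- The value of a two-form on a pair of tangent vectors, given in the model vector space. -/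
def Form.app2 (β : Form I M 2) (x : M) (v w : E) : ℝ :=
  (show E [⋀^Fin 2]→L[ℝ] ℝ from β x) ![v, w]

/-- The derivative of a map, as a linear map between the model vector spaces. -/
def tmap (I : ModelWithCorners ℝ E H) (J : ModelWithCorners ℝ E' H') (f : M → N) (x : M) :
    E →L[ℝ] E' := mfderiv I J f x

theorem Form.ext1 {α β : Form I M 1} {x : M} (h : ∀ v, α.app1 x v = β.app1 x v) : α x = β x := by
  refine ContinuousAlternatingMap.ext fun v => ?_
  have hv : v = ![v 0] := by ext i; fin_cases i; rfl
  rw [hv]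
  exact h (v 0)

theorem Form.ext2 {α β : Form I M 2} {x : M} (h : ∀ v w, α.app2 x v w = β.app2 x v w) :
    α x = β x := by
  refine ContinuousAlternatingMap.ext fun v => ?_
  have hv : v = ![v 0, v 1] := by ext i; fin_cases i <;> rfl
  rw [hv]
  exact h (v 0) (v 1)

theorem Form.app1_add (α : Form I M 1) (x : M) (v w : E) :
    α.app1 x (v + w) = α.app1 x v + α.app1 x w :=
  alternating_one_add _ v w

theorem Form.app1_smul (α : Form I M 1) (x : M) (c : ℝ) (v : E) :
    α.app1 x (c • v) = c * α.app1 x v :=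
  alternating_one_smul _ c v

theorem Form.app1_zero (α : Form I M 1) (x : M) : α.app1 x 0 = 0 := by
  simpa using α.app1_smul x 0 0

theorem Form.app2_smul_left (β : Form I M 2) (x : M) (c : ℝ) (v w : E) :
    β.app2 x (c • v) w = c * β.app2 x v w :=
  alternating_two_smul _ c v w

theorem Form.app2_swap (β : Form I M 2) (x : M) (v w : E) : β.app2 x v w = -β.app2 x w v := by
  have h := (show E [⋀^Fin 2]→L[ℝ] ℝ from β x).map_swap ![w, v] (i := 0) (j := 1) (by simp)
  have h2 : (![w, v] ∘ Equiv.swap (0 : Fin 2) 1) = ![v, w] := by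
    ext i; fin_cases i <;> simp
  rw [h2] at h
  exact h

theorem Form.app2_self (β : Form I M 2) (x : M) (v : E) : β.app2 x v v = 0 := by
  have := β.app2_swap x v v
  linarith

theorem Form.app2_zero_left (β : Form I M 2) (x : M) (w : E) : β.app2 x 0 w = 0 := by
  simpa using β.app2_smul_left x 0 0 w

theorem app1_pullback (f : M → N) (α : Form J N 1) (x : M) (v : E) :
    (pullback (I := I) f α).app1 x v = α.app1 (f x) (tmap I J f x v) := by
  refine congrArg (show E' [⋀^Fin 1]→L[ℝ] ℝ from α (f x)) ?_
  ext i; fin_cases i; rfl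

theorem app2_pullback (f : M → N) (α : Form J N 2) (x : M) (v w : E) :
    (pullback (I := I) f α).app2 x v w = α.app2 (f x) (tmap I J f x v) (tmap I J f x w) := by
  refine congrArg (show E' [⋀^Fin 2]→L[ℝ] ℝ from α (f x)) ?_
  ext i; fin_cases i <;> rfl

theorem app1_differential (f : M → ℝ) (x : M) (v : E) :
    (differential (I := I) f).app1 x v = tmap I 𝓘(ℝ, ℝ) f x v := rfl

theorem tmap_comp {E'' : Type*} [NormedAddCommGroup E''] [NormedSpace ℝ E'']
    {H'' : Type*} [TopologicalSpace H''] {K : ModelWithCorners ℝ E'' H''}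
    {P : Type*} [TopologicalSpace P] [ChartedSpace H'' P]
    {f : M → N} {g : N → P} {x : M} (hg : MDifferentiableAt J K g (f x))
    (hf : MDifferentiableAt I J f x) (v : E) :
    tmap I K (fun z => g (f z)) x v = tmap J K g (f x) (tmap I J f x v) := by
  have h := mfderiv_comp x hg hf
  exact congrArg (fun A : E →L[ℝ] E'' => A v) h

theorem tmap_id (x : M) (v : E) : tmap I I (fun z : M => z) x v = v := by
  have h : mfderiv I I (fun z : M => z) x = _ := mfderiv_id
  exact congrArg (fun A : E →L[ℝ] E => A v) h

theorem tmap_const (x : M) (y : N) (v : E) : tmap I J (fun _ : M => y) x v = 0 := by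
  have h : mfderiv I J (fun _ : M => y) x = _ := mfderiv_const
  exact congrArg (fun A : E →L[ℝ] E' => A v) h

theorem tmap_congr {f g : M → N} {x : M} (h : f =ᶠ[𝓝 x] g) : tmap I J f x = tmap I J g x :=
  h.mfderiv_eq

theorem tmap_prodMk {E'' : Type*} [NormedAddCommGroup E''] [NormedSpace ℝ E'']
    {H'' : Type*} [TopologicalSpace H''] {K : ModelWithCorners ℝ E'' H''}
    {P : Type*} [TopologicalSpace P] [ChartedSpace H'' P]
    {f : M → N} {g : M → P} {x : M} (hf : MDifferentiableAt I J f x)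
    (hg : MDifferentiableAt I K g x) (v : E) :
    tmap I (J.prod K) (fun z => (f z, g z)) x v = (tmap I J f x v, tmap I K g x v) := by
  have h := mfderiv_prodMk hf hg
  exact congrArg (fun A : E →L[ℝ] E' × E'' => A v) h

theorem tmap_fst (p : M × N) (v : E × E') :
    tmap (I.prod J) I (fun p : M × N => p.1) p v = v.1 := by
  have h : mfderiv (I.prod J) I (fun p : M × N => p.1) p = _ := mfderiv_fst
  exact congrArg (fun A : E × E' →L[ℝ] E => A v) h

theorem tmap_snd (p : M × N) (v : E × E') :
    tmap (I.prod J) J (fun p : M × N => p.2) p v = v.2 := by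
  have h : mfderiv (I.prod J) J (fun p : M × N => p.2) p = _ := mfderiv_snd
  exact congrArg (fun A : E × E' →L[ℝ] E' => A v) h

theorem tmap_inl (x : M) (y : N) (v : E) :
    tmap I (I.prod J) (fun z : M => (z, y)) x v = (v, 0) := by
  have h := tmap_prodMk (I := I) (J := I) (K := J) (f := fun z : M => z) (g := fun _ : M => y)
    (x := x) mdifferentiableAt_id mdifferentiableAt_const v
  rwa [tmap_const, tmap_id] at h

theorem tmap_inr (x : M) (y : N) (v : E') :
    tmap J (I.prod J) (fun z : N => (x, z)) y v = (0, v) := by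
  have h := tmap_prodMk (I := J) (J := I) (K := J) (f := fun _ : N => x) (g := fun z : N => z)
    (x := y) mdifferentiableAt_const mdifferentiableAt_id v
  rwa [tmap_const, tmap_id] at h

end Evaluation

section Cylinder

variable {E : Type} [NormedAddCommGroup E] [NormedSpace ℝ E] [FiniteDimensional ℝ E]
  {H : Type*} [TopologicalSpace H] {I : ModelWithCorners ℝ E H}
  {M : Type*} [TopologicalSpace M] [ChartedSpace H M] [IsManifold I ∞ M]

theorem extChartAt_cylinder (t : ℝ) (m : M) :
    extChartAt (𝓘(ℝ, ℝ).prod I) ((t, m) : ℝ × M) =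
      (PartialEquiv.refl ℝ).prod (extChartAt I m) := by
  rw [extChartAt_prod, extChartAt_model_space_eq_id]

theorem range_cylinder : range (𝓘(ℝ, ℝ).prod I) = (univ : Set ℝ) ×ˢ range I := by
  rw [modelWithCorners_prod_coe, range_prodMap]
  simp

theorem mem_extChartAt_cylinder_target {t : ℝ} {m : M} {p : ℝ × E} :
    p ∈ (extChartAt (𝓘(ℝ, ℝ).prod I) ((t, m) : ℝ × M)).target ↔ p.2 ∈ (extChartAt I m).target := by
  rw [extChartAt_cylinder]
  simp

theorem inChart_cylinder {k : ℕ} (ν : Form (𝓘(ℝ, ℝ).prod I) (ℝ × M) k) (t t' : ℝ) (m : M) :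
    Form.inChart ν (t, m) = Form.inChart ν (t', m) := by
  have h : extChartAt (𝓘(ℝ, ℝ).prod I) ((t, m) : ℝ × M) =
      extChartAt (𝓘(ℝ, ℝ).prod I) ((t', m) : ℝ × M) := by
    rw [extChartAt_cylinder, extChartAt_cylinder]
  have key : ∀ e e' : PartialEquiv (ℝ × M) (ℝ × E), e = e' → ∀ p,
      (ν (e.symm p)).compContinuousLinearMap (mfderivWithin 𝓘(ℝ, ℝ × E) (𝓘(ℝ, ℝ).prod I) e.symm
        (range (𝓘(ℝ, ℝ).prod I)) p) =
      (ν (e'.symm p)).compContinuousLinearMap (mfderivWithin 𝓘(ℝ, ℝ × E) (𝓘(ℝ, ℝ).prod I) e'.symm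
        (range (𝓘(ℝ, ℝ).prod I)) p) := by
    rintro _ _ rfl p; rfl
  exact funext fun p => key _ _ h p

/-- The derivative of the inverse of an extended chart, as a map of the model vector space. -/
def symmDeriv (I : ModelWithCorners ℝ E H) (m : M) (y : E) : E →L[ℝ] E :=
  mfderivWithin 𝓘(ℝ, E) I (extChartAt I m).symm (range I) y

theorem mfderivWithin_symm_cylinder {t : ℝ} {m : M} {p : ℝ × E} (hp : p.2 ∈ (extChartAt I m).target)
    (v : ℝ × E) :
    (mfderivWithin 𝓘(ℝ, ℝ × E) (𝓘(ℝ, ℝ).prod I)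
      (extChartAt (𝓘(ℝ, ℝ).prod I) ((t, m) : ℝ × M)).symm (range (𝓘(ℝ, ℝ).prod I)) p :
        ℝ × E →L[ℝ] ℝ × E) v =
      (v.1, symmDeriv I m p.2 v.2) := by
  have := isManifold_one (I := I) (M := M)
  have h0 : ((extChartAt (𝓘(ℝ, ℝ).prod I) ((t, m) : ℝ × M)).symm : ℝ × E → ℝ × M) =
      fun q => (q.1, (extChartAt I m).symm q.2) := by
    rw [extChartAt_cylinder]; rfl
  rw [h0, range_cylinder]
  have hu : UniqueMDiffWithinAt 𝓘(ℝ, ℝ × E) ((univ : Set ℝ) ×ˢ range I) p :=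
    ((uniqueDiffOn_univ.prod I.uniqueDiffOn) p
      ⟨trivial, extChartAt_target_subset_range m hp⟩).uniqueMDiffWithinAt
  have h1 : HasMFDerivWithinAt 𝓘(ℝ, ℝ × E) 𝓘(ℝ, ℝ) (fun q : ℝ × E => q.1)
      ((univ : Set ℝ) ×ˢ range I) p (ContinuousLinearMap.fst ℝ ℝ E) :=
    (hasFDerivAt_fst (𝕜 := ℝ) (p := p)).hasMFDerivAt.hasMFDerivWithinAt
  have h2 : HasMFDerivWithinAt 𝓘(ℝ, ℝ × E) 𝓘(ℝ, E) (fun q : ℝ × E => q.2)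
      ((univ : Set ℝ) ×ˢ range I) p (ContinuousLinearMap.snd ℝ ℝ E) :=
    (hasFDerivAt_snd (𝕜 := ℝ) (p := p)).hasMFDerivAt.hasMFDerivWithinAt
  have h3 := (mdifferentiableWithinAt_extChartAt_symm hp).hasMFDerivWithinAt
  have h4 : HasMFDerivWithinAt 𝓘(ℝ, ℝ × E) I (fun q : ℝ × E => (extChartAt I m).symm q.2)
      ((univ : Set ℝ) ×ˢ range I) p
      ((symmDeriv I m p.2).comp
        (ContinuousLinearMap.snd ℝ ℝ E)) :=
    HasMFDerivWithinAt.comp p h3 h2 fun q hq => hq.2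
  have h5 := (h1.prodMk h4).mfderivWithin hu
  exact congrArg (fun A : ℝ × E →L[ℝ] ℝ × E => A v) h5

theorem inChart_cylinder_apply (ν : Form (𝓘(ℝ, ℝ).prod I) (ℝ × M) 1) {t : ℝ} {m : M} {p : ℝ × E}
    (hp : p.2 ∈ (extChartAt I m).target) (v : ℝ × E) :
    Form.inChart ν (t, m) p ![v] = ν.app1 (p.1, (extChartAt I m).symm p.2)
      (v.1, symmDeriv I m p.2 v.2) := by
  have h0 : (extChartAt (𝓘(ℝ, ℝ).prod I) ((t, m) : ℝ × M)).symm p =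
      (p.1, (extChartAt I m).symm p.2) := by
    rw [extChartAt_cylinder]; rfl
  have key : ∀ (a b : ℝ × M) (_ : a = b) (A : ℝ × E →L[ℝ] ℝ × E),
      ((show (ℝ × E) [⋀^Fin 1]→L[ℝ] ℝ from ν a).compContinuousLinearMap A) ![v] =
        ν.app1 b (A v) := by
    rintro a _ rfl A
    refine congrArg (show (ℝ × E) [⋀^Fin 1]→L[ℝ] ℝ from ν a) ?_
    ext i <;> fin_cases i <;> rfl
  exact (key _ _ h0 _).trans (congrArg _ (mfderivWithin_symm_cylinder (t := t) hp v))

/-- The component of a one-form on `ℝ × M` in the direction of `ℝ`. -/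
def timeComponent (ν : Form (𝓘(ℝ, ℝ).prod I) (ℝ × M) 1) (p : ℝ × M) : ℝ := ν.app1 p (1, 0)

theorem timeComponent_symm_eventuallyEq (ν : Form (𝓘(ℝ, ℝ).prod I) (ℝ × M) 1) (p : ℝ × M) :
    (fun y => timeComponent ν ((extChartAt (𝓘(ℝ, ℝ).prod I) p).symm y))
      =ᶠ[𝓝[range (𝓘(ℝ, ℝ).prod I)] (extChartAt (𝓘(ℝ, ℝ).prod I) p p)]
      fun y => Form.inChart ν p y ![(1, 0)] := by
  filter_upwards [eventually_mem_extChartAt_target (mem_extChartAt_target p)] with y hy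
  obtain ⟨t, m⟩ := p
  rw [inChart_cylinder_apply ν (mem_extChartAt_cylinder_target.1 hy)]
  simp only [timeComponent, extChartAt_cylinder, map_zero]
  rfl

theorem contMDiffAt_iff_symm {f : M → ℝ} {x : M} :
    ContMDiffAt I 𝓘(ℝ, ℝ) ∞ f x ↔
      ContDiffWithinAt ℝ ∞ (fun y => f ((extChartAt I x).symm y)) (range I) (extChartAt I x x) := by
  refine ⟨fun h => h.contDiffWithinAt_symm, fun h => ?_⟩
  have h1 : ContMDiffWithinAt 𝓘(ℝ, E) 𝓘(ℝ, ℝ) ∞ (fun y => f ((extChartAt I x).symm y)) (range I)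
    (extChartAt I x x) := h.contMDiffWithinAt
  have h2 : ContMDiffAt I 𝓘(ℝ, E) ∞ (extChartAt I x) x := contMDiffAt_extChartAt
  have h3 : ContMDiffAt I 𝓘(ℝ, ℝ) ∞ (fun z => f ((extChartAt I x).symm (extChartAt I x z))) x := by
    rw [← contMDiffWithinAt_univ]
    refine h1.comp x h2.contMDiffWithinAt fun z _ => ?_
    exact ⟨chartAt H x z, rfl⟩
  refine h3.congr_of_eventuallyEq ?_
  filter_upwards [extChartAt_source_mem_nhds (I := I) x] with z hz
  rw [(extChartAt I x).left_inv hz]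

theorem contMDiffAt_timeComponent {ν : Form (𝓘(ℝ, ℝ).prod I) (ℝ × M) 1} {p : ℝ × M}
    (hν : Form.SmoothAt ν p) :
    ContMDiffAt (𝓘(ℝ, ℝ).prod I) 𝓘(ℝ, ℝ) ∞ (timeComponent ν) p := by
  rw [contMDiffAt_iff_symm]
  exact (contDiffWithinAt_alternating_iff.1 hν _).congr_of_eventuallyEq_of_mem
    (timeComponent_symm_eventuallyEq ν p)
    (extChartAt_target_subset_range p (mem_extChartAt_target p))

theorem exists_convex_subset_target {x₀ : M} {y : E} (hy : y ∈ (extChartAt I x₀).target) :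
    ∃ s : Set E, s ⊆ (extChartAt I x₀).target ∧ Convex ℝ s ∧ UniqueDiffOn ℝ s ∧
      s ∈ 𝓝[range I] y ∧ y ∈ s := by
  obtain ⟨ε, hε, h⟩ := Metric.mem_nhdsWithin_iff.1
    (eventually_mem_extChartAt_target (I := I) hy)
  refine ⟨Metric.ball y ε ∩ range I, h, (convex_ball y ε).inter I.convex_range, ?_,
    inter_mem (mem_nhdsWithin_of_mem_nhds (Metric.ball_mem_nhds y hε)) self_mem_nhdsWithin,
    Metric.mem_ball_self hε, extChartAt_target_subset_range x₀ hy⟩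
  rw [inter_comm]
  exact I.uniqueDiffOn.inter Metric.isOpen_ball

theorem contDiffOn_cylinder_symm {a : ℝ × M → ℝ}
    (ha : ContMDiff (𝓘(ℝ, ℝ).prod I) 𝓘(ℝ, ℝ) ∞ a) (m : M) :
    ContDiffOn ℝ ∞ (fun q : ℝ × E => a (q.1, (extChartAt I m).symm q.2))
      (univ ×ˢ (extChartAt I m).target) := by
  have h1 : ContMDiffOn 𝓘(ℝ, E) I ∞ (extChartAt I m).symm (extChartAt I m).target :=
    contMDiffOn_extChartAt_symm m
  have h2 : ContMDiffOn 𝓘(ℝ, ℝ × E) (𝓘(ℝ, ℝ).prod I) ∞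
      (fun q : ℝ × E => ((q.1, (extChartAt I m).symm q.2) : ℝ × M))
      (univ ×ˢ (extChartAt I m).target) :=
    ContMDiffOn.prodMk contDiff_fst.contMDiff.contMDiffOn
      (h1.comp (contDiff_snd (𝕜 := ℝ) (E := ℝ) (F := E)).contMDiff.contMDiffOn fun q hq => hq.2)
  exact (ha.comp_contMDiffOn h2).contDiffOn

/-- Integration in time of smooth functions on `ℝ × M` is smooth. -/
theorem contMDiff_timeIntegral {a : ℝ × M → ℝ}
    (ha : ContMDiff (𝓘(ℝ, ℝ).prod I) 𝓘(ℝ, ℝ) ∞ a) :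
    ContMDiff (𝓘(ℝ, ℝ).prod I) 𝓘(ℝ, ℝ) ∞ (timeIntegral a) := by
  rintro ⟨t, m⟩
  rw [contMDiffAt_iff_symm]
  obtain ⟨s, hs, hc, hu, hn, hm⟩ := exists_convex_subset_target (mem_extChartAt_target (I := I) m)
  have h1 := contDiffOn_timeIntegral hc hu
    ((contDiffOn_cylinder_symm ha m).mono (prod_mono_right hs))
  have h2 : ∀ y : ℝ × E, timeIntegral a ((extChartAt (𝓘(ℝ, ℝ).prod I) ((t, m) : ℝ × M)).symm y) =
      timeIntegral (fun q : ℝ × E => a (q.1, (extChartAt I m).symm q.2)) y := by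
    intro y
    rw [extChartAt_cylinder]; rfl
  simp only [h2]
  have h3 : extChartAt (𝓘(ℝ, ℝ).prod I) ((t, m) : ℝ × M) (t, m) = (t, extChartAt I m m) := by
    rw [extChartAt_cylinder]; rfl
  rw [h3, range_cylinder]
  refine (h1 (t, extChartAt I m m) ⟨trivial, hm⟩).mono_of_mem_nhdsWithin ?_
  rw [nhdsWithin_prod_eq]
  exact prod_mem_prod univ_mem hn

theorem app1_differential_slice {a : ℝ × M → ℝ} {t : ℝ} {m : M}
    (ha : MDifferentiableAt (𝓘(ℝ, ℝ).prod I) 𝓘(ℝ, ℝ) a (t, m)) (v : E) :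
    (differential (I := 𝓘(ℝ, ℝ).prod I) a).app1 (t, m) (0, v) =
      (differential (I := I) fun z => a (t, z)).app1 m v := by
  rw [app1_differential, app1_differential,
    tmap_comp (f := fun z : M => (t, z)) (g := a) ha
      (mdifferentiableAt_const.prodMk mdifferentiableAt_id), tmap_inr]

theorem app1_differential_eq_fderivWithin {f : M → ℝ} {x : M}
    (hf : MDifferentiableAt I 𝓘(ℝ, ℝ) f x) (v : E) :
    (differential (I := I) f).app1 x v =
      fderivWithin ℝ (fun y => f ((extChartAt I x).symm y)) (range I) (extChartAt I x x) v :=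
  congrArg (fun A : E →L[ℝ] ℝ => A v) hf.mfderiv

theorem continuous_app1_time {α : Form (𝓘(ℝ, ℝ).prod I) (ℝ × M) 1} (hα : Form.IsSmooth α) (m : M)
    (v : ℝ × E) : Continuous fun r : ℝ => α.app1 (r, m) v := by
  have h1 : (fun r : ℝ => α.app1 (r, m) v) =
      fun r => Form.inChart α (0, m) (r, extChartAt I m m) ![v] := by
    funext r
    have h3 : extChartAt (𝓘(ℝ, ℝ).prod I) ((r, m) : ℝ × M) (r, m) = (r, extChartAt I m m) := by
      rw [extChartAt_cylinder]; rfl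
    rw [inChart_cylinder α 0 r m, ← h3, inChart_self]
    rfl
  rw [h1]
  have h2 : ContinuousOn (Form.inChart α (0, m)) _ := (hα (0, m)).continuousOn
  have h4 : Continuous fun r : ℝ => Form.inChart α (0, m) (r, extChartAt I m m) :=
    h2.comp_continuous (by fun_prop) fun r =>
      mem_extChartAt_cylinder_target.2 (mem_extChartAt_target (I := I) m)
  exact (ContinuousAlternatingMap.apply ℝ (ℝ × E) ℝ ![v]).continuous.comp h4

theorem app1_differential_timeIntegral {a : ℝ × M → ℝ}
    (ha : ContMDiff (𝓘(ℝ, ℝ).prod I) 𝓘(ℝ, ℝ) ∞ a) (t : ℝ) (m : M) (v : E) :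
    (differential (I := 𝓘(ℝ, ℝ).prod I) (timeIntegral a)).app1 (t, m) (0, v) =
      ∫ r in (0 : ℝ)..t, (differential (I := 𝓘(ℝ, ℝ).prod I) a).app1 (r, m) (0, v) := by
  have hF := contMDiff_timeIntegral ha
  have hd : ∀ r, MDifferentiableAt I 𝓘(ℝ, ℝ) (fun z => a (r, z)) m := fun r =>
    MDifferentiableAt.comp m ((ha.mdifferentiable (by simp)) (r, m))
      (mdifferentiableAt_const.prodMk mdifferentiableAt_id)
  rw [app1_differential_slice ((hF.mdifferentiable (by simp)) (t, m)),
    app1_differential_eq_fderivWithin]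
  swap
  · exact MDifferentiableAt.comp m ((hF.mdifferentiable (by simp)) (t, m))
      (mdifferentiableAt_const.prodMk mdifferentiableAt_id)
  have h0 : ∀ r, (differential (I := 𝓘(ℝ, ℝ).prod I) a).app1 (r, m) (0, v) =
      fderivWithin ℝ (fun y => a (r, (extChartAt I m).symm y)) (range I) (extChartAt I m m) v := by
    intro r
    rw [app1_differential_slice ((ha.mdifferentiable (by simp)) (r, m)),
      app1_differential_eq_fderivWithin (hd r)]
  simp only [h0]
  obtain ⟨s, hs, hc, hu, hn, hm⟩ := exists_convex_subset_target (mem_extChartAt_target (I := I) m)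
  have h1 := (contDiffOn_cylinder_symm ha m).mono (prod_mono_right hs)
  set â : ℝ × E → ℝ := fun q => a (q.1, (extChartAt I m).symm q.2)
  have hu' : UniqueDiffOn ℝ ((univ : Set ℝ) ×ˢ s) := uniqueDiffOn_univ.prod hu
  set a' : ℝ × E → E →L[ℝ] ℝ := fun q =>
    (fderivWithin ℝ â (univ ×ˢ s) q).comp (ContinuousLinearMap.inr ℝ ℝ E) with ha'
  have h2 : ContinuousOn a' (univ ×ˢ s) :=
    (h1.continuousOn_fderivWithin hu' (by simp)).clm_comp continuousOn_const
  have h3 : ∀ r, ∀ y ∈ s, HasFDerivWithinAt (fun z => â (r, z)) (a' (r, y)) s y := fun r y hy =>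
    HasFDerivWithinAt.comp (g := â) (t := univ ×ˢ s) y
      ((h1.differentiableOn (by simp)) (r, y) ⟨trivial, hy⟩).hasFDerivWithinAt
      (hasFDerivAt_prodMk_right r y).hasFDerivWithinAt fun _ hz => ⟨trivial, hz⟩
  have hur : UniqueDiffWithinAt ℝ (range I) (extChartAt I m m) :=
    uniqueDiffWithinAt_range_extChartAt m
  have h4 := (hasFDerivWithinAt_timeIntegral_right hc h1.continuousOn h2 h3 t
    hm).mono_of_mem_nhdsWithin hn
  have h5 : ∀ r, fderivWithin ℝ (fun y => a (r, (extChartAt I m).symm y)) (range I)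
      (extChartAt I m m) = a' (r, extChartAt I m m) := fun r =>
    ((h3 r _ hm).mono_of_mem_nhdsWithin hn).fderivWithin hur
  have h6 := h4.fderivWithin hur
  have h7 : (fun z => timeIntegral â (t, z)) =
    fun y => timeIntegral a (t, (extChartAt I m).symm y) := rfl
  rw [h7] at h6
  simp only [h5]
  rw [h6, ContinuousLinearMap.intervalIntegral_apply]
  exact (ContinuousOn.comp_continuous h2 (f := fun r : ℝ => (r, extChartAt I m m)) (by fun_prop)
    fun r => ⟨trivial, hm⟩).intervalIntegrable _ _

/-- The Lie derivative in the direction of time of a one-form on `ℝ × M`, by Cartan's formula. -/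
theorem hasDerivAt_app1_time {ν : Form (𝓘(ℝ, ℝ).prod I) (ℝ × M) 1} (hν : Form.IsSmooth ν)
    (r : ℝ) (m : M) (v : E) :
    HasDerivAt (fun r' => ν.app1 (r', m) (0, v))
      ((Form.d ν).app2 (r, m) (1, 0) (0, v) +
        (differential (I := 𝓘(ℝ, ℝ).prod I) (timeComponent ν)).app1 (r, m) (0, v)) r := by
  set p : ℝ × M := (r, m) with hp
  have hpr := extChartAt_target_subset_range p (mem_extChartAt_target (I := 𝓘(ℝ, ℝ).prod I) p)
  have hN := (hν.smoothAt p).differentiableWithinAt.hasFDerivWithinAt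
  have hu := uniqueDiffWithinAt_range_extChartAt (I := 𝓘(ℝ, ℝ).prod I) p
  have hext : ∀ r' : ℝ, extChartAt (𝓘(ℝ, ℝ).prod I) ((r', m) : ℝ × M) (r', m) =
      (r', extChartAt I m m) := by
    intro r'
    rw [extChartAt_cylinder]; rfl
  have h1 : (Form.d ν).app2 p (1, 0) (0, v) = _ := Form.d_one_apply ν p (1, 0) (0, v)
  have h2 : (differential (I := 𝓘(ℝ, ℝ).prod I) (timeComponent ν)).app1 p (0, v) =
      fderivWithin ℝ (Form.inChart ν p) (range (𝓘(ℝ, ℝ).prod I))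
        (extChartAt (𝓘(ℝ, ℝ).prod I) p p) (0, v) ![(1, 0)] := by
    rw [app1_differential_eq_fderivWithin
      ((contMDiffAt_timeComponent (hν.smoothAt p)).mdifferentiableAt (by simp)),
      (timeComponent_symm_eventuallyEq ν p).fderivWithin_eq_of_mem hpr]
    have h3 := (ContinuousAlternatingMap.apply ℝ (ℝ × E) ℝ ![(1, 0)]).hasFDerivAt.comp_hasFDerivWithinAt
      _ hN
    have h4 := h3.fderivWithin hu
    exact congrArg (fun A : ℝ × E →L[ℝ] ℝ => A (0, v)) h4
  rw [h1, h2, sub_add_cancel]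
  have h5 : (fun r' : ℝ => ν.app1 (r', m) (0, v)) =
      fun r' => Form.inChart ν p (r', extChartAt I m m) ![(0, v)] := by
    funext r'
    rw [hp, inChart_cylinder ν r r' m, ← hext, inChart_self]
    rfl
  rw [h5]
  have h6 := (ContinuousAlternatingMap.apply ℝ (ℝ × E) ℝ
    ![(0, v)]).hasFDerivAt.comp_hasFDerivWithinAt _ hN
  have h7 : HasDerivAt (fun r' : ℝ => (r', extChartAt I m m)) ((1 : ℝ), (0 : E)) r :=
    (hasDerivAt_id r).prodMk (hasDerivAt_const r _)
  rw [hp, hext] at h6 ⊢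
  rw [← hasDerivWithinAt_univ]
  refine h6.comp_hasDerivWithinAt r h7.hasDerivWithinAt fun r' _ => ?_
  rw [range_cylinder]
  exact ⟨trivial, extChartAt_target_subset_range m (mem_extChartAt_target m)⟩

/-- The homotopy formula for one-forms on `ℝ × M`. -/
theorem homotopy_formula {ν : Form (𝓘(ℝ, ℝ).prod I) (ℝ × M) 1} (hν : Form.IsSmooth ν)
    (t : ℝ) (m : M) (v : E) {g : ℝ → ℝ} (hg : Continuous g)
    (hgν : ∀ r, (Form.d ν).app2 (r, m) (1, 0) (0, v) = g r) :
    (differential (I := 𝓘(ℝ, ℝ).prod I) (timeIntegral (timeComponent ν))).app1 (t, m) (0, v) =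
      ν.app1 (t, m) (0, v) - ν.app1 (0, m) (0, v) - ∫ r in (0 : ℝ)..t, g r := by
  have ha : ContMDiff (𝓘(ℝ, ℝ).prod I) 𝓘(ℝ, ℝ) ∞ (timeComponent ν) := fun p =>
    contMDiffAt_timeComponent (hν.smoothAt p)
  have hc := continuous_app1_time (isSmooth_differential ha) m (0, v)
  rw [app1_differential_timeIntegral ha]
  have h1 := intervalIntegral.integral_eq_sub_of_hasDerivAt (a := 0) (b := t)
    (fun r _ => hasDerivAt_app1_time hν r m v)
    (by simp only [hgν]; exact (hg.add hc).intervalIntegrable _ _)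
  simp only [hgν] at h1
  rw [intervalIntegral.integral_add (hg.intervalIntegrable _ _) (hc.intervalIntegrable _ _)] at h1
  linarith

end Cylinder

section Plane

/-- The Euclidean plane. -/
abbrev Plane : Type := EuclideanSpace ℝ (Fin 2)

/-- The point of the plane with given coordinates. -/
def pt (a b : ℝ) : Plane := !₂[a, b]

@[simp] theorem pt_zero (a b : ℝ) : pt a b 0 = a := rfl
@[simp] theorem pt_one (a b : ℝ) : pt a b 1 = b := rfl

theorem pt_eta (y : Plane) : pt (y 0) (y 1) = y := by
  ext i; fin_cases i <;> rfl

theorem contDiff_pt {X : Type*} [NormedAddCommGroup X] [NormedSpace ℝ X] {s : Set X} {n : WithTop ℕ∞}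
    {f g : X → ℝ} (hf : ContDiffOn ℝ n f s) (hg : ContDiffOn ℝ n g s) :
    ContDiffOn ℝ n (fun x => pt (f x) (g x)) s := by
  rw [contDiffOn_euclidean]
  intro i
  fin_cases i
  · exact hf
  · exact hg

theorem contDiff_coord {n : WithTop ℕ∞} (i : Fin 2) : ContDiff ℝ n (fun y : Plane => y i) :=
  (EuclideanSpace.proj i : Plane →L[ℝ] ℝ).contDiff

theorem continuous_pt {X : Type*} [TopologicalSpace X] {f g : X → ℝ} (hf : Continuous f)
    (hg : Continuous g) : Continuous fun x => pt (f x) (g x) := by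
  refine (PiLp.continuous_toLp 2 _).comp (continuous_pi fun i => ?_)
  fin_cases i
  · exact hf
  · exact hg

/-- The standard basis vectors of the plane. -/
def e₀ : Plane := pt 1 0
/-- The standard basis vectors of the plane. -/
def e₁ : Plane := pt 0 1

theorem add_smul_e₀ (y : Plane) (s : ℝ) : y + s • e₀ = pt (y 0 + s) (y 1) := by
  ext i; fin_cases i <;> simp [e₀, pt]

theorem add_smul_e₁ (y : Plane) (s : ℝ) : y + s • e₁ = pt (y 0) (y 1 + s) := by
  ext i; fin_cases i <;> simp [e₁, pt]

theorem eq_smul_add_smul (v : Plane) : v = v 0 • e₀ + v 1 • e₁ := by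
  ext i; fin_cases i <;> simp [e₀, e₁, pt]

theorem alternating_two_apply (σ : Plane [⋀^Fin 2]→L[ℝ] ℝ) (v w : Plane) :
    σ ![v, w] = (v 0 * w 1 - v 1 * w 0) * σ ![e₀, e₁] := by
  have hs : ∀ a b, σ ![a, b] = -σ ![b, a] := fun a b => by
    have h := σ.map_swap ![b, a] (i := 0) (j := 1) (by simp)
    have h2 : (![b, a] ∘ Equiv.swap (0 : Fin 2) 1) = ![a, b] := by
      ext i; fin_cases i <;> simp
    rwa [h2] at h
  have h0 : ∀ a, σ ![a, a] = 0 := fun a => by linarith [hs a a]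
  have hl : ∀ a b : ℝ, ∀ w, σ ![a • e₀ + b • e₁, w] = a * σ ![e₀, w] + b * σ ![e₁, w] := by
    intro a b w
    rw [alternating_two_add, alternating_two_smul, alternating_two_smul]
  conv_lhs => rw [eq_smul_add_smul v, eq_smul_add_smul w]
  rw [hl, hs e₀, hs e₁, hl, hl, h0, h0, hs e₁ e₀]
  ring

theorem alternating_two_ext {σ τ : Plane [⋀^Fin 2]→L[ℝ] ℝ} (h : σ ![e₀, e₁] = τ ![e₀, e₁]) :
    σ = τ := by
  ext v
  have hv : v = ![v 0, v 1] := by ext i; fin_cases i <;> rfl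
  rw [hv, alternating_two_apply σ, alternating_two_apply τ, h]

/-- The coordinate one-forms of the plane. -/
def dcoord (i : Fin 2) : Plane [⋀^Fin 1]→L[ℝ] ℝ :=
  ContinuousAlternatingMap.ofSubsingleton ℝ Plane ℝ (0 : Fin 1) (EuclideanSpace.proj i)

theorem dcoord_apply (i : Fin 2) (v : Plane) : dcoord i ![v] = v i := rfl

/-- The standard area form of the plane. -/
def planeArea : Plane [⋀^Fin 2]→L[ℝ] ℝ :=
  ContinuousAlternatingMap.alternatizeUncurryFin
    ((EuclideanSpace.proj 0 : Plane →L[ℝ] ℝ).smulRight (dcoord 1))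

theorem planeArea_apply : planeArea ![e₀, e₁] = 1 := by
  rw [planeArea, ContinuousAlternatingMap.alternatizeUncurryFin_apply, Fin.sum_univ_two]
  have h0 : (0 : Fin 2).removeNth ![e₀, e₁] = ![e₁] := by
    ext i; fin_cases i; rfl
  have h1 : (1 : Fin 2).removeNth ![e₀, e₁] = ![e₀] := by
    ext i; fin_cases i; rfl
  rw [h0, h1]
  simp [dcoord_apply, e₀, e₁]

/-- The one-form `P dx + Q dy` on the plane. -/
def planeForm (P Q : Plane → ℝ) (y : Plane) : Plane [⋀^Fin 1]→L[ℝ] ℝ :=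
  P y • dcoord 0 + Q y • dcoord 1

theorem fderivWithin_alternating_apply {E : Type*} [NormedAddCommGroup E] [NormedSpace ℝ E] {k : ℕ}
    {X : Type*} [NormedAddCommGroup X] [NormedSpace ℝ X]
    {σ : X → E [⋀^Fin k]→L[ℝ] ℝ} {s : Set X} {y : X}
    (h : DifferentiableWithinAt ℝ σ s y) (hs : UniqueDiffWithinAt ℝ s y) (v : X) (w : Fin k → E) :
    fderivWithin ℝ σ s y v w = fderivWithin ℝ (fun z => σ z w) s y v := by
  have h1 := (ContinuousAlternatingMap.apply ℝ E ℝ w).hasFDerivAt.comp_hasFDerivWithinAt y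
    h.hasFDerivWithinAt
  exact (congrArg (fun A : X →L[ℝ] ℝ => A v) (h1.fderivWithin hs)).symm

theorem contDiffOn_planeForm {P Q : Plane → ℝ} {s : Set Plane} {n : WithTop ℕ∞}
    (hP : ContDiffOn ℝ n P s) (hQ : ContDiffOn ℝ n Q s) : ContDiffOn ℝ n (planeForm P Q) s :=
  (hP.smul contDiffOn_const).add (hQ.smul contDiffOn_const)

theorem extDerivWithin_planeForm {P Q : Plane → ℝ} {s : Set Plane} {y : Plane}
    (hP : ContDiffOn ℝ ∞ P s) (hQ : ContDiffOn ℝ ∞ Q s) (hs : UniqueDiffOn ℝ s) (hy : y ∈ s) :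
    extDerivWithin (planeForm P Q) s y =
      (fderivWithin ℝ Q s y e₀ - fderivWithin ℝ P s y e₁) • planeArea := by
  apply alternating_two_ext
  have hd := (contDiffOn_planeForm hP hQ).differentiableOn (by simp) y hy
  rw [extDerivWithin_one_apply, fderivWithin_alternating_apply hd (hs y hy),
    fderivWithin_alternating_apply hd (hs y hy)]
  have h0 : (fun z => planeForm P Q z ![e₀]) = P := by
    funext z; simp [planeForm, dcoord_apply, e₀]
  have h1 : (fun z => planeForm P Q z ![e₁]) = Q := by
    funext z; simp [planeForm, dcoord_apply, e₁]
  rw [h0, h1]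
  simp [planeArea_apply]

theorem range_halfPlane : range (𝓡∂ 2) = {y : Plane | 0 ≤ y 0} :=
  range_modelWithCornersEuclideanHalfSpace 2

theorem convex_halfPlane : Convex ℝ {y : Plane | 0 ≤ y 0} := range_halfPlane ▸ (𝓡∂ 2).convex_range

theorem uniqueDiffOn_halfPlane : UniqueDiffOn ℝ {y : Plane | 0 ≤ y 0} :=
  range_halfPlane ▸ (𝓡∂ 2).uniqueDiffOn

/-- A derivative within a set, computed along a half-line. -/
theorem fderivWithin_apply_of_hasDerivWithinAt {X : Type*} [NormedAddCommGroup X] [NormedSpace ℝ X]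
    {G : X → ℝ} {s : Set X} {y v : X} {c : ℝ}
    (hG : DifferentiableWithinAt ℝ G s y) (hv : ∀ r ∈ Ici (0 : ℝ), y + r • v ∈ s)
    (h : HasDerivWithinAt (fun r : ℝ => G (y + r • v)) c (Ici 0) 0) :
    fderivWithin ℝ G s y v = c := by
  have h1 : HasDerivWithinAt (fun r : ℝ => y + r • v) v (Ici 0) 0 := by
    have := ((hasDerivAt_id (0 : ℝ)).smul_const v).const_add y
    simpa using this.hasDerivWithinAt
  have hy : y = y + (0 : ℝ) • v := by simp
  have h2 : HasFDerivWithinAt G (fderivWithin ℝ G s y) s (y + (0 : ℝ) • v) := by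
    rw [← hy]; exact hG.hasFDerivWithinAt
  have h3 := h2.comp_hasDerivWithinAt 0 h1 hv
  exact (uniqueDiffOn_Ici (0 : ℝ) 0 self_mem_Ici).eq_deriv _ h3 h

/-- The primitive in the direction of the first coordinate. -/
def primFst (a : ℝ) (f : Plane → ℝ) (y : Plane) : ℝ := ∫ s in a..(y 0), f (pt s (y 1))

theorem primFst_eq (a : ℝ) (f : Plane → ℝ) (y : Plane) :
    primFst a f y = ∫ u in (0 : ℝ)..1, (y 0 - a) * f (pt (a + (y 0 - a) * u) (y 1)) := by
  rw [primFst, intervalIntegral.integral_const_mul]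
  have := intervalIntegral.mul_integral_comp_add_mul (f := fun r => f (pt r (y 1))) (a := 0) (b := 1)
    (y 0 - a) a
  rw [this]
  simp

theorem contDiffOn_primFst {a : ℝ} {f : Plane → ℝ} {s : Set Plane} (hs : Convex ℝ s)
    (hs' : UniqueDiffOn ℝ s) (hf : ContDiffOn ℝ ∞ f s)
    (ha : ∀ y ∈ s, pt a (y 1) ∈ s) : ContDiffOn ℝ ∞ (primFst a f) s := by
  have h0 : ContDiffOn ℝ ∞ (fun q : ℝ × Plane => q.2 0 - a) (Icc 0 1 ×ˢ s) :=
    (((contDiff_coord 0).comp contDiff_snd).sub contDiff_const).contDiffOn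
  have h1 : ContDiffOn ℝ ∞ (fun q : ℝ × Plane => (q.2 0 - a) * f (pt (a + (q.2 0 - a) * q.1) (q.2 1)))
      (Icc 0 1 ×ˢ s) := by
    refine h0.mul (hf.comp (f := fun q : ℝ × Plane => pt (a + (q.2 0 - a) * q.1) (q.2 1))
      (contDiff_pt (contDiffOn_const.add (h0.mul contDiff_fst.contDiffOn))
      ((contDiff_coord 1).comp contDiff_snd).contDiffOn) ?_)
    rintro ⟨u, y⟩ ⟨hu, hy⟩
    have h2 := hs (ha y hy) hy (sub_nonneg.2 hu.2) hu.1 (by ring)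
    convert h2 using 1
    ext i
    fin_cases i
    · simp [pt]; ring
    · simp [pt]; ring
  exact (contDiffOn_parametric_integral hs hs' h1).congr fun y _ => primFst_eq a f y

theorem fderivWithin_primFst_e₀ {a : ℝ} (ha : 0 ≤ a) {f : Plane → ℝ}
    (hf : ContDiffOn ℝ ∞ f {y | 0 ≤ y 0}) {y : Plane} (hy : 0 ≤ y 0) :
    fderivWithin ℝ (primFst a f) {y | 0 ≤ y 0} y e₀ = f y := by
  have hG := (contDiffOn_primFst (a := a) convex_halfPlane uniqueDiffOn_halfPlane hf
    (fun _ _ => ha)).differentiableOn (by simp) y hy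
  refine fderivWithin_apply_of_hasDerivWithinAt hG (fun r hr => ?_) ?_
  · rw [add_smul_e₀]; exact add_nonneg hy hr
  · have hc : Continuous fun r : ℝ => f (pt (max r 0) (y 1)) :=
      hf.continuousOn.comp_continuous (continuous_pt (by fun_prop) continuous_const)
        fun r => le_max_right r 0
    have h1 : HasDerivAt (fun r : ℝ => ∫ s in a..(y 0 + r), f (pt (max s 0) (y 1)))
        (f (pt (max (y 0 + 0) 0) (y 1))) 0 := by
      have h2 := intervalIntegral.integral_hasDerivAt_right (a := a) (b := y 0 + 0)
        (hc.intervalIntegrable _ _) (hc.stronglyMeasurableAtFilter _ _) hc.continuousAt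
      exact h2.comp_const_add (y 0) 0
    have h3 : f (pt (max (y 0 + 0) 0) (y 1)) = f y := by
      rw [add_zero, max_eq_left hy, pt_eta]
    rw [h3] at h1
    refine h1.hasDerivWithinAt.congr (fun r hr => ?_) ?_
    · rw [add_smul_e₀, primFst]
      refine intervalIntegral.integral_congr fun s hs => ?_
      have h0 : 0 ≤ s := (le_min ha (add_nonneg hy hr)).trans hs.1
      simp [max_eq_left h0]
    · rw [add_smul_e₀, primFst]
      refine intervalIntegral.integral_congr fun s hs => ?_
      have h0 : 0 ≤ s := (le_min ha (by simpa using hy)).trans hs.1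
      simp [max_eq_left h0]

/-- A function with support in a box has a compactly supported primitive in the direction of the
first coordinate, if the box is allowed to touch the boundary of the half-plane. -/
theorem exists_primitive_halfPlane {f : Plane → ℝ} (hf : ContDiffOn ℝ ∞ f {y | 0 ≤ y 0})
    {a b c : ℝ} (ha : 0 ≤ a)
    (hsupp : ∀ y : Plane, 0 ≤ y 0 → f y ≠ 0 → y 0 < a ∧ y 1 ∈ Ioo b c) :
    ∃ G : Plane → ℝ, ContDiffOn ℝ ∞ G {y | 0 ≤ y 0} ∧
      (∀ y : Plane, 0 ≤ y 0 → G y ≠ 0 → y 0 ≤ a ∧ y 1 ∈ Icc b c) ∧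
      ∀ y : Plane, 0 ≤ y 0 → fderivWithin ℝ G {y | 0 ≤ y 0} y e₀ = f y := by
  refine ⟨primFst a f, contDiffOn_primFst convex_halfPlane uniqueDiffOn_halfPlane hf
    (fun _ _ => ha), fun y hy hG => ?_, fun y hy => fderivWithin_primFst_e₀ ha hf hy⟩
  by_contra hcon
  apply hG
  rw [primFst]
  refine intervalIntegral.integral_zero_ae (Eventually.of_forall fun s hs => ?_)
  by_contra hne
  have hs0 : 0 ≤ s := (le_min ha hy).trans hs.1.le
  obtain ⟨h1, h2⟩ := hsupp _ hs0 hne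
  refine hcon ⟨?_, Ioo_subset_Icc_self h2⟩
  by_contra hya
  push Not at hya
  have : min a (y 0) = a := min_eq_left hya.le
  have h3 := hs.1
  rw [this] at h3
  simp at h1
  linarith

theorem hasFDerivAt_apply_of_hasDerivAt {G : Plane → ℝ} {y v : Plane} {c : ℝ}
    (hG : DifferentiableAt ℝ G y)
    (h : HasDerivAt (fun r : ℝ => G (y + r • v)) c 0) : fderiv ℝ G y v = c := by
  rw [← fderivWithin_univ]
  exact fderivWithin_apply_of_hasDerivWithinAt hG.differentiableWithinAt (fun _ _ => trivial)
    h.hasDerivWithinAt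

theorem contDiff_primFst (a : ℝ) {f : Plane → ℝ} (hf : ContDiff ℝ ∞ f) :
    ContDiff ℝ ∞ (primFst a f) :=
  contDiffOn_univ.1 (contDiffOn_primFst convex_univ uniqueDiffOn_univ hf.contDiffOn
    fun _ _ => trivial)

theorem fderiv_primFst_e₀ (a : ℝ) {f : Plane → ℝ} (hf : ContDiff ℝ ∞ f) (y : Plane) :
    fderiv ℝ (primFst a f) y e₀ = f y := by
  refine hasFDerivAt_apply_of_hasDerivAt ((contDiff_primFst a hf).differentiable (by simp) y) ?_
  simp only [add_smul_e₀, primFst, pt_zero, pt_one]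
  have hc : Continuous fun r : ℝ => f (pt r (y 1)) :=
    hf.continuous.comp (continuous_pt continuous_id continuous_const)
  have h2 := intervalIntegral.integral_hasDerivAt_right (a := a) (b := y 0 + 0)
    (hc.intervalIntegrable _ _) (hc.stronglyMeasurableAtFilter _ _) hc.continuousAt
  have h3 := h2.comp_const_add (y 0) 0
  simpa [pt_eta] using h3

/-- A compactly supported function is, modulo derivatives of compactly supported functions, a
multiple of a given product of bump functions. -/
theorem exists_primitive_plane {f : Plane → ℝ} (hf : ContDiff ℝ ∞ f) {a₀ a₁ b₀ b₁ : ℝ}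
    (hsupp : ∀ y : Plane, f y ≠ 0 → y 0 ∈ Ioo a₀ a₁ ∧ y 1 ∈ Ioo b₀ b₁)
    {p q : ℝ → ℝ} (hp : ContDiff ℝ ∞ p) (hq : ContDiff ℝ ∞ q)
    (hps : ∀ s, p s ≠ 0 → s ∈ Ioo a₀ a₁) (hqs : ∀ s, q s ≠ 0 → s ∈ Ioo b₀ b₁)
    (hpi : ∫ s in a₀..a₁, p s = 1) (hqi : ∫ s in b₀..b₁, q s = 1) :
    ∃ (c : ℝ) (P Q : Plane → ℝ), ContDiff ℝ ∞ P ∧ ContDiff ℝ ∞ Q ∧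
      (∀ y, P y ≠ 0 → y 0 ∈ Icc a₀ a₁ ∧ y 1 ∈ Icc b₀ b₁) ∧
      (∀ y, Q y ≠ 0 → y 0 ∈ Icc a₀ a₁ ∧ y 1 ∈ Icc b₀ b₁) ∧
      ∀ y, fderiv ℝ Q y e₀ - fderiv ℝ P y e₁ = f y - c * (p (y 0) * q (y 1)) := by
  set F : ℝ → ℝ := fun t => primFst a₀ f (pt a₁ t) with hF
  have hFs : ContDiff ℝ ∞ F := (contDiff_primFst a₀ hf).comp
    (contDiffOn_univ.1 (contDiff_pt contDiffOn_const contDiffOn_id))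
  set c : ℝ := ∫ t in b₀..b₁, F t with hc
  set h : Plane → ℝ := fun y => f y - p (y 0) * F (y 1) with hh
  have hhs : ContDiff ℝ ∞ h := hf.sub ((hp.comp (contDiff_coord 0)).mul (hFs.comp (contDiff_coord 1)))
  set g : Plane → ℝ := fun y => F (y 0) - c * q (y 0) with hg
  have hgs : ContDiff ℝ ∞ g := (hFs.comp (contDiff_coord 0)).sub
    (contDiff_const.mul (hq.comp (contDiff_coord 0)))
  have hFsupp : ∀ t, F t ≠ 0 → t ∈ Ioo b₀ b₁ := by
    intro t ht
    by_contra hcon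
    apply ht
    refine intervalIntegral.integral_zero_ae (Eventually.of_forall fun s _ => ?_)
    by_contra hne
    exact hcon (hsupp _ hne).2
  have hflip : ContDiff ℝ ∞ (fun y : Plane => pt (y 1) (y 0)) :=
    contDiffOn_univ.1 (contDiff_pt (contDiff_coord 1).contDiffOn (contDiff_coord 0).contDiffOn)
  set K : Plane → ℝ := fun y => primFst b₀ g (pt (y 1) (y 0)) with hK
  have hKs : ContDiff ℝ ∞ K := (contDiff_primFst b₀ hgs).comp hflip
  refine ⟨c, fun y => -(p (y 0) * K y), primFst a₀ h, ?_, contDiff_primFst a₀ hhs, ?_, ?_, ?_⟩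
  · exact ((hp.comp (contDiff_coord 0)).mul hKs).neg
  · intro y hy
    have hp0 : p (y 0) ≠ 0 := fun h0 => hy (by simp [h0])
    have hK0 : K y ≠ 0 := fun h0 => hy (by simp [h0])
    refine ⟨Ioo_subset_Icc_self (hps _ hp0), ?_⟩
    by_contra hcon
    apply hK0
    have hgz : ∀ s, s ∉ Ioo b₀ b₁ → g (pt s (y 0)) = 0 := by
      intro s hs
      have h1 : F s = 0 := by_contra fun h0 => hs (hFsupp s h0)
      have h2 : q s = 0 := by_contra fun h0 => hs (hqs s h0)
      simp [hg, h1, h2]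
    change ∫ s in b₀..(y 1), g (pt s (y 0)) = 0
    rcases lt_or_ge (y 1) b₀ with hlt | hge
    · refine intervalIntegral.integral_zero_ae (Eventually.of_forall fun s hs => hgz s ?_)
      rw [uIoc_of_ge hlt.le] at hs
      exact fun h0 => absurd h0.1 (not_lt.2 hs.2)
    · have hgt : b₁ < y 1 := by
        by_contra h0
        exact hcon ⟨hge, not_lt.1 h0⟩
      have hgc : Continuous fun s => g (pt s (y 0)) :=
        hgs.continuous.comp (continuous_pt continuous_id continuous_const)
      rw [← intervalIntegral.integral_add_adjacent_intervals (b := b₁)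
        (hgc.intervalIntegrable _ _) (hgc.intervalIntegrable _ _)]
      have h1 : ∫ s in b₁..(y 1), g (pt s (y 0)) = 0 := by
        refine intervalIntegral.integral_zero_ae (Eventually.of_forall fun s hs => hgz s ?_)
        rw [uIoc_of_le hgt.le] at hs
        exact fun h0 => absurd h0.2 (not_lt.2 hs.1.le)
      have h2 : ∫ s in b₀..b₁, g (pt s (y 0)) = 0 := by
        have hqc : Continuous fun s => c * q s := continuous_const.mul hq.continuous
        simp only [hg, pt_zero]
        rw [intervalIntegral.integral_sub (hFs.continuous.intervalIntegrable _ _)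
          (hqc.intervalIntegrable _ _),
          intervalIntegral.integral_const_mul, hqi, ← hc]
        ring
      rw [h1, h2, add_zero]
  · intro y hy
    have hhc : Continuous fun s => h (pt s (y 1)) :=
      hhs.continuous.comp (continuous_pt continuous_id continuous_const)
    have hy1 : y 1 ∈ Ioo b₀ b₁ := by
      by_contra hcon
      apply hy
      refine intervalIntegral.integral_zero_ae (Eventually.of_forall fun s _ => ?_)
      have h1 : F (y 1) = 0 := by_contra fun h0 => hcon (hFsupp _ h0)
      have h2 : f (pt s (y 1)) = 0 := by_contra fun h0 => hcon (hsupp _ h0).2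
      simp [hh, h1, h2]
    refine ⟨?_, Ioo_subset_Icc_self hy1⟩
    by_contra hcon
    apply hy
    have hhz : ∀ s, s ∉ Ioo a₀ a₁ → h (pt s (y 1)) = 0 := by
      intro s hs
      have h1 : p s = 0 := by_contra fun h0 => hs (hps s h0)
      have h2 : f (pt s (y 1)) = 0 := by_contra fun h0 => hs (hsupp _ h0).1
      simp [hh, h1, h2]
    change ∫ s in a₀..(y 0), h (pt s (y 1)) = 0
    rcases lt_or_ge (y 0) a₀ with hlt | hge
    · refine intervalIntegral.integral_zero_ae (Eventually.of_forall fun s hs => hhz s ?_)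
      rw [uIoc_of_ge hlt.le] at hs
      exact fun h0 => absurd h0.1 (not_lt.2 hs.2)
    · have hgt : a₁ < y 0 := by
        by_contra h0
        exact hcon ⟨hge, not_lt.1 h0⟩
      rw [← intervalIntegral.integral_add_adjacent_intervals (b := a₁)
        (hhc.intervalIntegrable _ _) (hhc.intervalIntegrable _ _)]
      have h1 : ∫ s in a₁..(y 0), h (pt s (y 1)) = 0 := by
        refine intervalIntegral.integral_zero_ae (Eventually.of_forall fun s hs => hhz s ?_)
        rw [uIoc_of_le hgt.le] at hs
        exact fun h0 => absurd h0.2 (not_lt.2 hs.1.le)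
      have h2 : ∫ s in a₀..a₁, h (pt s (y 1)) = 0 := by
        have hfc : Continuous fun s => f (pt s (y 1)) :=
          hf.continuous.comp (continuous_pt continuous_id continuous_const)
        have hpc : Continuous fun s => p s * F (y 1) := hp.continuous.mul continuous_const
        simp only [hh, pt_zero, pt_one]
        rw [intervalIntegral.integral_sub (hfc.intervalIntegrable _ _)
          (hpc.intervalIntegrable _ _),
          intervalIntegral.integral_mul_const, hpi]
        simp [hF, primFst]
      rw [h1, h2, add_zero]
  · intro y
    rw [fderiv_primFst_e₀ a₀ hhs]
    have h1 : fderiv ℝ (fun y : Plane => -(p (y 0) * K y)) y e₁ = -(p (y 0) * g (pt (y 1) (y 0))) := by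
      refine hasFDerivAt_apply_of_hasDerivAt
        ((((hp.comp (contDiff_coord 0)).mul hKs).neg).differentiable (by simp) y) ?_
      simp only [add_smul_e₁, pt_zero, hK, pt_one, primFst]
      have hc : Continuous fun r : ℝ => g (pt r (y 0)) :=
        hgs.continuous.comp (continuous_pt continuous_id continuous_const)
      have h2 := intervalIntegral.integral_hasDerivAt_right (a := b₀) (b := y 1 + 0)
        (hc.intervalIntegrable _ _) (hc.stronglyMeasurableAtFilter _ _) hc.continuousAt
      have h3 := h2.comp_const_add (y 1) 0
      rw [add_zero] at h3
      exact (h3.const_mul _).neg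
    rw [h1]
    simp only [hh, hg, pt_zero]
    ring

end Plane

section ChartForms

variable {E : Type*} [NormedAddCommGroup E] [NormedSpace ℝ E] [FiniteDimensional ℝ E]
  {H : Type*} [TopologicalSpace H] {I : ModelWithCorners ℝ E H}
  {M : Type*} [TopologicalSpace M] [ChartedSpace H M] [IsManifold I ∞ M] {k : ℕ}

open Classical in
/-- The form on `M` with the given coordinate expression in the chart around `x₀`, extended by zero. -/
def chartForm (I : ModelWithCorners ℝ E H) (x₀ : M) (σ : E → E [⋀^Fin k]→L[ℝ] ℝ) : Form I M k :=
  fun x => if x ∈ (extChartAt I x₀).source then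
    (σ (extChartAt I x₀ x)).compContinuousLinearMap (mfderiv I 𝓘(ℝ, E) (extChartAt I x₀) x) else 0

theorem inChart_chartForm {x₀ : M} {σ : E → E [⋀^Fin k]→L[ℝ] ℝ} {y : E}
    (hy : y ∈ (extChartAt I x₀).target) : Form.inChart (chartForm I x₀ σ) x₀ y = σ y := by
  have := isManifold_one (I := I) (M := M)
  have h1 := mfderiv_extChartAt_comp_mfderivWithin_extChartAt_symm (I := I) hy
  have h2 : chartForm I x₀ σ ((extChartAt I x₀).symm y) =
      (σ y).compContinuousLinearMap
        (mfderiv I 𝓘(ℝ, E) (extChartAt I x₀) ((extChartAt I x₀).symm y)) := by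
    rw [chartForm, if_pos ((extChartAt I x₀).map_target hy), (extChartAt I x₀).right_inv hy]
  rw [Form.inChart, h2]
  ext v
  refine congrArg (σ y) ?_
  funext i
  exact congrArg (fun A : E →L[ℝ] E => A (v i)) h1

/-- A form is determined by its coordinate expressions. -/
theorem Form.eq_inChart_comp (α : Form I M k) {x₀ x : M} (hx : x ∈ (extChartAt I x₀).source) :
    α x = (Form.inChart α x₀ (extChartAt I x₀ x)).compContinuousLinearMap
      (mfderiv I 𝓘(ℝ, E) (extChartAt I x₀) x) := by
  have := isManifold_one (I := I) (M := M)
  have h1 := mfderivWithin_extChartAt_symm_comp_mfderiv_extChartAt' (I := I) hx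
  have h2 : ∀ p (_ : p = x) (A : E →L[ℝ] E) (B : E →L[ℝ] E),
      A.comp B = ContinuousLinearMap.id ℝ E → (show E [⋀^Fin k]→L[ℝ] ℝ from α x) =
      ((show E [⋀^Fin k]→L[ℝ] ℝ from α p).compContinuousLinearMap A).compContinuousLinearMap B := by
    rintro p rfl A B hAB
    ext v
    refine congrArg (show E [⋀^Fin k]→L[ℝ] ℝ from α p) ?_
    funext i
    exact (congrArg (fun A : E →L[ℝ] E => A (v i)) hAB).symm
  exact h2 _ ((extChartAt I x₀).left_inv hx) _ _ h1

theorem Form.eq_of_inChart_eq {α β : Form I M k} {x₀ x : M} (hx : x ∈ (extChartAt I x₀).source)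
    (h : Form.inChart α x₀ (extChartAt I x₀ x) = Form.inChart β x₀ (extChartAt I x₀ x)) :
    α x = β x := by
  rw [α.eq_inChart_comp hx, β.eq_inChart_comp hx, h]

variable [T2Space M]

theorem chartForm_eq_zero {x₀ : M} {σ : E → E [⋀^Fin k]→L[ℝ] ℝ} {K : Set E}
    (hσ : ∀ y ∈ range I, y ∉ K → σ y = 0) {x : M} (hx : x ∉ (extChartAt I x₀).symm '' K) :
    chartForm I x₀ σ x = 0 := by
  rw [chartForm]
  split_ifs with h
  · rw [hσ]
    · rfl
    · exact extChartAt_target_subset_range x₀ ((extChartAt I x₀).map_source h)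
    · exact fun hK => hx ⟨_, hK, (extChartAt I x₀).left_inv h⟩
  · rfl

theorem isClosed_symm_image {x₀ : M} {K : Set E} (hK : IsCompact K)
    (hKt : K ⊆ (extChartAt I x₀).target) : IsClosed ((extChartAt I x₀).symm '' K) :=
  (hK.image_of_continuousOn ((continuousOn_extChartAt_symm x₀).mono hKt)).isClosed

theorem isSmooth_chartForm {x₀ : M} {σ : E → E [⋀^Fin k]→L[ℝ] ℝ} (h : ContDiffOn ℝ ∞ σ (range I))
    {K : Set E} (hK : IsCompact K) (hKt : K ⊆ (extChartAt I x₀).target)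
    (hσ : ∀ y ∈ range I, y ∉ K → σ y = 0) : Form.IsSmooth (chartForm I x₀ σ) := by
  rw [Form.isSmooth_iff_smoothAt]
  intro x
  by_cases hx : x ∈ (extChartAt I x₀).source
  · rw [Form.smoothAt_iff_inChart hx]
    have hy := (extChartAt I x₀).map_source hx
    refine (h _ (extChartAt_target_subset_range x₀ hy)).congr_of_eventuallyEq_of_mem ?_
      (extChartAt_target_subset_range x₀ hy)
    filter_upwards [eventually_mem_extChartAt_target hy] with y hy using inChart_chartForm hy
  · have hx' : x ∉ (extChartAt I x₀).symm '' K := by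
      rintro ⟨y, hy, rfl⟩
      exact hx ((extChartAt I x₀).map_target (hKt hy))
    refine (Form.smoothAt_zero (x := x)).congr ?_
    filter_upwards [(isClosed_symm_image hK hKt).isOpen_compl.mem_nhds hx'] with z hz
    exact (chartForm_eq_zero hσ hz).symm

/-- A form supported in a chart is exact if its coordinate expression has a compactly supported
primitive. -/
theorem isExact_of_inChart {x₀ : M} {σ : E → E [⋀^Fin k]→L[ℝ] ℝ} (h : ContDiffOn ℝ ∞ σ (range I))
    {K : Set E} (hK : IsCompact K) (hKt : K ⊆ (extChartAt I x₀).target)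
    (hσ : ∀ y ∈ range I, y ∉ K → σ y = 0) {β : Form I M (k + 1)}
    (hβ : ∀ x ∉ (extChartAt I x₀).source, β x = 0)
    (hd : ∀ y ∈ (extChartAt I x₀).target,
      extDerivWithin σ (range I) y = Form.inChart β x₀ y) : Form.IsExact β := by
  have hs := isSmooth_chartForm h hK hKt hσ
  refine ⟨chartForm I x₀ σ, hs, funext fun x => ?_⟩
  by_cases hx : x ∈ (extChartAt I x₀).source
  · have hy := (extChartAt I x₀).map_source hx
    refine Form.eq_of_inChart_eq hx ?_
    rw [inChart_d hy (hs.smoothAt _), ← hd _ hy]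
    refine Filter.EventuallyEq.extDerivWithin_eq_of_mem ?_ (extChartAt_target_subset_range x₀ hy)
    filter_upwards [eventually_mem_extChartAt_target hy] with y hy using inChart_chartForm hy
  · have hx' : x ∉ (extChartAt I x₀).symm '' K := by
      rintro ⟨y, hy, rfl⟩
      exact hx ((extChartAt I x₀).map_target (hKt hy))
    rw [hβ x hx]
    have h1 : Form.d (chartForm I x₀ σ) x = Form.d (0 : Form I M k) x := by
      refine Form.d_congr ?_
      filter_upwards [(isClosed_symm_image hK hKt).isOpen_compl.mem_nhds hx'] with z hz
      exact chartForm_eq_zero hσ hz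
    rw [h1]
    have h2 := Form.d_sub (α := (0 : Form I M k)) (β := 0) (x := x) Form.smoothAt_zero
      Form.smoothAt_zero
    rwa [sub_self, sub_self] at h2

theorem Form.IsExact.add {α β : Form I M (k + 1)} (hα : Form.IsExact α) (hβ : Form.IsExact β) :
    Form.IsExact (α + β) := by
  obtain ⟨η, h1, rfl⟩ := hα
  obtain ⟨ζ, h2, rfl⟩ := hβ
  exact ⟨η + ζ, h1.add h2, funext fun x => Form.d_add (h1.smoothAt x) (h2.smoothAt x)⟩

theorem Form.isExact_zero : Form.IsExact (0 : Form I M (k + 1)) := by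
  have h0 : Form.IsSmooth (0 : Form I M k) :=
    Form.isSmooth_iff_smoothAt.2 fun _ => Form.smoothAt_zero
  refine ⟨0, h0, funext fun x => ?_⟩
  have h2 := Form.d_sub (h0.smoothAt x) (h0.smoothAt x)
  rwa [sub_self, sub_self] at h2

theorem Form.IsExact.sum {ι : Type*} (s : Finset ι) {α : ι → Form I M (k + 1)}
    (h : ∀ i ∈ s, Form.IsExact (α i)) : Form.IsExact (∑ i ∈ s, α i) := by
  classical
  induction s using Finset.induction_on with
  | empty => simpa using Form.isExact_zero
  | insert a s ha ih =>
    rw [Finset.sum_insert ha]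
    exact (h a (Finset.mem_insert_self a s)).add
      (ih fun i hi => h i (Finset.mem_insert_of_mem hi))

end ChartForms

section Exactness

variable {S : Type*} [TopologicalSpace S] [ChartedSpace (EuclideanHalfSpace 2) S]

theorem exists_normalized_bump {a b a₀ a₁ : ℝ} (hab : a < b) (h0 : a₀ ≤ a) (h1 : b ≤ a₁) :
    ∃ p : ℝ → ℝ, ContDiff ℝ ∞ p ∧ (∀ s, p s ≠ 0 → s ∈ Ioo a b) ∧ ∫ s in a₀..a₁, p s = 1 := by
  let f : ContDiffBump ((a + b) / 2) := ⟨(b - a) / 4, (b - a) / 2, by linarith, by linarith⟩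
  have hs : ∀ s, f.normed MeasureTheory.volume s ≠ 0 → s ∈ Ioo a b := by
    intro s hs
    have h2 : s ∈ Function.support (f.normed MeasureTheory.volume) := hs
    rw [ContDiffBump.support_normed_eq, Real.ball_eq_Ioo] at h2
    constructor
    · have := h2.1; change (a + b) / 2 - (b - a) / 2 < s at this; linarith
    · have := h2.2; change s < (a + b) / 2 + (b - a) / 2 at this; linarith
  refine ⟨f.normed MeasureTheory.volume, f.contDiff_normed, hs, ?_⟩
  rw [intervalIntegral.integral_eq_integral_of_support_subset, f.integral_normed]
  intro s h
  have := hs s h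
  exact ⟨lt_of_le_of_lt h0 this.1, this.2.le.trans h1⟩

/-- A closed coordinate box. -/
def box (a₀ a₁ b₀ b₁ : ℝ) : Set Plane := {y | y 0 ∈ Icc a₀ a₁ ∧ y 1 ∈ Icc b₀ b₁}

theorem isCompact_box (a₀ a₁ b₀ b₁ : ℝ) : IsCompact (box a₀ a₁ b₀ b₁) := by
  have h : box a₀ a₁ b₀ b₁ = (fun q : ℝ × ℝ => pt q.1 q.2) '' (Icc a₀ a₁ ×ˢ Icc b₀ b₁) := by
    ext y
    constructor
    · exact fun hy => ⟨(y 0, y 1), hy, pt_eta y⟩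
    · rintro ⟨q, hq, rfl⟩; exact hq
  rw [h]
  exact (isCompact_Icc.prod isCompact_Icc).image (continuous_pt continuous_fst continuous_snd)

/-- An open coordinate box. -/
def openBox (a₀ a₁ b₀ b₁ : ℝ) : Set Plane := {y | y 0 ∈ Ioo a₀ a₁ ∧ y 1 ∈ Ioo b₀ b₁}

theorem isOpen_openBox (a₀ a₁ b₀ b₁ : ℝ) : IsOpen (openBox a₀ a₁ b₀ b₁) :=
  (isOpen_Ioo.preimage (contDiff_coord (n := 0) 0).continuous).inter
    (isOpen_Ioo.preimage (contDiff_coord (n := 0) 1).continuous)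

theorem openBox_subset_box (a₀ a₁ b₀ b₁ : ℝ) : openBox a₀ a₁ b₀ b₁ ⊆ box a₀ a₁ b₀ b₁ :=
  fun _ h => ⟨Ioo_subset_Icc_self h.1, Ioo_subset_Icc_self h.2⟩

theorem box_subset_ball {z y : Plane} {r : ℝ} (hr : 0 < r)
    (hy : y ∈ box (z 0 - r / 2) (z 0 + r / 2) (z 1 - r / 2) (z 1 + r / 2)) :
    y ∈ Metric.ball z r := by
  rw [Metric.mem_ball, EuclideanSpace.dist_eq, Fin.sum_univ_two, Real.sqrt_lt' hr,
    Real.dist_eq, Real.dist_eq, sq_abs, sq_abs]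
  have h1 := hy.1.1
  have h2 := hy.1.2
  have h3 := hy.2.1
  have h4 := hy.2.2
  nlinarith

theorem exists_box_subset {z : Plane} {U : Set Plane} (hU : U ∈ 𝓝 z) :
    ∃ r > 0, box (z 0 - r) (z 0 + r) (z 1 - r) (z 1 + r) ⊆ U := by
  obtain ⟨ε, hε, h⟩ := Metric.mem_nhds_iff.1 hU
  exact ⟨ε / 2, by linarith, fun y hy => h (box_subset_ball hε hy)⟩

theorem mem_openBox_self {z : Plane} {r : ℝ} (hr : 0 < r) :
    z ∈ openBox (z 0 - r) (z 0 + r) (z 1 - r) (z 1 + r) :=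
  ⟨⟨by linarith, by linarith⟩, by linarith, by linarith⟩

/-- Every smooth two-form with support in `U` is exact. -/
def ExactOn (U : Set S) : Prop :=
  ∀ β : Form (𝓡∂ 2) S 2, Form.IsSmooth β → (∃ K, IsClosed K ∧ K ⊆ U ∧ ∀ x ∉ K, β x = 0) →
    Form.IsExact β

variable [IsManifold (𝓡∂ 2) ∞ S]

/-- The coefficient of a two-form in a chart, extended by zero. -/
def coeff (β : Form (𝓡∂ 2) S 2) (x₀ : S) (y : Plane) : ℝ :=
  letI := Classical.dec (y ∈ (extChartAt (𝓡∂ 2) x₀).target)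
  if y ∈ (extChartAt (𝓡∂ 2) x₀).target then Form.inChart β x₀ y ![e₀, e₁] else 0

theorem coeff_eq {β : Form (𝓡∂ 2) S 2} {x₀ : S} {y : Plane}
    (hy : y ∈ (extChartAt (𝓡∂ 2) x₀).target) : coeff β x₀ y = Form.inChart β x₀ y ![e₀, e₁] :=
  if_pos hy

theorem coeff_smul_planeArea {β : Form (𝓡∂ 2) S 2} {x₀ : S} {y : Plane}
    (hy : y ∈ (extChartAt (𝓡∂ 2) x₀).target) : coeff β x₀ y • planeArea = Form.inChart β x₀ y := by
  apply alternating_two_ext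
  rw [coeff_eq hy]
  simp [planeArea_apply]

theorem coeff_ne_zero {β : Form (𝓡∂ 2) S 2} {x₀ : S} {y : Plane} {K : Set S}
    (hβ : ∀ x ∉ K, β x = 0) (h : coeff β x₀ y ≠ 0) :
    y ∈ (extChartAt (𝓡∂ 2) x₀).target ∧ (extChartAt (𝓡∂ 2) x₀).symm y ∈ K := by
  have hy : y ∈ (extChartAt (𝓡∂ 2) x₀).target := by
    by_contra hy
    exact h (if_neg hy)
  refine ⟨hy, ?_⟩
  by_contra hK
  apply h
  rw [coeff_eq hy, Form.inChart, hβ _ hK]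
  rfl

theorem contDiffOn_coeff {β : Form (𝓡∂ 2) S 2} (hs : Form.IsSmooth β) {x₀ : S} {B : Set Plane}
    (hB : IsClosed B) (hBt : B ∩ range (𝓡∂ 2) ⊆ (extChartAt (𝓡∂ 2) x₀).target)
    (hβ : ∀ y, coeff β x₀ y ≠ 0 → y ∈ B) :
    ContDiffOn ℝ ∞ (coeff β x₀) (range (𝓡∂ 2)) := by
  intro y hyr
  by_cases hy : y ∈ B
  · have hyt := hBt ⟨hy, hyr⟩
    refine (contDiffWithinAt_alternating_iff.1 (hs.contDiffWithinAt hyt) ![e₀, e₁])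
      |>.congr_of_eventuallyEq_of_mem ?_ hyr
    filter_upwards [eventually_mem_extChartAt_target hyt] with z hz using coeff_eq hz
  · refine (contDiffWithinAt_const (c := (0 : ℝ))).congr_of_eventuallyEq_of_mem ?_ hyr
    filter_upwards [mem_nhdsWithin_of_mem_nhds (hB.isOpen_compl.mem_nhds hy)] with z hz
    by_contra h0
    exact hz (hβ z h0)

theorem mem_of_coeff_ne_zero {β : Form (𝓡∂ 2) S 2} {x₀ : S} {W : Set Plane} {K : Set S}
    (hK : K ⊆ (extChartAt (𝓡∂ 2) x₀).source ∩ extChartAt (𝓡∂ 2) x₀ ⁻¹' W)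
    (hβ : ∀ x ∉ K, β x = 0) {y : Plane} (h : coeff β x₀ y ≠ 0) : y ∈ W := by
  obtain ⟨h1, h2⟩ := coeff_ne_zero hβ h
  have h3 := (hK h2).2
  rwa [mem_preimage, (extChartAt (𝓡∂ 2) x₀).right_inv h1] at h3

variable [T2Space S]

/-- Forms with support in a box around a boundary point are exact. -/
theorem exists_exactOn_boundary {x₀ : S} (hx : x₀ ∈ (𝓡∂ 2).boundary S) :
    ∃ U : Set S, IsOpen U ∧ x₀ ∈ U ∧ ExactOn U := by
  set z := extChartAt (𝓡∂ 2) x₀ x₀ with hz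
  have hz0 : z 0 = 0 := by
    have h1 : z ∈ frontier (range (𝓡∂ 2)) := hx
    rw [frontier_range_modelWithCornersEuclideanHalfSpace] at h1
    exact h1.symm
  obtain ⟨ε, hε, hball⟩ := Metric.mem_nhdsWithin_iff.1 (extChartAt_target_mem_nhdsWithin (I := 𝓡∂ 2) x₀)
  set r := ε / 2 with hr
  have hr0 : 0 < r := by positivity
  have hbox : box (-r) r (z 1 - r) (z 1 + r) ∩ range (𝓡∂ 2) ⊆ (extChartAt (𝓡∂ 2) x₀).target := by
    rintro y ⟨hy, hyr⟩
    refine hball ⟨box_subset_ball hε ?_, hyr⟩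
    rw [hz0, zero_sub, zero_add]
    exact hy
  refine ⟨(extChartAt (𝓡∂ 2) x₀).source ∩ extChartAt (𝓡∂ 2) x₀ ⁻¹' openBox (-r) r (z 1 - r) (z 1 + r),
    isOpen_extChartAt_preimage' x₀ (isOpen_openBox _ _ _ _), ⟨mem_extChartAt_source x₀, ?_⟩, ?_⟩
  · have := mem_openBox_self (z := z) hr0
    rw [hz0, zero_sub, zero_add] at this
    exact this
  · rintro β hs ⟨K, hK, hKU, hβ⟩
    have hsupp : ∀ y, coeff β x₀ y ≠ 0 → y ∈ openBox (-r) r (z 1 - r) (z 1 + r) := fun y hy =>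
      mem_of_coeff_ne_zero hKU hβ hy
    have hsm := contDiffOn_coeff hs (isCompact_box _ _ _ _).isClosed hbox
      fun y hy => openBox_subset_box _ _ _ _ (hsupp y hy)
    rw [range_halfPlane] at hsm
    obtain ⟨G, hG, hGs, hGd⟩ := exists_primitive_halfPlane hsm hr0.le
      (b := z 1 - r) (c := z 1 + r) fun y _ hy => ⟨(hsupp y hy).1.2, (hsupp y hy).2⟩
    have hG0 : ContDiffOn ℝ ∞ (fun _ : Plane => (0 : ℝ)) {y : Plane | 0 ≤ y 0} := contDiffOn_const
    refine isExact_of_inChart (x₀ := x₀) (σ := planeForm (fun _ => 0) G)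
      (K := box 0 r (z 1 - r) (z 1 + r)) ?_ (isCompact_box _ _ _ _) ?_ ?_ ?_ ?_
    · rw [range_halfPlane]; exact contDiffOn_planeForm hG0 hG
    · intro y hy
      refine hbox ⟨⟨⟨by linarith [hy.1.1], hy.1.2⟩, hy.2⟩, ?_⟩
      rw [range_halfPlane]; exact hy.1.1
    · intro y hy hyK
      rw [range_halfPlane] at hy
      have : G y = 0 := by
        by_contra h0
        exact hyK ⟨⟨hy, (hGs y hy h0).1⟩, (hGs y hy h0).2⟩
      simp [planeForm, this]
    · exact fun x hx => hβ x fun hxK => hx (hKU hxK).1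
    · intro y hy
      have hyr : 0 ≤ y 0 := by
        have := extChartAt_target_subset_range x₀ hy
        rwa [range_halfPlane] at this
      rw [range_halfPlane, extDerivWithin_planeForm hG0 hG uniqueDiffOn_halfPlane hyr, hGd y hyr,
        ← coeff_smul_planeArea hy]
      simp

/-- In a box around an interior point, the support of a form can be moved to any open subset of
the box. -/
theorem exists_exactOn_interior {x₀ : S} (hx : x₀ ∉ (𝓡∂ 2).boundary S) :
    ∃ W : Set S, IsOpen W ∧ x₀ ∈ W ∧
      ∀ U : Set S, IsOpen U → (W ∩ U).Nonempty → ExactOn U → ExactOn W := by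
  set z := extChartAt (𝓡∂ 2) x₀ x₀ with hz
  have hzi : range (𝓡∂ 2) ∈ 𝓝 z := by
    have h1 : ¬ (𝓡∂ 2).IsBoundaryPoint x₀ := hx
    rw [← ModelWithCorners.isInteriorPoint_iff_not_isBoundaryPoint] at h1
    exact mem_interior_iff_mem_nhds.1 h1
  have htn : (extChartAt (𝓡∂ 2) x₀).target ∈ 𝓝 z := by
    have := extChartAt_target_mem_nhdsWithin (I := 𝓡∂ 2) x₀
    rwa [nhdsWithin_eq_nhds.2 hzi] at this
  obtain ⟨r, hr, hbox⟩ := exists_box_subset (interior_mem_nhds.2 htn)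
  set a₀ := z 0 - r with ha₀
  set a₁ := z 0 + r with ha₁
  set b₀ := z 1 - r with hb₀
  set b₁ := z 1 + r with hb₁
  have htr : (extChartAt (𝓡∂ 2) x₀).target ⊆ range (𝓡∂ 2) := extChartAt_target_subset_range x₀
  have hcd : ∀ β : Form (𝓡∂ 2) S 2, Form.IsSmooth β →
      (∀ y, coeff β x₀ y ≠ 0 → y ∈ openBox a₀ a₁ b₀ b₁) → ContDiff ℝ ∞ (coeff β x₀) := by
    intro β hs hsupp
    have hc := (isCompact_box a₀ a₁ b₀ b₁).isClosed
    rw [contDiff_iff_contDiffAt]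
    intro y
    by_cases hy : y ∈ box a₀ a₁ b₀ b₁
    · have hyn : range (𝓡∂ 2) ∈ 𝓝 y :=
        mem_of_superset (mem_interior_iff_mem_nhds.1 (hbox hy)) htr
      exact (contDiffOn_coeff hs hc (inter_subset_left.trans (hbox.trans interior_subset))
        (fun y hy => openBox_subset_box _ _ _ _ (hsupp y hy)) y (mem_of_mem_nhds hyn)).contDiffAt hyn
    · refine (contDiffAt_const (c := (0 : ℝ))).congr_of_eventuallyEq ?_
      filter_upwards [hc.isOpen_compl.mem_nhds hy] with w hw
      by_contra h0
      exact hw (openBox_subset_box _ _ _ _ (hsupp w h0))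
  refine ⟨(extChartAt (𝓡∂ 2) x₀).source ∩ extChartAt (𝓡∂ 2) x₀ ⁻¹' openBox a₀ a₁ b₀ b₁,
    isOpen_extChartAt_preimage' x₀ (isOpen_openBox _ _ _ _),
    ⟨mem_extChartAt_source x₀, mem_openBox_self hr⟩, ?_⟩
  rintro U hU ⟨x, ⟨hxs, hxb⟩, hxU⟩ hEU β hs ⟨K, hK, hKU, hβ⟩
  have hxt := (extChartAt (𝓡∂ 2) x₀).map_source hxs
  set w := extChartAt (𝓡∂ 2) x₀ x with hw
  have hwn : (extChartAt (𝓡∂ 2) x₀).symm ⁻¹' U ∩ openBox a₀ a₁ b₀ b₁ ∈ 𝓝 w := by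
    refine inter_mem ?_ ((isOpen_openBox _ _ _ _).mem_nhds hxb)
    refine (continuousAt_extChartAt_symm'' hxt).preimage_mem_nhds (hU.mem_nhds ?_)
    rwa [(extChartAt (𝓡∂ 2) x₀).left_inv hxs]
  obtain ⟨r', hr', hbox'⟩ := exists_box_subset hwn
  have hc1 : w 0 - r' ∈ Ioo a₀ a₁ ∧ w 1 - r' ∈ Ioo b₀ b₁ :=
    (hbox' (show pt (w 0 - r') (w 1 - r') ∈ box _ _ _ _ from
      ⟨⟨le_rfl, by simp; linarith⟩, le_rfl, by simp; linarith⟩)).2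
  have hc2 : w 0 + r' ∈ Ioo a₀ a₁ ∧ w 1 + r' ∈ Ioo b₀ b₁ :=
    (hbox' (show pt (w 0 + r') (w 1 + r') ∈ box _ _ _ _ from
      ⟨⟨by simp; linarith, le_rfl⟩, by simp; linarith, le_rfl⟩)).2
  obtain ⟨p, hp, hps, hpi⟩ := exists_normalized_bump (a := w 0 - r') (b := w 0 + r') (by linarith)
    hc1.1.1.le hc2.1.2.le
  obtain ⟨q, hq, hqs, hqi⟩ := exists_normalized_bump (a := w 1 - r') (b := w 1 + r') (by linarith)
    hc1.2.1.le hc2.2.2.le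
  have hsupp : ∀ y, coeff β x₀ y ≠ 0 → y ∈ openBox a₀ a₁ b₀ b₁ := fun y hy =>
    mem_of_coeff_ne_zero hKU hβ hy
  obtain ⟨c, P, Q, hP, hQ, hPs, hQs, hPQ⟩ := exists_primitive_plane (hcd β hs hsupp) hsupp hp hq
    (fun s h => ⟨hc1.1.1.trans (hps s h).1, (hps s h).2.trans hc2.1.2⟩)
    (fun s h => ⟨hc1.2.1.trans (hqs s h).1, (hqs s h).2.trans hc2.2.2⟩) hpi hqi
  -- the form carrying the total mass, supported in `U`
  set τ : Plane → Plane [⋀^Fin 2]→L[ℝ] ℝ := fun y => (-c * (p (y 0) * q (y 1))) • planeArea with hτ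
  have hτs : ContDiff ℝ ∞ τ := (contDiff_const.mul ((hp.comp (contDiff_coord 0)).mul
    (hq.comp (contDiff_coord 1)))).smul contDiff_const
  set C := box (w 0 - r') (w 0 + r') (w 1 - r') (w 1 + r') with hC
  have hCt : C ⊆ (extChartAt (𝓡∂ 2) x₀).target := fun y hy =>
    interior_subset (hbox (openBox_subset_box _ _ _ _ (hbox' hy).2))
  have hτ0 : ∀ y ∈ range (𝓡∂ 2), y ∉ C → τ y = 0 := by
    intro y _ hy
    have h0 : p (y 0) * q (y 1) = 0 := by
      by_contra h0
      refine hy ⟨Ioo_subset_Icc_self (hps _ (left_ne_zero_of_mul h0)),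
        Ioo_subset_Icc_self (hqs _ (right_ne_zero_of_mul h0))⟩
    simp [hτ, h0]
  have hms : Form.IsSmooth (chartForm (𝓡∂ 2) x₀ τ) :=
    isSmooth_chartForm hτs.contDiffOn (isCompact_box _ _ _ _) hCt hτ0
  have hme : Form.IsExact (chartForm (𝓡∂ 2) x₀ τ) := by
    refine hEU _ hms ⟨_, isClosed_symm_image (isCompact_box _ _ _ _) hCt, ?_,
      fun x hx => chartForm_eq_zero hτ0 hx⟩
    rintro _ ⟨y, hy, rfl⟩
    exact (hbox' hy).1
  have hne : Form.IsExact (-chartForm (𝓡∂ 2) x₀ τ) := by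
    obtain ⟨η, h1, h2⟩ := hme
    refine ⟨-η, Form.isSmooth_iff_smoothAt.2 fun x => (h1.smoothAt x).neg, funext fun x => ?_⟩
    rw [Form.d_neg, h2]; rfl
  have hPQe : Form.IsExact (β + chartForm (𝓡∂ 2) x₀ τ) := by
    refine isExact_of_inChart (x₀ := x₀) (σ := planeForm P Q) (K := box a₀ a₁ b₀ b₁)
      (contDiffOn_planeForm hP.contDiffOn hQ.contDiffOn) (isCompact_box _ _ _ _)
      (hbox.trans interior_subset) ?_ ?_ ?_
    · intro y _ hy
      have h1 : P y = 0 := by_contra fun h0 => hy (hPs y h0)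
      have h2 : Q y = 0 := by_contra fun h0 => hy (hQs y h0)
      simp [planeForm, h1, h2]
    · intro x hx
      have h1 : β x = 0 := hβ x fun hxK => hx (hKU hxK).1
      have h2 : chartForm (𝓡∂ 2) x₀ τ x = 0 := if_neg hx
      rw [Pi.add_apply, h1, h2, add_zero]
    · intro y hy
      have hr := htr hy
      have hu := (𝓡∂ 2).uniqueDiffOn y hr
      rw [extDerivWithin_planeForm hP.contDiffOn hQ.contDiffOn (𝓡∂ 2).uniqueDiffOn hr,
        inChart_add, Pi.add_apply, inChart_chartForm hy, ← coeff_smul_planeArea hy,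
        ((hQ.differentiable (by simp)) y).fderivWithin hu,
        ((hP.differentiable (by simp)) y).fderivWithin hu, hPQ, hτ, ← add_smul]
      congr 1
      ring
  have := hPQe.add hne
  rwa [add_neg_cancel_right] at this

variable [CompactSpace S]

/-- A two-form on a compact surface, each component of which has non-empty boundary, is exact. -/
theorem isExact_of_boundary (hS : ∀ x : S, (connectedComponent x ∩ (𝓡∂ 2).boundary S).Nonempty)
    {β : Form (𝓡∂ 2) S 2} (hβ : Form.IsSmooth β) : Form.IsExact β := by
  set G : Set S := {x | ∃ U : Set S, IsOpen U ∧ x ∈ U ∧ ExactOn U} with hG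
  have hGo : IsOpen G := by
    rw [isOpen_iff_mem_nhds]
    rintro x ⟨U, hU, hx, h⟩
    exact mem_of_superset (hU.mem_nhds hx) fun y hy => ⟨U, hU, hy, h⟩
  have hGc : IsClosed G := by
    refine isClosed_of_closure_subset fun x hx => ?_
    by_cases hxb : x ∈ (𝓡∂ 2).boundary S
    · exact exists_exactOn_boundary hxb
    · obtain ⟨W, hW, hxW, h⟩ := exists_exactOn_interior hxb
      obtain ⟨y, hyW, U, hU, hyU, hEU⟩ := mem_closure_iff.1 hx W hW hxW
      exact ⟨W, hW, hxW, h U hU ⟨y, hyW, hyU⟩ hEU⟩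
  have hall : ∀ x, x ∈ G := by
    intro x
    obtain ⟨b, hb, hbb⟩ := hS x
    have h1 := IsClopen.connectedComponent_subset ⟨hGc, hGo⟩
      (show b ∈ G from exists_exactOn_boundary hbb)
    rw [← connectedComponent_eq hb] at h1
    exact h1 mem_connectedComponent
  choose U hU hxU hEU using hall
  obtain ⟨t, ht⟩ := isCompact_univ.elim_finite_subcover U hU fun x _ => mem_iUnion.2 ⟨x, hxU x⟩
  obtain ⟨ρ, hρ⟩ := SmoothPartitionOfUnity.exists_isSubordinate (𝓡∂ 2) (s := (univ : Set S))
    isClosed_univ (fun i : t => U i) (fun i => hU i) (fun x hx => by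
      obtain ⟨i, hi, hxi⟩ := mem_iUnion₂.1 (ht hx)
      exact mem_iUnion.2 ⟨⟨i, hi⟩, hxi⟩)
  have hsum : β = ∑ i : t, (fun x => ρ i x • β x : Form (𝓡∂ 2) S 2) := by
    funext x
    rw [Finset.sum_apply, ← Finset.sum_smul]
    have h1 := ρ.sum_eq_one (mem_univ x)
    rw [finsum_eq_sum_of_fintype] at h1
    rw [h1, one_smul]
  rw [hsum]
  refine Form.IsExact.sum _ fun i _ => hEU i _ (Form.IsSmooth.smul (ρ i).contMDiff hβ)
    ⟨tsupport (ρ i), isClosed_tsupport _, hρ i, fun x hx => ?_⟩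
  rw [image_eq_zero_of_notMem_tsupport hx, zero_smul]

end Exactness

section Torus

/-- The model of `ℝ × S`. -/
abbrev CylModel : ModelWithCorners ℝ (ℝ × Plane) (ModelProd ℝ (EuclideanHalfSpace 2)) :=
  𝓘(ℝ, ℝ).prod (𝓡∂ 2)

variable {S : Type*} [TopologicalSpace S] [ChartedSpace (EuclideanHalfSpace 2) S]
  [IsManifold (𝓡∂ 2) ∞ S]

theorem contMDiff_slice (t : ℝ) :
    ContMDiff (𝓡∂ 2) CylModel ∞ (fun x : S => ((t, x) : ℝ × S)) :=
  contMDiff_const.prodMk contMDiff_id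

/-- A smooth function on `ℝ × S`, at a fixed time. -/
theorem contMDiff_at_time {F : ℝ × S → ℝ} (hF : ContMDiff CylModel 𝓘(ℝ, ℝ) ∞ F) (t : ℝ) :
    ContMDiff (𝓡∂ 2) 𝓘(ℝ, ℝ) ∞ (fun x => F (t, x)) := hF.comp (contMDiff_slice t)

theorem pullback_slice_app1 (μ : Form CylModel (ℝ × S) 1) (t : ℝ) (x : S) (v : Plane) :
    (pullback (I := 𝓡∂ 2) (fun x : S => ((t, x) : ℝ × S)) μ).app1 x v = μ.app1 (t, x) (0, v) := by
  rw [app1_pullback, tmap_inr]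

variable (φ : S ≃ₘ⟮𝓡∂ 2, 𝓡∂ 2⟯ S) [CompactSpace S] [T2Space S]

/-- If `Ω_φ` is exact, then `φ^* λ - λ` is exact for some primitive `λ` of `Ω`. -/
theorem exists_primitive_of_isExact_inducedForm {Ω : AreaForm S} (hφ : PreservesArea Ω φ)
    (h : Form.IsExact (inducedForm φ Ω)) :
    ∃ (lam : Form (𝓡∂ 2) S 1) (F : S → ℝ), Form.IsSmooth lam ∧ Form.d lam = Ω.form ∧
      ContMDiff (𝓡∂ 2) 𝓘(ℝ, ℝ) ∞ F ∧ pullback φ lam - lam = differential (I := 𝓡∂ 2) F := by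
  obtain ⟨η, hη, hdη⟩ := h
  let μ : Form CylModel (ℝ × S) 1 := pullback (I := CylModel) (proj φ) η
  have hμ : Form.IsSmooth μ := by
    have h1 : Form.IsSmooth (pullback (I := CylModel) (proj φ) η) := hη.pullback (contMDiff_proj φ)
    exact h1
  have hdμ : Form.d μ = pullback (I := CylModel) (Prod.snd : ℝ × S → S) Ω.form := by
    have h1 : Form.d (M := Cover φ) (pullback (I := CylModel) (proj φ) η) = coverForm φ Ω := by
      rw [← pullback_proj_inducedForm φ hφ, ← hdη]
      exact funext fun z => Form.d_pullback (hη.smoothAt _) (contMDiff_proj φ z)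
    exact h1
  have hcl : ∀ r m v, (Form.d μ).app2 (r, m) (1, 0) (0, v) = 0 := by
    intro r m v
    rw [hdμ, app2_pullback]
    have : tmap CylModel (𝓡∂ 2) (Prod.snd : ℝ × S → S) (r, m) ((1, 0) : ℝ × Plane) = 0 :=
      tmap_snd _ _
    rw [this, Form.app2_zero_left]
  have ha : ContMDiff CylModel 𝓘(ℝ, ℝ) ∞ (timeIntegral (timeComponent μ)) :=
    contMDiff_timeIntegral fun p => contMDiffAt_timeComponent (hμ.smoothAt p)
  refine ⟨pullback (I := 𝓡∂ 2) (fun x : S => ((0, x) : ℝ × S)) μ,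
    fun x => timeIntegral (timeComponent μ) (1, x), hμ.pullback (contMDiff_slice 0), ?_,
    contMDiff_at_time ha 1, ?_⟩
  · funext x
    rw [Form.d_pullback (hμ.smoothAt _) (contMDiff_slice 0 x), hdμ]
    refine Form.ext2 fun v w => ?_
    rw [app2_pullback, app2_pullback, tmap_inr, tmap_inr]
    have h1 : ∀ u : Plane, tmap CylModel (𝓡∂ 2) (Prod.snd : ℝ × S → S) (0, x)
      ((0, u) : ℝ × Plane) = u := fun u => tmap_snd _ _
    rw [h1, h1]
  · funext x
    refine Form.ext1 fun v => ?_
    have h1 : (pullback (I := 𝓡∂ 2) φ (pullback (I := 𝓡∂ 2)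
        (fun x : S => ((0, x) : ℝ × S)) μ)).app1 x v = μ.app1 (1, x) (0, v) := by
      have hd : ∀ t : ℝ, ∀ x : S, MDifferentiableAt (𝓡∂ 2) CylModel
          (fun x : S => (show Cover φ from ((t, x) : ℝ × S))) x := fun t x =>
        (contMDiff_slice (S := S) t).mdifferentiable (by simp) x
      have hp : MDifferentiable CylModel CylModel (proj φ) :=
        (contMDiff_proj φ).mdifferentiable (by simp)
      have e1 := pullback_comp (f := fun x : S => (show Cover φ from ((1, x) : ℝ × S))) (g := proj φ)
        (x := x) η (hp _) (hd 1 x)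
      have e2 := pullback_comp (f := fun x : S => (show Cover φ from ((0, x) : ℝ × S))) (g := proj φ)
        (x := φ x) η (hp _) (hd 0 _)
      have e3 := pullback_comp (f := φ)
        (g := proj φ ∘ fun x : S => (show Cover φ from ((0, x) : ℝ × S))) (x := x) η
        ((hp _).comp _ (hd 0 _)) (φ.contMDiff.mdifferentiable (by simp) x)
      have e4 : (proj φ ∘ fun x : S => (show Cover φ from ((1, x) : ℝ × S))) =
          (proj φ ∘ fun x : S => (show Cover φ from ((0, x) : ℝ × S))) ∘ φ :=
        funext fun p => proj_one φ p
      rw [← pullback_slice_app1]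
      have e5 : pullback (I := 𝓡∂ 2) φ (pullback (I := 𝓡∂ 2) (fun x : S => ((0, x) : ℝ × S)) μ) x =
          pullback (I := 𝓡∂ 2) (fun x : S => ((1, x) : ℝ × S)) μ x := by
        refine Eq.trans ?_ e1
        rw [e4, e3]
        exact congrArg (fun A : Plane [⋀^Fin 1]→L[ℝ] ℝ => A.compContinuousLinearMap
          (show Plane →L[ℝ] Plane from mfderiv (𝓡∂ 2) (𝓡∂ 2) φ x)) e2.symm
      exact congrArg (fun A : Plane [⋀^Fin 1]→L[ℝ] ℝ => A ![v]) e5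
    have h2 := homotopy_formula hμ 1 x v (g := fun _ => 0) continuous_const fun r => hcl r x v
    have h3 := app1_differential_slice (t := (1 : ℝ)) (m := x)
      (ha.mdifferentiable (by simp) (1, x)) v
    rw [← h3, h2, ← h1, ← pullback_slice_app1]
    simp only [intervalIntegral.integral_zero, sub_zero]
    rfl

/-- An invariant form on `ℝ × S` descends to the mapping torus. -/
def descend (μ : Form CylModel (Cover φ) 1) : Form CylModel (MappingTorus φ) 1 :=
  fun m => pullback (localSection φ (rep φ m)) μ m

theorem mem_localSection_rep (m : MappingTorus φ) : m ∈ (localSection φ (rep φ m)).source := by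
  have := (isLocalHomeomorph_proj φ).apply_self_mem_localInverseAt_source (x := rep φ m)
  rwa [proj_rep] at this

theorem contMDiffAt_localSection {w : Cover φ} {m : MappingTorus φ}
    (hm : m ∈ (localSection φ w).source) :
    ContMDiffAt CylModel CylModel ∞ (localSection φ w) m :=
  (contMDiffOn_localSection φ w).contMDiffAt ((localSection φ w).open_source.mem_nhds hm)

theorem descend_eq_pullback {μ : Form CylModel (Cover φ) 1}
    (hinv : ∀ n : ℤ, pullback (I := CylModel) (fun z : Cover φ => n +ᵥ z) μ = μ) {w : Cover φ}
    {m : MappingTorus φ} (hm : m ∈ (localSection φ w).source) :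
    descend φ μ m = pullback (localSection φ w) μ m := by
  set s := localSection φ (rep φ m) with hs
  have hms := mem_localSection_rep φ m
  have hps : ∀ m' ∈ s.source, proj φ (s m') = m' := fun m' h =>
    (isLocalHomeomorph_proj φ).apply_localInverseAt_of_mem h
  obtain ⟨n, hn⟩ := localSection_proj φ (w := w) (x := s m) (by rwa [hps m hms])
  have he : (localSection φ w : MappingTorus φ → Cover φ) =ᶠ[𝓝 m]
      (fun z : Cover φ => n +ᵥ z) ∘ s := by
    filter_upwards [(s.continuousAt hms).eventually hn, s.open_source.mem_nhds hms] with m' h1 h2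
    rw [hps m' h2] at h1
    exact h1
  have h1 := pullback_comp (f := s) (g := fun z : Cover φ => n +ᵥ z) (x := m) μ
    ((contMDiff_vadd φ n).mdifferentiable (by simp) _)
    ((contMDiffAt_localSection φ hms).mdifferentiableAt (by simp))
  rw [hinv n] at h1
  refine h1.symm.trans ?_
  have hv := he.self_of_nhds
  unfold pullback
  rw [he.mfderiv_eq]
  exact congrArg (fun y : Cover φ => (show (ℝ × Plane) [⋀^Fin 1]→L[ℝ] ℝ from
      μ y).compContinuousLinearMap (show (ℝ × Plane) →L[ℝ] (ℝ × Plane) from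
        mfderiv CylModel CylModel ((fun z : Cover φ => n +ᵥ z) ∘ s) m)) hv.symm

theorem isExact_inducedForm_of_invariant {Ω : AreaForm S} {μ : Form CylModel (Cover φ) 1}
    (hμ : Form.IsSmooth μ) (hdμ : Form.d μ = coverForm φ Ω)
    (hinv : ∀ n : ℤ, pullback (I := CylModel) (fun z : Cover φ => n +ᵥ z) μ = μ) :
    Form.IsExact (inducedForm φ Ω) := by
  have he : ∀ m : MappingTorus φ, ∀ᶠ m' in 𝓝 m,
      pullback (localSection φ (rep φ m)) μ m' = descend φ μ m' := fun m => by
    filter_upwards [(localSection φ (rep φ m)).open_source.mem_nhds (mem_localSection_rep φ m)]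
      with m' hm' using (descend_eq_pullback φ hinv hm').symm
  refine ⟨descend φ μ, Form.isSmooth_iff_smoothAt.2 fun m => ?_, funext fun m => ?_⟩
  · exact ((hμ.smoothAt _).pullback
      (contMDiffAt_localSection φ (mem_localSection_rep φ m))).congr (he m)
  · rw [← Form.d_congr (he m), Form.d_pullback (hμ.smoothAt _)
      (contMDiffAt_localSection φ (mem_localSection_rep φ m)), hdμ]
    rfl

theorem invariant_of_one {μ : Form CylModel (Cover φ) 1}
    (h : pullback (I := CylModel) (fun z : Cover φ => (1 : ℤ) +ᵥ z) μ = μ) (n : ℤ) :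
    pullback (I := CylModel) (fun z : Cover φ => n +ᵥ z) μ = μ := by
  have hd : ∀ n : ℤ, MDifferentiable CylModel CylModel (fun z : Cover φ => n +ᵥ z) := fun n =>
    (contMDiff_vadd φ n).mdifferentiable (by simp)
  have hc : ∀ a b : ℤ, ∀ z, pullback (I := CylModel) (fun z : Cover φ => (a + b) +ᵥ z) μ z =
      pullback (I := CylModel) (J := CylModel) (fun z : Cover φ => b +ᵥ z)
        (pullback (I := CylModel) (fun z : Cover φ => a +ᵥ z) μ) z := by
    intro a b z
    rw [← pullback_comp (f := fun z : Cover φ => b +ᵥ z) (g := fun z : Cover φ => a +ᵥ z) μ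
      (hd a _) (hd b _)]
    congr 1
    funext z
    exact add_vadd a b z
  have h0 : pullback (I := CylModel) (fun z : Cover φ => (0 : ℤ) +ᵥ z) μ = μ := by
    have : (fun z : Cover φ => (0 : ℤ) +ᵥ z) = fun z => z := funext fun z => zero_vadd ℤ z
    rw [this]
    funext z
    refine Form.ext1 fun v => ?_
    rw [app1_pullback, tmap_id]
  have hneg : pullback (I := CylModel) (fun z : Cover φ => (-1 : ℤ) +ᵥ z) μ = μ := by
    funext z
    have h1 := hc 1 (-1) z
    rw [h] at h1
    rw [← h1]
    exact congrFun h0 z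
  induction n with
  | zero => exact h0
  | succ n ih => funext z; rw [hc, ih, h]
  | pred n ih => funext z; rw [sub_eq_add_neg, hc, ih, hneg]

/-- The coefficients of the function `cocyclePotential`. -/
def cocycleCoeff (k : ℤ) (t : ℝ) : ℝ :=
  Real.smoothTransition (t - k) - if k < 0 then 1 else 0

theorem support_cocycleCoeff (t : ℝ) {k : ℤ} (h : cocycleCoeff k t ≠ 0) :
    k ∈ Icc (-⌈|t| + 1⌉) ⌈|t| + 1⌉ := by
  have hc := Int.le_ceil (|t| + 1)
  have ht := neg_abs_le t
  have ht' := le_abs_self t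
  by_contra hk
  rw [mem_Icc, not_and_or, not_le, not_le] at hk
  apply h
  rcases hk with hk | hk
  · have h1 : (k : ℝ) < -⌈|t| + 1⌉ := by exact_mod_cast hk
    have h2 : k < 0 := by
      have : (k : ℝ) < 0 := by linarith [abs_nonneg t]
      exact_mod_cast this
    rw [cocycleCoeff, if_pos h2, Real.smoothTransition.one_of_one_le (by linarith), sub_self]
  · have h1 : (⌈|t| + 1⌉ : ℝ) < k := by exact_mod_cast hk
    have h2 : ¬ k < 0 := by
      have : (0 : ℝ) < k := by linarith [abs_nonneg t]
      have : 0 < k := by exact_mod_cast this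
      omega
    rw [cocycleCoeff, if_neg h2, Real.smoothTransition.zero_of_nonpos (by linarith), sub_self]

/-- A function `G` on `ℝ × S` with `G(t, p) - G(t - 1, φ p) = F(p)`. -/
def cocyclePotential (F : S → ℝ) (z : ℝ × S) : ℝ :=
  ∑ᶠ k : ℤ, cocycleCoeff k z.1 * F ((φ.toEquiv ^ k) z.2)

theorem contMDiff_cocyclePotential {F : S → ℝ} (hF : ContMDiff (𝓡∂ 2) 𝓘(ℝ, ℝ) ∞ F) :
    ContMDiff CylModel 𝓘(ℝ, ℝ) ∞ (cocyclePotential φ F) := by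
  refine contMDiff_finsum (fun k => ?_) ?_
  · have h1 : ContDiff ℝ ∞ (cocycleCoeff k) :=
      (Real.smoothTransition.contDiff.comp (contDiff_id.sub contDiff_const)).sub contDiff_const
    have h2 : ContMDiff CylModel 𝓘(ℝ, ℝ) ∞ fun z : ℝ × S => cocycleCoeff k z.1 :=
      h1.contMDiff.comp contMDiff_fst
    exact h2.mul (hF.comp ((contMDiff_zpow φ k).comp contMDiff_snd))
  · intro z
    refine ⟨(fun z : ℝ × S => z.1) ⁻¹' Ioo (z.1 - 1) (z.1 + 1),
      continuous_fst.continuousAt.preimage_mem_nhds (Ioo_mem_nhds (by linarith) (by linarith)),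
      (Set.finite_Icc (-⌈|z.1| + 1 + 1⌉) ⌈|z.1| + 1 + 1⌉).subset ?_⟩
    rintro k ⟨w, hw, hwz⟩
    have h1 := support_cocycleCoeff w.1 (left_ne_zero_of_mul hw)
    have h2 : |w.1| ≤ |z.1| + 1 := by
      have h3 : |w.1 - z.1| ≤ 1 := by
        rw [abs_le]; constructor <;> linarith [hwz.1, hwz.2]
      have := abs_add_le (w.1 - z.1) z.1
      rw [sub_add_cancel] at this
      linarith
    have h4 : ⌈|w.1| + 1⌉ ≤ ⌈|z.1| + 1 + 1⌉ := Int.ceil_le_ceil (by linarith)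
    exact ⟨by have := h1.1; omega, by have := h1.2; omega⟩

theorem cocyclePotential_vadd (F : S → ℝ) (t : ℝ) (p : S) :
    cocyclePotential φ F (t, p) = cocyclePotential φ F (t - 1, φ p) + F p := by
  have hfin : ∀ (s : ℝ) (q : S), (Function.support fun k : ℤ =>
      cocycleCoeff k s * F ((φ.toEquiv ^ k) q)).Finite := fun s q =>
    (Set.finite_Icc _ _).subset fun k hk => support_cocycleCoeff s (left_ne_zero_of_mul hk)
  have h1 : cocyclePotential φ F (t - 1, φ p) =
      ∑ᶠ k : ℤ, cocycleCoeff (k - 1) (t - 1) * F ((φ.toEquiv ^ k) p) := by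
    rw [cocyclePotential, ← finsum_comp_equiv (Equiv.subRight (1 : ℤ))]
    refine finsum_congr fun k => ?_
    congr 2
    change (φ.toEquiv ^ (k - 1) * φ.toEquiv) p = _
    rw [← zpow_add_one, sub_add_cancel]
  have hfin' : (Function.support fun k : ℤ =>
      cocycleCoeff (k - 1) (t - 1) * F ((φ.toEquiv ^ k) p)).Finite := by
    refine ((Set.finite_Icc (-⌈|t - 1| + 1⌉) ⌈|t - 1| + 1⌉).image fun k => k + 1).subset
      fun k hk => ⟨k - 1, support_cocycleCoeff _ (left_ne_zero_of_mul hk), by ring⟩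
  rw [h1, ← sub_eq_iff_eq_add', cocyclePotential, ← finsum_sub_distrib (hfin t p) hfin',
    finsum_eq_single _ 0]
  · simp [cocycleCoeff]
    ring
  · intro k hk
    rw [← sub_mul]
    have : cocycleCoeff k t - cocycleCoeff (k - 1) (t - 1) = 0 := by
      have h2 : t - 1 - ((k - 1 : ℤ) : ℝ) = t - k := by push_cast; ring
      have h3 : (k - 1 < 0) ↔ (k < 0) := by omega
      simp only [cocycleCoeff, h2, h3]
      ring
    rw [this, zero_mul]

/-- The projection `ℝ × S → S`. -/
def coverSnd (z : Cover φ) : S := z.2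

theorem contMDiff_coverSnd : ContMDiff CylModel (𝓡∂ 2) ∞ (coverSnd φ) := contMDiff_snd_cover φ

/-- If `φ^* λ - λ` is exact for some primitive `λ` of `Ω`, then `Ω_φ` is exact. -/
theorem isExact_inducedForm_of_primitive {Ω : AreaForm S} {lam : Form (𝓡∂ 2) S 1} {F : S → ℝ}
    (hlam : Form.IsSmooth lam) (hd : Form.d lam = Ω.form) (hF : ContMDiff (𝓡∂ 2) 𝓘(ℝ, ℝ) ∞ F)
    (h : pullback φ lam - lam = differential (I := 𝓡∂ 2) F) :
    Form.IsExact (inducedForm φ Ω) := by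
  let G : Cover φ → ℝ := cocyclePotential φ F
  have hGs' : ContMDiff CylModel 𝓘(ℝ, ℝ) ∞ G := contMDiff_cocyclePotential φ hF
  set μ : Form CylModel (Cover φ) 1 := pullback (coverSnd φ) lam +
    differential (I := CylModel) G with hμ
  have hp := hlam.pullback (contMDiff_coverSnd φ)
  refine isExact_inducedForm_of_invariant φ (μ := μ) (hp.add (isSmooth_differential hGs')) ?_
    (invariant_of_one φ ?_)
  · funext z
    rw [hμ, Form.d_add (hp.smoothAt z) (smoothAt_differential (hGs' z)),
      Form.d_differential (hGs' z), add_zero,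
      Form.d_pullback (hlam.smoothAt _) (contMDiff_coverSnd φ z), hd]
    rfl
  · funext z
    refine Form.ext1 fun v => ?_
    have hT := (contMDiff_vadd φ 1).mdifferentiable (by simp) z
    have hq := (contMDiff_coverSnd φ).mdifferentiable (by simp)
    have hφd := φ.contMDiff.mdifferentiable (by simp)
    have hGd := hGs'.mdifferentiable (by simp)
    have hFd := hF.mdifferentiable (by simp)
    have e1 : coverSnd φ ∘ (fun z : Cover φ => (1 : ℤ) +ᵥ z) = φ ∘ coverSnd φ :=
      funext fun z => by
        change (φ.toEquiv ^ (1 : ℤ)) z.2 = φ z.2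
        rw [zpow_one]; rfl
    have e2 : (fun z : Cover φ => G ((1 : ℤ) +ᵥ z)) = fun z : Cover φ => G z - F (coverSnd φ z) :=
      funext fun z => by
        have h1 := cocyclePotential_vadd φ F z.1 z.2
        have h2 : ((1 : ℤ) +ᵥ z : Cover φ) = ((z.1 - 1, φ z.2) : ℝ × S) := by
          rw [vadd_def, zpow_one, Int.cast_one]; rfl
        rw [h2]
        exact eq_sub_of_add_eq h1.symm
    have h1 : (pullback (I := CylModel) (J := CylModel) (fun z : Cover φ => (1 : ℤ) +ᵥ z)
        (pullback (coverSnd φ) lam)).app1 z v = (pullback (I := CylModel) (coverSnd φ)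
          (pullback (I := 𝓡∂ 2) φ lam)).app1 z v := by
      have h3 := pullback_comp (f := fun z : Cover φ => (1 : ℤ) +ᵥ z) (g := coverSnd φ) (x := z) lam
        (hq _) hT
      have h4 := pullback_comp (f := coverSnd φ) (g := φ) (x := z) lam (hφd _) (hq _)
      rw [e1, h4] at h3
      exact congrArg (fun A : (ℝ × Plane) [⋀^Fin 1]→L[ℝ] ℝ => A ![v]) h3.symm
    have h2 : (pullback (I := CylModel) (J := CylModel) (fun z : Cover φ => (1 : ℤ) +ᵥ z)
        (differential (I := CylModel) G)).app1 z v =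
        (differential (I := CylModel) G).app1 z v -
          (pullback (I := CylModel) (coverSnd φ) (differential (I := 𝓡∂ 2) F)).app1 z v := by
      rw [app1_pullback, app1_pullback, app1_differential, app1_differential, app1_differential,
        ← tmap_comp (hGd _) hT, ← tmap_comp (hFd _) (hq _), e2]
      have h5 := mfderiv_sub (hGd z) ((hFd (coverSnd φ z)).comp z (hq z))
      exact congrArg (fun A : (ℝ × Plane) →L[ℝ] ℝ => A v) h5
    have h6 : pullback φ lam = lam + differential (I := 𝓡∂ 2) F := by rw [← h]; abel
    have h7 : (pullback (I := CylModel) (coverSnd φ) (pullback (I := 𝓡∂ 2) φ lam)).app1 z v =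
        (pullback (I := CylModel) (coverSnd φ) lam).app1 z v +
        (pullback (I := CylModel) (coverSnd φ) (differential (I := 𝓡∂ 2) F)).app1 z v := by
      rw [h6]; rfl
    calc _ = (pullback (I := CylModel) (J := CylModel) (fun z : Cover φ => (1 : ℤ) +ᵥ z)
          (pullback (coverSnd φ) lam)).app1 z v +
        (pullback (I := CylModel) (J := CylModel) (fun z : Cover φ => (1 : ℤ) +ᵥ z)
          (differential (I := CylModel) G)).app1 z v := rfl
      _ = (pullback (I := CylModel) (coverSnd φ) lam).app1 z v +
          (differential (I := CylModel) G).app1 z v := by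
        rw [h1, h2, h7]; ring
      _ = _ := rfl

end Torus

section FamiliesOfMaps

variable {E : Type} [NormedAddCommGroup E] [NormedSpace ℝ E] [FiniteDimensional ℝ E]
  {H : Type*} [TopologicalSpace H] {I : ModelWithCorners ℝ E H}
  {M : Type*} [TopologicalSpace M] [ChartedSpace H M] [IsManifold I ∞ M]
  {E' : Type*} [NormedAddCommGroup E'] [NormedSpace ℝ E'] [FiniteDimensional ℝ E']
  {H' : Type*} [TopologicalSpace H']
  {J : ModelWithCorners ℝ E' H'} {N : Type*} [TopologicalSpace N] [ChartedSpace H' N]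
  [IsManifold J ∞ N]

theorem tmap_slice {Ψ : ℝ × M → N} {t : ℝ} {x : M}
    (hΨ : MDifferentiableAt (𝓘(ℝ, ℝ).prod I) J Ψ (t, x)) (v : E) :
    tmap (𝓘(ℝ, ℝ).prod I) J Ψ (t, x) (0, v) = tmap I J (fun z => Ψ (t, z)) x v := by
  rw [tmap_comp (f := fun z : M => (t, z)) (g := Ψ) hΨ
    (mdifferentiableAt_const.prodMk mdifferentiableAt_id), tmap_inr]

theorem tmap_time {Ψ : ℝ × M → N} {t : ℝ} {x : M}
    (hΨ : MDifferentiableAt (𝓘(ℝ, ℝ).prod I) J Ψ (t, x)) (c : ℝ) :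
    tmap (𝓘(ℝ, ℝ).prod I) J Ψ (t, x) (c, 0) = tmap 𝓘(ℝ, ℝ) J (fun s => Ψ (s, x)) t c := by
  rw [tmap_comp (f := fun s : ℝ => (s, x)) (g := Ψ) hΨ
    (mdifferentiableAt_id.prodMk mdifferentiableAt_const), tmap_inl]

theorem tmap_sub {f g : M → ℝ} {x : M} (hf : MDifferentiableAt I 𝓘(ℝ, ℝ) f x)
    (hg : MDifferentiableAt I 𝓘(ℝ, ℝ) g x) (v : E) :
    tmap I 𝓘(ℝ, ℝ) (fun z => f z - g z) x v =
      tmap I 𝓘(ℝ, ℝ) f x v - tmap I 𝓘(ℝ, ℝ) g x v :=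
  congrArg (fun A : E →L[ℝ] ℝ => A v) (mfderiv_sub hf hg)

theorem tmap_add {f g : M → ℝ} {x : M} (hf : MDifferentiableAt I 𝓘(ℝ, ℝ) f x)
    (hg : MDifferentiableAt I 𝓘(ℝ, ℝ) g x) (v : E) :
    tmap I 𝓘(ℝ, ℝ) (fun z => f z + g z) x v =
      tmap I 𝓘(ℝ, ℝ) f x v + tmap I 𝓘(ℝ, ℝ) g x v :=
  congrArg (fun A : E →L[ℝ] ℝ => A v) (mfderiv_add hf hg)

/-- The form `Ψ^* λ` on `ℝ × M` for a family of maps `Ψ`. -/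
theorem app1_pullback_slice {Ψ : ℝ × M → N} (hΨ : ContMDiff (𝓘(ℝ, ℝ).prod I) J ∞ Ψ)
    (lam : Form J N 1) (t : ℝ) (x : M) (v : E) :
    (pullback (I := 𝓘(ℝ, ℝ).prod I) Ψ lam).app1 (t, x) (0, v) =
      (pullback (I := I) (fun z => Ψ (t, z)) lam).app1 x v := by
  rw [app1_pullback, app1_pullback, tmap_slice (hΨ.mdifferentiable (by simp) _)]

theorem app2_d_pullback_time {Ψ : ℝ × M → N} (hΨ : ContMDiff (𝓘(ℝ, ℝ).prod I) J ∞ Ψ)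
    {lam : Form J N 1} (hlam : Form.IsSmooth lam) (t : ℝ) (x : M) (v : E) :
    (Form.d (pullback (I := 𝓘(ℝ, ℝ).prod I) Ψ lam)).app2 (t, x) (1, 0) (0, v) =
      (Form.d lam).app2 (Ψ (t, x)) (tmap 𝓘(ℝ, ℝ) J (fun s => Ψ (s, x)) t 1)
        (tmap I J (fun z => Ψ (t, z)) x v) := by
  have h1 : Form.d (pullback (I := 𝓘(ℝ, ℝ).prod I) Ψ lam) = pullback (I := 𝓘(ℝ, ℝ).prod I) Ψ (Form.d lam) :=
    funext fun z => Form.d_pullback (hlam.smoothAt _) (hΨ z)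
  have hd := hΨ.mdifferentiable (by simp) (t, x)
  rw [h1, app2_pullback, tmap_slice hd, tmap_time hd]

end FamiliesOfMaps

section Flow

variable {S : Type*} [TopologicalSpace S] [ChartedSpace (EuclideanHalfSpace 2) S]
  [IsManifold (𝓡∂ 2) ∞ S]

theorem IsSmoothFamily.contMDiff {ψ : ℝ → S ≃ₘ⟮𝓡∂ 2, 𝓡∂ 2⟯ S} (h : IsSmoothFamily univ ψ) :
    ContMDiff CylModel (𝓡∂ 2) ∞ (fun z : ℝ × S => ψ z.1 z.2) := by
  have := h.1
  rwa [univ_prod_univ, contMDiffOn_univ] at this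

variable [CompactSpace S] [T2Space S]

/-- The time-one map of a Hamiltonian flow changes a primitive of `Ω` by an exact form. -/
theorem IsHamiltonianFlow.exists_primitive {Ω : AreaForm S} {H : ℝ × S → ℝ}
    {ψ : ℝ → S ≃ₘ⟮𝓡∂ 2, 𝓡∂ 2⟯ S} (hψ : IsHamiltonianFlow Ω H ψ)
    (hH : ContMDiff CylModel 𝓘(ℝ, ℝ) ∞ H) {lam : Form (𝓡∂ 2) S 1} (hlam : Form.IsSmooth lam)
    (hd : Form.d lam = Ω.form) :
    ∃ F : S → ℝ, ContMDiff (𝓡∂ 2) 𝓘(ℝ, ℝ) ∞ F ∧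
      pullback (ψ 1) lam - lam = differential (I := 𝓡∂ 2) F := by
  set Ψ : ℝ × S → S := fun z => ψ z.1 z.2 with hΨdef
  have hΨ : ContMDiff CylModel (𝓡∂ 2) ∞ Ψ := hψ.smooth.contMDiff
  set ν := pullback (I := CylModel) Ψ lam with hν
  have hνs : Form.IsSmooth ν := hlam.pullback hΨ
  set K : ℝ × S → ℝ := fun z => H (z.1, Ψ z) with hK
  have hKs : ContMDiff CylModel 𝓘(ℝ, ℝ) ∞ K := hH.comp (contMDiff_fst.prodMk hΨ)
  have hAs : ContMDiff CylModel 𝓘(ℝ, ℝ) ∞ (timeIntegral (timeComponent ν)) :=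
    contMDiff_timeIntegral fun p => contMDiffAt_timeComponent (hνs.smoothAt p)
  have hBs := contMDiff_timeIntegral hKs
  have hg : ∀ m v r, (Form.d ν).app2 (r, m) (1, 0) (0, v) =
      -(differential (I := CylModel) K).app1 (r, m) (0, v) := by
    intro m v r
    rw [app2_d_pullback_time hΨ hlam, hd]
    obtain ⟨X, hX, hXd⟩ := hψ.deriv r m
    have h1 : tmap 𝓘(ℝ, ℝ) (𝓡∂ 2) (fun s => Ψ (s, m)) r 1 = X := by
      have h2 := congrArg (fun A : ℝ →L[ℝ] Plane => A 1) hXd.mfderiv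
      refine h2.trans ?_
      exact one_smul ℝ (show Plane from X)
    rw [Form.app2_swap]
    congr 1
    rw [h1]
    have h3 := hX (tmap (𝓡∂ 2) (𝓡∂ 2) (fun z => Ψ (r, z)) m v)
    refine Eq.trans h3 ?_
    rw [app1_differential, tmap_slice (hKs.mdifferentiable (by simp) _)]
    exact (tmap_comp (f := fun z => Ψ (r, z)) (g := fun y => H (r, y)) (x := m)
      ((contMDiff_at_time hH r).mdifferentiable (by simp) _)
      ((hΨ.comp (contMDiff_slice r)).mdifferentiable (by simp) m) v).symm
  refine ⟨fun x => timeIntegral (timeComponent ν) (1, x) - timeIntegral K (1, x),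
    (contMDiff_at_time hAs 1).sub (contMDiff_at_time hBs 1), funext fun x => Form.ext1 fun v => ?_⟩
  have h1 := homotopy_formula hνs 1 x v
    (g := fun r => -(differential (I := CylModel) K).app1 (r, x) (0, v))
    (continuous_app1_time (isSmooth_differential hKs) x (0, v)).neg fun r => hg x v r
  rw [app1_differential_slice (hAs.mdifferentiable (by simp) _)] at h1
  have h2 := app1_differential_timeIntegral hKs 1 x v
  rw [app1_differential_slice (hBs.mdifferentiable (by simp) _)] at h2
  rw [app1_differential, tmap_sub ((contMDiff_at_time hAs 1).mdifferentiable (by simp) x)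
    ((contMDiff_at_time hBs 1).mdifferentiable (by simp) x)]
  rw [app1_differential] at h1 h2
  rw [h1, h2]
  simp only [intervalIntegral.integral_neg]
  have h3 : ν.app1 (0, x) (0, v) = lam.app1 x v := by
    rw [hν, app1_pullback_slice hΨ]
    have : (fun z => Ψ (0, z)) = fun z => z := by
      funext z
      simp only [hΨdef, hψ.zero]
      rfl
    rw [this, app1_pullback, tmap_id]
  rw [h3, hν, app1_pullback_slice hΨ]
  have h4 : (pullback (ψ 1) lam - lam).app1 x v = (pullback (ψ 1) lam).app1 x v - lam.app1 x v := rfl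
  rw [h4]
  ring

end Flow

section Nemytskii

universe u
variable {X : Type*} [TopologicalSpace X] [CompactSpace X]

/-- Pointwise evaluation of a continuous family of linear maps on a continuous family of vectors. -/
def pointwiseApply (X : Type*) [TopologicalSpace X] [CompactSpace X]
    (E F : Type*) [NormedAddCommGroup E] [NormedSpace ℝ E] [NormedAddCommGroup F] [NormedSpace ℝ F] :
    C(X, E →L[ℝ] F) →L[ℝ] C(X, E) →L[ℝ] C(X, F) :=
  LinearMap.mkContinuous₂
    (LinearMap.mk₂ ℝ (fun (A : C(X, E →L[ℝ] F)) (γ : C(X, E)) =>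
        (⟨fun x => A x (γ x), A.continuous.clm_apply γ.continuous⟩ : C(X, F)))
      (fun _ _ _ => rfl) (fun _ _ _ => rfl)
      (fun A γ δ => by ext x; exact map_add (A x) _ _)
      (fun c A γ => by ext x; exact map_smul (A x) _ _)) 1 (by
    intro A γ
    rw [one_mul, ContinuousMap.norm_le _ (by positivity)]
    intro x
    exact ((A x).le_opNorm _).trans
      (mul_le_mul (A.norm_coe_le_norm x) (γ.norm_coe_le_norm x) (norm_nonneg _) (norm_nonneg A)))

variable {E : Type u} [NormedAddCommGroup E] [NormedSpace ℝ E]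

theorem hasFDerivAt_comp_continuousMap {F : Type*} [NormedAddCommGroup F] [NormedSpace ℝ F]
    {f : C(E, F)} {f' : C(E, E →L[ℝ] F)} (hf : ∀ y, HasFDerivAt f (f' y) y) (γ : C(X, E)) :
    HasFDerivAt (fun γ : C(X, E) => f.comp γ) (pointwiseApply X E F (f'.comp γ)) γ := by
  rw [hasFDerivAt_iff_isLittleO, Asymptotics.isLittleO_iff]
  intro c hc
  have h1 := (ContinuousMap.continuous_postcomp (X := X) f').continuousAt (x := γ)
  obtain ⟨δ, hδ, h2⟩ := (Metric.continuousAt_iff (f := fun γ : C(X, E) => f'.comp γ)).1 h1 c hc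
  filter_upwards [Metric.ball_mem_nhds γ hδ] with γ' hγ'
  rw [ContinuousMap.norm_le _ (by positivity)]
  intro x
  have h3 : ∀ y ∈ segment ℝ (γ x) (γ' x), ‖f' y - f' (γ x)‖ ≤ c := by
    rintro y ⟨a, b, ha, hb, hab, rfl⟩
    have h4 : a • γ + b • γ' ∈ Metric.ball γ δ :=
      (convex_ball γ δ) (Metric.mem_ball_self hδ) hγ' ha hb hab
    have h5 := (ContinuousMap.dist_lt_iff hc).1 (h2 h4) x
    rw [dist_eq_norm] at h5
    exact h5.le
  have h6 := (convex_segment (γ x) (γ' x)).norm_image_sub_le_of_norm_hasFDerivWithin_le'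
    (fun y _ => (hf y).hasFDerivWithinAt) h3 (left_mem_segment ℝ _ _) (right_mem_segment ℝ _ _)
  exact h6.trans (mul_le_mul_of_nonneg_left ((γ' - γ).norm_coe_le_norm x) hc.le)

theorem contDiff_nat_comp_continuousMap (n : ℕ) : ∀ {F : Type u} [NormedAddCommGroup F]
    [NormedSpace ℝ F] {f : C(E, F)}, ContDiff ℝ ∞ f →
    ContDiff ℝ n (fun γ : C(X, E) => f.comp γ) := by
  induction n with
  | zero =>
    intro F _ _ f _
    exact contDiff_zero.2 (ContinuousMap.continuous_postcomp f)
  | succ n ih =>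
    intro F _ _ f hf
    have hf' : ContDiff ℝ ∞ (fderiv ℝ f) := hf.fderiv_right (by simp)
    rw [Nat.cast_add, Nat.cast_one, contDiff_succ_iff_hasFDerivAt]
    refine ⟨fun γ => pointwiseApply X E F ((⟨fderiv ℝ f, hf'.continuous⟩ : C(E, E →L[ℝ] F)).comp γ),
      ContDiff.comp (g := pointwiseApply X E F) (ContinuousLinearMap.contDiff (𝕜 := ℝ)
          (E := C(X, E →L[ℝ] F)) (F := C(X, E) →L[ℝ] C(X, F)) (pointwiseApply X E F))
        (ih (f := ⟨fderiv ℝ f, hf'.continuous⟩) hf'), fun γ => ?_⟩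
    exact hasFDerivAt_comp_continuousMap
      (fun y => (hf.differentiable (by simp) y).hasFDerivAt) γ

theorem contDiff_comp_continuousMap {F : Type u} [NormedAddCommGroup F]
    [NormedSpace ℝ F] {f : C(E, F)} (hf : ContDiff ℝ ∞ f) :
    ContDiff ℝ ∞ (fun γ : C(X, E) => f.comp γ) :=
  contDiff_infty.2 fun n => contDiff_nat_comp_continuousMap n hf

end Nemytskii

section LocalFlow

universe u
variable {E : Type u} [NormedAddCommGroup E] [NormedSpace ℝ E] [CompleteSpace E]

/-- The time interval `[-1, 1]`. -/
abbrev Interval : Type := Icc (-1 : ℝ) 1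

/-- The right endpoint of `[-1, 1]`. -/
def endpoint : Interval := ⟨1, by norm_num⟩

/-- Extension of a function on `[-1, 1]` to `ℝ`, constant outside. -/
def extendInterval (γ : C(Interval, E)) (r : ℝ) : E :=
  γ (projIcc (-1) 1 (by norm_num) r)

theorem continuous_extendInterval (γ : C(Interval, E)) : Continuous (extendInterval γ) :=
  γ.continuous.comp continuous_projIcc

theorem extendInterval_coe (γ : C(Interval, E)) (u : Interval) : extendInterval γ u = γ u := by
  rw [extendInterval, projIcc_val]

/-- The integral from `0`, as an operator on continuous functions on `[-1, 1]`. -/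
def integralOp (E : Type*) [NormedAddCommGroup E] [NormedSpace ℝ E] [CompleteSpace E] :
    C(Interval, E) →L[ℝ] C(Interval, E) :=
  LinearMap.mkContinuous
    { toFun := fun γ => ⟨fun u => ∫ r in (0 : ℝ)..u, extendInterval γ r,
        (intervalIntegral.continuous_primitive
          (fun a b => (continuous_extendInterval γ).intervalIntegrable a b) 0).comp
          continuous_subtype_val⟩
      map_add' := fun γ δ => by
        ext u
        exact intervalIntegral.integral_add ((continuous_extendInterval γ).intervalIntegrable _ _)
          ((continuous_extendInterval δ).intervalIntegrable _ _)
      map_smul' := fun c γ => by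
        ext u
        exact intervalIntegral.integral_smul c _ } 1 (by
    intro γ
    rw [one_mul, ContinuousMap.norm_le _ (norm_nonneg _)]
    intro u
    refine (intervalIntegral.norm_integral_le_of_norm_le_const (C := ‖γ‖)
      fun r _ => γ.norm_coe_le_norm _).trans ?_
    have : |(u : ℝ) - 0| ≤ 1 := by rw [sub_zero, abs_le]; exact u.2
    nlinarith [norm_nonneg γ])

/-- Constant functions, as an operator. -/
def constOp (E : Type*) [NormedAddCommGroup E] [NormedSpace ℝ E] : E →L[ℝ] C(Interval, E) :=
  LinearMap.mkContinuous
    { toFun := fun x => ContinuousMap.const _ x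
      map_add' := fun _ _ => rfl
      map_smul' := fun _ _ => rfl } 1 (by
    intro x
    rw [one_mul, ContinuousMap.norm_le _ (norm_nonneg _)]
    exact fun u => le_rfl)

/-- The map whose zeros over `(s, x)` are the solutions of the integral equation
`γ(u) = x + s ∫₀ᵘ f(γ)`. -/
def flowMap (f : C(E, E)) (p : C(Interval, E) × (ℝ × E)) : C(Interval, E) × (ℝ × E) :=
  (p.1 - (constOp E p.2.2 + p.2.1 • integralOp E (f.comp p.1)), p.2)

theorem contDiff_flowMap {f : C(E, E)} (hf : ContDiff ℝ ∞ f) : ContDiff ℝ ∞ (flowMap f) := by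
  have h1 : ContDiff ℝ ∞ fun p : C(Interval, E) × (ℝ × E) => integralOp E (f.comp p.1) :=
    (integralOp E).contDiff.comp ((contDiff_comp_continuousMap hf).comp contDiff_fst)
  have h2 : ContDiff ℝ ∞ fun p : C(Interval, E) × (ℝ × E) => constOp E p.2.2 :=
    (constOp E).contDiff.comp contDiff_snd.snd
  exact (contDiff_fst.sub (h2.add (contDiff_snd.fst.smul h1))).prodMk contDiff_snd

/-- The shear `(γ, q) ↦ (γ - L q, q)`. -/
def shear {A B : Type*} [NormedAddCommGroup A] [NormedSpace ℝ A] [NormedAddCommGroup B]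
    [NormedSpace ℝ B] (L : B →L[ℝ] A) : (A × B) ≃L[ℝ] (A × B) :=
  ContinuousLinearEquiv.equivOfInverse
    ((ContinuousLinearMap.fst ℝ A B - L.comp (ContinuousLinearMap.snd ℝ A B)).prod
      (ContinuousLinearMap.snd ℝ A B))
    ((ContinuousLinearMap.fst ℝ A B + L.comp (ContinuousLinearMap.snd ℝ A B)).prod
      (ContinuousLinearMap.snd ℝ A B))
    (fun p => by simp) (fun p => by simp)

theorem hasFDerivAt_flowMap {f : C(E, E)} (hf : ContDiff ℝ ∞ f) (x₀ : E) :
    ∃ e : (C(Interval, E) × (ℝ × E)) ≃L[ℝ] (C(Interval, E) × (ℝ × E)),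
      HasFDerivAt (flowMap f) (e : (C(Interval, E) × (ℝ × E)) →L[ℝ] (C(Interval, E) × (ℝ × E)))
        (constOp E x₀, ((0 : ℝ), x₀)) := by
  set p₀ : C(Interval, E) × (ℝ × E) := (constOp E x₀, ((0 : ℝ), x₀)) with hp
  have h1 : ContDiff ℝ ∞ fun p : C(Interval, E) × (ℝ × E) => integralOp E (f.comp p.1) :=
    (integralOp E).contDiff.comp ((contDiff_comp_continuousMap hf).comp contDiff_fst)
  have h2 := (h1.differentiable (by simp) p₀).hasFDerivAt
  have h3 : HasFDerivAt (fun p : C(Interval, E) × (ℝ × E) => p.2.1)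
      ((ContinuousLinearMap.fst ℝ ℝ E).comp (ContinuousLinearMap.snd ℝ C(Interval, E) (ℝ × E))) p₀ :=
    ContinuousLinearMap.hasFDerivAt (((ContinuousLinearMap.fst ℝ ℝ E).comp
      (ContinuousLinearMap.snd ℝ C(Interval, E) (ℝ × E))))
  have h4 : HasFDerivAt (fun p : C(Interval, E) × (ℝ × E) => constOp E p.2.2)
      ((constOp E).comp ((ContinuousLinearMap.snd ℝ ℝ E).comp
        (ContinuousLinearMap.snd ℝ C(Interval, E) (ℝ × E)))) p₀ :=
    ContinuousLinearMap.hasFDerivAt ((constOp E).comp ((ContinuousLinearMap.snd ℝ ℝ E).comp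
        (ContinuousLinearMap.snd ℝ C(Interval, E) (ℝ × E))))
  refine ⟨shear ((constOp E).comp (ContinuousLinearMap.snd ℝ ℝ E) +
    (ContinuousLinearMap.fst ℝ ℝ E).smulRight (integralOp E (f.comp (constOp E x₀)))), ?_⟩
  have h5 := (hasFDerivAt_fst.sub (h4.add (h3.smul h2))).prodMk
    (hasFDerivAt_snd (𝕜 := ℝ) (p := p₀))
  refine h5.congr_fderiv ?_
  ext p <;> simp [shear, hp]

/-- A smooth vector field on a Banach space has a smooth local flow. -/
theorem exists_contDiffOn_localFlow {f : E → E} (hf : ContDiff ℝ ∞ f) (x₀ : E) :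
    ∃ (ε : ℝ) (_ : 0 < ε) (U : Set E) (_ : U ∈ 𝓝 x₀) (Φ : ℝ × E → E),
      ContDiffOn ℝ ∞ Φ (Ioo (-ε) ε ×ˢ U) ∧ (∀ x ∈ U, Φ (0, x) = x) ∧
      ∀ s ∈ Ioo (-ε) ε, ∀ x ∈ U, HasDerivAt (fun r => Φ (r, x)) (f (Φ (s, x))) s := by
  let fc : C(E, E) := ⟨f, hf.continuous⟩
  have hfc : ContDiff ℝ ∞ fc := hf
  have hF := contDiff_flowMap hfc
  obtain ⟨e', he'⟩ := hasFDerivAt_flowMap hfc x₀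
  set p₀ : C(Interval, E) × (ℝ × E) := (constOp E x₀, ((0 : ℝ), x₀)) with hp
  set e := (hF.contDiffAt (x := p₀)).toOpenPartialHomeomorph (flowMap fc) he' (by simp) with he
  have hecoe : ⇑e = flowMap fc := (hF.contDiffAt (x := p₀)).toOpenPartialHomeomorph_coe he' (by simp)
  have hp₀s : p₀ ∈ e.source := (hF.contDiffAt (x := p₀)).mem_toOpenPartialHomeomorph_source he' (by simp)
  have hFp : flowMap fc p₀ = (0, ((0 : ℝ), x₀)) := by
    simp [flowMap, hp]
  have hq₀t : ((0 : C(Interval, E)), ((0 : ℝ), x₀)) ∈ e.target := by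
    rw [← hFp, ← hecoe]; exact e.map_source hp₀s
  have hsymm₀ : e.symm ((0 : C(Interval, E)), ((0 : ℝ), x₀)) = p₀ := by
    rw [← hFp, ← hecoe]; exact e.left_inv hp₀s
  -- a ball around the base curve in the domain of the local inverse
  obtain ⟨ρ, hρ, hball⟩ := Metric.isOpen_iff.1 e.open_source p₀ hp₀s
  -- the derivative is invertible near the base point
  have hinv : ∀ᶠ p in 𝓝 p₀, ∃ e'' : (C(Interval, E) × (ℝ × E)) ≃L[ℝ] (C(Interval, E) × (ℝ × E)),
      HasFDerivAt (flowMap fc) (e'' : (C(Interval, E) × (ℝ × E)) →L[ℝ] (C(Interval, E) × (ℝ × E))) p := by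
    have h1 : ContinuousAt (fderiv ℝ (flowMap fc)) p₀ :=
      (hF.continuous_fderiv (by simp)).continuousAt
    have h2 : range ((↑) : ((C(Interval, E) × (ℝ × E)) ≃L[ℝ] (C(Interval, E) × (ℝ × E))) → _) ∈
        𝓝 (fderiv ℝ (flowMap fc) p₀) := by
      rw [he'.fderiv]; exact ContinuousLinearEquiv.nhds e'
    filter_upwards [h1 h2] with p ⟨e'', he''⟩
    exact ⟨e'', by rw [he'']; exact (hF.differentiable (by simp) p).hasFDerivAt⟩
  let ι : ℝ × E → C(Interval, E) × (ℝ × E) := fun q => (0, q)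
  have hι : ContDiff ℝ ∞ ι := contDiff_const.prodMk contDiff_id
  have hev : ∀ᶠ q : ℝ × E in 𝓝 ((0 : ℝ), x₀), ι q ∈ e.target ∧
      e.symm (ι q) ∈ Metric.ball p₀ ρ ∧ ∃ e'' : (C(Interval, E) × (ℝ × E)) ≃L[ℝ]
        (C(Interval, E) × (ℝ × E)), HasFDerivAt (flowMap fc)
        (e'' : (C(Interval, E) × (ℝ × E)) →L[ℝ] (C(Interval, E) × (ℝ × E))) (e.symm (ι q)) := by
    have h1 : ContinuousAt ι ((0 : ℝ), x₀) := hι.continuous.continuousAt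
    have h2 : Tendsto (fun q => e.symm (ι q)) (𝓝 ((0 : ℝ), x₀)) (𝓝 p₀) := by
      have := (e.continuousAt_symm hq₀t).tendsto.comp h1.tendsto
      rwa [hsymm₀] at this
    exact (h1.eventually (e.open_target.mem_nhds hq₀t)).and
      ((h2.eventually (Metric.ball_mem_nhds p₀ hρ)).and (h2.eventually hinv))
  rw [nhds_prod_eq, Filter.eventually_prod_iff] at hev
  obtain ⟨pa, hpa, pb, hpb, hev⟩ := hev
  obtain ⟨ε₀, hε₀, hpa⟩ := Metric.eventually_nhds_iff.1 hpa
  set ε := min ε₀ ρ with hεdef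
  have hε : 0 < ε := lt_min hε₀ hρ
  have hpb' : pb x₀ := hpb.self_of_nhds
  set U : Set E := {x | pb x} ∩ Metric.ball x₀ ρ with hU
  have hs_of : ∀ s ∈ Ioo (-ε) ε, pa s := fun s hs => hpa (by
    rw [Real.dist_eq, sub_zero, abs_lt]
    exact ⟨by linarith [hs.1, min_le_left ε₀ ρ], by linarith [hs.2, min_le_left ε₀ ρ]⟩)
  set Γ : ℝ × E → C(Interval, E) := fun q => (e.symm (ι q)).1 with hΓ
  have hgood : ∀ s ∈ Ioo (-ε) ε, ∀ x ∈ U, _ := fun s hs x hx => hev (hs_of s hs) hx.1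
  -- the defining equation
  have heq : ∀ s ∈ Ioo (-ε) ε, ∀ x ∈ U, e.symm (ι (s, x)) = (Γ (s, x), (s, x)) ∧
      Γ (s, x) = constOp E x + s • integralOp E (fc.comp (Γ (s, x))) := by
    intro s hs x hx
    have h1 : flowMap fc (e.symm (ι (s, x))) = ι (s, x) := by
      rw [← hecoe]; exact e.right_inv (hgood s hs x hx).1
    have h2 : (e.symm (ι (s, x))).2 = (s, x) := congrArg Prod.snd h1
    refine ⟨Prod.ext rfl h2, ?_⟩
    have h3 : (e.symm (ι (s, x))).1 - (constOp E (e.symm (ι (s, x))).2.2 +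
      (e.symm (ι (s, x))).2.1 • integralOp E (fc.comp (e.symm (ι (s, x))).1)) = 0 :=
      congrArg Prod.fst h1
    rw [h2] at h3
    exact sub_eq_zero.1 h3
  have heq' : ∀ s ∈ Ioo (-ε) ε, ∀ x ∈ U, ∀ u : Interval,
      Γ (s, x) u = x + s • ∫ r in (0 : ℝ)..u, f (extendInterval (Γ (s, x)) r) := by
    intro s hs x hx u
    have h1 := congrArg (fun γ : C(Interval, E) => γ u) (heq s hs x hx).2
    exact h1
  -- the scaling property
  have hscale : ∀ s ∈ Ioo (-ε) ε, ∀ x ∈ U, ∀ u : Interval,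
      Γ (s * u, x) endpoint = Γ (s, x) u := by
    intro s hs x hx u
    have hu1 : |(u : ℝ)| ≤ 1 := abs_le.2 u.2
    have hsu : s * u ∈ Ioo (-ε) ε := by
      rw [mem_Ioo, ← abs_lt] at hs ⊢
      rw [abs_mul]
      exact lt_of_le_of_lt (mul_le_of_le_one_right (abs_nonneg s) hu1) hs
    have hmem : ∀ v : Interval, (u : ℝ) * v ∈ Icc (-1 : ℝ) 1 := fun v => by
      rw [mem_Icc, ← abs_le, abs_mul]
      exact mul_le_one₀ hu1 (abs_nonneg _) (abs_le.2 v.2)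
    let γ' : C(Interval, E) := ⟨fun v => Γ (s, x) ⟨u * v, hmem v⟩, by fun_prop⟩
    have hγ' : flowMap fc (γ', (s * u, x)) = ι (s * u, x) := by
      refine Prod.ext ?_ rfl
      change γ' - (constOp E x + (s * u) • integralOp E (fc.comp γ')) = 0
      rw [sub_eq_zero]
      ext v
      change Γ (s, x) ⟨u * v, hmem v⟩ = x + (s * u : ℝ) • ∫ r in (0 : ℝ)..v, f (extendInterval γ' r)
      rw [heq' s hs x hx, mul_smul]
      congr 2
      have h1 : ∫ r in (0 : ℝ)..v, f (extendInterval γ' r) =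
          ∫ r in (0 : ℝ)..v, f (extendInterval (Γ (s, x)) (u * r)) := by
        refine intervalIntegral.integral_congr fun r hr => ?_
        have hr1 : r ∈ Icc (-1 : ℝ) 1 := by
          have h2 := v.2
          rcases le_total 0 (v : ℝ) with h0 | h0
          · rw [uIcc_of_le h0] at hr; exact ⟨by linarith [hr.1], hr.2.trans h2.2⟩
          · rw [uIcc_of_ge h0] at hr; exact ⟨h2.1.trans hr.1, by linarith [hr.2]⟩
        have h3 : extendInterval γ' r = γ' ⟨r, hr1⟩ := extendInterval_coe γ' ⟨r, hr1⟩
        have h4 : extendInterval (Γ (s, x)) (u * r) = Γ (s, x) ⟨u * r, hmem ⟨r, hr1⟩⟩ :=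
          extendInterval_coe (Γ (s, x)) ⟨u * r, hmem ⟨r, hr1⟩⟩
        simp only [h3, h4]
        rfl
      rw [h1, intervalIntegral.smul_integral_comp_mul_left
        (fun r => f (extendInterval (Γ (s, x)) r)), mul_zero]
    have hγs : (γ', (s * u, x)) ∈ e.source := by
      apply hball
      have h1 := (hgood s hs x hx).2.1
      rw [(heq s hs x hx).1] at h1
      rw [Metric.mem_ball, Prod.dist_eq, max_lt_iff] at h1 ⊢
      refine ⟨?_, ?_⟩
      · rw [ContinuousMap.dist_lt_iff hρ]
        intro v
        exact (ContinuousMap.dist_lt_iff hρ).1 h1.1 ⟨u * v, hmem v⟩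
      · rw [Prod.dist_eq, max_lt_iff]
        refine ⟨?_, hx.2⟩
        change dist (s * (u : ℝ)) 0 < ρ
        rw [Real.dist_eq, sub_zero, abs_lt]
        exact ⟨by linarith [hsu.1, min_le_right ε₀ ρ], by linarith [hsu.2, min_le_right ε₀ ρ]⟩
    have h5 : e.symm (ι (s * u, x)) = (γ', (s * u, x)) := by
      rw [← hγ', ← hecoe]; exact e.left_inv hγs
    have h6 : Γ (s * u, x) = γ' := congrArg Prod.fst h5
    rw [h6]
    change Γ (s, x) ⟨u * (endpoint : ℝ), _⟩ = _
    congr 1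
    exact Subtype.ext (mul_one _)
  have hΓs : ∀ q ∈ Ioo (-ε) ε ×ˢ U, ContDiffAt ℝ ∞ Γ q := by
    rintro ⟨s, x⟩ ⟨hs, hx⟩
    obtain ⟨h1, -, e'', h2⟩ := hgood s hs x hx
    rw [← hecoe] at h2
    have h3 : ContDiffAt ℝ ∞ e.symm (ι (s, x)) :=
      e.contDiffAt_symm h1 h2 (by rw [hecoe]; exact hF.contDiffAt)
    exact contDiff_fst.contDiffAt.comp _ (h3.comp (s, x) hι.contDiffAt)
  refine ⟨ε / 2, by positivity, U, inter_mem hpb (Metric.ball_mem_nhds x₀ hρ),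
    fun q => Γ q endpoint, ?_, ?_, ?_⟩
  · rintro ⟨s, x⟩ ⟨hs, hx⟩
    have h1 := hΓs (s, x) ⟨⟨by linarith [hs.1], by linarith [hs.2]⟩, hx⟩
    exact ((ContinuousMap.evalCLM ℝ endpoint).contDiff.contDiffAt.comp _ h1).contDiffWithinAt
  · intro x hx
    have h0 : (0 : ℝ) ∈ Ioo (-ε) ε := ⟨by linarith, hε⟩
    change Γ (0, x) endpoint = x
    rw [heq' 0 h0 x hx, zero_smul, add_zero]
  · intro s hs x hx
    have hh : ε / 2 ∈ Ioo (-ε) ε := ⟨by linarith, by linarith⟩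
    set h := ε / 2 with hhd
    have hh0 : 0 < h := by positivity
    have hloc : (fun r => Γ (r, x) endpoint) =ᶠ[𝓝 s] fun r =>
        x + h • ∫ r' in (0 : ℝ)..(r / h), f (extendInterval (Γ (h, x)) r') := by
      filter_upwards [Ioo_mem_nhds hs.1 hs.2] with r hr
      have hr1 : r / h ∈ Icc (-1 : ℝ) 1 :=
        ⟨by rw [le_div_iff₀ hh0]; linarith [hr.1], by rw [div_le_iff₀ hh0]; linarith [hr.2]⟩
      have h1 := hscale h hh x hx ⟨r / h, hr1⟩
      have h2 : h * (r / h) = r := by field_simp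
      simp only [h2] at h1
      rw [h1, heq' h hh x hx]
    have hs1 : s / h ∈ Icc (-1 : ℝ) 1 :=
      ⟨by rw [le_div_iff₀ hh0]; linarith [hs.1], by rw [div_le_iff₀ hh0]; linarith [hs.2]⟩
    have hval : extendInterval (Γ (h, x)) (s / h) = Γ (s, x) endpoint := by
      have h1 := hscale h hh x hx ⟨s / h, hs1⟩
      have h2 : h * (s / h) = s := by field_simp
      simp only [h2] at h1
      rw [h1]
      exact extendInterval_coe (Γ (h, x)) ⟨s / h, hs1⟩
    have hc : Continuous fun r' => f (extendInterval (Γ (h, x)) r') :=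
      hf.continuous.comp (continuous_extendInterval _)
    have h3 := intervalIntegral.integral_hasDerivAt_right (a := 0) (b := s / h)
      (hc.intervalIntegrable _ _) (hc.stronglyMeasurableAtFilter _ _) hc.continuousAt
    have h4 := ((h3.scomp s ((hasDerivAt_id s).div_const h)).const_smul h).const_add x
    refine HasDerivAt.congr_of_eventuallyEq ?_ hloc
    convert! h4 using 1
    rw [smul_smul, hval]
    simp [hh0.ne']

end LocalFlow

section VectorFields

variable {E : Type} [NormedAddCommGroup E] [NormedSpace ℝ E] [FiniteDimensional ℝ E]
  {H : Type*} [TopologicalSpace H] (I : ModelWithCorners ℝ E H)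
  {M : Type*} [TopologicalSpace M] [ChartedSpace H M]

/-- The coordinate expression of a vector field. -/
def fieldInChart (V : M → E) (x₀ : M) (y : E) : E :=
  tmap I 𝓘(ℝ, E) (extChartAt I x₀) ((extChartAt I x₀).symm y) (V ((extChartAt I x₀).symm y))

/-- A vector field is smooth if its coordinate expressions are. -/
def IsSmoothField (V : M → E) : Prop :=
  ∀ x₀ : M, ContDiffOn ℝ ∞ (fieldInChart I V x₀) (extChartAt I x₀).target

/-- `γ` has velocity `V (γ s)` at the time `s`. -/
def HasVelocity (V : M → E) (γ : ℝ → M) (s : ℝ) : Prop :=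
  HasMFDerivAt 𝓘(ℝ, ℝ) I γ s ((1 : ℝ →L[ℝ] ℝ).smulRight (show TangentSpace I (γ s) from V (γ s)))

/-- `Θ` is a smooth flow of `V` for times in `(-ε, ε)` and initial points in `U`. -/
structure IsFlowOn (V : M → E) (ε : ℝ) (U : Set M) (Θ : ℝ × M → M) : Prop where
  smooth : ContMDiffOn (𝓘(ℝ, ℝ).prod I) I ∞ Θ (Ioo (-ε) ε ×ˢ U)
  zero : ∀ x ∈ U, Θ (0, x) = x
  velocity : ∀ x ∈ U, ∀ s ∈ Ioo (-ε) ε, HasVelocity I V (fun r => Θ (r, x)) s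

variable {I} [IsManifold I ∞ M]

theorem IsSmoothField.contMDiff {V : M → E} (hV : IsSmoothField I V) :
    ContMDiff I I.tangent 1
      (fun x => (⟨x, (show TangentSpace I x from V x)⟩ : TangentBundle I M)) := by
  have := isManifold_one (I := I) (M := M)
  intro x₀
  rw [Bundle.contMDiffAt_section]
  have h1 : ContMDiffAt I 𝓘(ℝ, E) ∞ (fun x => fieldInChart I V x₀ (extChartAt I x₀ x)) x₀ := by
    have h2 : ContMDiffWithinAt 𝓘(ℝ, E) 𝓘(ℝ, E) ∞ (fieldInChart I V x₀) (extChartAt I x₀).target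
        (extChartAt I x₀ x₀) := (hV x₀ _ (mem_extChartAt_target x₀)).contMDiffWithinAt
    have h3 : ContMDiffAt I 𝓘(ℝ, E) ∞ (extChartAt I x₀) x₀ := contMDiffAt_extChartAt
    have h4 := h2.comp (t := (extChartAt I x₀).target) x₀ (h3.contMDiffWithinAt
      (s := (extChartAt I x₀).source)) fun x hx => (extChartAt I x₀).map_source hx
    exact h4.contMDiffAt (extChartAt_source_mem_nhds x₀)
  refine (h1.of_le (by norm_cast)).congr_of_eventuallyEq ?_
  filter_upwards [extChartAt_source_mem_nhds (I := I) x₀] with x hx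
  have hx' : x ∈ (chartAt H x₀).source := by rwa [extChartAt_source] at hx
  rw [fieldInChart, (extChartAt I x₀).left_inv hx]
  have h5 := TangentBundle.continuousLinearMapAt_trivializationAt (I := I) hx'
  have h6 := congrArg (fun A : E →L[ℝ] E => A (V x)) h5
  refine Eq.trans ?_ h6
  have hb : x ∈ (trivializationAt E (TangentSpace I) x₀).baseSet := by simpa using hx'
  exact (congrFun (Bundle.Trivialization.coe_linearMapAt_of_mem (R := ℝ)
    (trivializationAt E (TangentSpace I) x₀) hb) (V x)).symm

theorem tmap_symm_fieldInChart (V : M → E) {x₀ : M} {y : E} (hy : y ∈ (extChartAt I x₀).target) :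
    (show E →L[ℝ] E from mfderivWithin 𝓘(ℝ, E) I (extChartAt I x₀).symm (range I) y)
      (fieldInChart I V x₀ y) = V ((extChartAt I x₀).symm y) := by
  have := isManifold_one (I := I) (M := M)
  have h1 := mfderivWithin_extChartAt_symm_comp_mfderiv_extChartAt (I := I) hy
  exact congrArg (fun A : E →L[ℝ] E => A (V ((extChartAt I x₀).symm y))) h1

theorem target_mem_nhds_of_isInteriorPoint {x₀ : M} (hx : I.IsInteriorPoint x₀) :
    (extChartAt I x₀).target ∈ 𝓝 (extChartAt I x₀ x₀) := by
  have := extChartAt_target_mem_nhdsWithin (I := I) x₀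
  rwa [nhdsWithin_eq_nhds.2 (range_mem_nhds_isInteriorPoint hx)] at this

theorem isInteriorPoint_symm {x₀ : M} {y : E} (hy : (extChartAt I x₀).target ∈ 𝓝 y) :
    I.IsInteriorPoint ((extChartAt I x₀).symm y) := by
  have hyt := mem_of_mem_nhds hy
  have hs := (extChartAt I x₀).map_target hyt
  rw [extChartAt_source] at hs
  rw [ModelWithCorners.isInteriorPoint_iff_of_mem_atlas (n := ∞) (by simp)
    (chart_mem_atlas H x₀) hs]
  change extChartAt I x₀ ((extChartAt I x₀).symm y) ∈ interior (extChartAt I x₀).target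
  rw [(extChartAt I x₀).right_inv hyt]
  exact mem_interior_iff_mem_nhds.2 hy

/-- A smooth function near a point of the interior of a set extends to the whole space. -/
theorem exists_contDiff_eventuallyEq {F : Type*} [NormedAddCommGroup F] [NormedSpace ℝ F] {f : E → F}
    {s : Set E} {z : E} (hs : s ∈ 𝓝 z) (hf : ContDiffOn ℝ ∞ f s) :
    ∃ g : E → F, ContDiff ℝ ∞ g ∧ g =ᶠ[𝓝 z] f := by
  obtain ⟨r, hr, hball⟩ := Metric.mem_nhds_iff.1 hs
  let b : ContDiffBump z := ⟨r / 4, r / 2, by positivity, by linarith⟩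
  refine ⟨fun y => b y • f y, ?_, ?_⟩
  · rw [contDiff_iff_contDiffAt]
    intro y
    by_cases hy : y ∈ Metric.ball z r
    · exact b.contDiff.contDiffAt.smul
        (hf.contDiffAt (mem_of_superset (Metric.isOpen_ball.mem_nhds hy) hball))
    · refine (contDiffAt_const (c := (0 : F))).congr_of_eventuallyEq ?_
      have hy' : y ∈ (tsupport b)ᶜ := by
        rw [b.tsupport_eq]
        intro h
        have h1 : dist y z ≤ r / 2 := h
        exact hy (by rw [Metric.mem_ball]; linarith)
      filter_upwards [(isClosed_tsupport b).isOpen_compl.mem_nhds hy'] with w hw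
      rw [image_eq_zero_of_notMem_tsupport hw, zero_smul]
  · filter_upwards [b.eventuallyEq_one] with y hy
    rw [hy, Pi.one_apply, one_smul]

/-- A smooth vector field has a smooth local flow near interior points. -/
theorem exists_isFlowOn {V : M → E} (hV : IsSmoothField I V) {x₀ : M} (hx : I.IsInteriorPoint x₀) :
    ∃ (ε : ℝ) (_ : 0 < ε) (U : Set M) (_ : IsOpen U) (_ : x₀ ∈ U) (Θ : ℝ × M → M),
      IsFlowOn I V ε U Θ ∧ ∀ x ∈ U, ∀ s ∈ Ioo (-ε) ε, I.IsInteriorPoint (Θ (s, x)) := by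
  have := isManifold_one (I := I) (M := M)
  set z := extChartAt I x₀ x₀ with hz
  have htn := target_mem_nhds_of_isInteriorPoint hx
  obtain ⟨f, hf, hfV⟩ := exists_contDiff_eventuallyEq htn (hV x₀)
  obtain ⟨r, hr, hball⟩ := Metric.mem_nhds_iff.1 (inter_mem (interior_mem_nhds.2 htn) hfV)
  have hbt : ∀ y ∈ Metric.ball z r, (extChartAt I x₀).target ∈ 𝓝 y := fun y hy =>
    mem_interior_iff_mem_nhds.1 (hball hy).1
  obtain ⟨ε₀, hε₀, U₀, hU₀, Φ, hΦ, hΦ0, hΦd⟩ := exists_contDiffOn_localFlow hf z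
  have hcont : ContinuousAt Φ ((0 : ℝ), z) :=
    (hΦ.continuousOn.continuousAt (prod_mem_nhds (Ioo_mem_nhds (by linarith) hε₀) hU₀))
  have hΦz : Φ ((0 : ℝ), z) = z := hΦ0 z (mem_of_mem_nhds hU₀)
  have hev : ∀ᶠ q in 𝓝 ((0 : ℝ), z), Φ q ∈ Metric.ball z r :=
    hcont.eventually (by rw [hΦz]; exact Metric.ball_mem_nhds z hr)
  rw [nhds_prod_eq, Filter.eventually_prod_iff] at hev
  obtain ⟨pa, hpa, pb, hpb, hev⟩ := hev
  obtain ⟨ε₁, hε₁, hpa⟩ := Metric.eventually_nhds_iff.1 hpa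
  set ε := min ε₀ ε₁ with hεd
  have hε : 0 < ε := lt_min hε₀ hε₁
  have hsub : ∀ s ∈ Ioo (-ε) ε, s ∈ Ioo (-ε₀) ε₀ ∧ pa s := fun s hs =>
    ⟨⟨by linarith [hs.1, min_le_left ε₀ ε₁], by linarith [hs.2, min_le_left ε₀ ε₁]⟩, hpa (by
      rw [Real.dist_eq, sub_zero, abs_lt]
      exact ⟨by linarith [hs.1, min_le_right ε₀ ε₁], by linarith [hs.2, min_le_right ε₀ ε₁]⟩)⟩
  obtain ⟨W, hWsub, hWo, hzW⟩ := mem_nhds_iff.1 (inter_mem hU₀ hpb)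
  set U := (extChartAt I x₀).source ∩ extChartAt I x₀ ⁻¹' W with hU
  have hmem : ∀ x ∈ U, ∀ s ∈ Ioo (-ε) ε, Φ (s, extChartAt I x₀ x) ∈ Metric.ball z r :=
    fun x hx s hs => hev (hsub s hs).2 (hWsub hx.2).2
  refine ⟨ε, hε, U, isOpen_extChartAt_preimage' x₀ hWo, ⟨mem_extChartAt_source x₀, hzW⟩,
    fun q => (extChartAt I x₀).symm (Φ (q.1, extChartAt I x₀ q.2)), ⟨?_, ?_, ?_⟩, ?_⟩
  · have h1 : ContMDiffOn 𝓘(ℝ, ℝ × E) 𝓘(ℝ, E) ∞ Φ (Ioo (-ε₀) ε₀ ×ˢ U₀) := hΦ.contMDiffOn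
    have h2 : ContMDiffOn (𝓘(ℝ, ℝ).prod I) 𝓘(ℝ, ℝ × E) ∞
        (fun q : ℝ × M => (q.1, extChartAt I x₀ q.2)) (Ioo (-ε) ε ×ˢ U) := by
      rw [modelWithCornersSelf_prod, ← chartedSpaceSelf_prod]
      refine contMDiff_fst.contMDiffOn.prodMk ?_
      refine (contMDiffOn_extChartAt (n := ∞) (x := x₀)).comp contMDiff_snd.contMDiffOn ?_
      rintro q ⟨_, hq⟩
      have := hq.1
      rwa [extChartAt_source] at this
    have h3 := h1.comp h2 fun q hq => ⟨(hsub _ hq.1).1, (hWsub hq.2.2).1⟩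
    exact (contMDiffOn_extChartAt_symm x₀).comp h3
      fun q hq => show Φ (q.1, extChartAt I x₀ q.2) ∈ (extChartAt I x₀).target from
        mem_of_mem_nhds (hbt _ (hmem _ hq.2 _ hq.1))
  · rintro x ⟨hxs, hxW⟩
    change (extChartAt I x₀).symm (Φ (0, extChartAt I x₀ x)) = x
    rw [hΦ0 _ (hWsub hxW).1, (extChartAt I x₀).left_inv hxs]
  · intro x hx s hs
    have hy := hmem x hx s hs
    set y := Φ (s, extChartAt I x₀ x) with hyd
    have h1 := hΦd s (hsub s hs).1 _ (hWsub hx.2).1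
    have h2 : HasMFDerivAt 𝓘(ℝ, E) I (extChartAt I x₀).symm y
        (mfderivWithin 𝓘(ℝ, E) I (extChartAt I x₀).symm (range I) y) :=
      ((mdifferentiableWithinAt_extChartAt_symm (mem_of_mem_nhds (hbt y hy))).hasMFDerivWithinAt
        ).hasMFDerivAt (mem_of_superset (hbt y hy) (extChartAt_target_subset_range x₀))
    have h3 := h2.comp s h1.hasFDerivAt.hasMFDerivAt
    have hfy : f y = fieldInChart I V x₀ y := (hball hy).2
    have h4 := tmap_symm_fieldInChart V (I := I) (mem_of_mem_nhds (hbt y hy))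
    have key : ∀ (A : E →L[ℝ] E) (u w : E), A u = w → A.comp (ContinuousLinearMap.toSpanSingleton ℝ u) =
        (1 : ℝ →L[ℝ] ℝ).smulRight w := by
      rintro A u w rfl
      ext
      simp
    exact h3.congr_mfderiv (key _ _ _ (by rw [hfy]; exact h4))
  · intro x hx s hs
    exact isInteriorPoint_symm (hbt _ (hmem x hx s hs))

theorem HasVelocity.congr {V : M → E} {γ γ' : ℝ → M} {s : ℝ} (h : HasVelocity I V γ s)
    (h' : γ' =ᶠ[𝓝 s] γ) : HasVelocity I V γ' s := by
  have h0 : HasMFDerivAt 𝓘(ℝ, ℝ) I γ s ((1 : ℝ →L[ℝ] ℝ).smulRight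
    (show TangentSpace I (γ s) from V (γ s))) := h
  have h1 : HasMFDerivAt 𝓘(ℝ, ℝ) I γ' s _ := h0.congr_of_eventuallyEq h'
  have h2 : γ' s = γ s := h'.self_of_nhds
  have h3 : (show E from V (γ' s)) = V (γ s) := by rw [h2]
  exact h1.congr_mfderiv (show (1 : ℝ →L[ℝ] ℝ).smulRight (show E from V (γ s)) =
    (1 : ℝ →L[ℝ] ℝ).smulRight (show E from V (γ' s)) by rw [h3])

theorem hasVelocity_const {V : M → E} {x : M} (hx : V x = 0) (s : ℝ) :
    HasVelocity I V (fun _ => x) s := by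
  have h1 : HasMFDerivAt 𝓘(ℝ, ℝ) I (fun _ : ℝ => x) s _ := hasMFDerivAt_const x s
  exact h1.congr_mfderiv (show (0 : ℝ →L[ℝ] E) = (1 : ℝ →L[ℝ] ℝ).smulRight (V x) by
    rw [hx]; ext; simp)

theorem HasVelocity.comp_add {V : M → E} {γ : ℝ → M} {s c : ℝ} (h : HasVelocity I V γ (s + c)) :
    HasVelocity I V (fun r => γ (r + c)) s := by
  have h1 : HasMFDerivAt 𝓘(ℝ, ℝ) 𝓘(ℝ, ℝ) (fun r : ℝ => r + c) s (ContinuousLinearMap.id ℝ ℝ) :=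
    ((hasFDerivAt_id s).add_const c).hasMFDerivAt
  have h0 : HasMFDerivAt 𝓘(ℝ, ℝ) I γ (s + c) ((1 : ℝ →L[ℝ] ℝ).smulRight
    (show TangentSpace I (γ (s + c)) from V (γ (s + c)))) := h
  exact (HasMFDerivAt.comp (f := fun r : ℝ => r + c) (g := γ) s h0 h1).congr_mfderiv
    (show ((1 : ℝ →L[ℝ] ℝ).smulRight (show E from V (γ (s + c)))).comp (ContinuousLinearMap.id ℝ ℝ) =
      (1 : ℝ →L[ℝ] ℝ).smulRight (show E from V (γ (s + c))) by ext; simp)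

variable [T2Space M]

theorem eqOn_of_hasVelocity {V : M → E} (hV : IsSmoothField I V) {a b : ℝ} (h0 : (0 : ℝ) ∈ Ioo a b)
    {γ γ' : ℝ → M} (hi : ∀ s ∈ Ioo a b, I.IsInteriorPoint (γ s))
    (hγ : ∀ s ∈ Ioo a b, HasVelocity I V γ s) (hγ' : ∀ s ∈ Ioo a b, HasVelocity I V γ' s)
    (h : γ 0 = γ' 0) : EqOn γ γ' (Ioo a b) := by
  have := isManifold_one (I := I) (M := M)
  exact isMIntegralCurveOn_Ioo_eqOn_of_contMDiff h0 hi hV.contMDiff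
    (fun s hs => HasMFDerivAt.hasMFDerivWithinAt (hγ s hs))
    (fun s hs => HasMFDerivAt.hasMFDerivWithinAt (hγ' s hs)) h

/-- A smooth vector field with compact support in the interior has a smooth flow for small times. -/
theorem exists_isFlowOn_univ {V : M → E} (hV : IsSmoothField I V) {K : Set M} (hK : IsCompact K)
    (hKi : ∀ x ∈ K, I.IsInteriorPoint x) (hKV : ∀ x ∉ K, V x = 0) :
    ∃ (ε : ℝ) (_ : 0 < ε) (Θ : ℝ × M → M), IsFlowOn I V ε univ Θ ∧
      (∀ x ∉ K, ∀ s ∈ Ioo (-ε) ε, Θ (s, x) = x) ∧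
      ∀ x, ∀ s ∈ Ioo (-ε) ε, Θ (-s, Θ (s, x)) = x := by
  classical
  choose ε hε U hUo hxU Θ hΘ hΘi using fun x : K => exists_isFlowOn hV (hKi x x.2)
  obtain ⟨t, ht⟩ := hK.elim_finite_subcover U hUo fun x hx => mem_iUnion.2 ⟨⟨x, hx⟩, hxU ⟨x, hx⟩⟩
  obtain ⟨e, he, he0⟩ : ∃ e : ℝ, (∀ i ∈ t, e ≤ ε i) ∧ 0 < e := by
    have h1 : ∀ᶠ e in 𝓝[>] (0 : ℝ), ∀ i ∈ t, e ≤ ε i :=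
      (Filter.eventually_all_finset t).2 fun i _ =>
        mem_nhdsWithin_of_mem_nhds (Iic_mem_nhds (hε i))
    exact (h1.and self_mem_nhdsWithin).exists
  have hsub : ∀ i ∈ t, ∀ s ∈ Ioo (-e) e, s ∈ Ioo (-ε i) (ε i) := fun i hi s hs =>
    ⟨by linarith [hs.1, he i hi], by linarith [hs.2, he i hi]⟩
  let Ψ : ℝ × M → M := fun q => if h : ∃ i : K, i ∈ t ∧ q.2 ∈ U i then Θ h.choose q else q.2
  have h0 : (0 : ℝ) ∈ Ioo (-e) e := ⟨by linarith, he0⟩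
  -- the pieces agree
  have hloc : ∀ i ∈ t, ∀ x ∈ U i, ∀ s ∈ Ioo (-e) e, Ψ (s, x) = Θ i (s, x) := by
    intro i hi x hx s hs
    have h : ∃ i : K, i ∈ t ∧ x ∈ U i := ⟨i, hi, hx⟩
    have h1 : Ψ (s, x) = Θ h.choose (s, x) := dif_pos h
    have hj := h.choose_spec
    rw [h1]
    refine eqOn_of_hasVelocity hV h0 (γ := fun s => Θ h.choose (s, x)) (γ' := fun s => Θ i (s, x))
      (fun s hs => hΘi _ x hj.2 s (hsub _ hj.1 s hs))
      (fun s hs => (hΘ _).velocity x hj.2 s (hsub _ hj.1 s hs))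
      (fun s hs => (hΘ i).velocity x hx s (hsub i hi s hs)) ?_ hs
    rw [(hΘ _).zero x hj.2, (hΘ i).zero x hx]
  have hconst : ∀ x ∉ K, ∀ s ∈ Ioo (-e) e, Ψ (s, x) = x := by
    intro x hx s hs
    by_cases h : ∃ i : K, i ∈ t ∧ x ∈ U i
    · obtain ⟨i, hi, hxi⟩ := h
      rw [hloc i hi x hxi s hs]
      refine eqOn_of_hasVelocity hV h0 (γ := fun s => Θ i (s, x)) (γ' := fun _ => x)
        (fun s hs => hΘi i x hxi s (hsub i hi s hs))
        (fun s hs => (hΘ i).velocity x hxi s (hsub i hi s hs))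
        (fun s _ => hasVelocity_const (hKV x hx) s) ?_ hs
      exact (hΘ i).zero x hxi
    · exact dif_neg h
  have hcov : ∀ x ∈ K, ∃ i ∈ t, x ∈ U i := fun x hx => by
    obtain ⟨i, hi, h⟩ := mem_iUnion₂.1 (ht hx)
    exact ⟨i, hi, h⟩
  have hzero : ∀ x, Ψ (0, x) = x := by
    intro x
    by_cases hx : x ∈ K
    · obtain ⟨i, hi, hxi⟩ := hcov x hx
      rw [hloc i hi x hxi 0 h0, (hΘ i).zero x hxi]
    · exact hconst x hx 0 h0
  have hvel : ∀ x, ∀ s ∈ Ioo (-e) e, HasVelocity I V (fun r => Ψ (r, x)) s := by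
    intro x s hs
    by_cases hx : x ∈ K
    · obtain ⟨i, hi, hxi⟩ := hcov x hx
      refine ((hΘ i).velocity x hxi s (hsub i hi s hs)).congr ?_
      filter_upwards [Ioo_mem_nhds hs.1 hs.2] with r hr using hloc i hi x hxi r hr
    · refine (hasVelocity_const (hKV x hx) s).congr ?_
      filter_upwards [Ioo_mem_nhds hs.1 hs.2] with r hr using hconst x hx r hr
  refine ⟨e, he0, Ψ, ⟨?_, fun x _ => hzero x, fun x _ => hvel x⟩, hconst, ?_⟩
  · rintro ⟨s, x⟩ ⟨hs, -⟩
    apply ContMDiffAt.contMDiffWithinAt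
    by_cases hx : x ∈ K
    · obtain ⟨i, hi, hxi⟩ := hcov x hx
      have hn : Ioo (-e) e ×ˢ U i ∈ 𝓝 (s, x) :=
        prod_mem_nhds (Ioo_mem_nhds hs.1 hs.2) ((hUo i).mem_nhds hxi)
      have h1 := (hΘ i).smooth.contMDiffAt (x := (s, x))
        (mem_of_superset hn (prod_mono_left fun s hs => hsub i hi s hs))
      refine h1.congr_of_eventuallyEq ?_
      filter_upwards [hn] with q hq using hloc i hi q.2 hq.2 q.1 hq.1
    · refine (contMDiff_snd.contMDiffAt (x := (s, x))).congr_of_eventuallyEq ?_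
      filter_upwards [prod_mem_nhds (Ioo_mem_nhds hs.1 hs.2)
        (hK.isClosed.isOpen_compl.mem_nhds hx)] with q hq using hconst q.2 hq.2 q.1 hq.1
  · intro x s hs
    have hns : -s ∈ Ioo (-e) e := ⟨by linarith [hs.2], by linarith [hs.1]⟩
    by_cases hx : x ∈ K
    · obtain ⟨i, hi, hxi⟩ := hcov x hx
      have hmem : ∀ σ ∈ Ioo (max (-e) (-e - s)) (min e (e - s)),
          σ ∈ Ioo (-e) e ∧ σ + s ∈ Ioo (-e) e := fun σ hσ => by
        have h1 := max_lt_iff.1 hσ.1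
        have h2 := lt_min_iff.1 hσ.2
        exact ⟨⟨h1.1, h2.1⟩, by linarith [h1.2], by linarith [h2.2]⟩
      have h2 : EqOn (fun σ => Ψ (σ + s, x)) (fun σ => Ψ (σ, Ψ (s, x)))
          (Ioo (max (-e) (-e - s)) (min e (e - s))) := by
        refine eqOn_of_hasVelocity hV ⟨max_lt (by linarith) (by linarith [hs.1]),
          lt_min he0 (by linarith [hs.2])⟩ (fun σ hσ => ?_)
          (fun σ hσ => (hvel x _ (hmem σ hσ).2).comp_add) (fun σ hσ => hvel _ σ (hmem σ hσ).1) ?_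
        · rw [hloc i hi x hxi _ (hmem σ hσ).2]
          exact hΘi i x hxi _ (hsub i hi _ (hmem σ hσ).2)
        · simp only [zero_add, hzero]
      have h3 := h2 (x := -s) ⟨max_lt (by linarith [hs.2]) (by linarith),
        lt_min (by linarith [hs.1]) (by linarith)⟩
      simp only [neg_add_cancel, hzero] at h3
      exact h3.symm
    · rw [hconst x hx s hs, hconst x hx (-s) hns]

end VectorFields

section AreaDual

variable {S : Type*} [TopologicalSpace S] [ChartedSpace (EuclideanHalfSpace 2) S]

theorem app2_eq_mul (β : Form (𝓡∂ 2) S 2) (x : S) (v w : Plane) :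
    β.app2 x v w = (v 0 * w 1 - v 1 * w 0) * β.app2 x e₀ e₁ :=
  alternating_two_apply _ v w

theorem AreaForm.app2_ne_zero (Ω : AreaForm S) (x : S) : Ω.form.app2 x e₀ e₁ ≠ 0 := fun h =>
  Ω.ne_zero x (alternating_two_ext (τ := 0) h)

theorem AreaForm.eq_of_app2 (Ω : AreaForm S) {x : S} {u u' : Plane}
    (h : ∀ v, Ω.form.app2 x u v = Ω.form.app2 x u' v) : u = u' := by
  have hw := Ω.app2_ne_zero x
  have h0 := h e₀
  have h1 := h e₁
  rw [app2_eq_mul, app2_eq_mul _ _ u'] at h0 h1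
  have h0' := mul_right_cancel₀ hw h0
  have h1' := mul_right_cancel₀ hw h1
  simp only [e₀, e₁, pt_zero, pt_one] at h0' h1'
  ext i
  fin_cases i
  · change u 0 = u' 0; linarith
  · change u 1 = u' 1; linarith

/-- The vertical vector field on `ℝ × S` dual to (minus) the vertical part of `κ` with respect to
the area form. -/
def verticalDual (Ω : AreaForm S) (κ : Form CylModel (ℝ × S) 1) (z : ℝ × S) : Plane :=
  (Ω.form.app2 z.2 e₀ e₁)⁻¹ • pt (-(κ.app1 z (0, e₁))) (κ.app1 z (0, e₀))

theorem app1_vertical (κ : Form CylModel (ℝ × S) 1) (z : ℝ × S) (v : Plane) :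
    κ.app1 z (0, v) = v 0 * κ.app1 z (0, e₀) + v 1 * κ.app1 z (0, e₁) := by
  have h : ((0 : ℝ), v) = v 0 • ((0 : ℝ), e₀) + v 1 • ((0 : ℝ), e₁) := by
    ext1
    · simp
    · exact eq_smul_add_smul v
  rw [h, Form.app1_add, Form.app1_smul, Form.app1_smul]

theorem app2_verticalDual (Ω : AreaForm S) (κ : Form CylModel (ℝ × S) 1) (z : ℝ × S) (v : Plane) :
    Ω.form.app2 z.2 (verticalDual Ω κ z) v = -κ.app1 z (0, v) := by
  have hw := Ω.app2_ne_zero z.2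
  rw [verticalDual, Form.app2_smul_left, app2_eq_mul _ _ (pt _ _), pt_zero, pt_one, app1_vertical κ z v]
  field_simp
  ring

theorem verticalDual_eq_zero {Ω : AreaForm S} {κ : Form CylModel (ℝ × S) 1} {z : ℝ × S}
    (h : ∀ v, κ.app1 z (0, v) = 0) : verticalDual Ω κ z = 0 := by
  refine Ω.eq_of_app2 (x := z.2) fun v => ?_
  rw [app2_verticalDual, h, Form.app2_zero_left, neg_zero]

variable [IsManifold (𝓡∂ 2) ∞ S]

theorem inChart_apply_two (β : Form (𝓡∂ 2) S 2) (x₀ : S) (y v w : Plane) :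
    Form.inChart β x₀ y ![v, w] = β.app2 ((extChartAt (𝓡∂ 2) x₀).symm y)
      (symmDeriv (𝓡∂ 2) x₀ y v) (symmDeriv (𝓡∂ 2) x₀ y w) := by
  refine congrArg (show Plane [⋀^Fin 2]→L[ℝ] ℝ from β _) ?_
  ext i; fin_cases i <;> rfl

theorem symmDeriv_surjective {x₀ : S} {y : Plane} (hy : y ∈ (extChartAt (𝓡∂ 2) x₀).target) :
    Function.Surjective (symmDeriv (𝓡∂ 2) x₀ y) := fun v =>
  ⟨_, tmap_symm_fieldInChart (I := 𝓡∂ 2) (fun _ : S => v) hy⟩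

theorem AreaForm.inChart_ne_zero (Ω : AreaForm S) {x₀ : S} {y : Plane}
    (hy : y ∈ (extChartAt (𝓡∂ 2) x₀).target) : Form.inChart Ω.form x₀ y ![e₀, e₁] ≠ 0 := by
  intro h
  obtain ⟨v, hv⟩ := symmDeriv_surjective hy e₀
  obtain ⟨w, hw⟩ := symmDeriv_surjective hy e₁
  have h1 := alternating_two_apply (Form.inChart Ω.form x₀ y) v w
  rw [h, mul_zero, inChart_apply_two, hv, hw] at h1
  exact Ω.app2_ne_zero _ h1

theorem isSmoothField_verticalDual (Ω : AreaForm S) {κ : Form CylModel (ℝ × S) 1}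
    (hκ : Form.IsSmooth κ) : IsSmoothField CylModel (fun z => ((0 : ℝ), verticalDual Ω κ z)) := by
  rintro ⟨t₀, x₀⟩
  set V : ℝ × S → ℝ × Plane := fun z => ((0 : ℝ), verticalDual Ω κ z) with hV
  set T := (extChartAt CylModel ((t₀, x₀) : ℝ × S)).target with hT
  have hT2 : ∀ p ∈ T, p.2 ∈ (extChartAt (𝓡∂ 2) x₀).target := fun p hp =>
    mem_extChartAt_cylinder_target.1 hp
  set W : ℝ × Plane → ℝ := fun p => Form.inChart Ω.form x₀ p.2 ![e₀, e₁] with hW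
  set κ' : Plane → ℝ × Plane → ℝ := fun v p => Form.inChart κ (t₀, x₀) p ![(0, v)] with hκ'
  have hWs : ContDiffOn ℝ ∞ W T :=
    ContDiffOn.comp (contDiffOn_alternating_iff.1 (Ω.smooth x₀) ![e₀, e₁]) contDiff_snd.contDiffOn hT2
  have hκs : ∀ v, ContDiffOn ℝ ∞ (κ' v) T := fun v => contDiffOn_alternating_iff.1 (hκ (t₀, x₀)) _
  have hW0 : ∀ p ∈ T, W p ≠ 0 := fun p hp => Ω.inChart_ne_zero (hT2 p hp)
  have key : ContDiffOn ℝ ∞ (fun p => ((0 : ℝ), pt (-(κ' e₁ p) / W p) (κ' e₀ p / W p))) T :=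
    contDiffOn_const.prodMk (contDiff_pt ((hκs e₁).neg.div hWs hW0) ((hκs e₀).div hWs hW0))
  refine key.congr fun p hp => ?_
  set u := fieldInChart CylModel V (t₀, x₀) p with hu
  have h1 : (u.1, symmDeriv (𝓡∂ 2) x₀ p.2 u.2) =
      V ((extChartAt CylModel ((t₀, x₀) : ℝ × S)).symm p) :=
    (mfderivWithin_symm_cylinder (t := t₀) (hT2 p hp) u).symm.trans
      (tmap_symm_fieldInChart (I := CylModel) V hp)
  have h0 : (extChartAt CylModel ((t₀, x₀) : ℝ × S)).symm p =
      (p.1, (extChartAt (𝓡∂ 2) x₀).symm p.2) := by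
    rw [extChartAt_cylinder]; rfl
  rw [h0] at h1
  have h2 : u.1 = 0 := congrArg Prod.fst h1
  have h3 : symmDeriv (𝓡∂ 2) x₀ p.2 u.2 = verticalDual Ω κ (p.1, (extChartAt (𝓡∂ 2) x₀).symm p.2) :=
    congrArg Prod.snd h1
  have h4 : ∀ v, (u.2 0 * v 1 - u.2 1 * v 0) * W p = -κ' v p := by
    intro v
    have h5 := inChart_apply_two Ω.form x₀ p.2 u.2 v
    rw [h3, app2_verticalDual Ω κ (p.1, (extChartAt (𝓡∂ 2) x₀).symm p.2), alternating_two_apply] at h5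
    rw [hκ']
    simp only
    rw [inChart_cylinder_apply κ (hT2 p hp)]
    exact h5
  have h5 := h4 e₀
  have h6 := h4 e₁
  simp only [e₀, e₁, pt_zero, pt_one] at h5 h6
  ext1
  · exact h2
  · rw [← pt_eta u.2]
    have hw := hW0 p hp
    congr 1
    · rw [eq_div_iff hw]; simp only [e₁]; linarith
    · rw [eq_div_iff hw]; simp only [e₀]; linarith

end AreaDual

section Shear

variable {S : Type*} [TopologicalSpace S] [ChartedSpace (EuclideanHalfSpace 2) S]
  [IsManifold (𝓡∂ 2) ∞ S]

/-- `T` is a level preserving diffeomorphism of `ℝ × S` with inverse `T'` and support in `K`; on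
vertical vectors it preserves `κ` and changes `λ` by `-c κ + dC`. -/
structure IsShear (lam : Form (𝓡∂ 2) S 1) (κ : Form CylModel (ℝ × S) 1) (K : Set (ℝ × S)) (c : ℝ)
    (T T' : ℝ × S → ℝ × S) (C : ℝ × S → ℝ) : Prop where
  smooth : ContMDiff CylModel CylModel ∞ T
  smooth_symm : ContMDiff CylModel CylModel ∞ T'
  left_inv : ∀ z, T' (T z) = z
  right_inv : ∀ z, T (T' z) = z
  fst : ∀ z, (T z).1 = z.1
  smooth_potential : ContMDiff CylModel 𝓘(ℝ, ℝ) ∞ C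
  eq_self : ∀ z ∉ K, T z = z
  potential_eq_zero : ∀ z ∉ K, C z = 0
  app1_form : ∀ z v, κ.app1 (T z) (tmap CylModel CylModel T z (0, v)) = κ.app1 z (0, v)
  app1_primitive : ∀ z v, lam.app1 (T z).2 (tmap CylModel CylModel T z (0, v)).2 =
    lam.app1 z.2 v - c * κ.app1 z (0, v) + tmap CylModel 𝓘(ℝ, ℝ) C z (0, v)

theorem tmap_fst_of_level {T : ℝ × S → ℝ × S} {z : ℝ × S}
    (hT : MDifferentiableAt CylModel CylModel T z) (h : ∀ z, (T z).1 = z.1) (v : ℝ × Plane) :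
    (tmap CylModel CylModel T z v).1 = v.1 := by
  have h1 := tmap_comp (f := T) (g := fun z : ℝ × S => z.1) (x := z) (K := 𝓘(ℝ, ℝ))
    mdifferentiableAt_fst hT v
  rw [tmap_fst] at h1
  rw [← h1]
  simp only [h]
  exact tmap_fst z v

theorem tmap_vertical_of_level {T : ℝ × S → ℝ × S} {z : ℝ × S}
    (hT : MDifferentiableAt CylModel CylModel T z) (h : ∀ z, (T z).1 = z.1) (v : Plane) :
    tmap CylModel CylModel T z (0, v) = (0, (tmap CylModel CylModel T z (0, v)).2) :=
  Prod.ext (tmap_fst_of_level hT h _) rfl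

theorem isShear_id (lam : Form (𝓡∂ 2) S 1) (κ : Form CylModel (ℝ × S) 1) (K : Set (ℝ × S)) :
    IsShear lam κ K 0 (fun z => z) (fun z => z) (fun _ => 0) where
  smooth := contMDiff_id
  smooth_symm := contMDiff_id
  left_inv _ := rfl
  right_inv _ := rfl
  fst _ := rfl
  smooth_potential := contMDiff_const
  eq_self _ _ := rfl
  potential_eq_zero _ _ := rfl
  app1_form z v := by rw [tmap_id]
  app1_primitive z v := by rw [tmap_id, tmap_const]; ring

theorem IsShear.comp {lam : Form (𝓡∂ 2) S 1} {κ : Form CylModel (ℝ × S) 1} {K : Set (ℝ × S)}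
    {c d : ℝ} {T T' R R' : ℝ × S → ℝ × S} {C D : ℝ × S → ℝ} (hT : IsShear lam κ K c T T' C)
    (hR : IsShear lam κ K d R R' D) :
    IsShear lam κ K (c + d) (fun z => T (R z)) (fun z => R' (T' z)) (fun z => D z + C (R z)) := by
  have hRd := hR.smooth.mdifferentiable (by simp)
  have htmap : ∀ z v, tmap CylModel CylModel (fun z => T (R z)) z (0, v) =
      tmap CylModel CylModel T (R z) (0, (tmap CylModel CylModel R z (0, v)).2) := fun z v => by
    rw [tmap_comp (f := R) (g := T) (hT.smooth.mdifferentiable (by simp) _) (hRd z),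
      tmap_vertical_of_level (hRd z) hR.fst]
  refine ⟨hT.smooth.comp hR.smooth, hR.smooth_symm.comp hT.smooth_symm,
    fun z => by rw [hT.left_inv, hR.left_inv], fun z => by rw [hR.right_inv, hT.right_inv],
    fun z => by rw [hT.fst, hR.fst],
    hR.smooth_potential.add (hT.smooth_potential.comp hR.smooth), fun z hz => ?_, fun z hz => ?_,
    fun z v => ?_, fun z v => ?_⟩
  · rw [hR.eq_self z hz, hT.eq_self z hz]
  · rw [hR.eq_self z hz, hR.potential_eq_zero z hz, hT.potential_eq_zero z hz, add_zero]
  · rw [htmap, hT.app1_form, ← tmap_vertical_of_level (hRd z) hR.fst, hR.app1_form]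
  · have h1 : tmap CylModel 𝓘(ℝ, ℝ) (fun z => D z + C (R z)) z (0, v) =
        tmap CylModel 𝓘(ℝ, ℝ) D z (0, v) + tmap CylModel 𝓘(ℝ, ℝ) C (R z)
          (0, (tmap CylModel CylModel R z (0, v)).2) := by
      rw [tmap_add (f := D) (g := fun z => C (R z)) (hR.smooth_potential.mdifferentiable (by simp) z)
        ((hT.smooth_potential.comp hR.smooth).mdifferentiable (by simp) z),
        tmap_comp (f := R) (g := C) (hT.smooth_potential.mdifferentiable (by simp) _) (hRd z),
        ← tmap_vertical_of_level (hRd z) hR.fst]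
    rw [htmap, hT.app1_primitive, h1, hR.app1_primitive, ← tmap_vertical_of_level (hRd z) hR.fst,
      hR.app1_form]
    ring

theorem isInteriorPoint_cylinder {z : ℝ × S} (hz : (𝓡∂ 2).IsInteriorPoint z.2) :
    CylModel.IsInteriorPoint z := by
  have h : z ∈ CylModel.interior (ℝ × S) := by
    rw [ModelWithCorners.interior_prod]
    exact ⟨BoundarylessManifold.isInteriorPoint, hz⟩
  exact h

variable [T2Space S]

theorem exists_isShear_small (Ω : AreaForm S) {lam : Form (𝓡∂ 2) S 1} (hlam : Form.IsSmooth lam)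
    (hd : Form.d lam = Ω.form) {κ : Form CylModel (ℝ × S) 1} (hκ : Form.IsSmooth κ)
    (hκd : ∀ z v w, (Form.d κ).app2 z (0, v) (0, w) = 0) {K : Set (ℝ × S)} (hK : IsCompact K)
    (hKi : ∀ z ∈ K, (𝓡∂ 2).IsInteriorPoint z.2) (hκK : ∀ z ∉ K, ∀ v, κ.app1 z (0, v) = 0) :
    ∃ ε > 0, ∀ c, 0 ≤ c → c < ε → ∃ T T' C, IsShear lam κ K c T T' C := by
  set V : ℝ × S → ℝ × Plane := fun z => ((0 : ℝ), verticalDual Ω κ z) with hV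
  have hVK : ∀ z ∉ K, V z = 0 := fun z hz => by
    simp only [hV, verticalDual_eq_zero (hκK z hz), Prod.mk_zero_zero]
  obtain ⟨ε, hε, Θ, hΘ, hΘK, hΘi⟩ := exists_isFlowOn_univ (isSmoothField_verticalDual Ω hκ) hK
    (fun z hz => isInteriorPoint_cylinder (hKi z hz)) hVK
  refine ⟨ε, hε, fun c hc hcε => ?_⟩
  set ρ : ℝ → ℝ := fun s => c * Real.smoothTransition s with hρ
  have hρs : ContDiff ℝ ∞ ρ := contDiff_const.mul Real.smoothTransition.contDiff
  have hρm : ∀ s, ρ s ∈ Ioo (-ε) ε := fun s =>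
    ⟨by have := mul_nonneg hc (Real.smoothTransition.nonneg s); simp only [hρ]; linarith,
      by have := mul_le_mul_of_nonneg_left (Real.smoothTransition.le_one s) hc
         simp only [hρ]; linarith⟩
  have hρ0 : ρ 0 = 0 := by simp [hρ]
  have hρ1 : ρ 1 = c := by simp [hρ]
  set Ψ : ℝ × (ℝ × S) → ℝ × S := fun p => Θ (ρ p.1, p.2) with hΨ
  have hΨs : ContMDiff (𝓘(ℝ, ℝ).prod CylModel) CylModel ∞ Ψ := by
    have h1 : ContMDiff (𝓘(ℝ, ℝ).prod CylModel) (𝓘(ℝ, ℝ).prod CylModel) ∞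
        (fun p : ℝ × (ℝ × S) => (ρ p.1, p.2)) :=
      (hρs.contMDiff.comp contMDiff_fst).prodMk contMDiff_snd
    exact fun p => (hΘ.smooth.contMDiffAt (prod_mem_nhds (isOpen_Ioo.mem_nhds (hρm p.1))
      univ_mem)).comp p (h1 p)
  have hΨt : ∀ s z, tmap 𝓘(ℝ, ℝ) CylModel (fun r => Ψ (r, z)) s 1 = deriv ρ s • V (Ψ (s, z)) := by
    intro s z
    have h1 : HasMFDerivAt 𝓘(ℝ, ℝ) CylModel (fun r => Θ (r, z)) (ρ s) ((1 : ℝ →L[ℝ] ℝ).smulRight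
      (show TangentSpace CylModel (Θ (ρ s, z)) from V (Θ (ρ s, z)))) :=
      hΘ.velocity z trivial (ρ s) (hρm s)
    have h2 : HasMFDerivAt 𝓘(ℝ, ℝ) 𝓘(ℝ, ℝ) ρ s ((1 : ℝ →L[ℝ] ℝ).smulRight (deriv ρ s)) :=
      ((hρs.differentiable (by simp)) s).hasDerivAt.hasFDerivAt.hasMFDerivAt
    have h3 := (HasMFDerivAt.comp (f := ρ) (g := fun r => Θ (r, z)) s h1 h2).mfderiv
    refine (congrArg (fun A : ℝ →L[ℝ] ℝ × Plane => A 1) h3).trans ?_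
    change ((1 : ℝ) * deriv ρ s) • V (Θ (ρ s, z)) = _
    rw [one_mul]
  have hΨ1 : ∀ s z, (Ψ (s, z)).1 = z.1 := by
    intro s z
    have h1 : ∀ r, HasDerivAt (fun r => (Ψ (r, z)).1) 0 r := by
      intro r
      have hm : MDifferentiableAt 𝓘(ℝ, ℝ) CylModel (fun r => Ψ (r, z)) r :=
        (hΨs.comp (contMDiff_id.prodMk contMDiff_const)).mdifferentiable (by simp) r
      have h2 := tmap_comp (f := fun r => Ψ (r, z)) (g := fun z : ℝ × S => z.1) (x := r)
        (K := 𝓘(ℝ, ℝ)) mdifferentiableAt_fst hm 1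
      rw [tmap_fst, hΨt] at h2
      have h3 : MDifferentiableAt 𝓘(ℝ, ℝ) 𝓘(ℝ, ℝ) (fun r => (Ψ (r, z)).1) r :=
        mdifferentiableAt_fst.comp r hm
      have h4 := h3.differentiableAt.hasDerivAt
      have h5 : deriv (fun r => (Ψ (r, z)).1) r = 0 := by
        have h6 : tmap 𝓘(ℝ, ℝ) 𝓘(ℝ, ℝ) (fun r => (Ψ (r, z)).1) r 1 =
            fderiv ℝ (fun r => (Ψ (r, z)).1) r 1 := by
          rw [tmap, mfderiv_eq_fderiv]
        rw [← fderiv_apply_one_eq_deriv, ← h6, h2]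
        simp [hV]
      rwa [h5] at h4
    have h2 := is_const_of_deriv_eq_zero (fun r => (h1 r).differentiableAt) (fun r => (h1 r).deriv) s 0
    rw [h2]
    simp only [hΨ, hρ0, hΘ.zero z trivial]
  have hΨ0 : ∀ z, Ψ (0, z) = z := fun z => by simp only [hΨ, hρ0, hΘ.zero z trivial]
  have hΨss : ∀ s, ContMDiff CylModel CylModel ∞ (fun z => Ψ (s, z)) := fun s =>
    hΨs.comp (contMDiff_const.prodMk contMDiff_id)
  have hκΨ : ∀ s z v, κ.app1 (Ψ (s, z)) (tmap CylModel CylModel (fun z => Ψ (s, z)) z (0, v)) =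
      κ.app1 z (0, v) := by
    intro s z v
    have h1 := homotopy_formula (hκ.pullback hΨs) s z (0, v) (g := fun _ => 0) continuous_const
      (fun r => by
        rw [app2_d_pullback_time hΨs hκ, hΨt, Form.app2_smul_left,
          tmap_vertical_of_level ((hΨss r).mdifferentiable (by simp) _) (hΨ1 r), hκd, mul_zero])
    have h2 : timeComponent (pullback (I := 𝓘(ℝ, ℝ).prod CylModel) Ψ κ) = fun _ => 0 := by
      funext p
      rw [timeComponent, app1_pullback, tmap_time (hΨs.mdifferentiable (by simp) _), hΨt,
        Form.app1_smul]
      have h3 := app2_verticalDual Ω κ (Ψ (p.1, p.2)) (verticalDual Ω κ (Ψ (p.1, p.2)))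
      rw [Form.app2_self] at h3
      have h4 : κ.app1 (Ψ (p.1, p.2)) (V (Ψ (p.1, p.2))) = 0 := by linarith
      exact (congrArg (fun t => deriv ρ p.1 * t) h4).trans (mul_zero _)
    have h3 : (timeIntegral fun _ : ℝ × (ℝ × S) => (0 : ℝ)) = fun _ => 0 := by
      funext p; simp [timeIntegral]
    rw [h2, h3, app1_differential, tmap_const, app1_pullback_slice hΨs, app1_pullback_slice hΨs,
      app1_pullback, app1_pullback, intervalIntegral.integral_zero] at h1
    simp only [hΨ0, tmap_id] at h1
    linarith
  set μ : Form CylModel (ℝ × S) 1 := pullback (I := CylModel) (fun z : ℝ × S => z.2) lam with hμ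
  have hμs : Form.IsSmooth μ := hlam.pullback contMDiff_snd
  have hμ1 : ∀ z v, μ.app1 z v = lam.app1 z.2 v.2 := fun z v => by
    rw [hμ, app1_pullback, tmap_snd]
  have hμd : ∀ z v w, (Form.d μ).app2 z v w = Ω.form.app2 z.2 v.2 w.2 := fun z v w => by
    have h1 : Form.d μ = pullback (I := CylModel) (fun z : ℝ × S => z.2) (Form.d lam) :=
      funext fun z => Form.d_pullback (hlam.smoothAt _) (contMDiff_snd z)
    rw [h1, hd, app2_pullback, tmap_snd, tmap_snd]
  clear_value μ
  set ν := pullback (I := 𝓘(ℝ, ℝ).prod CylModel) Ψ μ with hν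
  have hνs : Form.IsSmooth ν := hμs.pullback hΨs
  have hA : ContMDiff (𝓘(ℝ, ℝ).prod CylModel) 𝓘(ℝ, ℝ) ∞ (timeIntegral (timeComponent ν)) :=
    contMDiff_timeIntegral fun p => contMDiffAt_timeComponent (hνs.smoothAt p)
  refine ⟨fun z => Ψ (1, z), fun z => Θ (-c, z), fun z => timeIntegral (timeComponent ν) (1, z),
    hΨss 1, ?_, fun z => ?_, fun z => ?_, hΨ1 1, hA.comp (contMDiff_const.prodMk contMDiff_id),
    fun z hz => hΘK z hz _ (hρm 1), fun z hz => ?_, hκΨ 1, fun z v => ?_⟩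
  · exact fun z => (hΘ.smooth.contMDiffAt (prod_mem_nhds (isOpen_Ioo.mem_nhds
      ⟨by linarith, by linarith⟩) univ_mem)).comp z
      ((contMDiff_const.prodMk contMDiff_id : ContMDiff CylModel (𝓘(ℝ, ℝ).prod CylModel) ∞
        (fun z : ℝ × S => (-c, z))) z)
  · change Θ (-c, Θ (ρ 1, z)) = z
    rw [hρ1]
    exact hΘi z c ⟨by linarith, hcε⟩
  · change Θ (ρ 1, Θ (-c, z)) = z
    have := hΘi z (-c) ⟨by linarith, by linarith⟩
    rw [neg_neg] at this
    rw [hρ1, this]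
  · have h1 : ∀ r, timeComponent ν (r, z) = 0 := by
      intro r
      rw [timeComponent, hν, app1_pullback, tmap_time (hΨs.mdifferentiable (by simp) _), hΨt]
      have h2 : Ψ (r, z) = z := hΘK z hz _ (hρm r)
      rw [h2, hVK z hz, smul_zero, Form.app1_zero]
    simp [timeIntegral, h1]
  · have hg : ∀ r, (Form.d ν).app2 (r, z) (1, 0) (0, (0, v)) = -(deriv ρ r * κ.app1 z (0, v)) := by
      intro r
      rw [hν, app2_d_pullback_time hΨs hμs, hΨt, Form.app2_smul_left, hμd]
      have h1 := app2_verticalDual Ω κ (Ψ (r, z))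
        (tmap CylModel CylModel (fun z => Ψ (r, z)) z (0, v)).2
      rw [← tmap_vertical_of_level ((hΨss r).mdifferentiable (by simp) _) (hΨ1 r), hκΨ] at h1
      rw [neg_mul_eq_mul_neg]
      exact congrArg (fun t => deriv ρ r * t) h1
    have hc' : Continuous (deriv ρ) := hρs.continuous_deriv (by simp)
    have h1 := homotopy_formula hνs 1 z (0, v)
      (g := fun r => -(deriv ρ r * κ.app1 z (0, v))) (hc'.mul continuous_const).neg hg
    rw [app1_differential, tmap_slice (hA.mdifferentiable (by simp) _), hν,
      app1_pullback_slice hΨs, app1_pullback_slice hΨs, app1_pullback, app1_pullback, hμ1, hμ1,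
      intervalIntegral.integral_neg, intervalIntegral.integral_mul_const,
      intervalIntegral.integral_deriv_eq_sub (fun r _ => (hρs.differentiable (by simp)) r)
        (hc'.intervalIntegrable _ _), hρ0, hρ1] at h1
    simp only [hΨ0, tmap_id] at h1
    rw [h1]
    ring

/-- The flow of the vertical vector field dual to a vertically closed one-form with compact
support. -/
theorem exists_isShear (Ω : AreaForm S) {lam : Form (𝓡∂ 2) S 1} (hlam : Form.IsSmooth lam)
    (hd : Form.d lam = Ω.form) {κ : Form CylModel (ℝ × S) 1} (hκ : Form.IsSmooth κ)
    (hκd : ∀ z v w, (Form.d κ).app2 z (0, v) (0, w) = 0) {K : Set (ℝ × S)} (hK : IsCompact K)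
    (hKi : ∀ z ∈ K, (𝓡∂ 2).IsInteriorPoint z.2) (hκK : ∀ z ∉ K, ∀ v, κ.app1 z (0, v) = 0) :
    ∃ T T' C, IsShear lam κ K 1 T T' C := by
  obtain ⟨ε, hε, h⟩ := exists_isShear_small Ω hlam hd hκ hκd hK hKi hκK
  obtain ⟨n, hn⟩ := exists_nat_one_div_lt hε
  obtain ⟨T, T', C, hT⟩ := h (1 / (n + 1)) (by positivity) hn
  have key : ∀ k : ℕ, ∃ T T' C, IsShear lam κ K (k * (1 / ((n : ℝ) + 1))) T T' C := by
    intro k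
    induction k with
    | zero => exact ⟨_, _, _, by simpa using isShear_id lam κ K⟩
    | succ k ih =>
      obtain ⟨R, R', D, hR⟩ := ih
      have := hT.comp hR
      rw [show 1 / ((n : ℝ) + 1) + k * (1 / ((n : ℝ) + 1)) =
        ((k + 1 : ℕ) : ℝ) * (1 / ((n : ℝ) + 1)) by push_cast; ring] at this
      exact ⟨_, _, _, this⟩
  obtain ⟨R, R', D, hR⟩ := key (n + 1)
  rw [show ((n + 1 : ℕ) : ℝ) * (1 / ((n : ℝ) + 1)) = 1 by push_cast; field_simp] at hR
  exact ⟨R, R', D, hR⟩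

end Shear

section Boundary

variable {S : Type*} [TopologicalSpace S] [ChartedSpace (EuclideanHalfSpace 2) S]

theorem mem_boundary_iff {x : S} :
    x ∈ (𝓡∂ 2).boundary S ↔ (extChartAt (𝓡∂ 2) x x : Plane) 0 = 0 := by
  change (𝓡∂ 2).IsBoundaryPoint x ↔ _
  rw [ModelWithCorners.isBoundaryPoint_iff, frontier_range_modelWithCornersEuclideanHalfSpace]
  exact eq_comm

theorem coord_nonneg {x₀ : S} {y : Plane} (hy : y ∈ (extChartAt (𝓡∂ 2) x₀).target) : 0 ≤ y 0 := by
  have := extChartAt_target_subset_range x₀ hy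
  rwa [range_halfPlane] at this

variable [IsManifold (𝓡∂ 2) ∞ S]

theorem target_mem_nhds_of_pos {x₀ : S} {y : Plane} (hy : y ∈ (extChartAt (𝓡∂ 2) x₀).target)
    (h : 0 < y 0) : (extChartAt (𝓡∂ 2) x₀).target ∈ 𝓝 y := by
  have h1 : (extChartAt (𝓡∂ 2) x₀).target ∈ 𝓝[range (𝓡∂ 2)] y :=
    eventually_mem_extChartAt_target hy
  have h2 : range (𝓡∂ 2) ∈ 𝓝 y := by
    rw [range_halfPlane]
    exact mem_of_superset ((isOpen_lt continuous_const
      (contDiff_coord (n := 0) 0).continuous).mem_nhds h) fun z hz => (show 0 < z 0 from hz).le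
  rwa [nhdsWithin_eq_nhds.2 h2] at h1

theorem not_mem_nhds_of_coord_eq_zero {x₀ : S} {y : Plane} (h : y 0 = 0) :
    (extChartAt (𝓡∂ 2) x₀).target ∉ 𝓝 y := by
  intro hn
  have h1 : Tendsto (fun s : ℝ => y + s • e₀) (𝓝 0) (𝓝 y) := by
    have : Continuous fun s : ℝ => y + s • e₀ := by fun_prop
    simpa using this.tendsto 0
  obtain ⟨ε, hε, hb⟩ := Metric.eventually_nhds_iff.1 (h1.eventually hn)
  have h2 := coord_nonneg (hb (y := -(ε / 2)) (by
    rw [Real.dist_eq, sub_zero, abs_neg, abs_of_pos (by linarith)]; linarith))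
  rw [add_smul_e₀, pt_zero, h] at h2
  linarith

theorem mem_boundary_iff_of_mem {x₀ x : S} (hx : x ∈ (extChartAt (𝓡∂ 2) x₀).source) :
    x ∈ (𝓡∂ 2).boundary S ↔ (extChartAt (𝓡∂ 2) x₀ x : Plane) 0 = 0 := by
  have ht := (extChartAt (𝓡∂ 2) x₀).map_source hx
  have h1 : (𝓡∂ 2).IsInteriorPoint x ↔ extChartAt (𝓡∂ 2) x₀ x ∈
      interior (extChartAt (𝓡∂ 2) x₀).target :=
    ModelWithCorners.isInteriorPoint_iff_of_mem_atlas (n := ∞) (by simp)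
      (chart_mem_atlas (EuclideanHalfSpace 2) x₀) (by rwa [extChartAt_source] at hx)
  rw [mem_interior_iff_mem_nhds] at h1
  change (𝓡∂ 2).IsBoundaryPoint x ↔ _
  rw [ModelWithCorners.isBoundaryPoint_iff_not_isInteriorPoint, h1]
  constructor
  · intro h
    by_contra h0
    exact h (target_mem_nhds_of_pos ht (lt_of_le_of_ne (coord_nonneg ht) (Ne.symm h0)))
  · exact fun h => not_mem_nhds_of_coord_eq_zero h

/-- The velocity of a curve in the boundary is tangent to the boundary. -/
theorem tmap_curve_boundary {γ : ℝ → S} {t : ℝ} (hγ : MDifferentiableAt 𝓘(ℝ, ℝ) (𝓡∂ 2) γ t)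
    (h : ∀ᶠ s in 𝓝 t, γ s ∈ (𝓡∂ 2).boundary S) (c : ℝ) :
    (tmap 𝓘(ℝ, ℝ) (𝓡∂ 2) γ t c) 0 = 0 := by
  have h1 : HasFDerivAt (fun s => (extChartAt (𝓡∂ 2) (γ t) (γ s) : Plane))
      (tmap 𝓘(ℝ, ℝ) (𝓡∂ 2) γ t) t := by
    have h2 : HasFDerivWithinAt (fun s => (extChartAt (𝓡∂ 2) (γ t) (γ s) : Plane))
      (tmap 𝓘(ℝ, ℝ) (𝓡∂ 2) γ t) (range 𝓘(ℝ, ℝ)) t := hγ.hasMFDerivAt.2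
    rwa [modelWithCornersSelf_coe, range_id, hasFDerivWithinAt_univ] at h2
  have h2 : HasDerivAt (fun s => (extChartAt (𝓡∂ 2) (γ t) (γ s) : Plane) 0)
      ((tmap 𝓘(ℝ, ℝ) (𝓡∂ 2) γ t 1) 0) t :=
    ((EuclideanSpace.proj (𝕜 := ℝ) (0 : Fin 2) : Plane →L[ℝ] ℝ).hasFDerivAt.comp t h1).hasDerivAt
  have h3 : (fun s => (extChartAt (𝓡∂ 2) (γ t) (γ s) : Plane) 0) =ᶠ[𝓝 t] fun _ => (0 : ℝ) := by
    filter_upwards [h, hγ.continuousAt.eventually (extChartAt_source_mem_nhds (I := 𝓡∂ 2) (γ t))]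
      with s hs hs'
    exact (mem_boundary_iff_of_mem hs').1 hs
  have h4 : (tmap 𝓘(ℝ, ℝ) (𝓡∂ 2) γ t 1) 0 = 0 :=
    h2.unique ((hasDerivAt_const t (0 : ℝ)).congr_of_eventuallyEq h3)
  have h5 : tmap 𝓘(ℝ, ℝ) (𝓡∂ 2) γ t c = c • tmap 𝓘(ℝ, ℝ) (𝓡∂ 2) γ t 1 := by
    rw [← map_smul, smul_eq_mul, mul_one]
  rw [h5, PiLp.smul_apply, h4, smul_zero]

theorem boundaryLine_eventually {x₀ : S} {y : Plane} (hy : y ∈ (extChartAt (𝓡∂ 2) x₀).target)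
    (h : y 0 = 0) : ∀ᶠ s in 𝓝 (0 : ℝ), y + s • e₁ ∈ (extChartAt (𝓡∂ 2) x₀).target := by
  have h1 : Tendsto (fun s : ℝ => y + s • e₁) (𝓝 0) (𝓝[range (𝓡∂ 2)] y) := by
    refine tendsto_nhdsWithin_iff.2 ⟨?_, Eventually.of_forall fun s => ?_⟩
    · have : Continuous fun s : ℝ => y + s • e₁ := by fun_prop
      simpa using this.tendsto 0
    · rw [range_halfPlane, add_smul_e₁]
      exact h.ge
  exact h1.eventually (eventually_mem_extChartAt_target hy)

theorem symm_mem_boundary {x₀ : S} {y : Plane} (hy : y ∈ (extChartAt (𝓡∂ 2) x₀).target)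
    (h : y 0 = 0) : (extChartAt (𝓡∂ 2) x₀).symm y ∈ (𝓡∂ 2).boundary S := by
  rw [mem_boundary_iff_of_mem ((extChartAt (𝓡∂ 2) x₀).map_target hy),
    (extChartAt (𝓡∂ 2) x₀).right_inv hy, h]

/-- The coordinate line in the boundary through a boundary point. -/
theorem hasMFDerivAt_boundaryLine {x₀ : S} {y : Plane} (hy : y ∈ (extChartAt (𝓡∂ 2) x₀).target)
    (h : y 0 = 0) :
    MDifferentiableAt 𝓘(ℝ, ℝ) (𝓡∂ 2) (fun s : ℝ => (extChartAt (𝓡∂ 2) x₀).symm (y + s • e₁)) 0 ∧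
      tmap 𝓘(ℝ, ℝ) (𝓡∂ 2) (fun s : ℝ => (extChartAt (𝓡∂ 2) x₀).symm (y + s • e₁)) 0 1 =
        symmDeriv (𝓡∂ 2) x₀ y e₁ := by
  have := isManifold_one (I := 𝓡∂ 2) (M := S)
  have h1 : HasMFDerivWithinAt 𝓘(ℝ, Plane) (𝓡∂ 2) (extChartAt (𝓡∂ 2) x₀).symm (range (𝓡∂ 2)) y
      (symmDeriv (𝓡∂ 2) x₀ y) := (mdifferentiableWithinAt_extChartAt_symm hy).hasMFDerivWithinAt
  have h2 : HasMFDerivWithinAt 𝓘(ℝ, ℝ) 𝓘(ℝ, Plane) (fun s : ℝ => y + s • e₁) univ 0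
      ((1 : ℝ →L[ℝ] ℝ).smulRight e₁) :=
    (((1 : ℝ →L[ℝ] ℝ).smulRight e₁).hasFDerivAt.const_add y).hasMFDerivAt.hasMFDerivWithinAt
  have h0 : y + (0 : ℝ) • e₁ = y := by simp
  have h1' : HasMFDerivWithinAt 𝓘(ℝ, Plane) (𝓡∂ 2) (extChartAt (𝓡∂ 2) x₀).symm (range (𝓡∂ 2))
      (y + (0 : ℝ) • e₁) (symmDeriv (𝓡∂ 2) x₀ (y + (0 : ℝ) • e₁)) := by rw [h0]; exact h1
  have h3 := HasMFDerivWithinAt.comp (f := fun s : ℝ => y + s • e₁)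
    (g := (extChartAt (𝓡∂ 2) x₀).symm) 0 h1' h2 (fun s _ => by
      rw [mem_preimage, range_halfPlane, add_smul_e₁]; exact h.ge)
  have h4 := hasMFDerivWithinAt_univ.1 h3
  refine ⟨h4.mdifferentiableAt, (congrArg (fun A : ℝ →L[ℝ] Plane => A 1) h4.mfderiv).trans ?_⟩
  change symmDeriv (𝓡∂ 2) x₀ (y + (0 : ℝ) • e₁) ((1 : ℝ) • e₁) = _
  rw [h0, one_smul]

theorem symmDeriv_boundary {x₀ : S} {y : Plane} (hy : y ∈ (extChartAt (𝓡∂ 2) x₀).target)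
    (h : y 0 = 0) : (symmDeriv (𝓡∂ 2) x₀ y e₁) 0 = 0 := by
  obtain ⟨h1, h2⟩ := hasMFDerivAt_boundaryLine hy h
  rw [← h2]
  refine tmap_curve_boundary h1 ?_ 1
  filter_upwards [boundaryLine_eventually hy h] with s hs
  exact symm_mem_boundary hs (by rw [add_smul_e₁]; exact h)

theorem symmDeriv_self (x : S) (v : Plane) :
    symmDeriv (𝓡∂ 2) x (extChartAt (𝓡∂ 2) x x) v = v := by
  have := isManifold_one (I := 𝓡∂ 2) (M := S)
  have h1 : mfderivWithin 𝓘(ℝ, Plane) (𝓡∂ 2) (extChartAt (𝓡∂ 2) x).symm (range (𝓡∂ 2))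
      (extChartAt (𝓡∂ 2) x x) = ContinuousLinearMap.id ℝ Plane := mfderivWithin_range_extChartAt_symm
  exact congrArg (fun A : Plane →L[ℝ] Plane => A v) h1

theorem eq_smul_e₁ {v : Plane} (h : v 0 = 0) : v = v 1 • e₁ := by
  have := eq_smul_add_smul v
  rwa [h, zero_smul, zero_add] at this

/-- A map preserving the boundary maps vectors tangent to the boundary to such vectors. -/
theorem tmap_boundary {ψ : S → S} {x : S} (hψ : MDifferentiableAt (𝓡∂ 2) (𝓡∂ 2) ψ x)
    (h : ∀ z ∈ (𝓡∂ 2).boundary S, ψ z ∈ (𝓡∂ 2).boundary S) (hx : x ∈ (𝓡∂ 2).boundary S)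
    {v : Plane} (hv : v 0 = 0) : (tmap (𝓡∂ 2) (𝓡∂ 2) ψ x v) 0 = 0 := by
  have hy := mem_extChartAt_target (I := 𝓡∂ 2) x
  have h0 := mem_boundary_iff.1 hx
  obtain ⟨h1, h2⟩ := hasMFDerivAt_boundaryLine hy h0
  rw [symmDeriv_self] at h2
  have hx0 : (extChartAt (𝓡∂ 2) x).symm (extChartAt (𝓡∂ 2) x x + (0 : ℝ) • e₁) = x := by
    rw [zero_smul, add_zero, extChartAt_to_inv]
  have hψ' : MDifferentiableAt (𝓡∂ 2) (𝓡∂ 2) ψ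
      ((extChartAt (𝓡∂ 2) x).symm (extChartAt (𝓡∂ 2) x x + (0 : ℝ) • e₁)) := by rwa [hx0]
  have h3 := tmap_comp (f := fun s : ℝ => (extChartAt (𝓡∂ 2) x).symm
    (extChartAt (𝓡∂ 2) x x + s • e₁)) (g := ψ) (x := 0) hψ' h1 1
  rw [h2, hx0] at h3
  rw [eq_smul_e₁ hv, map_smul, ← h3, PiLp.smul_apply, tmap_curve_boundary
    (γ := fun s : ℝ => ψ ((extChartAt (𝓡∂ 2) x).symm (extChartAt (𝓡∂ 2) x x + s • e₁)))
    (hψ'.comp 0 h1) ?_ 1,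
    smul_zero]
  filter_upwards [boundaryLine_eventually hy h0] with s hs
  exact h _ (symm_mem_boundary hs (by rw [add_smul_e₁]; exact h0))

theorem app2_tangent_boundary (β : Form (𝓡∂ 2) S 2) (x : S) {v w : Plane} (hv : v 0 = 0)
    (hw : w 0 = 0) : β.app2 x v w = 0 := by
  rw [app2_eq_mul, hv, hw]; ring

/-- The derivative of a function along a coordinate line in the boundary. -/
theorem hasDerivAt_boundaryLine {f : S → ℝ} (hf : ContMDiff (𝓡∂ 2) 𝓘(ℝ, ℝ) ∞ f)
    {x₀ : S} {y : Plane} (hy : y ∈ (extChartAt (𝓡∂ 2) x₀).target) (h : y 0 = 0) :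
    HasDerivAt (fun s : ℝ => f ((extChartAt (𝓡∂ 2) x₀).symm (y + s • e₁)))
      (tmap (𝓡∂ 2) 𝓘(ℝ, ℝ) f ((extChartAt (𝓡∂ 2) x₀).symm y) (symmDeriv (𝓡∂ 2) x₀ y e₁)) 0 := by
  obtain ⟨h1, h2⟩ := hasMFDerivAt_boundaryLine hy h
  have hfd := hf.mdifferentiable (by simp)
  have h3 := tmap_comp (f := fun s : ℝ => (extChartAt (𝓡∂ 2) x₀).symm (y + s • e₁)) (g := f) (x := 0)
    (hfd _) h1 1
  have hd : MDifferentiableAt 𝓘(ℝ, ℝ) 𝓘(ℝ, ℝ)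
      (fun s : ℝ => f ((extChartAt (𝓡∂ 2) x₀).symm (y + s • e₁))) 0 := (hfd _).comp 0 h1
  rw [h2, tmap, mfderiv_eq_fderiv] at h3
  simp only [zero_smul, add_zero] at h3
  rw [← h3]
  exact hd.differentiableAt.hasDerivAt

/-- A function whose derivative vanishes on vectors tangent to the boundary is locally constant on
the boundary. -/
theorem isLocallyConstant_boundary {f : S → ℝ} (hf : ContMDiff (𝓡∂ 2) 𝓘(ℝ, ℝ) ∞ f)
    (h : ∀ x ∈ (𝓡∂ 2).boundary S, ∀ v : Plane, v 0 = 0 → tmap (𝓡∂ 2) 𝓘(ℝ, ℝ) f x v = 0) :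
    IsLocallyConstant (fun x : (𝓡∂ 2).boundary S => f x) := by
  refine (IsLocallyConstant.iff_eventually_eq _).2 fun x₀ => ?_
  have hy := mem_extChartAt_target (I := 𝓡∂ 2) (x₀ : S)
  set y : Plane := extChartAt (𝓡∂ 2) (x₀ : S) x₀ with hyd
  have hy0 : y 0 = 0 := mem_boundary_iff.1 x₀.2
  obtain ⟨ε, hε, hb⟩ := Metric.mem_nhdsWithin_iff.1 (eventually_mem_extChartAt_target hy)
  have hline : ∀ s ∈ Ioo (-ε) ε, y + s • e₁ ∈ (extChartAt (𝓡∂ 2) (x₀ : S)).target := by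
    intro s hs
    refine hb ⟨?_, by rw [range_halfPlane, add_smul_e₁]; exact hy0.ge⟩
    have he : ‖e₁‖ = 1 := by simp [e₁, pt, EuclideanSpace.norm_eq]
    rw [Metric.mem_ball, dist_eq_norm, add_sub_cancel_left, norm_smul, he, mul_one, Real.norm_eq_abs]
    exact abs_lt.2 hs
  set g : ℝ → ℝ := fun s => f ((extChartAt (𝓡∂ 2) (x₀ : S)).symm (y + s • e₁)) with hg
  have hd : ∀ s ∈ Ioo (-ε) ε, HasDerivAt g 0 s := by
    intro s hs
    have h0 : (y + s • e₁) 0 = 0 := by rw [add_smul_e₁]; exact hy0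
    have h1 := hasDerivAt_boundaryLine hf (hline s hs) h0
    rw [h _ (symm_mem_boundary (hline s hs) h0) _ (symmDeriv_boundary (hline s hs) h0)] at h1
    rw [show (0 : ℝ) = s - s by ring] at h1
    have h2 := h1.comp_sub_const s s
    refine h2.congr_of_eventuallyEq (Eventually.of_forall fun r => ?_) |>.congr_deriv (by ring)
    simp only [hg, add_assoc, ← add_smul, add_sub_cancel]
  have hconst : ∀ s ∈ Ioo (-ε) ε, g s = g 0 := fun s hs =>
    isOpen_Ioo.is_const_of_deriv_eq_zero isPreconnected_Ioo
      (fun r hr => (hd r hr).differentiableAt.differentiableWithinAt) (fun r hr => (hd r hr).deriv)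
      hs ⟨by linarith, hε⟩
  have hcont : Continuous fun x : (𝓡∂ 2).boundary S => (x : S) := continuous_subtype_val
  have h1 : ∀ᶠ x in 𝓝 (x₀ : S), x ∈ (extChartAt (𝓡∂ 2) (x₀ : S)).source ∧
      (extChartAt (𝓡∂ 2) (x₀ : S) x : Plane) ∈ Metric.ball y ε :=
    (show ∀ᶠ x in 𝓝 (x₀ : S), x ∈ (extChartAt (𝓡∂ 2) (x₀ : S)).source from
      extChartAt_source_mem_nhds (x₀ : S)).and
      ((continuousAt_extChartAt (x₀ : S)).eventually (Metric.ball_mem_nhds y hε))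
  filter_upwards [hcont.continuousAt.eventually h1] with x hx
  have hx0 := (mem_boundary_iff_of_mem hx.1).1 x.2
  set w : Plane := extChartAt (𝓡∂ 2) (x₀ : S) x with hw
  have h2 : y + (w 1 - y 1) • e₁ = w := by
    rw [add_smul_e₁, hy0, ← hx0, ← pt_eta w, pt_zero, pt_one, add_sub_cancel]
  have h3 : w 1 - y 1 ∈ Ioo (-ε) ε := by
    rw [mem_Ioo, ← abs_lt]
    have h4 := (EuclideanSpace.norm_eq (w - y)).symm.le
    have h5 : ‖w - y‖ < ε := by rw [← dist_eq_norm]; exact hx.2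
    have h6 : ‖(w - y) 1‖ ≤ ‖w - y‖ := PiLp.norm_apply_le (w - y) 1
    exact lt_of_le_of_lt h6 h5
  have h4 := hconst _ h3
  simp only [hg, h2, zero_smul, add_zero] at h4
  rwa [hw, (extChartAt (𝓡∂ 2) (x₀ : S)).left_inv hx.1, hyd, extChartAt_to_inv] at h4

end Boundary

section PlanarCollar

/-- The retraction of the second factor of `ℝ × Plane` towards the boundary of the half plane. -/
def retraction (r : ℝ) (p : ℝ × Plane) : ℝ × Plane := (p.1, pt (r * p.2 0) (p.2 1))

theorem retraction_eq_sub (r : ℝ) (p : ℝ × Plane) :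
    retraction r p = p + (0, ((r - 1) * p.2 0) • e₀) := by
  ext1
  · simp [retraction]
  · change pt (r * p.2 0) (p.2 1) = p.2 + ((r - 1) * p.2 0) • e₀
    rw [add_smul_e₀]
    congr 1
    ring

/-- The primitive of `P dy₀ + Q dy₁` vanishing on the boundary of the half plane. -/
def collarPrimitive (P : ℝ × Plane → ℝ) (p : ℝ × Plane) : ℝ :=
  ∫ r in (0 : ℝ)..1, p.2 0 * P (retraction r p)

variable {D : Set (ℝ × Plane)} {P Q : ℝ × Plane → ℝ}

theorem contDiff_retraction :
    ContDiff ℝ ∞ (fun q : ℝ × (ℝ × Plane) => retraction q.1 q.2) := by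
  have h0 : ContDiff ℝ ∞ fun q : ℝ × (ℝ × Plane) => q.2.2 0 :=
    (contDiff_coord 0).comp (contDiff_snd.comp contDiff_snd)
  have h1 : ContDiff ℝ ∞ fun q : ℝ × (ℝ × Plane) => q.2.2 1 :=
    (contDiff_coord 1).comp (contDiff_snd.comp contDiff_snd)
  rw [← contDiffOn_univ] at h0 h1 ⊢
  exact (contDiff_fst.comp contDiff_snd).contDiffOn.prodMk
    (contDiff_pt (contDiff_fst.contDiffOn.mul h0) h1)

theorem contDiffOn_collarIntegrand (hDr : ∀ p ∈ D, ∀ r ∈ Icc (0 : ℝ) 1, retraction r p ∈ D)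
    (hP : ContDiffOn ℝ ∞ P D) :
    ContDiffOn ℝ ∞ (fun q : ℝ × (ℝ × Plane) => q.2.2 0 * P (retraction q.1 q.2)) (Icc 0 1 ×ˢ D) :=
  ((contDiff_coord 0).comp (contDiff_snd.comp contDiff_snd)).contDiffOn.mul
    (hP.comp contDiff_retraction.contDiffOn fun q hq => hDr q.2 hq.2 q.1 hq.1)

theorem contDiffOn_collarPrimitive (hD : Convex ℝ D) (hD' : UniqueDiffOn ℝ D)
    (hDr : ∀ p ∈ D, ∀ r ∈ Icc (0 : ℝ) 1, retraction r p ∈ D) (hP : ContDiffOn ℝ ∞ P D) :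
    ContDiffOn ℝ ∞ (collarPrimitive P) D :=
  contDiffOn_parametric_integral hD hD' (contDiffOn_collarIntegrand hDr hP)

theorem map_vertical (A : ℝ × Plane →L[ℝ] ℝ) (v : Plane) :
    A (0, v) = v 0 * A (0, e₀) + v 1 * A (0, e₁) := by
  have h : ((0 : ℝ), v) = v 0 • ((0 : ℝ), e₀) + v 1 • ((0 : ℝ), e₁) := by
    ext1
    · simp
    · exact eq_smul_add_smul v
  rw [h, map_add, map_smul, map_smul, smul_eq_mul, smul_eq_mul]

theorem fderivWithin_collarPrimitive (hD : Convex ℝ D) (hD' : UniqueDiffOn ℝ D)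
    (hDr : ∀ p ∈ D, ∀ r ∈ Icc (0 : ℝ) 1, retraction r p ∈ D) (hP : ContDiffOn ℝ ∞ P D)
    (hQ : ContDiffOn ℝ ∞ Q D)
    (hPQ : ∀ q ∈ D, fderivWithin ℝ Q D q (0, e₀) = fderivWithin ℝ P D q (0, e₁))
    (hQ0 : ∀ q ∈ D, q.2 0 = 0 → Q q = 0) {p : ℝ × Plane} (hp : p ∈ D) (v : Plane) :
    fderivWithin ℝ (collarPrimitive P) D p (0, v) = v 0 * P p + v 1 * Q p := by
  set G : ℝ × (ℝ × Plane) → ℝ := fun q => q.2.2 0 * P (retraction q.1 q.2) with hG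
  have hGs := contDiffOn_collarIntegrand hDr hP
  have h1 : HasFDerivWithinAt (collarPrimitive P) (∫ u in (0 : ℝ)..1, partialSnd G D (u, p)) D p :=
    hasFDerivWithinAt_parametric_integral_partialSnd hD hD' (n := ∞) (by simp) hGs hp
  have hc : ContinuousOn (fun u => partialSnd G D (u, p)) (Icc (0 : ℝ) 1) :=
    (contDiffOn_partialSnd hD' (m := 0) (n := ∞) (by simp) hGs).continuousOn.comp
      (by fun_prop) fun u hu => ⟨hu, hp⟩
  have hint : IntervalIntegrable (fun u => partialSnd G D (u, p)) MeasureTheory.volume 0 1 := by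
    refine ContinuousOn.intervalIntegrable ?_
    rwa [uIcc_of_le zero_le_one]
  have hPd : ∀ q ∈ D, HasFDerivWithinAt P (fderivWithin ℝ P D q) D q := fun q hq =>
    (hP.differentiableOn (by simp) q hq).hasFDerivWithinAt
  have hQd : ∀ q ∈ D, HasFDerivWithinAt Q (fderivWithin ℝ Q D q) D q := fun q hq =>
    (hQ.differentiableOn (by simp) q hq).hasFDerivWithinAt
  have hder : ∀ u ∈ Icc (0 : ℝ) 1, partialSnd G D (u, p) (0, v) =
      p.2 0 * (u * v 0 * fderivWithin ℝ P D (retraction u p) (0, e₀) +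
        v 1 * fderivWithin ℝ P D (retraction u p) (0, e₁)) + v 0 * P (retraction u p) := by
    intro u hu
    have h2 := hasFDerivWithinAt_partialSnd (n := ∞) (by simp) hGs hu hp
    set L : ℝ × Plane →L[ℝ] ℝ :=
      (EuclideanSpace.proj (𝕜 := ℝ) (0 : Fin 2) : Plane →L[ℝ] ℝ).comp
        (ContinuousLinearMap.snd ℝ ℝ Plane) with hL
    have h3 : HasFDerivWithinAt (fun z : ℝ × Plane => z.2 0) L D p := L.hasFDerivWithinAt
    set R : ℝ × Plane →L[ℝ] ℝ × Plane := ContinuousLinearMap.id ℝ (ℝ × Plane) +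
      ((u - 1) • L).smulRight ((0 : ℝ), e₀) with hR
    have hRe : ∀ z, retraction u z = R z := fun z => by
      rw [retraction_eq_sub]
      simp [hR, hL]
    have h4 : HasFDerivWithinAt (fun z : ℝ × Plane => retraction u z) R D p := by
      simp only [hRe]
      exact R.hasFDerivWithinAt
    have h5 := h3.mul ((hPd _ (hDr p hp u hu)).comp p h4 fun z hz => hDr z hz u hu)
    rw [(hD' p hp).eq h2 h5]
    have h6 : R (0, v) = (0, pt (u * v 0) (v 1)) := (hRe (0, v)).symm
    have h7 : L (0, v) = v 0 := rfl
    simp only [add_apply, smul_apply,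
      ContinuousLinearMap.comp_apply, h6, h7, smul_eq_mul, Function.comp]
    rw [map_vertical, pt_zero, pt_one]
    ring
  set F : ℝ → ℝ := fun u => v 0 * (u * P (retraction u p)) + v 1 * Q (retraction u p) with hF
  have hcurve : ∀ u, HasDerivWithinAt (fun u => retraction u p) (0, p.2 0 • e₀) (Icc 0 1) u := by
    intro u
    have h2 : HasDerivAt (fun u : ℝ => p + ((0 : ℝ), ((u - 1) * p.2 0) • e₀)) (0, p.2 0 • e₀) u := by
      refine HasDerivAt.const_add p (HasDerivAt.prodMk (hasDerivAt_const u (0 : ℝ)) ?_)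
      have := (((hasDerivAt_id u).sub_const 1).mul_const (p.2 0)).smul_const e₀
      simpa using this
    simp only [retraction_eq_sub]
    exact h2.hasDerivWithinAt
  have hF' : ∀ u ∈ Icc (0 : ℝ) 1, HasDerivWithinAt F (partialSnd G D (u, p) (0, v)) (Icc 0 1) u := by
    intro u hu
    have hm : MapsTo (fun u => retraction u p) (Icc (0 : ℝ) 1) D := fun r hr => hDr p hp r hr
    have hq := hDr p hp u hu
    have h2 := (hPd _ hq).comp_hasDerivWithinAt u (hcurve u) hm
    have h3 := (hQd _ hq).comp_hasDerivWithinAt u (hcurve u) hm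
    have h4 := (((hasDerivWithinAt_id u (Icc (0 : ℝ) 1)).mul h2).const_mul (v 0)).add
      (h3.const_mul (v 1))
    refine h4.congr_deriv ?_
    have h5 : ((0 : ℝ), p.2 0 • e₀) = p.2 0 • ((0 : ℝ), e₀) := by simp
    rw [hder u hu, h5, map_smul, map_smul, hPQ _ hq]
    simp only [id, smul_eq_mul, Function.comp]
    ring
  have hFi : ∫ u in (0 : ℝ)..1, partialSnd G D (u, p) (0, v) = F 1 - F 0 := by
    refine intervalIntegral.integral_eq_sub_of_hasDerivAt_of_le zero_le_one
      (fun u hu => (hF' u hu).continuousWithinAt)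
      (fun u hu => (hF' u (Ioo_subset_Icc_self hu)).hasDerivAt (Icc_mem_nhds hu.1 hu.2)) ?_
    refine ContinuousOn.intervalIntegrable ?_
    rw [uIcc_of_le zero_le_one]
    exact hc.clm_apply continuousOn_const
  rw [h1.fderivWithin (hD' p hp), ContinuousLinearMap.intervalIntegral_apply hint, hFi]
  have h8 : retraction 1 p = p := by rw [retraction_eq_sub]; simp
  have h9 : Q (retraction 0 p) = 0 := hQ0 _ (hDr p hp 0 (by simp)) (by simp [retraction])
  simp only [hF, h8, h9]
  ring

end PlanarCollar

section Collar

variable {S : Type*} [TopologicalSpace S] [ChartedSpace (EuclideanHalfSpace 2) S]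
  [IsManifold (𝓡∂ 2) ∞ S]

/-- `g` is a primitive near the boundary, on each level of `ℝ × U`, of the vertical part of `Γ`. -/
structure IsCollarPrimitive (Γ : Form CylModel (ℝ × S) 1) (U : Set S) (g : ℝ × S → ℝ) : Prop where
  smooth : ContMDiffOn CylModel 𝓘(ℝ, ℝ) ∞ g (univ ×ˢ U)
  deriv : ∀ b ∈ U ∩ (𝓡∂ 2).boundary S, ∀ᶠ x in 𝓝 b, ∀ t v,
    tmap CylModel 𝓘(ℝ, ℝ) g (t, x) (0, v) = Γ.app1 (t, x) (0, v)
  boundary : ∀ b ∈ U ∩ (𝓡∂ 2).boundary S, ∀ t, g (t, b) = 0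
  vanish : ∀ t, (∀ x v, Γ.app1 (t, x) (0, v) = 0) → ∀ x ∈ U, g (t, x) = 0

theorem inChart_d_cylinder {Γ : Form CylModel (ℝ × S) 1} (hΓ : Form.IsSmooth Γ)
    (hΓd : ∀ z v w, (Form.d Γ).app2 z (0, v) (0, w) = 0) {t : ℝ} {x₀ : S} {p : ℝ × Plane}
    (hp : p.2 ∈ (extChartAt (𝓡∂ 2) x₀).target) (v w : Plane) :
    fderivWithin ℝ (fun q => Form.inChart Γ (t, x₀) q ![(0, w)]) (range CylModel) p (0, v) =
      fderivWithin ℝ (fun q => Form.inChart Γ (t, x₀) q ![(0, v)]) (range CylModel) p (0, w) := by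
  have hpt : p ∈ (extChartAt CylModel ((t, x₀) : ℝ × S)).target :=
    mem_extChartAt_cylinder_target.2 hp
  have hpr := extChartAt_target_subset_range _ hpt
  have hdiff : DifferentiableWithinAt ℝ (Form.inChart Γ (t, x₀)) (range CylModel) p :=
    (hΓ.contDiffWithinAt hpt).differentiableWithinAt (by simp)
  have hu := CylModel.uniqueDiffOn p hpr
  have h1 := inChart_d hpt (hΓ.smoothAt ((extChartAt CylModel ((t, x₀) : ℝ × S)).symm p))
  have h2 := congrArg (fun σ : (ℝ × Plane) [⋀^Fin 2]→L[ℝ] ℝ => σ ![(0, v), (0, w)]) h1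
  simp only [extDerivWithin_one_apply] at h2
  rw [fderivWithin_alternating_apply hdiff hu, fderivWithin_alternating_apply hdiff hu] at h2
  have h3 : Form.inChart (Form.d Γ) (t, x₀) p ![(0, v), (0, w)] = 0 := by
    have key : ∀ A : ℝ × Plane →L[ℝ] ℝ × Plane, (∀ u, A (0, u) = (0, symmDeriv (𝓡∂ 2) x₀ p.2 u)) →
        (show (ℝ × Plane) [⋀^Fin 2]→L[ℝ] ℝ from Form.d Γ ((extChartAt CylModel
          ((t, x₀) : ℝ × S)).symm p)).compContinuousLinearMap A ![(0, v), (0, w)] = 0 := by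
      intro A hA
      refine Eq.trans ?_ (hΓd ((extChartAt CylModel ((t, x₀) : ℝ × S)).symm p)
        (symmDeriv (𝓡∂ 2) x₀ p.2 v) (symmDeriv (𝓡∂ 2) x₀ p.2 w))
      rw [← hA, ← hA]
      refine congrArg (show (ℝ × Plane) [⋀^Fin 2]→L[ℝ] ℝ from Form.d Γ _) ?_
      ext1 i; fin_cases i <;> rfl
    exact key _ fun u => mfderivWithin_symm_cylinder (t := t) hp ((0 : ℝ), u)
  rw [h3] at h2
  linarith

theorem exists_isCollarPrimitive_of_mem_boundary {Γ : Form CylModel (ℝ × S) 1}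
    (hΓ : Form.IsSmooth Γ) (hΓd : ∀ z v w, (Form.d Γ).app2 z (0, v) (0, w) = 0)
    (hΓb : ∀ t, ∀ x ∈ (𝓡∂ 2).boundary S, ∀ v : Plane, v 0 = 0 → Γ.app1 (t, x) (0, v) = 0)
    {x₀ : S} (hx₀ : x₀ ∈ (𝓡∂ 2).boundary S) :
    ∃ U : Set S, IsOpen U ∧ x₀ ∈ U ∧ ∃ g, IsCollarPrimitive Γ U g := by
  have hy := mem_extChartAt_target (I := 𝓡∂ 2) x₀
  set y : Plane := extChartAt (𝓡∂ 2) x₀ x₀ with hyd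
  have hy0 : y 0 = 0 := mem_boundary_iff.1 hx₀
  obtain ⟨O, hO, hOt⟩ := mem_nhdsWithin_iff_exists_mem_nhds_inter.1
    (eventually_mem_extChartAt_target hy)
  obtain ⟨r, hr, hbox⟩ := exists_box_subset hO
  set W := openBox (y 0 - r) (y 0 + r) (y 1 - r) (y 1 + r) with hW
  have hWo : IsOpen W := isOpen_openBox _ _ _ _
  set B : Set Plane := range (𝓡∂ 2) ∩ W with hB
  have hBt : B ⊆ (extChartAt (𝓡∂ 2) x₀).target := fun z hz =>
    hOt ⟨hbox (openBox_subset_box _ _ _ _ hz.2), hz.1⟩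
  have hWc : Convex ℝ W := by
    have h0 : Convex ℝ ((EuclideanSpace.proj (𝕜 := ℝ) (0 : Fin 2) : Plane →L[ℝ] ℝ) ⁻¹'
      Ioo (y 0 - r) (y 0 + r)) := (convex_Ioo _ _).linear_preimage _
    have h1 : Convex ℝ ((EuclideanSpace.proj (𝕜 := ℝ) (1 : Fin 2) : Plane →L[ℝ] ℝ) ⁻¹'
      Ioo (y 1 - r) (y 1 + r)) := (convex_Ioo _ _).linear_preimage _
    exact h0.inter h1
  set D : Set (ℝ × Plane) := univ ×ˢ B with hD
  have hDc : Convex ℝ D := convex_univ.prod ((𝓡∂ 2).convex_range.inter hWc)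
  have hDu : UniqueDiffOn ℝ D :=
    uniqueDiffOn_univ.prod ((𝓡∂ 2).uniqueDiffOn.inter hWo)
  have hDT : D ⊆ (extChartAt CylModel (((0 : ℝ), x₀) : ℝ × S)).target := fun q hq =>
    mem_extChartAt_cylinder_target.2 (hBt hq.2)
  have hDn : ∀ q ∈ D, D =ᶠ[𝓝 q] range CylModel := by
    intro q hq
    have h1 : D = range CylModel ∩ (univ ×ˢ W) := by
      rw [range_cylinder, prod_inter_prod, univ_inter]
    rw [h1]
    filter_upwards [(isOpen_univ.prod hWo).mem_nhds ⟨trivial, hq.2.2⟩] with z hz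
    exact propext ⟨fun h => h.1, fun h => ⟨h, hz⟩⟩
  have hDr : ∀ p ∈ D, ∀ s ∈ Icc (0 : ℝ) 1, retraction s p ∈ D := by
    rintro p ⟨-, hp1, hp2⟩ s hs
    rw [range_halfPlane] at hp1
    have h0 : 0 ≤ p.2 0 := hp1
    have h1 : s * p.2 0 ≤ p.2 0 := by nlinarith [hs.2]
    refine ⟨trivial, ?_, ⟨?_, ?_⟩, hp2.2⟩
    · rw [range_halfPlane]; exact mul_nonneg hs.1 h0
    · change y 0 - r < s * p.2 0
      have := mul_nonneg hs.1 h0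
      linarith
    · exact lt_of_le_of_lt h1 hp2.1.2
  set P : ℝ × Plane → ℝ := fun q => Form.inChart Γ ((0 : ℝ), x₀) q ![(0, e₀)] with hP
  set Q : ℝ × Plane → ℝ := fun q => Form.inChart Γ ((0 : ℝ), x₀) q ![(0, e₁)] with hQ
  have hPs : ContDiffOn ℝ ∞ P D := (contDiffOn_alternating_iff.1 (hΓ (0, x₀)) _).mono hDT
  have hQs : ContDiffOn ℝ ∞ Q D := (contDiffOn_alternating_iff.1 (hΓ (0, x₀)) _).mono hDT
  have happ : ∀ q ∈ D, ∀ v, Form.inChart Γ ((0 : ℝ), x₀) q ![(0, v)] =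
      Γ.app1 (q.1, (extChartAt (𝓡∂ 2) x₀).symm q.2) (0, symmDeriv (𝓡∂ 2) x₀ q.2 v) :=
    fun q hq v => inChart_cylinder_apply Γ (hBt hq.2) (0, v)
  have hPQ : ∀ q ∈ D, fderivWithin ℝ Q D q (0, e₀) = fderivWithin ℝ P D q (0, e₁) := by
    intro q hq
    rw [fderivWithin_congr_set (hDn q hq), fderivWithin_congr_set (hDn q hq)]
    exact inChart_d_cylinder hΓ hΓd (hBt hq.2) e₀ e₁
  have hQ0 : ∀ q ∈ D, q.2 0 = 0 → Q q = 0 := by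
    intro q hq h0
    rw [hQ]
    simp only
    rw [happ q hq]
    exact hΓb _ _ (symm_mem_boundary (hBt hq.2) h0) _ (symmDeriv_boundary (hBt hq.2) h0)
  set U : Set S := (extChartAt (𝓡∂ 2) x₀).source ∩ extChartAt (𝓡∂ 2) x₀ ⁻¹' W with hU
  have hUo : IsOpen U := isOpen_extChartAt_preimage' x₀ hWo
  have hUB : ∀ x ∈ U, (extChartAt (𝓡∂ 2) x₀ x : Plane) ∈ B := fun x hx =>
    ⟨extChartAt_target_subset_range x₀ ((extChartAt (𝓡∂ 2) x₀).map_source hx.1), hx.2⟩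
  set g : ℝ × S → ℝ := fun z => collarPrimitive P (z.1, extChartAt (𝓡∂ 2) x₀ z.2) with hg
  have hgs : ContMDiffOn CylModel 𝓘(ℝ, ℝ) ∞ g (univ ×ˢ U) := by
    have h1 : ContMDiffOn 𝓘(ℝ, ℝ × Plane) 𝓘(ℝ, ℝ) ∞ (collarPrimitive P) D :=
      (contDiffOn_collarPrimitive hDc hDu hDr hPs).contMDiffOn
    have h2 : ContMDiffOn CylModel 𝓘(ℝ, ℝ × Plane) ∞
        (fun z : ℝ × S => (z.1, (extChartAt (𝓡∂ 2) x₀ z.2 : Plane))) (univ ×ˢ U) := by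
      rw [modelWithCornersSelf_prod, ← chartedSpaceSelf_prod]
      refine contMDiff_fst.contMDiffOn.prodMk ?_
      refine (contMDiffOn_extChartAt (n := ∞) (x := x₀)).comp contMDiff_snd.contMDiffOn ?_
      rintro q ⟨_, hq⟩
      have := hq.1
      rwa [extChartAt_source] at this
    exact h1.comp h2 fun z hz => ⟨trivial, hUB z.2 hz.2⟩
  refine ⟨U, hUo, ⟨mem_extChartAt_source x₀, mem_openBox_self hr⟩, g, hgs, ?_, ?_, ?_⟩
  · intro b hb
    filter_upwards [hUo.mem_nhds hb.1] with x hx t v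
    set q : ℝ × Plane := (t, extChartAt (𝓡∂ 2) x₀ x) with hq
    have hqD : q ∈ D := ⟨trivial, hUB x hx⟩
    have hqs : (extChartAt (𝓡∂ 2) x₀).symm q.2 = x := (extChartAt (𝓡∂ 2) x₀).left_inv hx.1
    have hqs' : (extChartAt CylModel (((0 : ℝ), x₀) : ℝ × S)).symm q = (t, x) := by
      rw [extChartAt_cylinder]
      exact Prod.ext rfl hqs
    obtain ⟨w, rfl⟩ := symmDeriv_surjective (hBt hqD.2) v
    have h1 := inChart_cylinder_apply (differential (I := CylModel) g) (t := 0) (hBt hqD.2) (0, w)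
    have hgd : MDifferentiableAt CylModel 𝓘(ℝ, ℝ) g
        ((extChartAt CylModel (((0 : ℝ), x₀) : ℝ × S)).symm q) := by
      rw [hqs']
      exact (hgs.contMDiffAt ((isOpen_univ.prod hUo).mem_nhds ⟨trivial, hx⟩)).mdifferentiableAt
        (by simp)
    rw [inChart_differential (hDT hqD) hgd, hqs, app1_differential] at h1
    refine h1.symm.trans ?_
    have h2 : fderivWithin ℝ (fun z => g ((extChartAt CylModel (((0 : ℝ), x₀) : ℝ × S)).symm z))
        (range CylModel) q = fderivWithin ℝ (collarPrimitive P) D q := by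
      rw [← fderivWithin_congr_set (hDn q hqD)]
      refine fderivWithin_congr (fun z hz => ?_) ?_
      · rw [extChartAt_cylinder]
        exact congrArg (fun u => collarPrimitive P (z.1, u))
          ((extChartAt (𝓡∂ 2) x₀).right_inv (hBt hz.2))
      · rw [hqs']
    change fderivWithin ℝ _ (range CylModel) q (0, w) = _
    rw [h2, fderivWithin_collarPrimitive hDc hDu hDr hPs hQs hPQ hQ0 hqD]
    simp only [hP, hQ]
    rw [happ q hqD, happ q hqD, hqs]
    have h3 : ((0 : ℝ), symmDeriv (𝓡∂ 2) x₀ q.2 w) = w 0 • ((0 : ℝ), symmDeriv (𝓡∂ 2) x₀ q.2 e₀) +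
        w 1 • ((0 : ℝ), symmDeriv (𝓡∂ 2) x₀ q.2 e₁) := by
      ext1
      · simp
      · change _ = w 0 • symmDeriv (𝓡∂ 2) x₀ q.2 e₀ + w 1 • symmDeriv (𝓡∂ 2) x₀ q.2 e₁
        rw [← map_smul, ← map_smul, ← map_add, ← eq_smul_add_smul]
    exact ((congrArg (Γ.app1 (t, x)) h3).trans
      (by rw [Form.app1_add, Form.app1_smul, Form.app1_smul])).symm
  · rintro b ⟨hbU, hb⟩ t
    have h1 := (mem_boundary_iff_of_mem hbU.1).1 hb
    simp only [hg, collarPrimitive, h1, zero_mul, intervalIntegral.integral_zero]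
  · intro t ht x hx
    have h1 : ∀ s ∈ uIcc (0 : ℝ) 1, (extChartAt (𝓡∂ 2) x₀ x : Plane) 0 *
        P (retraction s (t, extChartAt (𝓡∂ 2) x₀ x)) = 0 := by
      intro s hs
      rw [uIcc_of_le zero_le_one] at hs
      simp only [hP]
      rw [happ _ (hDr _ ⟨trivial, hUB x hx⟩ s hs)]
      exact mul_eq_zero_of_right _ (ht _ _)
    simp only [hg, collarPrimitive]
    rw [intervalIntegral.integral_congr h1, intervalIntegral.integral_zero]

end Collar

section CollarPatching

variable {S : Type*} [TopologicalSpace S] [ChartedSpace (EuclideanHalfSpace 2) S]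
  [IsManifold (𝓡∂ 2) ∞ S]

theorem IsCollarPrimitive.contMDiffAt {Γ : Form CylModel (ℝ × S) 1} {U : Set S} {g : ℝ × S → ℝ}
    (hg : IsCollarPrimitive Γ U g) (hU : IsOpen U) {z : ℝ × S} (hz : z.2 ∈ U) :
    ContMDiffAt CylModel 𝓘(ℝ, ℝ) ∞ g z :=
  hg.smooth.contMDiffAt ((isOpen_univ.prod hU).mem_nhds ⟨trivial, hz⟩)

theorem IsCollarPrimitive.eventually_eq {Γ : Form CylModel (ℝ × S) 1} {U U' : Set S}
    {g g' : ℝ × S → ℝ} (hg : IsCollarPrimitive Γ U g) (hg' : IsCollarPrimitive Γ U' g')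
    (hU : IsOpen U) (hU' : IsOpen U') {b : S} (hb : b ∈ U) (hb' : b ∈ U')
    (hbb : b ∈ (𝓡∂ 2).boundary S) : ∀ᶠ x in 𝓝 b, ∀ t, g (t, x) = g' (t, x) := by
  have hsl : ∀ (t : ℝ) (x : S), MDifferentiableAt (𝓡∂ 2) CylModel (fun z : S => (t, z)) x :=
    fun t x => mdifferentiableAt_const.prodMk mdifferentiableAt_id
  have h1 : ∀ᶠ x in 𝓝 b, ∀ t, HasMFDerivAt (𝓡∂ 2) 𝓘(ℝ, ℝ) (fun z => g (t, z) - g' (t, z)) x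
      (0 : Plane →L[ℝ] ℝ) := by
    filter_upwards [hU.mem_nhds hb, hU'.mem_nhds hb', hg.deriv b ⟨hb, hbb⟩, hg'.deriv b ⟨hb', hbb⟩]
      with x hx hx' hd hd' t
    have h2 := (hg.contMDiffAt hU (z := (t, x)) hx).mdifferentiableAt (by simp)
    have h3 := (hg'.contMDiffAt hU' (z := (t, x)) hx').mdifferentiableAt (by simp)
    have h2' : MDifferentiableAt (𝓡∂ 2) 𝓘(ℝ, ℝ) (fun z => g (t, z)) x := h2.comp x (hsl t x)
    have h3' : MDifferentiableAt (𝓡∂ 2) 𝓘(ℝ, ℝ) (fun z => g' (t, z)) x := h3.comp x (hsl t x)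
    have h4 : tmap (𝓡∂ 2) 𝓘(ℝ, ℝ) (fun z => g (t, z) - g' (t, z)) x = 0 := by
      ext1 v
      rw [tmap_sub h2' h3', ← tmap_slice h2, ← tmap_slice h3, hd, hd', sub_self]
      rfl
    have h5 := (h2'.sub h3').hasMFDerivAt
    exact h5.congr_mfderiv h4
  have hy := mem_extChartAt_target (I := 𝓡∂ 2) b
  set y : Plane := extChartAt (𝓡∂ 2) b b with hyd
  rw [← extChartAt_to_inv (I := 𝓡∂ 2) b] at h1
  obtain ⟨ε, hε, hball⟩ := Metric.mem_nhdsWithin_iff.1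
    ((eventually_mem_extChartAt_target hy).and (eventually_extChartAt_symm hy h1))
  have hs : Convex ℝ (Metric.ball y ε ∩ range (𝓡∂ 2)) :=
    (convex_ball y ε).inter (𝓡∂ 2).convex_range
  have hder : ∀ t, ∀ w ∈ Metric.ball y ε ∩ range (𝓡∂ 2), HasFDerivWithinAt
      (fun w => g (t, (extChartAt (𝓡∂ 2) b).symm w) - g' (t, (extChartAt (𝓡∂ 2) b).symm w))
      (0 : Plane →L[ℝ] ℝ) (Metric.ball y ε ∩ range (𝓡∂ 2)) w := by
    have := isManifold_one (I := 𝓡∂ 2) (M := S)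
    intro t w hw
    have h2 := ((hball hw).2 t).comp_hasMFDerivWithinAt w
      (mdifferentiableWithinAt_extChartAt_symm (hball hw).1).hasMFDerivWithinAt
    have h3 : HasFDerivWithinAt
      (fun w => g (t, (extChartAt (𝓡∂ 2) b).symm w) - g' (t, (extChartAt (𝓡∂ 2) b).symm w))
      ((0 : Plane →L[ℝ] ℝ).comp (symmDeriv (𝓡∂ 2) b w)) (range (𝓡∂ 2)) w :=
      hasMFDerivWithinAt_iff_hasFDerivWithinAt.1 h2
    rw [ContinuousLinearMap.zero_comp] at h3
    exact h3.mono inter_subset_right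
  filter_upwards [(show ∀ᶠ x in 𝓝 b, x ∈ (extChartAt (𝓡∂ 2) b).source from
    extChartAt_source_mem_nhds b), (continuousAt_extChartAt (I := 𝓡∂ 2) b).eventually
      (Metric.ball_mem_nhds y hε)] with x hx hxb t
  have h2 := hs.is_const_of_fderivWithin_eq_zero (𝕜 := ℝ)
    (fun w hw => (hder t w hw).differentiableWithinAt)
    (fun w hw => (hder t w hw).fderivWithin (by
      rw [inter_comm]
      exact (𝓡∂ 2).uniqueDiffOn.inter Metric.isOpen_ball w ⟨hw.2, hw.1⟩))
    (x := extChartAt (𝓡∂ 2) b x) (y := y)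
    ⟨hxb, extChartAt_target_subset_range b ((extChartAt (𝓡∂ 2) b).map_source hx)⟩
    ⟨Metric.mem_ball_self hε, extChartAt_target_subset_range b hy⟩
  rw [(extChartAt (𝓡∂ 2) b).left_inv hx, hyd, extChartAt_to_inv, hg.boundary b ⟨hb, hbb⟩,
    hg'.boundary b ⟨hb', hbb⟩, sub_self] at h2
  linarith

theorem isCollarPrimitive_zero_interior (Γ : Form CylModel (ℝ × S) 1) :
    IsCollarPrimitive Γ ((𝓡∂ 2).interior S) (fun _ => 0) where
  smooth := contMDiff_const.contMDiffOn
  deriv _ hb := (Set.disjoint_left.1 ModelWithCorners.disjoint_interior_boundary hb.1 hb.2).elim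
  boundary _ _ _ := rfl
  vanish _ _ _ _ := rfl

variable [CompactSpace S] [T2Space S]

theorem exists_isCollarPrimitive {Γ : Form CylModel (ℝ × S) 1}
    (hΓ : Form.IsSmooth Γ) (hΓd : ∀ z v w, (Form.d Γ).app2 z (0, v) (0, w) = 0)
    (hΓb : ∀ t, ∀ x ∈ (𝓡∂ 2).boundary S, ∀ v : Plane, v 0 = 0 → Γ.app1 (t, x) (0, v) = 0) :
    ∃ g, IsCollarPrimitive Γ univ g := by
  have hloc : ∀ x : S, ∃ U : Set S, IsOpen U ∧ x ∈ U ∧ ∃ g, IsCollarPrimitive Γ U g := by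
    intro x
    by_cases hx : x ∈ (𝓡∂ 2).boundary S
    · exact exists_isCollarPrimitive_of_mem_boundary hΓ hΓd hΓb hx
    · refine ⟨(𝓡∂ 2).interior S, ModelWithCorners.isOpen_interior (n := ∞) (by simp), ?_, _,
        isCollarPrimitive_zero_interior Γ⟩
      rwa [← ModelWithCorners.compl_boundary]
  choose U hU hxU g hg using hloc
  obtain ⟨t, ht⟩ := isCompact_univ.elim_finite_subcover U hU fun x _ => mem_iUnion.2 ⟨x, hxU x⟩
  obtain ⟨ρ, hρ⟩ := SmoothPartitionOfUnity.exists_isSubordinate (𝓡∂ 2) (s := (univ : Set S))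
    isClosed_univ (fun i : t => U i) (fun i => hU i) (fun x hx => by
      obtain ⟨i, hi, hxi⟩ := mem_iUnion₂.1 (ht hx)
      exact mem_iUnion.2 ⟨⟨i, hi⟩, hxi⟩)
  have hsum : ∀ x, ∑ i : t, ρ i x = 1 := by
    intro x
    have h1 := ρ.sum_eq_one (mem_univ x)
    rwa [finsum_eq_sum_of_fintype] at h1
  have hzero : ∀ (i : t) (x : S), x ∉ U i → ∀ᶠ z in 𝓝 x, ρ i z = 0 := by
    intro i x hx
    filter_upwards [(isClosed_tsupport (ρ i)).isOpen_compl.mem_nhds fun h => hx (hρ i h)] with z hz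
    exact image_eq_zero_of_notMem_tsupport hz
  set G : ℝ × S → ℝ := fun z => ∑ i : t, ρ i z.2 * g i z with hG
  have hGs : ContMDiff CylModel 𝓘(ℝ, ℝ) ∞ G := by
    refine contMDiff_finsetSum fun i _ z => ?_
    by_cases hz : z.2 ∈ U i
    · exact (((ρ i).contMDiff.comp contMDiff_snd) z).mul ((hg i).contMDiffAt (hU i) hz)
    · refine (contMDiffAt_const (c := (0 : ℝ))).congr_of_eventuallyEq ?_
      filter_upwards [continuous_snd.continuousAt.eventually (hzero i z.2 hz)] with w hw
      rw [hw, zero_mul]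
  have hGzero : ∀ t x, (∀ i, x ∈ U i → g i (t, x) = 0) → G (t, x) = 0 := by
    intro t x h
    refine Finset.sum_eq_zero fun i _ => ?_
    by_cases hx : x ∈ U i
    · rw [h i hx, mul_zero]
    · rw [(hzero i x hx).self_of_nhds, zero_mul]
  refine ⟨G, hGs.contMDiffOn, ?_, ?_, ?_⟩
  · rintro b ⟨-, hb⟩
    have h1 : ∀ i : t, ∀ᶠ x in 𝓝 b, ∀ s, ρ i x * g i (s, x) = ρ i x * g b (s, x) := by
      intro i
      by_cases hbi : b ∈ U i
      · filter_upwards [(hg i).eventually_eq (hg b) (hU i) (hU b) hbi (hxU b) hb] with x hx s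
        rw [hx]
      · filter_upwards [hzero i b hbi] with x hx s
        rw [hx, zero_mul, zero_mul]
    have h2 : ∀ᶠ x in 𝓝 b, ∀ s, G (s, x) = g b (s, x) := by
      filter_upwards [eventually_all.2 h1] with x hx s
      simp only [hG, hx, ← Finset.sum_mul, hsum, one_mul]
    filter_upwards [eventually_eventually_nhds.2 h2, (hg b).deriv b ⟨hxU b, hb⟩] with x hx hd s v
    rw [← hd, tmap_congr]
    filter_upwards [continuous_snd.continuousAt.eventually hx] with z hz
    exact hz z.1
  · rintro b ⟨-, hb⟩ s
    exact hGzero s b fun i hi => (hg i).boundary b ⟨hi, hb⟩ s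
  · intro s hs x _
    exact hGzero s x fun i hi => (hg i).vanish s hs x hi

end CollarPatching

section Correction

variable {S : Type*} [TopologicalSpace S] [ChartedSpace (EuclideanHalfSpace 2) S]

theorem tmap_const_mul {E : Type*} [NormedAddCommGroup E] [NormedSpace ℝ E]
    {H : Type*} [TopologicalSpace H] {I : ModelWithCorners ℝ E H}
    {M : Type*} [TopologicalSpace M] [ChartedSpace H M] {f : M → ℝ} {x : M}
    (hf : MDifferentiableAt I 𝓘(ℝ, ℝ) f x) (c : ℝ) (v : E) :
    tmap I 𝓘(ℝ, ℝ) (fun z => c * f z) x v = c * tmap I 𝓘(ℝ, ℝ) f x v := by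
  have h1 : HasFDerivAt (fun y : ℝ => c * y) (c • ContinuousLinearMap.id ℝ ℝ) (f x) :=
    (c • ContinuousLinearMap.id ℝ ℝ).hasFDerivAt
  rw [tmap_comp (f := f) (g := fun y : ℝ => c * y) h1.differentiableAt.mdifferentiableAt hf, tmap,
    mfderiv_eq_fderiv, h1.fderiv]
  rfl

/-- A smooth step function. -/
def step (t : ℝ) : ℝ := Real.smoothTransition (3 * t - 1)

theorem contDiff_step : ContDiff ℝ ∞ step :=
  Real.smoothTransition.contDiff.comp ((contDiff_const.mul contDiff_id).sub contDiff_const)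

theorem step_mem (t : ℝ) : step t ∈ Icc (0 : ℝ) 1 :=
  ⟨Real.smoothTransition.nonneg _, Real.smoothTransition.le_one _⟩

theorem step_of_lt {t : ℝ} (h : t < 1 / 3) : step t = 0 :=
  Real.smoothTransition.zero_of_nonpos (by linarith)

theorem step_of_gt {t : ℝ} (h : 2 / 3 < t) : step t = 1 :=
  Real.smoothTransition.one_of_one_le (by linarith)

variable [IsManifold (𝓡∂ 2) ∞ S]

theorem IsAreaIsotopicToId.exists_family {Ω : AreaForm S} {φ : S ≃ₘ⟮𝓡∂ 2, 𝓡∂ 2⟯ S}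
    (h : IsAreaIsotopicToId Ω φ) : ∃ ψ : ℝ → S ≃ₘ⟮𝓡∂ 2, 𝓡∂ 2⟯ S, IsSmoothFamily univ ψ ∧
      (∀ t, PreservesArea Ω (ψ t)) ∧ (∀ t < 1 / 3, ψ t = Diffeomorph.refl (𝓡∂ 2) S ∞) ∧
      ∀ t, 2 / 3 < t → ψ t = φ := by
  obtain ⟨ψ, hψ, hA, h0, h1⟩ := h
  have hs : ContMDiff CylModel CylModel ∞ (fun z : ℝ × S => (step z.1, z.2)) :=
    (contDiff_step.contMDiff.comp contMDiff_fst).prodMk contMDiff_snd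
  refine ⟨fun t => ψ (step t), ⟨?_, ?_⟩, fun t => hA _ (step_mem t), fun t ht => ?_, fun t ht => ?_⟩
  · exact hψ.1.comp hs.contMDiffOn fun z _ => ⟨step_mem _, trivial⟩
  · exact hψ.2.comp hs.contMDiffOn fun z _ => ⟨step_mem _, trivial⟩
  · simp only [step_of_lt ht, h0]
  · simp only [step_of_gt ht, h1]

theorem IsSmoothFamily.contMDiff_symm {ψ : ℝ → S ≃ₘ⟮𝓡∂ 2, 𝓡∂ 2⟯ S} (h : IsSmoothFamily univ ψ) :
    ContMDiff CylModel (𝓡∂ 2) ∞ (fun z : ℝ × S => (ψ z.1).symm z.2) := by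
  have := h.2
  rwa [univ_prod_univ, contMDiffOn_univ] at this

theorem mem_boundary_of_diffeomorph (ψ : S ≃ₘ⟮𝓡∂ 2, 𝓡∂ 2⟯ S) {x : S}
    (hx : x ∈ (𝓡∂ 2).boundary S) : ψ x ∈ (𝓡∂ 2).boundary S := by
  rw [← Diffeomorph.preimage_boundary (n := ∞) (by simp) ψ] at hx
  exact hx

theorem tmap_family_boundary {ψ : ℝ → S ≃ₘ⟮𝓡∂ 2, 𝓡∂ 2⟯ S} (h : IsSmoothFamily univ ψ) (t : ℝ)
    {x : S} (hx : x ∈ (𝓡∂ 2).boundary S) :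
    (tmap 𝓘(ℝ, ℝ) (𝓡∂ 2) (fun s => ψ s x) t 1) 0 = 0 :=
  tmap_curve_boundary ((h.contMDiff.comp (contMDiff_id.prodMk contMDiff_const)).mdifferentiable
    (by simp) t) (Eventually.of_forall fun s => mem_boundary_of_diffeomorph (ψ s) hx) 1

variable [CompactSpace S] [T2Space S]

/-- A family of area-preserving maps ending at `φ` can be changed, relative to its ends, into a
family for which `ψ_t^* λ - λ` is exact for all `t`, if it is for the map `φ`. -/
theorem exists_exact_family {Ω : AreaForm S} {φ : S ≃ₘ⟮𝓡∂ 2, 𝓡∂ 2⟯ S}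
    {ψ : ℝ → S ≃ₘ⟮𝓡∂ 2, 𝓡∂ 2⟯ S} (hψ : IsSmoothFamily univ ψ) (hA : ∀ t, PreservesArea Ω (ψ t))
    (hψ0 : ∀ t < 1 / 3, ψ t = Diffeomorph.refl (𝓡∂ 2) S ∞) (hψ1 : ∀ t, 2 / 3 < t → ψ t = φ)
    {lam : Form (𝓡∂ 2) S 1} {F' : S → ℝ} (hlam : Form.IsSmooth lam) (hd : Form.d lam = Ω.form)
    (hF' : ContMDiff (𝓡∂ 2) 𝓘(ℝ, ℝ) ∞ F')
    (hφ : pullback φ lam - lam = differential (I := 𝓡∂ 2) F') :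
    ∃ (ψ' : ℝ → S ≃ₘ⟮𝓡∂ 2, 𝓡∂ 2⟯ S) (D : ℝ × S → ℝ), IsSmoothFamily univ ψ' ∧
      (∀ t < 1 / 3, ψ' t = Diffeomorph.refl (𝓡∂ 2) S ∞) ∧ (∀ t, 2 / 3 < t → ψ' t = φ) ∧
      ContMDiff CylModel 𝓘(ℝ, ℝ) ∞ D ∧
      (∀ t x v, lam.app1 (ψ' t x) (tmap (𝓡∂ 2) (𝓡∂ 2) (ψ' t) x v) =
        lam.app1 x v + tmap CylModel 𝓘(ℝ, ℝ) D (t, x) (0, v)) ∧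
      (∀ t < 1 / 3, ∀ x, D (t, x) = 0) ∧ ∀ t, 2 / 3 < t → ∀ x, D (t, x) = F' x := by
  set Ψ : ℝ × S → S := fun z => ψ z.1 z.2 with hΨdef
  have hΨ : ContMDiff CylModel (𝓡∂ 2) ∞ Ψ := hψ.contMDiff
  have hΨd := hΨ.mdifferentiable (by simp)
  have hsnd : ContMDiff CylModel (𝓡∂ 2) ∞ (fun z : ℝ × S => z.2) := contMDiff_snd
  set ν : Form CylModel (ℝ × S) 1 := pullback (I := CylModel) Ψ lam -
    pullback (I := CylModel) (fun z : ℝ × S => z.2) lam with hν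
  have hνs : Form.IsSmooth ν := (hlam.pullback hΨ).sub (hlam.pullback hsnd)
  have hν1 : ∀ z v, ν.app1 z v = lam.app1 (Ψ z) (tmap CylModel (𝓡∂ 2) Ψ z v) - lam.app1 z.2 v.2 := by
    intro z v
    have h1 : ν.app1 z v = (pullback (I := CylModel) Ψ lam).app1 z v -
      (pullback (I := CylModel) (fun z : ℝ × S => z.2) lam).app1 z v := rfl
    rw [h1, app1_pullback, app1_pullback, tmap_snd]
  have hνd : ∀ z v w, (Form.d ν).app2 z v w = Ω.form.app2 (Ψ z) (tmap CylModel (𝓡∂ 2) Ψ z v)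
      (tmap CylModel (𝓡∂ 2) Ψ z w) - Ω.form.app2 z.2 v.2 w.2 := by
    intro z v w
    have h1 : Form.d ν z = Form.d (pullback (I := CylModel) Ψ lam) z -
        Form.d (pullback (I := CylModel) (fun z : ℝ × S => z.2) lam) z :=
      Form.d_sub ((hlam.pullback hΨ).smoothAt z) ((hlam.pullback hsnd).smoothAt z)
    rw [Form.d_pullback (hlam.smoothAt _) (hΨ z), Form.d_pullback (hlam.smoothAt _) (hsnd z),
      hd] at h1
    have h2 : (Form.d ν).app2 z v w = (pullback (I := CylModel) Ψ Ω.form).app2 z v w -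
        (pullback (I := CylModel) (fun z : ℝ × S => z.2) Ω.form).app2 z v w :=
      congrArg (fun σ : (ℝ × Plane) [⋀^Fin 2]→L[ℝ] ℝ => σ ![v, w]) h1
    rw [h2, app2_pullback, app2_pullback, tmap_snd, tmap_snd]
  clear_value ν
  have hνv : ∀ z v w, (Form.d ν).app2 z (0, v) (0, w) = 0 := by
    rintro ⟨t, x⟩ v w
    rw [hνd, tmap_slice (hΨd _), tmap_slice (hΨd _), sub_eq_zero]
    have h1 := congrArg (fun β : Form (𝓡∂ 2) S 2 => β.app2 x v w) (hA t)
    simp only [app2_pullback] at h1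
    exact h1
  have htime0 : ∀ t x, t < 1 / 3 ∨ 2 / 3 < t → timeComponent ν (t, x) = 0 := by
    intro t x ht
    have h1 : ∃ y, (fun s => Ψ (s, x)) =ᶠ[𝓝 t] fun _ => y := by
      rcases ht with ht | ht
      · exact ⟨x, by filter_upwards [Iio_mem_nhds ht] with s hs; simp only [hΨdef, hψ0 s hs]; rfl⟩
      · exact ⟨φ x, by filter_upwards [Ioi_mem_nhds ht] with s hs; simp only [hΨdef, hψ1 s hs]⟩
    obtain ⟨y, hy⟩ := h1
    rw [timeComponent, hν1, tmap_time (hΨd _), tmap_congr hy, tmap_const, Form.app1_zero,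
      Form.app1_zero, sub_zero]
  set A := timeIntegral (timeComponent ν) with hAdef
  have hAs : ContMDiff CylModel 𝓘(ℝ, ℝ) ∞ A :=
    contMDiff_timeIntegral fun p => contMDiffAt_timeComponent (hνs.smoothAt p)
  have hA0 : ∀ t < 1 / 3, ∀ x, A (t, x) = 0 := by
    intro t ht x
    rw [hAdef, timeIntegral, intervalIntegral.integral_congr (g := fun _ => (0 : ℝ)) fun r hr =>
      htime0 r x (Or.inl ?_), intervalIntegral.integral_zero]
    rcases le_total 0 t with h | h
    · rw [uIcc_of_le h] at hr; exact lt_of_le_of_lt hr.2 ht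
    · rw [uIcc_of_ge h] at hr; linarith [hr.2]
  have hA1 : ∀ t, 2 / 3 < t → ∀ x, A (t, x) = A (1, x) := by
    intro t ht x
    have hint : ∀ a b : ℝ, IntervalIntegrable (fun r => timeComponent ν (r, x))
        MeasureTheory.volume a b := fun a b =>
      (continuous_app1_time hνs x (1, 0)).intervalIntegrable a b
    have h1 : ∫ r in (1 : ℝ)..t, timeComponent ν (r, x) = 0 := by
      rw [intervalIntegral.integral_congr (g := fun _ => (0 : ℝ)) fun r hr =>
        htime0 r x (Or.inr ?_), intervalIntegral.integral_zero]
      rcases le_total 1 t with h | h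
      · rw [uIcc_of_le h] at hr; linarith [hr.1]
      · rw [uIcc_of_ge h] at hr; exact lt_of_lt_of_le ht hr.1
    have h2 := intervalIntegral.integral_add_adjacent_intervals (hint 0 1) (hint 1 t)
    rw [h1, add_zero] at h2
    exact h2.symm
  set F : S → ℝ := fun x => F' x - A (1, x) with hF
  have hFs : ContMDiff (𝓡∂ 2) 𝓘(ℝ, ℝ) ∞ F := hF'.sub (contMDiff_at_time hAs 1)
  set B : ℝ × S → ℝ := fun z => A z + step z.1 * F z.2 with hB
  have hBs : ContMDiff CylModel 𝓘(ℝ, ℝ) ∞ B :=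
    hAs.add ((contDiff_step.contMDiff.comp contMDiff_fst).mul (hFs.comp contMDiff_snd))
  have hBv : ∀ t x v, tmap CylModel 𝓘(ℝ, ℝ) B (t, x) (0, v) =
      tmap CylModel 𝓘(ℝ, ℝ) A (t, x) (0, v) + step t * tmap (𝓡∂ 2) 𝓘(ℝ, ℝ) F x v := by
    intro t x v
    have hFd := hFs.mdifferentiable (by simp) x
    rw [tmap_slice (hBs.mdifferentiable (by simp) _), tmap_slice (hAs.mdifferentiable (by simp) _),
      ← tmap_const_mul hFd]
    exact tmap_add (f := fun z => A (t, z)) (g := fun z => step t * F z)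
      ((contMDiff_at_time hAs t).mdifferentiable (by simp) x)
      ((contMDiff_const.mul hFs).mdifferentiable (by simp) x) v
  have hB0 : ∀ t < 1 / 3, ∀ x, B (t, x) = 0 := fun t ht x => by
    simp only [hB, hA0 t ht, step_of_lt ht, zero_mul, add_zero]
  have hB1 : ∀ t, 2 / 3 < t → ∀ x, B (t, x) = F' x := fun t ht x => by
    simp only [hB, hA1 t ht, step_of_gt ht, hF]; ring
  have hν0 : ∀ t < 1 / 3, ∀ x v, ν.app1 (t, x) (0, v) = 0 := by
    intro t ht x v
    have h1 : (fun z => Ψ (t, z)) = fun z => z := by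
      funext z; simp only [hΨdef, hψ0 t ht]; rfl
    rw [hν1, tmap_slice (hΨd _), h1, tmap_id]
    have h2 : Ψ (t, x) = x := congrFun h1 x
    rw [h2, sub_self]
  have hν2 : ∀ t, 2 / 3 < t → ∀ x v, ν.app1 (t, x) (0, v) = tmap (𝓡∂ 2) 𝓘(ℝ, ℝ) F' x v := by
    intro t ht x v
    have h1 : (fun z => Ψ (t, z)) = φ := by
      funext z; simp only [hΨdef, hψ1 t ht]
    have h2 : Ψ (t, x) = φ x := congrFun h1 x
    rw [hν1, tmap_slice (hΨd _), h1, h2, ← app1_differential, ← hφ]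
    exact congrArg (· - lam.app1 x v) (app1_pullback φ lam x v).symm
  set μ : Form CylModel (ℝ × S) 1 := ν - differential (I := CylModel) B with hμ
  have hμs : Form.IsSmooth μ := hνs.sub (isSmooth_differential hBs)
  have hμ1 : ∀ z v, μ.app1 z v = ν.app1 z v - tmap CylModel 𝓘(ℝ, ℝ) B z v := fun z v => rfl
  have hμd : ∀ z v w, (Form.d μ).app2 z (0, v) (0, w) = 0 := by
    intro z v w
    have h1 : Form.d μ z = Form.d ν z - Form.d (differential (I := CylModel) B) z :=
      Form.d_sub (hνs.smoothAt z) ((isSmooth_differential hBs).smoothAt z)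
    rw [Form.d_differential (hBs z), sub_zero] at h1
    exact (congrArg (fun σ : (ℝ × Plane) [⋀^Fin 2]→L[ℝ] ℝ => σ ![(0, v), (0, w)]) h1).trans
      (hνv z v w)
  clear_value μ
  have hconst : ∀ {G : ℝ × S → ℝ}, ContMDiff CylModel 𝓘(ℝ, ℝ) ∞ G → ∀ t, (∀ x, G (t, x) = 0) →
      ∀ x v, tmap CylModel 𝓘(ℝ, ℝ) G (t, x) (0, v) = 0 := by
    intro G hG t h x v
    rw [tmap_slice (hG.mdifferentiable (by simp) _)]
    simp only [h]
    exact tmap_const x _ v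
  have hμ0 : ∀ t, t ∉ Icc (1 / 3 : ℝ) (2 / 3) → ∀ x v, μ.app1 (t, x) (0, v) = 0 := by
    intro t ht x v
    rw [mem_Icc, not_and_or, not_le, not_le] at ht
    rcases ht with ht | ht
    · rw [hμ1, hν0 t ht, hconst hBs t (hB0 t ht), sub_zero]
    · rw [hμ1, hν2 t ht, tmap_slice (hBs.mdifferentiable (by simp) _), sub_eq_zero]
      simp only [hB1 t ht]
  have hνA : ∀ t, ∀ x ∈ (𝓡∂ 2).boundary S, ∀ v : Plane, v 0 = 0 →
      ν.app1 (t, x) (0, v) = tmap CylModel 𝓘(ℝ, ℝ) A (t, x) (0, v) := by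
    intro t x hx v hv
    have h1 := homotopy_formula hνs t x v (g := fun _ => 0) continuous_const (fun r => by
      rw [hνd, tmap_time (hΨd _), tmap_slice (hΨd _), Form.app2_zero_left, sub_zero]
      exact app2_tangent_boundary _ _ (tmap_family_boundary hψ r hx)
        (tmap_boundary ((ψ r).contMDiff.mdifferentiable (by simp) x)
          (fun z hz => mem_boundary_of_diffeomorph (ψ r) hz) hx hv))
    rw [app1_differential, intervalIntegral.integral_zero, hν0 0 (by norm_num), sub_zero,
      sub_zero] at h1
    exact h1.symm
  have hμb : ∀ t, ∀ x ∈ (𝓡∂ 2).boundary S, ∀ v : Plane, v 0 = 0 → μ.app1 (t, x) (0, v) = 0 := by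
    intro t x hx v hv
    have h1 : tmap (𝓡∂ 2) 𝓘(ℝ, ℝ) F x v = 0 := by
      have h2 := hνA 1 x hx v hv
      rw [hν2 1 (by norm_num), tmap_slice (hAs.mdifferentiable (by simp) _)] at h2
      rw [hF, tmap_sub (hF'.mdifferentiable (by simp) x)
        ((contMDiff_at_time hAs 1).mdifferentiable (by simp) x), h2, sub_self]
    rw [hμ1, hBv, h1, mul_zero, add_zero, hνA t x hx v hv, sub_self]
  obtain ⟨g, hg⟩ := exists_isCollarPrimitive hμs hμd hμb
  have hgs : ContMDiff CylModel 𝓘(ℝ, ℝ) ∞ g := fun z => hg.contMDiffAt isOpen_univ trivial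
  have hg0 : ∀ t, t ∉ Icc (1 / 3 : ℝ) (2 / 3) → ∀ x, g (t, x) = 0 := fun t ht x =>
    hg.vanish t (fun x v => hμ0 t ht x v) x trivial
  set κ : Form CylModel (ℝ × S) 1 := μ - differential (I := CylModel) g with hκ
  have hκs : Form.IsSmooth κ := hμs.sub (isSmooth_differential hgs)
  have hκ1 : ∀ z v, κ.app1 z v = μ.app1 z v - tmap CylModel 𝓘(ℝ, ℝ) g z v := fun z v => rfl
  have hκd : ∀ z v w, (Form.d κ).app2 z (0, v) (0, w) = 0 := by
    intro z v w
    have h1 : Form.d κ z = Form.d μ z - Form.d (differential (I := CylModel) g) z :=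
      Form.d_sub (hμs.smoothAt z) ((isSmooth_differential hgs).smoothAt z)
    rw [Form.d_differential (hgs z), sub_zero] at h1
    exact (congrArg (fun σ : (ℝ × Plane) [⋀^Fin 2]→L[ℝ] ℝ => σ ![(0, v), (0, w)]) h1).trans
      (hμd z v w)
  clear_value κ
  set O : Set S := interior {x | ∀ t v, tmap CylModel 𝓘(ℝ, ℝ) g (t, x) (0, v) =
    μ.app1 (t, x) (0, v)} with hO
  have hOb : ∀ b ∈ (𝓡∂ 2).boundary S, b ∈ O := fun b hb =>
    mem_interior_iff_mem_nhds.2 (hg.deriv b ⟨trivial, hb⟩)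
  set K : Set (ℝ × S) := Icc (1 / 3 : ℝ) (2 / 3) ×ˢ Oᶜ with hK
  have hKc : IsCompact K := isCompact_Icc.prod isOpen_interior.isClosed_compl.isCompact
  have hKi : ∀ z ∈ K, (𝓡∂ 2).IsInteriorPoint z.2 := by
    intro z hz
    rw [ModelWithCorners.isInteriorPoint_iff_not_isBoundaryPoint]
    exact fun hb => hz.2 (hOb z.2 hb)
  have hκK : ∀ z ∉ K, ∀ v, κ.app1 z (0, v) = 0 := by
    rintro ⟨t, x⟩ hz v
    by_cases ht : t ∈ Icc (1 / 3 : ℝ) (2 / 3)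
    · have hx : x ∈ O := by
        by_contra h
        exact hz ⟨ht, h⟩
      rw [hκ1, interior_subset hx t v, sub_self]
    · rw [hκ1, hμ0 t ht, hconst hgs t (hg0 t ht), sub_zero]
  obtain ⟨T, T', C, hT⟩ := exists_isShear Ω hlam hd hκs hκd hKc hKi hκK
  have hT'1 : ∀ z, (T' z).1 = z.1 := fun z => by rw [← hT.fst, hT.right_inv]
  have hTe : ∀ t x, (t, (T (t, x)).2) = T (t, x) := fun t x => Prod.ext (hT.fst (t, x)).symm rfl
  have hTe' : ∀ t x, (t, (T' (t, x)).2) = T' (t, x) := fun t x => Prod.ext (hT'1 (t, x)).symm rfl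
  have hTd := hT.smooth.mdifferentiable (by simp)
  let θ : ℝ → S ≃ₘ⟮𝓡∂ 2, 𝓡∂ 2⟯ S := fun t =>
    { toFun := fun x => (T (t, x)).2
      invFun := fun x => (T' (t, x)).2
      left_inv := fun x => by simp only [hTe, hT.left_inv]
      right_inv := fun x => by simp only [hTe', hT.right_inv]
      contMDiff_toFun := contMDiff_snd.comp (hT.smooth.comp (contMDiff_slice t))
      contMDiff_invFun := contMDiff_snd.comp (hT.smooth_symm.comp (contMDiff_slice t)) }
  have hT0 : ∀ t, t ∉ Icc (1 / 3 : ℝ) (2 / 3) → ∀ x, T (t, x) = (t, x) := fun t ht x =>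
    hT.eq_self _ fun h => ht h.1
  have hC0 : ∀ t, t ∉ Icc (1 / 3 : ℝ) (2 / 3) → ∀ x, C (t, x) = 0 := fun t ht x =>
    hT.potential_eq_zero _ fun h => ht h.1
  have hlt : ∀ t : ℝ, t < 1 / 3 → t ∉ Icc (1 / 3 : ℝ) (2 / 3) := fun t ht h => by linarith [h.1]
  have hgt : ∀ t : ℝ, 2 / 3 < t → t ∉ Icc (1 / 3 : ℝ) (2 / 3) := fun t ht h => by linarith [h.2]
  have happ : ∀ t x, (θ t).trans (ψ t) x = Ψ (T (t, x)) := fun t x => by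
    change ψ t (T (t, x)).2 = ψ (T (t, x)).1 (T (t, x)).2
    rw [hT.fst]
  refine ⟨fun t => (θ t).trans (ψ t), fun z => C z + (B (T z) + g (T z)), ⟨?_, ?_⟩, fun t ht => ?_,
    fun t ht => ?_, ?_, fun t x v => ?_, fun t ht x => ?_, fun t ht x => ?_⟩
  · refine ContMDiff.contMDiffOn ?_
    simp only [happ]
    exact hΨ.comp hT.smooth
  · refine ContMDiff.contMDiffOn ?_
    exact contMDiff_snd.comp (hT.smooth_symm.comp (contMDiff_fst.prodMk hψ.contMDiff_symm))
  · ext x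
    change ψ t (T (t, x)).2 = x
    rw [hT0 t (hlt t ht), hψ0 t ht]
    rfl
  · ext x
    change ψ t (T (t, x)).2 = φ x
    rw [hT0 t (hgt t ht), hψ1 t ht]
  · exact hT.smooth_potential.add ((hBs.comp hT.smooth).add (hgs.comp hT.smooth))
  · set z : ℝ × S := (t, x) with hz
    have hBT : MDifferentiableAt CylModel 𝓘(ℝ, ℝ) (fun z => B (T z)) z :=
      (hBs.comp hT.smooth).mdifferentiable (by simp) z
    have hgT : MDifferentiableAt CylModel 𝓘(ℝ, ℝ) (fun z => g (T z)) z :=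
      (hgs.comp hT.smooth).mdifferentiable (by simp) z
    have h1 : tmap (𝓡∂ 2) (𝓡∂ 2) ((θ t).trans (ψ t)) x v =
        tmap CylModel (𝓡∂ 2) Ψ (T z) (tmap CylModel CylModel T z (0, v)) := by
      have h2 : ((θ t).trans (ψ t) : S → S) = fun x => Ψ (T (t, x)) := funext (happ t)
      rw [h2, ← tmap_comp (f := T) (g := Ψ) (hΨd _) (hTd z),
        tmap_slice (Ψ := fun z => Ψ (T z)) ((hΨ.comp hT.smooth).mdifferentiable (by simp) _)]
    have h2 : tmap CylModel 𝓘(ℝ, ℝ) (fun z => C z + (B (T z) + g (T z))) z (0, v) =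
        tmap CylModel 𝓘(ℝ, ℝ) C z (0, v) +
          (tmap CylModel 𝓘(ℝ, ℝ) B (T z) (tmap CylModel CylModel T z (0, v)) +
            tmap CylModel 𝓘(ℝ, ℝ) g (T z) (tmap CylModel CylModel T z (0, v))) := by
      rw [tmap_add (f := C) (g := fun z => B (T z) + g (T z))
        (hT.smooth_potential.mdifferentiable (by simp) z) (hBT.add hgT),
        tmap_add (f := fun z => B (T z)) (g := fun z => g (T z)) hBT hgT,
        tmap_comp (f := T) (g := B) (hBs.mdifferentiable (by simp) _) (hTd z),
        tmap_comp (f := T) (g := g) (hgs.mdifferentiable (by simp) _) (hTd z)]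
    have h3 := hν1 (T z) (tmap CylModel CylModel T z (0, v))
    have h4 := hκ1 (T z) (tmap CylModel CylModel T z (0, v))
    rw [hμ1, hT.app1_form z v] at h4
    have h5 := hT.app1_primitive z v
    rw [h2, h1, happ]
    change lam.app1 (Ψ (T z)) _ = lam.app1 z.2 v + _
    linarith
  · simp only [hT0 t (hlt t ht), hC0 t (hlt t ht), hg0 t (hlt t ht), hB0 t ht, add_zero]
  · simp only [hT0 t (hgt t ht), hC0 t (hgt t ht), hg0 t (hgt t ht), hB1 t ht, add_zero, zero_add]

end Correction

section Periodic

variable {S : Type*} [TopologicalSpace S] [ChartedSpace (EuclideanHalfSpace 2) S]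

/-- The periodic continuation `ψ_{t - ⌊t⌋} ∘ φ^{⌊t⌋}` of a family of diffeomorphisms. -/
def continuation (φ : S ≃ₘ⟮𝓡∂ 2, 𝓡∂ 2⟯ S) (ψ : ℝ → S ≃ₘ⟮𝓡∂ 2, 𝓡∂ 2⟯ S) (t : ℝ) :
    S ≃ₘ⟮𝓡∂ 2, 𝓡∂ 2⟯ S where
  toEquiv := (φ.toEquiv ^ ⌊t⌋ : Equiv.Perm S).trans (ψ (t - ⌊t⌋)).toEquiv
  contMDiff_toFun := (ψ (t - ⌊t⌋)).contMDiff.comp (contMDiff_zpow φ ⌊t⌋)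
  contMDiff_invFun := by
    have h := (contMDiff_zpow φ (-⌊t⌋)).comp (ψ (t - ⌊t⌋)).symm.contMDiff
    rw [zpow_neg] at h
    exact h

variable {φ : S ≃ₘ⟮𝓡∂ 2, 𝓡∂ 2⟯ S} {ψ : ℝ → S ≃ₘ⟮𝓡∂ 2, 𝓡∂ 2⟯ S}

theorem continuation_eventually (hψ0 : ∀ t < 1 / 3, ψ t = Diffeomorph.refl (𝓡∂ 2) S ∞)
    (hψ1 : ∀ t, 2 / 3 < t → ψ t = φ) (t₀ : ℝ) : ∀ᶠ t in 𝓝 t₀,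
      (continuation φ ψ t).toEquiv = (φ.toEquiv ^ ⌊t₀⌋ : Equiv.Perm S).trans (ψ (t - ⌊t₀⌋)).toEquiv ∧
      (⌊t⌋ = ⌊t₀⌋ ∨ t - ⌊t₀⌋ < 1 / 3 ∧ 2 / 3 < t - ⌊t⌋) := by
  have h1 := Int.floor_le t₀
  filter_upwards [Ioo_mem_nhds (show t₀ - 1 / 3 < t₀ by linarith) (Int.lt_floor_add_one t₀)]
    with t ht
  rcases le_or_gt (⌊t₀⌋ : ℝ) t with h | h
  · have hf : ⌊t⌋ = ⌊t₀⌋ := Int.floor_eq_iff.2 ⟨h, ht.2⟩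
    exact ⟨by simp only [continuation, hf], Or.inl hf⟩
  · have hf : ⌊t⌋ = ⌊t₀⌋ - 1 := Int.floor_eq_iff.2 ⟨by push_cast; linarith [ht.1], by
      push_cast; linarith⟩
    have h2 : t - ⌊t₀⌋ < 1 / 3 := by linarith
    have h3 : 2 / 3 < t - ⌊t⌋ := by rw [hf]; push_cast; linarith [ht.1]
    refine ⟨?_, Or.inr ⟨h2, h3⟩⟩
    simp only [continuation, hψ0 _ h2, hψ1 _ h3]
    rw [hf]
    ext x
    change (φ.toEquiv * φ.toEquiv ^ (⌊t₀⌋ - 1) : Equiv.Perm S) x = (φ.toEquiv ^ ⌊t₀⌋ : Equiv.Perm S) x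
    rw [← zpow_one_add, add_sub_cancel]

theorem isSmoothFamily_continuation (hψ : IsSmoothFamily univ ψ)
    (hψ0 : ∀ t < 1 / 3, ψ t = Diffeomorph.refl (𝓡∂ 2) S ∞)
    (hψ1 : ∀ t, 2 / 3 < t → ψ t = φ) [IsManifold (𝓡∂ 2) ∞ S] :
    IsSmoothFamily univ (continuation φ ψ) := by
  have hsub : ∀ n : ℤ, ContMDiff CylModel 𝓘(ℝ, ℝ) ∞ (fun z : ℝ × S => z.1 - (n : ℝ)) := fun n =>
    contMDiff_fst.sub contMDiff_const
  constructor
  · refine ContMDiff.contMDiffOn fun z => ?_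
    have h1 : ContMDiff CylModel (𝓡∂ 2) ∞
        (fun w : ℝ × S => ψ (w.1 - ⌊z.1⌋) ((φ.toEquiv ^ ⌊z.1⌋ : Equiv.Perm S) w.2)) :=
      hψ.contMDiff.comp ((hsub _).prodMk ((contMDiff_zpow φ _).comp contMDiff_snd))
    refine (h1 z).congr_of_eventuallyEq ?_
    filter_upwards [continuous_fst.continuousAt.eventually
      (continuation_eventually hψ0 hψ1 z.1)] with w hw
    exact congrArg (fun e : S ≃ S => e w.2) hw.1
  · refine ContMDiff.contMDiffOn fun z => ?_
    have h1 : ContMDiff CylModel (𝓡∂ 2) ∞ (fun w : ℝ × S =>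
        (φ.toEquiv ^ (-⌊z.1⌋) : Equiv.Perm S) ((ψ (w.1 - ⌊z.1⌋)).symm w.2)) :=
      (contMDiff_zpow φ _).comp (hψ.contMDiff_symm.comp ((hsub _).prodMk contMDiff_snd))
    refine (h1 z).congr_of_eventuallyEq ?_
    filter_upwards [continuous_fst.continuousAt.eventually
      (continuation_eventually hψ0 hψ1 z.1)] with w hw
    rw [zpow_neg]
    exact congrArg (fun e : S ≃ S => e.symm w.2) hw.1

theorem continuation_zero (hψ0 : ∀ t < 1 / 3, ψ t = Diffeomorph.refl (𝓡∂ 2) S ∞) :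
    continuation φ ψ 0 = Diffeomorph.refl (𝓡∂ 2) S ∞ := by
  ext x
  change ψ ((0 : ℝ) - ⌊(0 : ℝ)⌋) ((φ.toEquiv ^ ⌊(0 : ℝ)⌋ : Equiv.Perm S) x) = x
  rw [Int.floor_zero, Int.cast_zero, sub_zero, hψ0 0 (by norm_num), zpow_zero]
  rfl

theorem continuation_one (hψ0 : ∀ t < 1 / 3, ψ t = Diffeomorph.refl (𝓡∂ 2) S ∞) :
    continuation φ ψ 1 = φ := by
  ext x
  change ψ ((1 : ℝ) - ⌊(1 : ℝ)⌋) ((φ.toEquiv ^ ⌊(1 : ℝ)⌋ : Equiv.Perm S) x) = φ x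
  rw [Int.floor_one, Int.cast_one, sub_self, hψ0 0 (by norm_num), zpow_one]
  rfl

end Periodic

section Hamiltonian

variable {S : Type*} [TopologicalSpace S] [ChartedSpace (EuclideanHalfSpace 2) S]
  [IsManifold (𝓡∂ 2) ∞ S]

/-- The velocity of a family `ψ` for which `ψ_t^* λ - λ = dD_t` is Hamiltonian. -/
theorem exists_hamiltonian_of_exact_family {Ω : AreaForm S} {ψ : ℝ → S ≃ₘ⟮𝓡∂ 2, 𝓡∂ 2⟯ S}
    (hψ : IsSmoothFamily univ ψ) {lam : Form (𝓡∂ 2) S 1} (hlam : Form.IsSmooth lam)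
    (hd : Form.d lam = Ω.form) {D : ℝ × S → ℝ} (hD : ContMDiff CylModel 𝓘(ℝ, ℝ) ∞ D)
    (hψD : ∀ t x v, lam.app1 (ψ t x) (tmap (𝓡∂ 2) (𝓡∂ 2) (ψ t) x v) =
        lam.app1 x v + tmap CylModel 𝓘(ℝ, ℝ) D (t, x) (0, v)) :
    ∃ H : ℝ × S → ℝ, ContMDiff CylModel 𝓘(ℝ, ℝ) ∞ H ∧
      (∀ t x, IsHamiltonianVector Ω (fun y => H (t, y)) (ψ t x)
        (tmap 𝓘(ℝ, ℝ) (𝓡∂ 2) (fun s => ψ s x) t 1)) ∧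
      ∀ t, (∀ x, ∃ y c, (fun s => ψ s x) =ᶠ[𝓝 t] (fun _ => y) ∧
        (fun s => D (s, x)) =ᶠ[𝓝 t] fun _ => c) → ∀ y, H (t, y) = 0 := by
  set Ψ : ℝ × S → S := fun z => ψ z.1 z.2 with hΨdef
  have hΨ : ContMDiff CylModel (𝓡∂ 2) ∞ Ψ := hψ.contMDiff
  have hΨd := hΨ.mdifferentiable (by simp)
  set ν : Form CylModel (ℝ × S) 1 := pullback (I := CylModel) Ψ lam - differential (I := CylModel) D
    with hν
  have hνs : Form.IsSmooth ν := (hlam.pullback hΨ).sub (isSmooth_differential hD)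
  have hν1 : ∀ z v, ν.app1 z v = lam.app1 (Ψ z) (tmap CylModel (𝓡∂ 2) Ψ z v) -
      tmap CylModel 𝓘(ℝ, ℝ) D z v := by
    intro z v
    rw [← app1_pullback]
    rfl
  have hν2 : ∀ t x v, ν.app1 (t, x) (0, v) = lam.app1 x v := by
    intro t x v
    rw [hν1, tmap_slice (hΨd _)]
    have := hψD t x v
    exact sub_eq_of_eq_add this
  have hνd : ∀ t x v, (Form.d ν).app2 (t, x) (1, 0) (0, v) = Ω.form.app2 (ψ t x)
      (tmap 𝓘(ℝ, ℝ) (𝓡∂ 2) (fun s => ψ s x) t 1) (tmap (𝓡∂ 2) (𝓡∂ 2) (ψ t) x v) := by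
    intro t x v
    have h1 : Form.d ν (t, x) = Form.d (pullback (I := CylModel) Ψ lam) (t, x) -
        Form.d (differential (I := CylModel) D) (t, x) :=
      Form.d_sub ((hlam.pullback hΨ).smoothAt _) ((isSmooth_differential hD).smoothAt _)
    rw [Form.d_differential (hD _), sub_zero] at h1
    refine (congrArg (fun σ : (ℝ × Plane) [⋀^Fin 2]→L[ℝ] ℝ => σ ![(1, 0), (0, v)]) h1).trans ?_
    refine (app2_d_pullback_time hΨ hlam t x v).trans ?_
    rw [hd]
  clear_value ν
  set h : ℝ × S → ℝ := timeComponent ν with hh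
  have hhs : ContMDiff CylModel 𝓘(ℝ, ℝ) ∞ h := fun p => contMDiffAt_timeComponent (hνs.smoothAt p)
  have hcartan : ∀ t x v, Ω.form.app2 (ψ t x) (tmap (𝓡∂ 2) (𝓡∂ 2) (ψ t) x v)
      (tmap 𝓘(ℝ, ℝ) (𝓡∂ 2) (fun s => ψ s x) t 1) =
        tmap (𝓡∂ 2) 𝓘(ℝ, ℝ) (fun z => h (t, z)) x v := by
    intro t x v
    have h1 := hasDerivAt_app1_time hνs t x v
    simp only [hν2] at h1
    have h2 := h1.unique (hasDerivAt_const t _)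
    rw [hνd, app1_differential, tmap_slice (hhs.mdifferentiable (by simp) _)] at h2
    rw [Form.app2_swap]
    linarith
  refine ⟨fun z => h (z.1, (ψ z.1).symm z.2), hhs.comp (contMDiff_fst.prodMk hψ.contMDiff_symm),
    fun t x w => ?_, fun t ht y => ?_⟩
  · have hψd : MDifferentiableAt (𝓡∂ 2) (𝓡∂ 2) (ψ t) x := (ψ t).contMDiff.mdifferentiable (by simp) x
    have hψd' : MDifferentiableAt (𝓡∂ 2) (𝓡∂ 2) (ψ t).symm (ψ t x) :=
      (ψ t).symm.contMDiff.mdifferentiable (by simp) _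
    have hht := (contMDiff_at_time hhs t).mdifferentiable (by simp)
    set v : Plane := tmap (𝓡∂ 2) (𝓡∂ 2) (ψ t).symm (ψ t x) w with hv
    have hx : (ψ t).symm (ψ t x) = x := (ψ t).symm_apply_apply x
    have h1 : tmap (𝓡∂ 2) (𝓡∂ 2) (ψ t) x v = w := by
      have hψd2 : MDifferentiableAt (𝓡∂ 2) (𝓡∂ 2) (ψ t) ((ψ t).symm (ψ t x)) := by rwa [hx]
      have h2 := tmap_comp (f := (ψ t).symm) (g := ψ t) hψd2 hψd' w
      rw [hx] at h2
      rw [hv, ← h2]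
      have h3 : (fun z => ψ t ((ψ t).symm z)) = fun z => z := funext (ψ t).apply_symm_apply
      rw [h3]
      exact tmap_id _ _
    have h2 := hcartan t x v
    rw [h1] at h2
    refine Eq.trans h2 ?_
    have hhx : MDifferentiableAt (𝓡∂ 2) 𝓘(ℝ, ℝ) (fun z => h (t, z)) ((ψ t).symm (ψ t x)) := hht _
    have h3 := tmap_comp (f := (ψ t).symm) (g := fun z => h (t, z)) hhx hψd' w
    rw [hx] at h3
    exact h3.symm
  · obtain ⟨z, c, h1, h2⟩ := ht ((ψ t).symm y)
    change timeComponent ν _ = 0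
    rw [timeComponent, hν1, tmap_time (hΨd _), tmap_time (hD.mdifferentiable (by simp) _),
      tmap_congr h1, tmap_congr h2, tmap_const, tmap_const, Form.app1_zero, sub_zero]

variable [CompactSpace S] [T2Space S]

/-- If `φ^* λ - λ` is exact, then `φ` is Hamiltonian. -/
theorem isHamiltonian_of_primitive {Ω : AreaForm S} {φ : S ≃ₘ⟮𝓡∂ 2, 𝓡∂ 2⟯ S}
    (hiso : IsAreaIsotopicToId Ω φ) {lam : Form (𝓡∂ 2) S 1} {F : S → ℝ} (hlam : Form.IsSmooth lam)
    (hd : Form.d lam = Ω.form) (hF : ContMDiff (𝓡∂ 2) 𝓘(ℝ, ℝ) ∞ F)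
    (hφ : pullback φ lam - lam = differential (I := 𝓡∂ 2) F) : IsHamiltonian Ω φ := by
  obtain ⟨ψ₀, hψ₀, hA, hψ₀0, hψ₀1⟩ := hiso.exists_family
  obtain ⟨ψ, D, hψ, hψ0, hψ1, hD, hψD, hD0, hD1⟩ :=
    exists_exact_family hψ₀ hA hψ₀0 hψ₀1 hlam hd hF hφ
  obtain ⟨H, hH, hHv, hH0⟩ := exists_hamiltonian_of_exact_family hψ hlam hd hD hψD
  have hHlt : ∀ t < 1 / 3, ∀ y, H (t, y) = 0 := fun t ht => hH0 t fun x => by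
    refine ⟨x, 0, ?_, ?_⟩
    · filter_upwards [Iio_mem_nhds ht] with s hs
      rw [hψ0 s hs]; rfl
    · filter_upwards [Iio_mem_nhds ht] with s hs
      exact hD0 s hs x
  have hHgt : ∀ t, 2 / 3 < t → ∀ y, H (t, y) = 0 := fun t ht => hH0 t fun x => by
    refine ⟨φ x, F x, ?_, ?_⟩
    · filter_upwards [Ioi_mem_nhds ht] with s hs
      rw [hψ1 s hs]
    · filter_upwards [Ioi_mem_nhds ht] with s hs
      exact hD1 s hs x
  refine ⟨fun z => H (z.1 - ⌊z.1⌋, z.2), continuation φ ψ, ⟨?_, fun t x => ?_, fun t => ?_⟩,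
    ⟨isSmoothFamily_continuation hψ hψ0 hψ1, continuation_zero hψ0, fun t x => ?_⟩,
    continuation_one hψ0⟩
  · intro z
    have h1 : ContMDiff CylModel 𝓘(ℝ, ℝ) ∞ (fun w : ℝ × S => H (w.1 - (⌊z.1⌋ : ℝ), w.2)) :=
      hH.comp ((contMDiff_fst.sub contMDiff_const).prodMk contMDiff_snd)
    refine (h1 z).congr_of_eventuallyEq ?_
    filter_upwards [continuous_fst.continuousAt.eventually
      (continuation_eventually hψ0 hψ1 z.1)] with w hw
    rcases hw.2 with h2 | h2
    · rw [h2]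
    · rw [hHlt _ h2.1, hHgt _ h2.2]
  · simp only [Int.floor_add_one, Int.cast_add, Int.cast_one, add_sub_add_right_eq_sub]
  · refine isLocallyConstant_boundary (f := fun x => H (t - (⌊t⌋ : ℝ), x))
      (contMDiff_at_time hH _) fun y hy w hw => ?_
    set s := t - (⌊t⌋ : ℝ)
    have hx : (ψ s).symm y ∈ (𝓡∂ 2).boundary S := mem_boundary_of_diffeomorph _ hy
    have h1 := hHv s ((ψ s).symm y)
    rw [(ψ s).apply_symm_apply] at h1
    exact (h1 w).symm.trans (app2_tangent_boundary _ _ hw (tmap_family_boundary hψ s hx))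
  · set n := ⌊t⌋ with hn
    set x' : S := (φ.toEquiv ^ n : Equiv.Perm S) x with hx'
    have hγd : MDifferentiable 𝓘(ℝ, ℝ) (𝓡∂ 2) (fun s => ψ s x') :=
      (hψ.contMDiff.comp (contMDiff_id.prodMk contMDiff_const)).mdifferentiable (by simp)
    have hsub : HasFDerivAt (fun s : ℝ => s - (n : ℝ)) (ContinuousLinearMap.id ℝ ℝ) t :=
      (hasFDerivAt_id t).sub_const _
    have hev : (fun s => continuation φ ψ s x) =ᶠ[𝓝 t] fun s => ψ (s - n) x' := by
      filter_upwards [continuation_eventually hψ0 hψ1 t] with s hs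
      exact congrArg (fun e : S ≃ S => e x) hs.1
    have hd1 : MDifferentiableAt 𝓘(ℝ, ℝ) (𝓡∂ 2) (fun s => ψ (s - n) x') t :=
      MDifferentiableAt.comp (f := fun s : ℝ => s - (n : ℝ)) (g := fun s => ψ s x') t (hγd _)
        hsub.differentiableAt.mdifferentiableAt
    have hX : tmap 𝓘(ℝ, ℝ) (𝓡∂ 2) (fun s => continuation φ ψ s x) t 1 =
        tmap 𝓘(ℝ, ℝ) (𝓡∂ 2) (fun s => ψ s x') (t - n) 1 := by
      rw [tmap_congr hev, tmap_comp (f := fun s : ℝ => s - (n : ℝ)) (g := fun s => ψ s x') (hγd _)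
        hsub.differentiableAt.mdifferentiableAt]
      congr 1
      rw [tmap, mfderiv_eq_fderiv, hsub.fderiv]
      rfl
    refine ⟨tmap 𝓘(ℝ, ℝ) (𝓡∂ 2) (fun s => ψ s x') (t - n) 1, hHv (t - n) x', ?_⟩
    have h1 := (hd1.congr_of_eventuallyEq hev).hasMFDerivAt
    refine h1.congr_mfderiv (show tmap 𝓘(ℝ, ℝ) (𝓡∂ 2) (fun s => continuation φ ψ s x) t =
      (1 : ℝ →L[ℝ] ℝ).smulRight (tmap 𝓘(ℝ, ℝ) (𝓡∂ 2) (fun s => ψ s x') (t - n) 1) from ?_)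
    ext1
    rw [hX]
    exact (one_smul ℝ _).symm

end Hamiltonian
end SurfaceDynamics

end

open SurfaceDynamics

theorem lemma2p1 {S : Type*} [TopologicalSpace S] [T2Space S] [CompactSpace S]
    [ChartedSpace (EuclideanHalfSpace 2) S] [IsManifold (𝓡∂ 2) ∞ S]
    (hS : ∀ x : S, (connectedComponent x ∩ (𝓡∂ 2).boundary S).Nonempty)
    (Ω : AreaForm S) (φ : S ≃ₘ⟮𝓡∂ 2, 𝓡∂ 2⟯ S)
    (hφ : PreservesArea Ω φ) (hiso : IsAreaIsotopicToId Ω φ) :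
    IsHamiltonian Ω φ ↔ Form.IsExact (inducedForm φ Ω) := by
  constructor
  · rintro ⟨H, ψ, hH, hψ, h1⟩
    obtain ⟨lam, hlam, hd⟩ := isExact_of_boundary hS Ω.smooth
    obtain ⟨F, hF, h⟩ := hψ.exists_primitive hH.smooth hlam hd
    rw [h1] at h
    exact isExact_inducedForm_of_primitive φ hlam hd hF h
  · intro h
    obtain ⟨lam, F, hlam, hd, hF, h⟩ := exists_primitive_of_isExact_inducedForm φ hφ h
    exact isHamiltonian_of_primitive hiso hlam hd hF h
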